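/- Let $k$ be a field and $I$ a set. All complexes are complexes of $k$-vector spaces with a differential of degree $-1$, signs follow the Koszul rule, and $(\Sigma V)_n=V_{n-1}$. **Setting.** Given a set $\mathbb E$ of 1-morphisms with source and target maps $\mathbb E\to I$, a cell $(s;t)$ consists of a nonempty composable path $s=(s_1,\dots,s_n)$ in $\mathbb E$ and of $t\in\mathbb E$ with the same end points as $s$. An $(I,\mathbb E)$-sequence is a family of complexes $X(s;t)$ indexed by the cells. Put $$(X\odot Y)(s;u)=\bigoplus_{t_1,\dots,t_r,\ s=s^1\cdots s^r} X(t_1,\dots,t_r;u)\otimes Y(s^1;t_1)\otimes\cdots\otimes Y(s^r;t_r),$$ and let $k_{\mathbb E}$ be the sequence with $k$ in degree $0$ at the cells $(t;t)$ and $0$ elsewhere; it is the unit for $\odot$. * $2\text{-Cat}_I$ is the category of pairs $(\mathbb E,A)$ with $A$ an augmented unital associative algebra for $\odot$. A morphism $A\to A'$ consists of a map $f:\mathbb E\to\mathbb E'$ preserving sources and targets and of maps of complexes $A(s;t)\to A'(f(s);f(t))$ compatible with compositions, units and augmentations. $\bar A$ is the kernel of $A\to k_{\mathbb E}$. * $2\text{-coCat}_I$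 is the category of pairs $(\mathbb E,C)$ with $C$ a coaugmented counital coassociative coalgebra for $\odot$ that is connected: the filtration $F_0=k_{\mathbb E}$, $F_{n+1}=\Delta^{-1}(k_{\mathbb E}\odot C+C\odot F_n)$ is exhaustive. A morphism $C\to C'$ consists of a map $f:\mathbb E\to\mathbb E'$ preserving sources and targets and of maps of complexes $C(s;t)\to C'(f(s);f(t))$ compatible with decompositions, counits and coaugmentations. $\bar C$ is the kernel of $C\to k_{\mathbb E}$. * For an $(I,\mathbb E)$-sequence $V$ let $F(V)(s;t)$ be the direct sum, over all planar rooted trees with leaves labelled by $s$, root labelled by $t$ and inner edges labelled by $\mathbb E$ (equivalently, labelled decompositions of a polygon by chords), of the tensor products of $V(\text{inputs};\text{output})$ over the vertices; the tree without vertices gives $k_{\mathbb E}$. With grafting of trees it is the free algebra on $V$, with cutting of trees it is the cofree connected coalgebra on $V$. * The bar construction $\mathcal B(A)$ is the cofree coalgebra $F(\Sigma\bar A)$; its differential is the internal one plus the sum over all inner edges of the contraction of the edge by means of the composition of $A$, $\Sigma a\otimes\Sigma b\mapsto(-1)^{|a|}\Sigma\,a(1,\dots,1,b,1,\dots,1)$.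 * The cobar construction $\mathcal B^*(C)$ is the free algebra $F(\Sigma^{-1}\bar C)$; its differential is the derivation given on generators by $\Sigma^{-1}c\mapsto-\Sigma^{-1}dc-\sum(-1)^{|c'|}\,\Sigma^{-1}c'(1,\dots,1,\Sigma^{-1}c'',1,\dots,1)$, where the sum is over the reduced decompositions of $c$ into two factors. * A twisting cochain from $(\mathbb E_C,C)$ to $(\mathbb E_A,A)$ consists of a map $f:\mathbb E_C\to\mathbb E_A$ preserving sources and targets and of maps $\alpha:\bar C(s;t)\to\bar A(f(s);f(t))$ of degree $-1$ (that is, maps $\bar C\to\Sigma\bar A$ of degree $0$), extended by $0$ to $k_{\mathbb E_C}$, which satisfy the Maurer–Cartan equation $$d_A\alpha+\alpha d_C+\alpha\star\alpha=0,\qquad (\alpha\star\alpha)(c)=\sum(-1)^{|c'|}\,\alpha(c')(1,\dots,1,\alpha(c''),1,\dots,1),$$ with the sum over the decompositions of $c$ into two factors (all other factors being units). **Proposition.** $\mathcal B(A)$ is an object of $2\text{-coCat}_I$ and $\mathcal B^*(C)$ is an object of $2\text{-Cat}_I$ for all $A\in 2\text{-Cat}_I$ and $C\in2\text{-coCat}_I$;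 $\mathcal B$ and $\mathcal B^*$ are functors; and $\mathcal B$ is right adjoint to $\mathcal B^*$: $$\operatorname{Hom}_{2\text{-Cat}_I}(\mathcal B^*(C),A)\cong\operatorname{Hom}_{2\text{-coCat}_I}(C,\mathcal B(A)),$$ naturally in $C$ and $A$. Moreover, restriction to the generators, $F\mapsto F|_{\Sigma^{-1}\bar C}$, and projection to the cogenerators, $G\mapsto(C\to\mathcal B(A)\to\Sigma\bar A)$, are bijections from the left hand side and from the right hand side to the set of twisting cochains from $C$ to $A$, and the adjunction isomorphism is compatible with these two bijections. -/

import Mathlib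

open CategoryTheory
open scoped TensorProduct DirectSum

universe u w

namespace BarCobar

noncomputable section

open scoped Classical

/-! ## Graded cells, families, total spaces -/

/-- A pair (path `top` of 1-morphisms; 1-morphism `bot`), together with a homological degree. -/
structure GCell (E : Type u) where
  top : List E
  bot : E
  deg : ℤ

/-- A family of vector spaces `X(s;t)_n`. -/
abbrev Fam (k : Type u) [Field k] (E : Type u) : Type (u + 1) := GCell E → ModuleCat.{u} k

section Basic

variable {k : Type u} [Field k] {E : Type u}

/-- The direct sum of all the `X(s;t)_n`. -/
abbrev Tot (X : Fam k E) : Type u := ⨁ p : GCell E, X p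

/-- Inclusion of the summand `X(s;t)_n`. -/
abbrev of (X : Fam k E) (p : GCell E) : X p →ₗ[k] Tot X := DirectSum.lof k (GCell E) (fun p => X p) p

/-- `x` lies in the summand `X(s;t)_n`. -/
def IsIn (X : Fam k E) (s : List E) (t : E) (n : ℤ) (x : Tot X) : Prop :=
  x ∈ LinearMap.range (of X ⟨s, t, n⟩)

/-- `x ↦ (-1)^|x| x`. -/
def sg (X : Fam k E) : Tot X →ₗ[k] Tot X :=
  DirectSum.toModule k _ _ fun p => p.deg.negOnePow • of X p

/-- The projection to the part of odd degree. -/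
def odd (X : Fam k E) : Tot X →ₗ[k] Tot X :=
  DirectSum.toModule k _ _ fun p => if Odd p.deg then of X p else 0

/-- Homogeneous elements. -/
abbrev HEl (X : Fam k E) : Type u := Σ p : GCell E, X p

/-- A homogeneous element as an element of the total space. -/
abbrev HEl.tot {X : Fam k E} (a : HEl X) : Tot X := of X a.1 a.2

/-- The word `b₁ ⊗ ⋯ ⊗ b_r`. -/
def word {X : Fam k E} (l : List (HEl X)) : TensorAlgebra k (Tot X) :=
  (l.map fun b => TensorAlgebra.ι k b.tot).prod

/-- For `b_i ∈ X(s_i;t_i)`, the concatenated path `s₁ ⋯ s_r`. -/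
def tops {X : Fam k E} (l : List (HEl X)) : List E := l.flatMap fun b => b.1.top

/-- For `b_i ∈ X(s_i;t_i)`, the path `t₁ ⋯ t_r`. -/
def bots {X : Fam k E} (l : List (HEl X)) : List E := l.map fun b => b.1.bot

/-- The sum of the degrees. -/
def degs {X : Fam k E} (l : List (HEl X)) : ℤ := (l.map fun b => b.1.deg).sum

/-- The Koszul sign of `b₁ c₁ b₂ c₂ ⋯ b_r c_r ↦ b₁ ⋯ b_r c₁ ⋯ c_r` (each `c_i` is a word). -/
def koszul {X : Fam k E} : List (HEl X × List (HEl X)) → ℤˣ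
  | [] => 1
  | x :: m => (degs x.2 * degs (m.map Prod.fst)).negOnePow * koszul m

end Basic

/-! ## Tensor algebra helpers -/

section Tensor

variable {k : Type u} [Field k] {M B : Type u} [AddCommGroup M] [Module k M] [Ring B] [Algebra k B]

/-- The linear map `c₁ ⊗ ⋯ ⊗ c_n ↦ ∑ i, u(c₁) ⋯ u(c_{i-1}) v(c_i) w(c_{i+1}) ⋯ w(c_n)`: the upper
right entry of a product of upper triangular matrices. -/
def insertOne (u v w : M →ₗ[k] B) : TensorAlgebra k M →ₗ[k] B :=
  Matrix.entryLinearMap k B (0 : Fin 2) (1 : Fin 2) ∘ₗ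
    (TensorAlgebra.lift k
      ({ toFun := fun c => !![u c, v c; 0, w c]
         map_add' := fun a b => by ext i j; fin_cases i <;> fin_cases j <;> simp
         map_smul' := fun a b => by ext i j; fin_cases i <;> fin_cases j <;> simp } :
        M →ₗ[k] Matrix (Fin 2) (Fin 2) B)).toLinearMap

/-- For a product `m` on `M` and the projection `o` of `M` to its odd part: the product
`(a ⊗ b)(c ⊗ d) = (-1)^{|b||c|} ac ⊗ bd` on `M ⊗ M`. -/
def ksMul (m : M ⊗[k] M →ₗ[k] M) (o : M →ₗ[k] M) :
    (M ⊗[k] M) ⊗[k] (M ⊗[k] M) →ₗ[k] M ⊗[k] M :=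
  TensorProduct.map m m ∘ₗ (TensorProduct.tensorTensorTensorComm k M M M M).toLinearMap ∘ₗ
    (LinearMap.id - (2 : k) • TensorProduct.map (TensorProduct.map LinearMap.id o)
      (TensorProduct.map o LinearMap.id))

/-- `m₁ ⊗ ⋯ ⊗ m_n ↦ op m₁ (op m₂ (⋯ (op m_n n₀)))`. -/
def tfold {N : Type u} [AddCommGroup N] [Module k N] (op : M ⊗[k] N →ₗ[k] N) (n₀ : N) :
    TensorAlgebra k M →ₗ[k] N :=
  LinearMap.applyₗ n₀ ∘ₗ
    (TensorAlgebra.lift k (TensorProduct.curry op : M →ₗ[k] Module.End k N)).toLinearMap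

end Tensor

section TensorFam

variable {k : Type u} [Field k] {E : Type u}

/-- The words in the elements of `X`. -/
abbrev Words (X : Fam k E) : Type u := TensorAlgebra k (Tot X)

/-- A letter as a word. -/
abbrev letter (X : Fam k E) : Tot X →ₗ[k] Words X := TensorAlgebra.ι k

/-- The extension of a degree `-1` map to words as a (signed) derivation. -/
def wordD (X : Fam k E) (d : Tot X →ₗ[k] Tot X) : Words X →ₗ[k] Words X :=
  insertOne (letter X ∘ₗ sg X) (letter X ∘ₗ d) (letter X)

/-- The projection of the words to the odd part. -/
def wordOdd (X : Fam k E) : Words X →ₗ[k] Words X :=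
  insertOne (letter X ∘ₗ sg X) (letter X ∘ₗ odd X) (letter X)

/-- Apply a linear map to each letter. -/
def wordMap {X : Fam k E} {E' : Type u} {X' : Fam k E'} (f : Tot X →ₗ[k] Tot X') :
    Words X →ₗ[k] Words X' :=
  (TensorAlgebra.lift k (letter X' ∘ₗ f)).toLinearMap

theorem wordMap_id (X : Fam k E) :
    wordMap (LinearMap.id : Tot X →ₗ[k] Tot X) = LinearMap.id := by
  have : TensorAlgebra.lift k (letter X) = AlgHom.id k (Words X) := by ext; simp
  simp [wordMap, this]

end TensorFam

/-! ## The underlying sequences of complexes -/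

/-- A set `E` of 1-morphisms between elements of `I`, a family `X(s;t)_n` with a map `d` on
`⨁ X(s;t)_n`, elements `unit t` and a functional `aug`. -/
structure SeqData (k : Type u) [Field k] (I : Type w) where
  E : Type u
  src : E → I
  tgt : E → I
  X : Fam k E
  d : Tot X →ₗ[k] Tot X
  unit : E → Tot X
  aug : Tot X →ₗ[k] k

namespace SeqData

variable {k : Type u} [Field k] {I : Type w}

/-- `s` is a path of 1-morphisms from `i` to `j`. -/
def IsPath (S : SeqData k I) : I → List S.E → I → Prop
  | i, [], j => i = j
  | i, e :: s, j => S.src e = i ∧ S.IsPath (S.tgt e) s j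

/-- `(s;t)` is a cell: `s` is a nonempty path with the same end points as `t`. -/
def IsCell (S : SeqData k I) (s : List S.E) (t : S.E) : Prop :=
  s ≠ [] ∧ S.IsPath (S.src t) s (S.tgt t)

/-- `X` is a family of complexes (with differential of degree `-1`) indexed by the cells, `unit` is
a map of complexes `k_E → X` and `aug` is a map of complexes `X → k_E` with `aug ∘ unit = id`. Here
`k_E` is `k` in degree `0` at the cells `(t;t)` and `0` elsewhere. -/
structure IsComplex (S : SeqData k I) : Prop where
  supp : ∀ p : GCell S.E, ¬ S.IsCell p.top p.bot → Subsingleton (S.X p)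
  d_mem : ∀ (p : GCell S.E) (x : S.X p), IsIn S.X p.top p.bot (p.deg - 1) (S.d (of S.X p x))
  d_d : S.d ∘ₗ S.d = 0
  unit_mem : ∀ e : S.E, IsIn S.X [e] e 0 (S.unit e)
  d_unit : ∀ e : S.E, S.d (S.unit e) = 0
  aug_off : ∀ (p : GCell S.E) (x : S.X p), p ≠ ⟨[p.bot], p.bot, 0⟩ → S.aug (of S.X p x) = 0
  aug_unit : ∀ e : S.E, S.aug (S.unit e) = 1
  aug_d : S.aug ∘ₗ S.d = 0

/-- `X̄ = ker (aug : X → k_E)`. -/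
def red (S : SeqData k I) : Fam k S.E := fun p =>
  ModuleCat.of k (LinearMap.ker (S.aug ∘ₗ of S.X p))

/-- The inclusion `X̄ → X`. -/
def inc (S : SeqData k I) : Tot S.red →ₗ[k] Tot S.X :=
  DirectSum.toModule k _ _ fun p => of S.X p ∘ₗ (LinearMap.ker (S.aug ∘ₗ of S.X p)).subtype

/-- The projection `x ↦ x - aug(x) unit` on `X(s;t)_n`. -/
def redProj (S : SeqData k I) (p : GCell S.E) : S.X p →ₗ[k] S.X p :=
  LinearMap.id - LinearMap.toSpanSingleton k (S.X p)
    (DirectSum.component k (GCell S.E) (fun p => S.X p) p (S.unit p.bot)) ∘ₗ S.aug ∘ₗ of S.X p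

theorem redProj_mem {S : SeqData k I} (h : S.IsComplex) (p : GCell S.E) (x : S.X p) :
    S.redProj p x ∈ LinearMap.ker (S.aug ∘ₗ of S.X p) := by
  rw [LinearMap.mem_ker]
  by_cases hp : p = ⟨[p.bot], p.bot, 0⟩
  · obtain ⟨y, hy⟩ := h.unit_mem p.bot
    have key : of S.X p (DirectSum.component k (GCell S.E) (fun p => S.X p) p (S.unit p.bot))
        = S.unit p.bot := by
      obtain ⟨t, b, n⟩ := p
      simp only [GCell.mk.injEq, true_and] at hp
      obtain ⟨rfl, rfl⟩ := hp
      rw [← hy, DirectSum.component.lof_self]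
    simp only [redProj, LinearMap.comp_apply, LinearMap.sub_apply, LinearMap.id_apply, map_sub,
      LinearMap.toSpanSingleton_apply, map_smul, key, h.aug_unit]
    simp
  · exact h.aug_off p _ hp

/-- The projection `X → X̄` with kernel spanned by the units. -/
def ret {S : SeqData k I} (h : S.IsComplex) : Tot S.X →ₗ[k] Tot S.red :=
  DirectSum.toModule k _ _ fun p =>
    of S.red p ∘ₗ LinearMap.codRestrict (LinearMap.ker (S.aug ∘ₗ of S.X p)) (S.redProj p)
      (redProj_mem h p)

/-- A map of 1-morphisms with a linear map. -/
@[ext]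
structure PreHom (S S' : SeqData k I) where
  col : S.E → S'.E
  lin : Tot S.X →ₗ[k] Tot S'.X

/-- The identity of `S`. -/
def PreHom.id (S : SeqData k I) : PreHom S S := ⟨fun e => e, LinearMap.id⟩

/-- Composition: first `F`, then `G`. -/
def PreHom.comp {S S' S'' : SeqData k I} (F : PreHom S S') (G : PreHom S' S'') : PreHom S S'' :=
  ⟨G.col ∘ F.col, G.lin ∘ₗ F.lin⟩

/-- `F` is given by maps of complexes `X(s;t) → X'(col s; col t)`, where `col` preserves sources and
targets of 1-morphisms, compatible with `unit` and `aug`. -/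
structure PreHom.IsSeqHom {S S' : SeqData k I} (F : PreHom S S') : Prop where
  src : ∀ e, S'.src (F.col e) = S.src e
  tgt : ∀ e, S'.tgt (F.col e) = S.tgt e
  mem : ∀ (p : GCell S.E) (x : S.X p),
    IsIn S'.X (p.top.map F.col) (F.col p.bot) p.deg (F.lin (of S.X p x))
  d : F.lin ∘ₗ S.d = S'.d ∘ₗ F.lin
  unit : ∀ e, F.lin (S.unit e) = S'.unit (F.col e)
  aug : S'.aug ∘ₗ F.lin = S.aug

theorem PreHom.IsSeqHom.id (S : SeqData k I) : (PreHom.id S).IsSeqHom where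
  src _ := rfl
  tgt _ := rfl
  mem p x := by
    simp only [PreHom.id, List.map_id', LinearMap.id_apply]
    exact ⟨x, rfl⟩
  d := rfl
  unit _ := rfl
  aug := rfl

theorem PreHom.IsSeqHom.comp {S S' S'' : SeqData k I} {F : PreHom S S'} {G : PreHom S' S''}
    (hF : F.IsSeqHom) (hG : G.IsSeqHom) : (F.comp G).IsSeqHom where
  src e := (hG.src _).trans (hF.src e)
  tgt e := (hG.tgt _).trans (hF.tgt e)
  mem p x := by
    obtain ⟨y, hy⟩ := hF.mem p x
    have := hG.mem _ y
    rw [hy] at this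
    simpa only [PreHom.comp, LinearMap.comp_apply, List.map_map, Function.comp_apply] using this
  d := by
    simp only [PreHom.comp]
    rw [LinearMap.comp_assoc, hF.d, ← LinearMap.comp_assoc, hG.d, LinearMap.comp_assoc]
  unit e := by simp [PreHom.comp, hF.unit, hG.unit]
  aug := by
    simp only [PreHom.comp]
    rw [← LinearMap.comp_assoc, hG.aug, hF.aug]

theorem PreHom.IsSeqHom.exists_word {S S' : SeqData k I} {F : PreHom S S'} (hF : F.IsSeqHom)
    (l : List (HEl S.X)) : ∃ l' : List (HEl S'.X),
      wordMap F.lin (word l) = word l' ∧ bots l' = (bots l).map F.col := by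
  induction l with
  | nil => exact ⟨[], by simp [word, wordMap], by simp [bots]⟩
  | cons b l ih =>
    obtain ⟨l', h1, h2⟩ := ih
    obtain ⟨y, hy⟩ := hF.mem b.1 b.2
    refine ⟨⟨_, y⟩ :: l', ?_, ?_⟩
    · simp only [word, wordMap, AlgHom.toLinearMap_apply, List.map_cons, List.prod_cons, map_mul,
        TensorAlgebra.lift_ι_apply, LinearMap.comp_apply] at h1 ⊢
      rw [h1]
      exact congrArg (fun z => letter S'.X z * _) hy.symm
    · simp only [bots, List.map_cons] at h2 ⊢
      rw [h2]

end SeqData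

/-! ## 2-categories -/

/-- The data of an object of 2-Cat_I: a composition map, written as a map on words in all of the
`X(s;t)` (it will be required to vanish on words that do not match). -/
structure TwoCatData (k : Type u) [Field k] (I : Type w) extends SeqData.{u, w} k I where
  mul : Tot X →ₗ[k] Words X →ₗ[k] Tot X

/-- `A` is an augmented unital associative algebra for the product `⊙`. -/
structure TwoCatData.IsTwoCat {k : Type u} [Field k] {I : Type w} (A : TwoCatData.{u, w} k I) :
    Prop where
  isComplex : A.toSeqData.IsComplex
  /-- The composition has components
  `A(t₁ ⋯ t_r;u) ⊗ A(s₁;t₁) ⊗ ⋯ ⊗ A(s_r;t_r) → A(s₁ ⋯ s_r;u)` of degree `0`. -/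
  mul_mem : ∀ (a : HEl A.X) (l : List (HEl A.X)), bots l = a.1.top →
    IsIn A.X (tops l) a.1.bot (a.1.deg + degs l) (A.mul a.tot (word l))
  mul_zero : ∀ (a : HEl A.X) (l : List (HEl A.X)), bots l ≠ a.1.top → A.mul a.tot (word l) = 0
  /-- `(a ∘ (b₁, …, b_r)) ∘ (c₁ ⋯ c_r) = ± a ∘ (b₁ ∘ c₁, …, b_r ∘ c_r)` for words `c_i`. -/
  mul_assoc : ∀ (a : HEl A.X) (m : List (HEl A.X × List (HEl A.X))),
    bots (m.map Prod.fst) = a.1.top → (∀ x ∈ m, bots x.2 = x.1.1.top) →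
    A.mul (A.mul a.tot (word (m.map Prod.fst))) (word (m.flatMap Prod.snd)) =
      koszul m • A.mul a.tot (m.map fun x => letter A.X (A.mul x.1.tot (word x.2))).prod
  unit_mul : ∀ a : HEl A.X, A.mul (A.unit a.1.bot) (letter A.X a.tot) = a.tot
  mul_unit : ∀ a : HEl A.X,
    A.mul a.tot (a.1.top.map fun e => letter A.X (A.unit e)).prod = a.tot
  /-- The composition is a map of complexes. -/
  d_mul : ∀ (a : Tot A.X) (x : Words A.X),
    A.d (A.mul a x) = A.mul (A.d a) x + A.mul (sg A.X a) (wordD A.X A.d x)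
  aug_mul : ∀ (a : HEl A.X) (l : List (HEl A.X)), bots l = a.1.top →
    A.aug (A.mul a.tot (word l)) = A.aug a.tot * (l.map fun b => A.aug b.tot).prod

/-- `F` is compatible with compositions. -/
structure TwoCatData.IsHom {k : Type u} [Field k] {I : Type w} {A A' : TwoCatData.{u, w} k I}
    (F : SeqData.PreHom A.toSeqData A'.toSeqData) : Prop where
  isSeqHom : F.IsSeqHom
  mul : ∀ (a : HEl A.X) (l : List (HEl A.X)), bots l = a.1.top →
    F.lin (A.mul a.tot (word l)) = A'.mul (F.lin a.tot) (wordMap F.lin (word l))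

/-- The objects of 2-Cat_I, augmented. -/
structure TwoCat (k : Type u) [Field k] (I : Type w) where
  data : TwoCatData.{u, w} k I
  isTwoCat : data.IsTwoCat

namespace TwoCat

variable {k : Type u} [Field k] {I : Type w}

/-- The underlying sequence. -/
abbrev seq (A : TwoCat.{u, w} k I) : SeqData k I := A.data.toSeqData

/-- Morphisms of 2-Cat_I. -/
@[ext]
structure Hom (A A' : TwoCat.{u, w} k I) where
  pre : SeqData.PreHom A.seq A'.seq
  isHom : TwoCatData.IsHom (A := A.data) (A' := A'.data) pre

instance : Category (TwoCat.{u, w} k I) where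
  Hom := Hom
  id A := ⟨SeqData.PreHom.id _, SeqData.PreHom.IsSeqHom.id _, fun a l _ => by
    simp [SeqData.PreHom.id, wordMap_id]⟩
  comp F G := ⟨F.pre.comp G.pre, F.isHom.isSeqHom.comp G.isHom.isSeqHom, fun a l hl => by
    obtain ⟨l', h1, h2⟩ := F.isHom.isSeqHom.exists_word l
    obtain ⟨y, hy⟩ := F.isHom.isSeqHom.mem a.1 a.2
    have h3 : wordMap (G.pre.lin ∘ₗ F.pre.lin) (word l) =
        wordMap G.pre.lin (wordMap F.pre.lin (word l)) := by
      simp [wordMap, word, map_list_prod, Function.comp_def]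
    have h4 := G.isHom.mul ⟨_, y⟩ l' (by rw [h2, hl])
    simp only [SeqData.PreHom.comp, LinearMap.comp_apply, F.isHom.mul a l hl, h3]
    rw [h1, ← hy]
    exact h4⟩

end TwoCat

/-! ## 2-cocategories -/

/-- The data of an object of 2-coCat_I: a decomposition map, with values in
`⨁ C(t₁ ⋯ t_r;u) ⊗ C(s₁;t₁) ⊗ ⋯ ⊗ C(s_r;t_r)`, written inside the space of all `a ⊗ (word)`. -/
structure TwoCoCatData (k : Type u) [Field k] (I : Type w) extends SeqData.{u, w} k I where
  comul : Tot X →ₗ[k] Tot X ⊗[k] Words X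

namespace TwoCoCatData

variable {k : Type u} [Field k] {I : Type w}

/-- The extension of the decomposition map to words, multiplicative with Koszul signs. -/
def wordComul (C : TwoCoCatData.{u, w} k I) : Words C.X →ₗ[k] Words C.X ⊗[k] Words C.X :=
  tfold (ksMul (LinearMap.mul' k (Words C.X)) (wordOdd C.X) ∘ₗ
    LinearMap.rTensor _ (LinearMap.rTensor _ (letter C.X) ∘ₗ C.comul)) (1 ⊗ₜ[k] 1)

/-- The span `k_E` of the units. -/
def units (C : TwoCoCatData.{u, w} k I) : Submodule k (Tot C.X) :=
  Submodule.span k (Set.range C.unit)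

/-- The coradical filtration with respect to `k_E`:
`corad (n + 1) = Δ⁻¹(k_E ⊙ C + C ⊙ corad n)`. -/
def corad (C : TwoCoCatData.{u, w} k I) : ℕ → Submodule k (Tot C.X)
  | 0 => C.units
  | n + 1 => Submodule.comap C.comul
      (LinearMap.range (LinearMap.rTensor (Words C.X) C.units.subtype) ⊔
        LinearMap.range (LinearMap.lTensor (Tot C.X) (Subalgebra.toSubmodule
          (Algebra.adjoin k (letter C.X '' (C.corad n : Set (Tot C.X))))).subtype))

/-- `C` is a coaugmented counital coassociative coalgebra for the product `⊙`, and it is connected: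
the coradical filtration starting with `k_E` is exhaustive. -/
structure IsTwoCoCat (C : TwoCoCatData.{u, w} k I) : Prop where
  isComplex : C.toSeqData.IsComplex
  comul_mem : ∀ (p : GCell C.E) (x : C.X p), C.comul (of C.X p x) ∈ Submodule.span k
    {y | ∃ (a : HEl C.X) (l : List (HEl C.X)), bots l = a.1.top ∧ tops l = p.top ∧
      a.1.bot = p.bot ∧ a.1.deg + degs l = p.deg ∧ y = a.tot ⊗ₜ[k] word l}
  coassoc : (TensorProduct.assoc k _ _ _).toLinearMap ∘ₗ C.comul.rTensor _ ∘ₗ C.comul =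
    C.wordComul.lTensor _ ∘ₗ C.comul
  counit_comul : (TensorProduct.lid k _).toLinearMap ∘ₗ C.aug.rTensor _ ∘ₗ C.comul = letter C.X
  comul_counit : (TensorProduct.rid k _).toLinearMap ∘ₗ
    (TensorAlgebra.lift k C.aug).toLinearMap.lTensor _ ∘ₗ C.comul = LinearMap.id
  /-- The decomposition map is a map of complexes. -/
  comul_d : C.comul ∘ₗ C.d =
    (C.d.rTensor _ + TensorProduct.map (sg C.X) (wordD C.X C.d)) ∘ₗ C.comul
  comul_unit : ∀ e : C.E, C.comul (C.unit e) = C.unit e ⊗ₜ[k] letter C.X (C.unit e)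
  connected : ∀ c : Tot C.X, ∃ n : ℕ, c ∈ C.corad n

/-- `F` is compatible with decompositions. -/
structure IsHom {C C' : TwoCoCatData.{u, w} k I}
    (F : SeqData.PreHom C.toSeqData C'.toSeqData) : Prop where
  isSeqHom : F.IsSeqHom
  comul : C'.comul ∘ₗ F.lin = TensorProduct.map F.lin (wordMap F.lin) ∘ₗ C.comul

end TwoCoCatData

/-- The objects of 2-coCat_I, connected. -/
structure TwoCoCat (k : Type u) [Field k] (I : Type w) where
  data : TwoCoCatData.{u, w} k I
  isTwoCoCat : data.IsTwoCoCat

namespace TwoCoCat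

variable {k : Type u} [Field k] {I : Type w}

/-- The underlying sequence. -/
abbrev seq (C : TwoCoCat.{u, w} k I) : SeqData k I := C.data.toSeqData

/-- Morphisms of 2-coCat_I. -/
@[ext]
structure Hom (C C' : TwoCoCat.{u, w} k I) where
  pre : SeqData.PreHom C.seq C'.seq
  isHom : TwoCoCatData.IsHom (C := C.data) (C' := C'.data) pre

instance : Category (TwoCoCat.{u, w} k I) where
  Hom := Hom
  id C := ⟨SeqData.PreHom.id _, SeqData.PreHom.IsSeqHom.id _, by
    simp [SeqData.PreHom.id, wordMap_id]⟩
  comp F G := ⟨F.pre.comp G.pre, F.isHom.isSeqHom.comp G.isHom.isSeqHom, by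
    have h3 : wordMap (G.pre.lin ∘ₗ F.pre.lin) = wordMap G.pre.lin ∘ₗ wordMap F.pre.lin := by
      have : TensorAlgebra.lift k (letter _ ∘ₗ (G.pre.lin ∘ₗ F.pre.lin)) =
          (TensorAlgebra.lift k (letter _ ∘ₗ G.pre.lin)).comp
            (TensorAlgebra.lift k (letter _ ∘ₗ F.pre.lin)) := by
        ext; simp
      simp [wordMap, this]
    simp only [SeqData.PreHom.comp]
    rw [← LinearMap.comp_assoc, G.isHom.comul, LinearMap.comp_assoc, F.isHom.comul, h3,
      TensorProduct.map_comp, LinearMap.comp_assoc]⟩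

end TwoCoCat

/-! ## Planar forests -/

/-- Planar rooted forests with leaves labelled by elements of `E` and vertices labelled by graded
cells. A forest is empty, or its first tree is a single leaf `e` without vertices and `f` is the
rest, or the root vertex of its first tree is `p`, the trees above `p` form the forest `ch`, and `f`
is the rest. (A planar tree is the same as a decomposition of a polygon by chords: the vertices are
the cells of the decomposition, the leaves and the root are the edges of the polygon, and the inner
edges are the chords.) -/
inductive PForest (E : Type u) : Type u
  | nil : PForest E
  | leaf (e : E) (f : PForest E) : PForest E
  | node (p : GCell E) (ch f : PForest E) : PForest E

namespace PForest

variable {E : Type u}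

/-- The labels of the leaves, from left to right. -/
def leaves : PForest E → List E
  | nil => []
  | leaf e f => e :: f.leaves
  | node _ ch f => ch.leaves ++ f.leaves

/-- The labels of the roots. -/
def roots : PForest E → List E
  | nil => []
  | leaf e f => e :: f.roots
  | node p _ f => p.bot :: f.roots

/-- The labels fit together along the inner edges. -/
def WF : PForest E → Prop
  | nil => True
  | leaf _ f => f.WF
  | node p ch f => ch.roots = p.top ∧ ch.WF ∧ f.WF

/-- The degree of a forest, where a vertex `p` has degree `p.deg + s`. -/
def deg (s : ℤ) : PForest E → ℤ
  | nil => 0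
  | leaf _ f => f.deg s
  | node p ch f => p.deg + s + (ch.deg s + f.deg s)

/-- The tensor product of `V(p)` over the vertices `p`, in depth-first order. -/
def mod {k : Type u} [Field k] (V : Fam k E) : PForest E → ModuleCat.{u} k
  | nil => ModuleCat.of k k
  | leaf _ f => f.mod V
  | node p ch f => ModuleCat.of k (V p ⊗[k] (ch.mod V ⊗[k] f.mod V))

end PForest

section Forests

variable {k : Type u} [Field k] {E : Type u}

/-- The direct sum over all forests. -/
abbrev Forests (V : Fam k E) : Type u := ⨁ f : PForest E, f.mod V

/-- Inclusion of the summand of a forest. -/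
abbrev ofF (V : Fam k E) (f : PForest E) : f.mod V →ₗ[k] Forests V :=
  DirectSum.lof k (PForest E) (fun f => f.mod V) f

/-- Define a map on forests from its components. -/
abbrev elimF {V : Fam k E} {N : Type u} [AddCommGroup N] [Module k N]
    (φ : ∀ f : PForest E, f.mod V →ₗ[k] N) : Forests V →ₗ[k] N :=
  DirectSum.toModule k _ _ φ

/-- Define a map on `Forests V ⊗ P` from its components. -/
abbrev elimF₂ {V : Fam k E} {P N : Type u} [AddCommGroup P] [Module k P] [AddCommGroup N]
    [Module k N] (φ : ∀ f : PForest E, f.mod V ⊗[k] P →ₗ[k] N) : Forests V ⊗[k] P →ₗ[k] N :=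
  TensorProduct.lift (elimF fun f => TensorProduct.curry (φ f))

/-- The empty forest. -/
def nilF (V : Fam k E) : Forests V := ofF V PForest.nil (1 : k)

/-- Add a leaf in front of a forest. -/
def leafOp (V : Fam k E) (e : E) : Forests V →ₗ[k] Forests V :=
  elimF fun f => (ofF V (PForest.leaf e f) : f.mod V →ₗ[k] Forests V)

/-- The tree without vertices. -/
def leafTree (V : Fam k E) (e : E) : Forests V := leafOp V e (nilF V)

/-- `v ⊗ (x ⊗ y) ↦` the forest with first tree `v` with `x` above it, followed by `y`. -/
def nodeOp (V : Fam k E) : Tot V ⊗[k] (Forests V ⊗[k] Forests V) →ₗ[k] Forests V :=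
  TensorProduct.lift <| DirectSum.toModule k _ _ fun p => TensorProduct.curry <|
    (elimF₂ fun ch => (elimF₂ fun f =>
      ((ofF V (PForest.node p ch f) : V p ⊗[k] (ch.mod V ⊗[k] f.mod V) →ₗ[k] Forests V) ∘ₗ
        (TensorProduct.leftComm k _ _ _).toLinearMap ∘ₗ
        LinearMap.lTensor _ (TensorProduct.comm k _ _).toLinearMap ∘ₗ
        (TensorProduct.leftComm k _ _ _).toLinearMap)) ∘ₗ
      (TensorProduct.leftComm k _ _ _).toLinearMap ∘ₗ
      LinearMap.lTensor _ (TensorProduct.comm k _ _).toLinearMap) ∘ₗ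
    (TensorProduct.leftComm k _ _ _).toLinearMap

theorem nodeOp_apply (V : Fam k E) (p : GCell E) (ch f : PForest E) (v : V p) (x : ch.mod V)
    (y : f.mod V) : nodeOp V (of V p v ⊗ₜ (ofF V ch x ⊗ₜ ofF V f y)) =
      (ofF V (PForest.node p ch f) : V p ⊗[k] (ch.mod V ⊗[k] f.mod V) →ₗ[k] Forests V)
        (v ⊗ₜ (x ⊗ₜ y)) := by
  simp [nodeOp]
  rfl

/-- `v ⊗ x ↦` the tree with root vertex `v` and `x` above it. -/
def treeOp (V : Fam k E) : Tot V ⊗[k] Forests V →ₗ[k] Forests V :=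
  nodeOp V ∘ₗ LinearMap.lTensor _ ((TensorProduct.mk k _ _).flip (nilF V))

/-- The forest consisting of leaves. -/
def leavesF (V : Fam k E) : List E → Forests V
  | [] => nilF V
  | e :: l => leafOp V e (leavesF V l)

/-- `v ↦` the tree with one vertex `v`. -/
def corolla (V : Fam k E) : Tot V →ₗ[k] Forests V :=
  DirectSum.toModule k _ _ fun p =>
    treeOp V ∘ₗ (TensorProduct.mk k _ _).flip (leavesF V p.top) ∘ₗ of V p

/-- `x ↦ (-1)^{n|x|} x`. -/
def sgF (V : Fam k E) (s n : ℤ) : Forests V →ₗ[k] Forests V :=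
  elimF fun f => (n * f.deg s).negOnePow • ofF V f

/-- The projection to the odd part. -/
def oddF (V : Fam k E) (s : ℤ) : Forests V →ₗ[k] Forests V :=
  elimF fun f => if Odd (f.deg s) then ofF V f else 0

/-- Concatenation of forests. -/
def cat (V : Fam k E) : ∀ f : PForest E, f.mod V ⊗[k] Forests V →ₗ[k] Forests V
  | PForest.nil => (TensorProduct.lid k (Forests V)).toLinearMap
  | PForest.leaf e f => leafOp V e ∘ₗ cat V f
  | PForest.node p ch f =>
    nodeOp V ∘ₗ TensorProduct.map (of V p) (TensorProduct.map (ofF V ch) (cat V f) ∘ₗ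
      (TensorProduct.assoc k (ch.mod V) (f.mod V) (Forests V)).toLinearMap) ∘ₗ
      (TensorProduct.assoc k (V p) (ch.mod V ⊗[k] f.mod V) (Forests V)).toLinearMap

/-- Concatenation of forests. -/
def catOp (V : Fam k E) : Forests V ⊗[k] Forests V →ₗ[k] Forests V := elimF₂ (cat V)

/-- The coefficient of the empty forest. -/
def nilCoeff (V : Fam k E) : Forests V →ₗ[k] k := elimF fun f => match f with
  | PForest.nil => (LinearMap.id : k →ₗ[k] k)
  | _ => 0

/-- The sum of the coefficients of the trees without vertices. -/
def leafCoeff (V : Fam k E) : Forests V →ₗ[k] k := elimF fun f => match f with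
  | PForest.leaf _ PForest.nil => (LinearMap.id : k →ₗ[k] k)
  | _ => 0

/-- The coefficient of a forest of leaves. -/
def leavesCoeff (V : Fam k E) : ∀ f : PForest E, f.mod V →ₗ[k] k
  | PForest.nil => (LinearMap.id : k →ₗ[k] k)
  | PForest.leaf _ f => leavesCoeff V f
  | PForest.node _ _ _ => 0

/-- The projection to the trees with one vertex. -/
def cogen (V : Fam k E) : Forests V →ₗ[k] Tot V := elimF fun f => match f with
  | PForest.node p ch PForest.nil => of V p ∘ₗ (TensorProduct.rid k (V p)).toLinearMap ∘ₗ
      LinearMap.lTensor (V p) ((TensorProduct.rid k k).toLinearMap ∘ₗ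
        LinearMap.rTensor k (leavesCoeff V ch))
  | _ => 0

/-- Apply a map to every vertex, and relabel leaves. -/
def mapForest {V : Fam k E} {E' : Type u} {V' : Fam k E'} (col : E → E')
    (φ : Tot V →ₗ[k] Tot V') : ∀ f : PForest E, f.mod V →ₗ[k] Forests V'
  | PForest.nil => LinearMap.toSpanSingleton k (Forests V') (nilF V')
  | PForest.leaf e f => leafOp V' (col e) ∘ₗ mapForest col φ f
  | PForest.node p ch f => nodeOp V' ∘ₗ TensorProduct.map (φ ∘ₗ of V p)
      (TensorProduct.map (mapForest col φ ch) (mapForest col φ f))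

/-- The sum over the cuts of a forest into a part `x₁` containing the roots and a forest `x₂` of
the trees above the cut, of `± x₁ ⊗ x₂` with the Koszul sign. A single tree `v` with `x` above it
has the cut below `v`, and the cuts of `x`. -/
def cut (V : Fam k E) (s : ℤ) : ∀ f : PForest E, f.mod V →ₗ[k] Forests V ⊗[k] Forests V
  | PForest.nil => LinearMap.toSpanSingleton k _ (nilF V ⊗ₜ[k] nilF V)
  | PForest.leaf e f => TensorProduct.map (leafOp V e) (leafOp V e) ∘ₗ cut V s f
  | PForest.node p ch f =>
    ksMul (catOp V) (oddF V s) ∘ₗ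
      TensorProduct.map
        (TensorProduct.mk k _ _ (leafTree V p.bot) ∘ₗ treeOp V ∘ₗ
            TensorProduct.map (of V p) (ofF V ch) +
          LinearMap.rTensor _ (treeOp V) ∘ₗ (TensorProduct.assoc k _ _ _).symm.toLinearMap ∘ₗ
            TensorProduct.map (of V p) (cut V s ch))
        (cut V s f) ∘ₗ
      (TensorProduct.assoc k (V p) (ch.mod V) (f.mod V)).symm.toLinearMap

/-- Split off the first tree of a forest, if its root is `e` (and `0` if there is none). -/
def uncons (V : Fam k E) (e : E) : Forests V →ₗ[k] Forests V ⊗[k] Forests V :=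
  elimF fun f => match f with
  | PForest.nil => 0
  | PForest.leaf e' f =>
    if e' = e then (TensorProduct.mk k _ _ (leafTree V e) ∘ₗ ofF V f :
      f.mod V →ₗ[k] Forests V ⊗[k] Forests V) else 0
  | PForest.node p ch f =>
    if p.bot = e then
      TensorProduct.map (treeOp V ∘ₗ TensorProduct.map (of V p) (ofF V ch)) (ofF V f) ∘ₗ
        (TensorProduct.assoc k (V p) (ch.mod V) (f.mod V)).symm.toLinearMap
    else 0

/-- Put the first trees of a forest `l` on the leaves of `x` from left to right, and return the
result together with the remaining trees of `l`, with the Koszul sign. In the case of a vertex: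
`(v x y) l ↦ v x l y ↦ v (x ∘ l₁) m y ↦ v (x ∘ l₁) y m ↦ v (x ∘ l₁) (y ∘ m₁) n` for
`l = l₁ m` and `m = m₁ n`. -/
def graft (V : Fam k E) (s : ℤ) :
    ∀ f : PForest E, f.mod V ⊗[k] Forests V →ₗ[k] Forests V ⊗[k] Forests V
  | PForest.nil =>
    TensorProduct.mk k _ _ (nilF V) ∘ₗ (TensorProduct.lid k (Forests V)).toLinearMap
  | PForest.leaf e f =>
    LinearMap.rTensor _ (catOp V) ∘ₗ (TensorProduct.assoc k _ _ _).symm.toLinearMap ∘ₗ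
      LinearMap.lTensor _ (graft V s f) ∘ₗ
      (TensorProduct.leftComm k (f.mod V) (Forests V) (Forests V)).toLinearMap ∘ₗ
      LinearMap.lTensor (f.mod V) (LinearMap.rTensor _ (sgF V s (f.deg s)) ∘ₗ uncons V e)
  | PForest.node p ch f =>
    LinearMap.rTensor _ (nodeOp V) ∘ₗ (TensorProduct.assoc k _ _ _).symm.toLinearMap ∘ₗ
      LinearMap.lTensor _ ((TensorProduct.assoc k _ _ _).symm.toLinearMap ∘ₗ
        LinearMap.lTensor _ (graft V s f ∘ₗ (TensorProduct.comm k _ _).toLinearMap ∘ₗ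
          LinearMap.rTensor _ (sgF V s (f.deg s))) ∘ₗ
        (TensorProduct.assoc k _ _ _).toLinearMap ∘ₗ
        LinearMap.rTensor (f.mod V) (graft V s ch) ∘ₗ
        (TensorProduct.assoc k (ch.mod V) (Forests V) (f.mod V)).symm.toLinearMap ∘ₗ
        LinearMap.lTensor (ch.mod V) (LinearMap.rTensor _ (sgF V s (f.deg s)) ∘ₗ
          (TensorProduct.comm k (f.mod V) (Forests V)).toLinearMap) ∘ₗ
        (TensorProduct.assoc k (ch.mod V) (f.mod V) (Forests V)).toLinearMap) ∘ₗ
      LinearMap.rTensor _ (of V p) ∘ₗ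
      (TensorProduct.assoc k (V p) (ch.mod V ⊗[k] f.mod V) (Forests V)).toLinearMap

/-- `x ⊗ l ↦ x ∘ l`, where the trees of `l` are put on the leaves of `x` (and `0` if they do not
match). -/
def graftOp (V : Fam k E) (s : ℤ) : Forests V ⊗[k] Forests V →ₗ[k] Forests V :=
  (TensorProduct.rid k _).toLinearMap ∘ₗ LinearMap.lTensor _ (nilCoeff V) ∘ₗ elimF₂ (graft V s)

/-- The underlying family of the free 2-category and of the cofree 2-cocategory on `Σ^s V`: the
direct sum, over all trees with given leaves and root, of the tensor products of `Σ^s V` over the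
vertices. Here `(Σ^s V)_n = V_{n-s}`. -/
def freeFam (V : Fam k E) (s : ℤ) : Fam k E := fun p => ModuleCat.of k
  (⨁ f : {f : PForest E // f.WF ∧ f.leaves = p.top ∧ f.roots = [p.bot] ∧ f.deg s = p.deg},
    f.1.mod V)

/-- The inclusion into the sum over all forests. -/
def inclF (V : Fam k E) (s : ℤ) : Tot (freeFam V s) →ₗ[k] Forests V :=
  DirectSum.toModule k _ _ fun _ => DirectSum.toModule k _ _ fun f => ofF V f.1

/-- The projection that annihilates the forests which are not trees with matching labels. -/
def projF (V : Fam k E) (s : ℤ) : Forests V →ₗ[k] Tot (freeFam V s) :=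
  elimF fun f => if h : f.WF ∧ ∃ t, f.roots = [t] then
    of (freeFam V s) ⟨f.leaves, h.2.choose, f.deg s⟩ ∘ₗ
      DirectSum.lof k
        {g : PForest E // g.WF ∧ g.leaves = f.leaves ∧ g.roots = [h.2.choose] ∧
          g.deg s = f.deg s} (fun g => g.1.mod V) ⟨f, h.1, rfl, h.2.choose_spec, rfl⟩
    else 0

/-- A forest as a word of trees. -/
def forestToWord (V : Fam k E) (s : ℤ) : ∀ f : PForest E, f.mod V →ₗ[k] Words (freeFam V s)
  | PForest.nil => LinearMap.toSpanSingleton k _ 1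
  | PForest.leaf e f =>
    LinearMap.mulLeft k (letter _ (projF V s (leafTree V e))) ∘ₗ forestToWord V s f
  | PForest.node p ch f =>
    LinearMap.mul' k _ ∘ₗ
      TensorProduct.map
        (letter _ ∘ₗ projF V s ∘ₗ treeOp V ∘ₗ TensorProduct.map (of V p) (ofF V ch))
        (forestToWord V s f) ∘ₗ
      (TensorProduct.assoc k (V p) (ch.mod V) (f.mod V)).symm.toLinearMap

/-- A word of trees as a forest. -/
def wordToForest (V : Fam k E) (s : ℤ) : Words (freeFam V s) →ₗ[k] Forests V :=
  tfold (catOp V ∘ₗ LinearMap.rTensor _ (inclF V s)) (nilF V)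

end Forests

/-! ## The bar construction -/

section Bar

variable {k : Type u} [Field k] {I : Type w} (A : TwoCat.{u, w} k I)

namespace TwoCat

/-- `x ↦ ∑ ± (1 ⋯ 1 b 1 ⋯ 1) ⊗ y`, the sum over the root vertices `b` of the trees of `x`, where
`y` is `x` with the vertex `b` removed, and the word has a unit for each other tree of `x`. The
sign is that of moving the suspension of `b` to the left. -/
def extractRoot : ∀ f : PForest A.seq.E, f.mod A.seq.red →ₗ[k]
      Words A.seq.X ⊗[k] Forests A.seq.red
  | PForest.nil => 0
  | PForest.leaf e f =>
    TensorProduct.map (LinearMap.mulLeft k (letter A.seq.X (A.seq.unit e)))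
      (leafOp A.seq.red e) ∘ₗ extractRoot f
  | PForest.node p ch f =>
    TensorProduct.map
        (LinearMap.mulRight k (f.roots.map fun e => letter A.seq.X (A.seq.unit e)).prod ∘ₗ
          letter A.seq.X ∘ₗ A.seq.inc ∘ₗ of A.seq.red p)
        (catOp A.seq.red ∘ₗ TensorProduct.map (ofF A.seq.red ch) (ofF A.seq.red f)) +
      LinearMap.lTensor _ (nodeOp A.seq.red ∘ₗ
          TensorProduct.map (of A.seq.red p) (LinearMap.rTensor _ (ofF A.seq.red ch))) ∘ₗ
        (TensorProduct.leftComm k _ _ _).toLinearMap ∘ₗ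
        LinearMap.lTensor (A.seq.red p) ((TensorProduct.leftComm k _ _ _).toLinearMap ∘ₗ
          LinearMap.lTensor (ch.mod A.seq.red) (LinearMap.rTensor _
              (LinearMap.mulLeft k (letter A.seq.X (A.seq.unit p.bot)) ∘ₗ
                (if Odd (p.deg + 1 + ch.deg 1) then -wordMap (sg A.seq.X) else LinearMap.id)) ∘ₗ
            extractRoot f))

/-- The differential on trees of elements of `ΣĀ`: the differential of `ΣĀ` at each vertex, plus
the contractions of the inner edges, `Σa ⊗ Σb ↦ (-1)^|a| Σ(a ∘ (1, …, 1, b, 1, …, 1))`. -/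
def barD : ∀ f : PForest A.seq.E, f.mod A.seq.red →ₗ[k] Forests A.seq.red
  | PForest.nil => 0
  | PForest.leaf e f => leafOp A.seq.red e ∘ₗ barD f
  | PForest.node p ch f =>
    nodeOp A.seq.red ∘ₗ
        TensorProduct.map
          (-(SeqData.ret A.isTwoCat.isComplex ∘ₗ A.seq.d ∘ₗ A.seq.inc ∘ₗ of A.seq.red p))
          (TensorProduct.map (ofF A.seq.red ch) (ofF A.seq.red f)) +
      p.deg.negOnePow • (nodeOp A.seq.red ∘ₗ
        TensorProduct.map
          (SeqData.ret A.isTwoCat.isComplex ∘ₗ TensorProduct.lift A.data.mul ∘ₗ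
            LinearMap.rTensor _ (A.seq.inc ∘ₗ of A.seq.red p)) LinearMap.id ∘ₗ
        (TensorProduct.assoc k _ _ _).symm.toLinearMap ∘ₗ
        LinearMap.lTensor (A.seq.red p) ((TensorProduct.assoc k _ _ _).toLinearMap ∘ₗ
          TensorProduct.map (extractRoot A ch) (ofF A.seq.red f))) +
      (p.deg + 1).negOnePow • (nodeOp A.seq.red ∘ₗ TensorProduct.map (of A.seq.red p)
        (TensorProduct.map (barD ch) (ofF A.seq.red f))) +
      (p.deg + 1 + ch.deg 1).negOnePow • (nodeOp A.seq.red ∘ₗ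
        TensorProduct.map (of A.seq.red p) (TensorProduct.map (ofF A.seq.red ch) (barD f)))

/-- The bar construction: the cofree 2-cocategory on `ΣĀ` with the differential `barD`. -/
def bar : TwoCoCatData.{u, w} k I where
  E := A.seq.E
  src := A.seq.src
  tgt := A.seq.tgt
  X := freeFam A.seq.red 1
  d := projF A.seq.red 1 ∘ₗ elimF (barD A) ∘ₗ inclF A.seq.red 1
  unit e := projF A.seq.red 1 (leafTree A.seq.red e)
  aug := leafCoeff A.seq.red ∘ₗ inclF A.seq.red 1
  comul := TensorProduct.map (projF A.seq.red 1) (elimF (forestToWord A.seq.red 1)) ∘ₗ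
    elimF (cut A.seq.red 1) ∘ₗ inclF A.seq.red 1

variable {A}

/-- The bar construction on morphisms. -/
def barMap {A' : TwoCat.{u, w} k I} (F : A ⟶ A') :
    SeqData.PreHom A.bar.toSeqData A'.bar.toSeqData where
  col := F.pre.col
  lin := projF A'.seq.red 1 ∘ₗ
    elimF (mapForest F.pre.col
      (SeqData.ret A'.isTwoCat.isComplex ∘ₗ F.pre.lin ∘ₗ A.seq.inc)) ∘ₗ inclF A.seq.red 1

variable (A)

/-- The map `𝓑(A) → ΣĀ → A` of degree `-1`. -/
def barProj : Tot A.bar.X →ₗ[k] Tot A.seq.X :=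
  A.seq.inc ∘ₗ cogen A.seq.red ∘ₗ inclF A.seq.red 1

end TwoCat

end Bar

/-! ## The cobar construction -/

section Cobar

variable {k : Type u} [Field k] {I : Type w} (C : TwoCoCat.{u, w} k I)

namespace TwoCoCat

/-- `c₁ ⋯ c_r ↦ ∑ i`, the forest with one vertex, `Σ⁻¹c̄_i` as `i`-th tree, with coefficient
`∏ j ≠ i, aug(c_j)`. -/
def wordToVertex : Words C.seq.X →ₗ[k] Forests C.seq.red :=
  tfold (catOp C.seq.red) (nilF C.seq.red) ∘ₗ
    (let u : Tot C.seq.X →ₗ[k] Forests C.seq.red := DirectSum.toModule k _ _ fun p =>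
        (C.seq.aug ∘ₗ of C.seq.X p).smulRight (leafTree C.seq.red p.bot)
     insertOne (TensorAlgebra.ι k ∘ₗ u)
      (TensorAlgebra.ι k ∘ₗ corolla C.seq.red ∘ₗ SeqData.ret C.isTwoCoCat.isComplex)
      (TensorAlgebra.ι k ∘ₗ u))

/-- The differential of a generator: `Σ⁻¹c ↦ -Σ⁻¹dc - ∑ (-1)^|a| Σ⁻¹a ∘ (1, …, 1, Σ⁻¹b, 1, …, 1)`,
the sum over the reduced decompositions of `c` with two factors `a`, `b`. -/
def cobarGen : Tot C.seq.red →ₗ[k] Forests C.seq.red :=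
  -(corolla C.seq.red ∘ₗ SeqData.ret C.isTwoCoCat.isComplex ∘ₗ C.seq.d ∘ₗ C.seq.inc) -
    treeOp C.seq.red ∘ₗ
      TensorProduct.map (SeqData.ret C.isTwoCoCat.isComplex ∘ₗ sg C.seq.X) (wordToVertex C) ∘ₗ
      C.data.comul ∘ₗ C.seq.inc

/-- The derivation extending `cobarGen`. -/
def cobarD : ∀ f : PForest C.seq.E, f.mod C.seq.red →ₗ[k] Forests C.seq.red
  | PForest.nil => 0
  | PForest.leaf e f => leafOp C.seq.red e ∘ₗ cobarD f
  | PForest.node p ch f =>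
    catOp C.seq.red ∘ₗ
        TensorProduct.map (graftOp C.seq.red (-1) ∘ₗ
          TensorProduct.map (cobarGen C ∘ₗ of C.seq.red p) (ofF C.seq.red ch))
          (ofF C.seq.red f) ∘ₗ
        (TensorProduct.assoc k (C.seq.red p) (ch.mod C.seq.red)
          (f.mod C.seq.red)).symm.toLinearMap +
      (p.deg - 1).negOnePow • (nodeOp C.seq.red ∘ₗ TensorProduct.map (of C.seq.red p)
        (TensorProduct.map (cobarD ch) (ofF C.seq.red f))) +
      (p.deg - 1 + ch.deg (-1)).negOnePow • (nodeOp C.seq.red ∘ₗ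
        TensorProduct.map (of C.seq.red p) (TensorProduct.map (ofF C.seq.red ch) (cobarD f)))

/-- The cobar construction: the free 2-category on `Σ⁻¹C̄` with the differential `cobarD`. -/
def cobar : TwoCatData.{u, w} k I where
  E := C.seq.E
  src := C.seq.src
  tgt := C.seq.tgt
  X := freeFam C.seq.red (-1)
  d := projF C.seq.red (-1) ∘ₗ elimF (cobarD C) ∘ₗ inclF C.seq.red (-1)
  unit e := projF C.seq.red (-1) (leafTree C.seq.red e)
  aug := leafCoeff C.seq.red ∘ₗ inclF C.seq.red (-1)
  mul := TensorProduct.curry (projF C.seq.red (-1) ∘ₗ graftOp C.seq.red (-1) ∘ₗ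
    TensorProduct.map (inclF C.seq.red (-1)) (wordToForest C.seq.red (-1)))

variable {C}

/-- The cobar construction on morphisms. -/
def cobarMap {C' : TwoCoCat.{u, w} k I} (F : C ⟶ C') :
    SeqData.PreHom C.cobar.toSeqData C'.cobar.toSeqData where
  col := F.pre.col
  lin := projF C'.seq.red (-1) ∘ₗ
    elimF (mapForest F.pre.col
      (SeqData.ret C'.isTwoCoCat.isComplex ∘ₗ F.pre.lin ∘ₗ C.seq.inc)) ∘ₗ inclF C.seq.red (-1)

variable (C)

/-- The map `C → Σ⁻¹C̄ → 𝓑*(C)` of degree `-1`. -/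
def cobarIncl : Tot C.seq.X →ₗ[k] Tot C.cobar.X :=
  projF C.seq.red (-1) ∘ₗ corolla C.seq.red ∘ₗ SeqData.ret C.isTwoCoCat.isComplex

end TwoCoCat

end Cobar

/-! ## The functors -/

/-- The bar construction is a functor to 2-coCat_I. -/
structure BarLaws (k : Type u) [Field k] (I : Type w) : Prop where
  obj : ∀ A : TwoCat.{u, w} k I, A.bar.IsTwoCoCat
  map : ∀ {A A' : TwoCat.{u, w} k I} (F : A ⟶ A'),
    TwoCoCatData.IsHom (C := A.bar) (C' := A'.bar) (TwoCat.barMap F)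
  map_id : ∀ A : TwoCat.{u, w} k I, TwoCat.barMap (𝟙 A) = SeqData.PreHom.id _
  map_comp : ∀ {A A' A'' : TwoCat.{u, w} k I} (F : A ⟶ A') (G : A' ⟶ A''),
    TwoCat.barMap (F ≫ G) = (TwoCat.barMap F).comp (TwoCat.barMap G)

/-- The cobar construction is a functor to 2-Cat_I. -/
structure CobarLaws (k : Type u) [Field k] (I : Type w) : Prop where
  obj : ∀ C : TwoCoCat.{u, w} k I, C.cobar.IsTwoCat
  map : ∀ {C C' : TwoCoCat.{u, w} k I} (F : C ⟶ C'),
    TwoCatData.IsHom (A := C.cobar) (A' := C'.cobar) (TwoCoCat.cobarMap F)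
  map_id : ∀ C : TwoCoCat.{u, w} k I, TwoCoCat.cobarMap (𝟙 C) = SeqData.PreHom.id _
  map_comp : ∀ {C C' C'' : TwoCoCat.{u, w} k I} (F : C ⟶ C') (G : C' ⟶ C''),
    TwoCoCat.cobarMap (F ≫ G) = (TwoCoCat.cobarMap F).comp (TwoCoCat.cobarMap G)

/-- The functor `𝓑 : 2-Cat_I ⥤ 2-coCat_I`. -/
def barFunctor {k : Type u} [Field k] {I : Type w} (h : BarLaws.{u, w} k I) :
    TwoCat.{u, w} k I ⥤ TwoCoCat.{u, w} k I where
  obj A := ⟨A.bar, h.obj A⟩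
  map F := ⟨TwoCat.barMap F, h.map F⟩
  map_id A := TwoCoCat.Hom.ext (h.map_id A)
  map_comp F G := TwoCoCat.Hom.ext (h.map_comp F G)

/-- The functor `𝓑* : 2-coCat_I ⥤ 2-Cat_I`. -/
def cobarFunctor {k : Type u} [Field k] {I : Type w} (h : CobarLaws.{u, w} k I) :
    TwoCoCat.{u, w} k I ⥤ TwoCat.{u, w} k I where
  obj C := ⟨C.cobar, h.obj C⟩
  map F := ⟨TwoCoCat.cobarMap F, h.map F⟩
  map_id C := TwoCat.Hom.ext (h.map_id C)
  map_comp F G := TwoCat.Hom.ext (h.map_comp F G)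

/-! ## Twisting cochains -/

section Twisting

variable {k : Type u} [Field k] {I : Type w}

/-- `(α ⋆ α)(c) = ∑ (-1)^|a| α(a) ∘ (1, …, 1, α(b), 1, …, 1)`, the sum over the decompositions
of `c` with two factors `a`, `b` (all other factors being units, through `aug`). -/
def star (C : TwoCoCat.{u, w} k I) (A : TwoCat.{u, w} k I)
    (α : SeqData.PreHom C.seq A.seq) : Tot C.seq.X →ₗ[k] Tot A.seq.X :=
  let u : Tot C.seq.X →ₗ[k] Tot A.seq.X := DirectSum.toModule k _ _ fun p =>
    (C.seq.aug ∘ₗ of C.seq.X p).smulRight (A.seq.unit (α.col p.bot))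
  TensorProduct.lift A.data.mul ∘ₗ
    TensorProduct.map (α.lin ∘ₗ sg C.seq.X)
      (insertOne (letter A.seq.X ∘ₗ u) (letter A.seq.X ∘ₗ α.lin) (letter A.seq.X ∘ₗ u)) ∘ₗ
    C.data.comul

/-- Twisting cochains: maps `C → A` of degree `-1` over a map of 1-morphisms, with values in `Ā` and
vanishing on the units (that is, maps `C̄ → ΣĀ` of degree `0`), which satisfy the Maurer–Cartan
equation. -/
structure IsTwistingCochain (C : TwoCoCat.{u, w} k I) (A : TwoCat.{u, w} k I)
    (α : SeqData.PreHom C.seq A.seq) : Prop where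
  src : ∀ e, A.seq.src (α.col e) = C.seq.src e
  tgt : ∀ e, A.seq.tgt (α.col e) = C.seq.tgt e
  mem : ∀ (p : GCell C.seq.E) (x : C.seq.X p),
    IsIn A.seq.X (p.top.map α.col) (α.col p.bot) (p.deg - 1) (α.lin (of C.seq.X p x))
  aug : A.seq.aug ∘ₗ α.lin = 0
  unit : ∀ e, α.lin (C.seq.unit e) = 0
  maurerCartan : A.seq.d ∘ₗ α.lin + α.lin ∘ₗ C.seq.d + star C A α = 0

end Twisting

end
end BarCobar

/-!
# The bar–cobar adjunction for 2-categories with a fixed set of objects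

Both sides of the adjunction are the set of twisting cochains from `C` to `A`, that is, of the
solutions of the Maurer–Cartan equation `d ∘ α + α ∘ d + α ⋆ α = 0`.

**Forests.** Composition takes a tree and a word of trees as its arguments, decomposition has values
in such pairs, and a word of trees is a planar forest. All operations (concatenation, grafting,
cutting, the differentials) are therefore studied on `Forests V`, the sum over all planar forests,
where they satisfy recursions on the first tree of a forest. They are multilinear, so that they are
determined by decorated forests (`DF V`, `DF.ev`), on which induction is possible. The subspaces `FS
V s t b n` of the sums of forests with leaves `t`, roots `b` and degree `n` record that labels
match. Trees are the forests with a single root (`inclF`, `projF`), and words of trees are forests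
(`wordToForest`, `ftw`). The laws of the free algebra and of the cofree coalgebra are
`graftOp_assoc` and `cutOp_coassoc`.

**The Bianchi identity.** For a degree `-1` map `α` with `d ∘ α + α ∘ d + α ⋆ α = 0`, where `d` is a
(co)derivation that need not have square zero, one has `d ∘ d ∘ α = α ∘ d ∘ d` (`bianchi`); the
reason is the associativity `(α ⋆ α) ⋆ α = α ⋆ (α ⋆ α)` (`starOp_assoc`), in which the insertions at
two different letters of a word cancel. It gives `d ∘ d = 0` for both constructions.

**Cobar construction.** The differential is a derivation for grafting (`cobarDF_graftOp`). The
inclusion `C → 𝓑*(C)` of the generators satisfies the Maurer–Cartan equation by the definition of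
the differential, so `d ∘ d` vanishes on the generators by the Bianchi identity, and hence
everywhere (`cobar_isTwoCat`). A twisting cochain `α` extends to a unique map of algebras, the
evaluation of trees in `A`; the Maurer–Cartan equation says that the extension commutes with the
differentials on the generators (`cobarLift_isHom`, `eq_cobarLift`).

**Bar construction.** The differential acts on a tree by the internal differential, by contraction
of the edges at the root vertex, and by recursion above the root vertex. The contraction first
removes a root vertex from the forest above the root of the tree (`rootOp`), which commutes with
cutting (`rootOp_cutOp`); this makes the differential a coderivation (`cutOp_barDF`). The projection
`𝓑(A) → A` to the cogenerators satisfies the Maurer–Cartan equation (`barProj_maurerCartan`), so `d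
∘ d` vanishes after the projection to the cogenerators by the Bianchi identity, and hence
everywhere, since a tree is determined by the root vertices of its cuts (`bar_isTwoCoCat`). A map `β
: C → ΣĀ` extends to a unique map `g : C → 𝓑(A)` of coalgebras, the solution of `g(c) = aug(c) + ∑
β(c')(g(c''), …, g(c''))`, which is found by recursion over the coradical filtration of `C`
(`IsCoExt`, `exists_isCoExt`, `IsCoExt.cutOp`). It commutes with the differentials if and only if
the Maurer–Cartan equation holds (`IsCoExt.isHom`, `exists_barLift`, `bar_hom_ext`).

**Adjunction.** Twisting cochains can be composed with morphisms on either side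
(`IsTwistingCochain.comp_hom`, `IsTwistingCochain.hom_comp`). Functoriality and naturality are
therefore checked on generators and cogenerators, where they are evident.
-/

namespace BarCobar

noncomputable section

open scoped Classical

open TensorProduct (map_tmul tmul_smul smul_tmul' add_tmul tmul_add zero_tmul tmul_zero lid_tmul
  rid_tmul assoc_tmul assoc_symm_tmul mk_apply induction_on smul_tmul_smul)
open TensorProduct renaming map → tmap, mk → tmk, assoc → tassoc
open LinearMap (rTensor lTensor rTensor_tmul lTensor_tmul mulLeft mulRight mulRight_apply)
open LinearMap renaming comp_apply → lcomp_apply, add_apply → ladd_apply,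
  zero_apply → lzero_apply, smul_apply → lsmul_apply
open Submodule (subset_span span_le)

/-! ### Koszul signs as scalars -/

section Signs

/-- The Koszul sign `(-1)^n` as an element of the ground field. -/
def sgn (k : Type u) [Field k] (n : ℤ) : k := ((n.negOnePow : ℤˣ) : ℤ)

variable {k : Type u} [Field k] {M : Type u} [AddCommGroup M] [Module k M]

theorem negOnePow_smul (n : ℤ) (x : M) : n.negOnePow • x = sgn k n • x := by
  rw [sgn, Units.smul_def, Int.cast_smul_eq_zsmul]

theorem sgn_add (a b : ℤ) : sgn k (a + b) = sgn k a * sgn k b := by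
  simp [sgn, Int.negOnePow_add]

@[simp] theorem sgn_zero : sgn k 0 = 1 := by simp [sgn]

@[simp] theorem sgn_one : sgn k 1 = -1 := by simp [sgn]

theorem sgn_even {n : ℤ} (h : Even n) : sgn k n = 1 := by simp [sgn, Int.negOnePow_even n h]

theorem sgn_odd {n : ℤ} (h : Odd n) : sgn k n = -1 := by simp [sgn, Int.negOnePow_odd n h]

/-- Signs depend only on the exponent modulo two. -/
theorem sgn_congr {a b : ℤ} (h : (a : ZMod 2) = (b : ZMod 2)) : sgn k a = sgn k b := by
  have : a.negOnePow = b.negOnePow := by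
    rw [Int.negOnePow_eq_iff, even_iff_two_dvd]
    have := (ZMod.intCast_eq_intCast_iff_dvd_sub b a 2).1 h.symm
    simpa using this
  simp [sgn, this]

theorem sgn_mul_self (a : ℤ) : sgn k a * sgn k a = 1 := by
  rw [← sgn_add]; exact sgn_even (Even.add_self a)

theorem neg_eq_sgn_smul (x : M) : -x = sgn k 1 • x := by simp

end Signs

/-! ### Linear algebra of words -/

section Linear

variable {k : Type u} [Field k] {M B N : Type u} [AddCommGroup M] [Module k M] [Ring B]
  [Algebra k B] [AddCommGroup N] [Module k N]

/-- The product of `ksMul` on tensors of homogeneous elements. -/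
theorem ksMul_tmul (m : M ⊗[k] M →ₗ[k] M) (o : M →ₗ[k] M) (a b c d : M) (i j : ℤ)
    (hb : o b = if Odd i then b else 0) (hc : o c = if Odd j then c else 0) :
    ksMul m o ((a ⊗ₜ b) ⊗ₜ (c ⊗ₜ d)) = sgn k (i * j) • (m (a ⊗ₜ c) ⊗ₜ[k] m (b ⊗ₜ d)) := by
  simp only [ksMul, lcomp_apply, LinearMap.sub_apply, lsmul_apply, map_tmul, LinearMap.id_apply,
    map_sub, map_smul, hb, hc, LinearEquiv.coe_coe, TensorProduct.tensorTensorTensorComm_tmul]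
  rcases Int.even_or_odd i with hi | hi
  · rw [sgn_even (hi.mul_right j), if_neg (Int.not_odd_iff_even.2 hi)]
    simp
  · rcases Int.even_or_odd j with hj | hj
    · rw [sgn_even (hj.mul_left i), if_neg (Int.not_odd_iff_even.2 hj)]
      simp
    · rw [sgn_odd (hi.mul hj), if_pos hi, if_pos hj, neg_one_smul, two_smul]
      abel

theorem tfold_one (op : M ⊗[k] N →ₗ[k] N) (n₀ : N) : tfold op n₀ (1 : TensorAlgebra k M) = n₀ := by
  simp [tfold]

theorem tfold_ι_mul (op : M ⊗[k] N →ₗ[k] N) (n₀ : N) (c : M) (x : TensorAlgebra k M) :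
    tfold op n₀ (TensorAlgebra.ι k c * x) = op (c ⊗ₜ tfold op n₀ x) := by
  simp [tfold]

theorem insertOne_aux (u v w : M →ₗ[k] B) (x : TensorAlgebra k M) :
    ∀ L : M →ₗ[k] Matrix (Fin 2) (Fin 2) B, (∀ c, L c = !![u c, v c; 0, w c]) →
    TensorAlgebra.lift k L x 1 0 = 0 ∧
      TensorAlgebra.lift k L x 1 1 = TensorAlgebra.lift k w x := by
  intro L hL
  induction x using TensorAlgebra.induction with
  | algebraMap r => simp [Matrix.algebraMap_matrix_apply]
  | ι c => simp [hL]
  | mul a b ha hb => simp [Matrix.mul_apply, ha, hb]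
  | add a b ha hb => simp [ha, hb]

theorem insertOne_one (u v w : M →ₗ[k] B) : insertOne u v w 1 = 0 := by
  simp [insertOne]

theorem insertOne_ι_mul (u v w : M →ₗ[k] B) (c : M) (x : TensorAlgebra k M) :
    insertOne u v w (TensorAlgebra.ι k c * x) =
      u c * insertOne u v w x + v c * TensorAlgebra.lift k w x := by
  simp only [insertOne, lcomp_apply, AlgHom.toLinearMap_apply, map_mul, TensorAlgebra.lift_ι_apply,
    Matrix.entryLinearMap_apply, Matrix.mul_apply, Fin.sum_univ_two]
  rw [(insertOne_aux u v w x _ (fun _ => rfl)).2]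
  simp

theorem insertOne_ι (u v w : M →ₗ[k] B) (c : M) :
    insertOne u v w (TensorAlgebra.ι k c) = v c := by
  have := insertOne_ι_mul u v w c 1
  simpa [insertOne_one] using this

/-- A subspace of the tensor algebra that contains `1` and is stable under left multiplication by
the letters in `S` contains the subalgebra generated by these letters. -/
theorem adjoin_ι_le (S : Set M) (p : Submodule k (TensorAlgebra k M)) (h1 : 1 ∈ p)
    (hm : ∀ c ∈ S, ∀ x ∈ p, TensorAlgebra.ι k c * x ∈ p) :
    Subalgebra.toSubmodule (Algebra.adjoin k (TensorAlgebra.ι k '' S)) ≤ p := by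
  rw [Algebra.adjoin_eq_span, span_le]
  intro x hx
  induction hx using Submonoid.closure_induction_left with
  | one => exact h1
  | mul_left y hy z hz ih =>
    obtain ⟨c, hc, rfl⟩ := hy
    exact hm c hc _ ih

theorem tensorAlgebra_le (p : Submodule k (TensorAlgebra k M)) (h1 : 1 ∈ p)
    (hm : ∀ c, ∀ x ∈ p, TensorAlgebra.ι k c * x ∈ p) (x : TensorAlgebra k M) : x ∈ p := by
  have := adjoin_ι_le Set.univ p h1 (fun c _ => hm c)
  apply this
  rw [Set.image_univ, TensorAlgebra.adjoin_range_ι]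
  trivial

/-- Two linear maps on the tensor algebra agree if they agree on `1` and satisfy the same recursion
on the first letter. -/
theorem tensorAlgebra_ext {f g : TensorAlgebra k M →ₗ[k] N} (h1 : f 1 = g 1)
    (hm : ∀ c x, f x = g x → f (TensorAlgebra.ι k c * x) = g (TensorAlgebra.ι k c * x))
    (x : TensorAlgebra k M) : f x = g x :=
  tensorAlgebra_le (LinearMap.eqLocus f g) h1 hm x

theorem adjoin_ι_ext {f g : TensorAlgebra k M →ₗ[k] N} (S : Set M) (h1 : f 1 = g 1)
    (hm : ∀ c ∈ S, ∀ x, f x = g x → f (TensorAlgebra.ι k c * x) = g (TensorAlgebra.ι k c * x))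
    {x : TensorAlgebra k M} (hx : x ∈ Algebra.adjoin k (TensorAlgebra.ι k '' S)) : f x = g x :=
  adjoin_ι_le S (LinearMap.eqLocus f g) h1 hm hx

theorem ι_inj {a b : M} (h : TensorAlgebra.ι k a = TensorAlgebra.ι k b) : a = b :=
  TensorAlgebra.ι_leftInverse.injective h

theorem ιInv_ι (a : M) : TensorAlgebra.ιInv (TensorAlgebra.ι k a) = a :=
  TensorAlgebra.ι_leftInverse a

/-- Two linear maps agree on the images of `x` if they do so after applying them to both entries
of all elements of a spanning set. -/
theorem span_ext {f g : M →ₗ[k] N} {S : Set M} (h : ∀ x ∈ S, f x = g x) {x : M}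
    (hx : x ∈ Submodule.span k S) : f x = g x :=
  LinearMap.eqOn_span (f := f) (g := g) h hx

theorem tensor_ext {M' : Type u} [AddCommGroup M'] [Module k M'] {f g : M ⊗[k] M' →ₗ[k] N}
    (h : ∀ a b, f (a ⊗ₜ b) = g (a ⊗ₜ b)) (x : M ⊗[k] M') : f x = g x :=
  congrArg (fun φ : M ⊗[k] M' →ₗ[k] N => φ x) (TensorProduct.ext' h)

end Linear

/-! ### Decorated forests -/

section Decorated

variable {k : Type u} [Field k] {E : Type u}

theorem elimF_ofF {V : Fam k E} {N : Type u} [AddCommGroup N] [Module k N]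
    (φ : ∀ f : PForest E, f.mod V →ₗ[k] N) (f : PForest E) (x : f.mod V) : elimF φ (ofF V f x) = φ f x :=
  DirectSum.toModule_lof ..

/-- Planar forests whose vertices carry homogeneous elements of `V`. They stand for the pure tensors
in `Forests V`. -/
inductive DF (V : Fam k E) : Type u
  | nil : DF V
  | leaf (e : E) (f : DF V) : DF V
  | node (a : HEl V) (ch f : DF V) : DF V

namespace DF

variable {V : Fam k E}

/-- The underlying forest. -/
def shape : DF V → PForest E
  | nil => PForest.nil
  | leaf e f => PForest.leaf e f.shape
  | node a ch f => PForest.node a.1 ch.shape f.shape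

/-- The tensor product of the elements at the vertices. -/
def val : ∀ x : DF V, x.shape.mod V
  | nil => (1 : k)
  | leaf _ f => f.val
  | node a ch f => a.2 ⊗ₜ[k] (ch.val ⊗ₜ[k] f.val)

/-- The element of the sum over all forests given by a decorated forest. -/
def ev (x : DF V) : Forests V := ofF V x.shape x.val

/-- The labels of the leaves. -/
def leaves (x : DF V) : List E := x.shape.leaves

/-- The labels of the roots. -/
def roots (x : DF V) : List E := x.shape.roots

/-- The labels fit together along the inner edges. -/
def WF (x : DF V) : Prop := x.shape.WF

/-- The total degree, where each vertex is shifted by `s`. -/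
def deg (s : ℤ) (x : DF V) : ℤ := x.shape.deg s

/-- Concatenation of decorated forests. -/
def append : DF V → DF V → DF V
  | nil, y => y
  | leaf e f, y => leaf e (f.append y)
  | node a ch f, y => node a ch (f.append y)

@[simp] theorem leaves_nil : (nil : DF V).leaves = [] := rfl
@[simp] theorem leaves_leaf (e : E) (f : DF V) : (leaf e f).leaves = e :: f.leaves := rfl
@[simp] theorem leaves_node (a : HEl V) (ch f : DF V) :
    (node a ch f).leaves = ch.leaves ++ f.leaves := rfl
@[simp] theorem roots_nil : (nil : DF V).roots = [] := rfl
@[simp] theorem roots_leaf (e : E) (f : DF V) : (leaf e f).roots = e :: f.roots := rfl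
@[simp] theorem roots_node (a : HEl V) (ch f : DF V) :
    (node a ch f).roots = a.1.bot :: f.roots := rfl
@[simp] theorem wf_nil : (nil : DF V).WF ↔ True := Iff.rfl
@[simp] theorem wf_leaf (e : E) (f : DF V) : (leaf e f).WF ↔ f.WF := Iff.rfl
@[simp] theorem wf_node (a : HEl V) (ch f : DF V) :
    (node a ch f).WF ↔ ch.roots = a.1.top ∧ ch.WF ∧ f.WF := Iff.rfl
@[simp] theorem deg_nil (s : ℤ) : (nil : DF V).deg s = 0 := rfl
@[simp] theorem deg_leaf (s : ℤ) (e : E) (f : DF V) : (leaf e f).deg s = f.deg s := rfl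
@[simp] theorem deg_node (s : ℤ) (a : HEl V) (ch f : DF V) :
    (node a ch f).deg s = a.1.deg + s + (ch.deg s + f.deg s) := rfl

@[simp] theorem nil_append (y : DF V) : (nil : DF V).append y = y := rfl
@[simp] theorem leaf_append (e : E) (f y : DF V) : (leaf e f).append y = leaf e (f.append y) := rfl
@[simp] theorem node_append (a : HEl V) (ch f y : DF V) :
    (node a ch f).append y = node a ch (f.append y) := rfl

@[simp] theorem append_nil (x : DF V) : x.append nil = x := by
  induction x <;> simp_all

theorem append_assoc (x y z : DF V) : (x.append y).append z = x.append (y.append z) := by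
  induction x <;> simp_all

@[simp] theorem leaves_append (x y : DF V) : (x.append y).leaves = x.leaves ++ y.leaves := by
  induction x <;> simp_all

@[simp] theorem roots_append (x y : DF V) : (x.append y).roots = x.roots ++ y.roots := by
  induction x <;> simp_all

@[simp] theorem wf_append (x y : DF V) : (x.append y).WF ↔ x.WF ∧ y.WF := by
  induction x <;> simp_all [and_assoc]

@[simp] theorem deg_append (s : ℤ) (x y : DF V) : (x.append y).deg s = x.deg s + y.deg s := by
  induction x <;> simp_all [add_assoc]

/-- A forest can be cut between any two of its trees. -/
theorem exists_append (x : DF V) (l m : List E) (h : x.roots = l ++ m) :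
    ∃ y z : DF V, x = y.append z ∧ y.roots = l ∧ z.roots = m := by
  induction l generalizing x with
  | nil => exact ⟨nil, x, rfl, rfl, h⟩
  | cons e l ih =>
    cases x with
    | nil => simp at h
    | leaf e' f =>
      simp only [roots_leaf, List.cons_append, List.cons.injEq] at h
      obtain ⟨y, z, rfl, hy, hz⟩ := ih f h.2
      exact ⟨leaf e' y, z, rfl, by simp [h.1, hy], hz⟩
    | node a ch f =>
      simp only [roots_node, List.cons_append, List.cons.injEq] at h
      obtain ⟨y, z, rfl, hy, hz⟩ := ih f h.2
      exact ⟨node a ch y, z, rfl, by simp [h.1, hy], hz⟩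

theorem eq_nil_of_roots (x : DF V) (h : x.roots = []) : x = nil := by
  cases x <;> simp_all

/-- A tree is a leaf, or a vertex with a forest above it. -/
theorem tree_cases (x : DF V) (e : E) (h : x.roots = [e]) :
    x = leaf e nil ∨ ∃ a ch, x = node a ch nil ∧ a.1.bot = e := by
  cases x with
  | nil => simp at h
  | leaf e' f =>
    simp only [roots_leaf, List.cons.injEq] at h
    exact Or.inl (by rw [h.1, eq_nil_of_roots f h.2])
  | node a ch f =>
    simp only [roots_node, List.cons.injEq] at h
    exact Or.inr ⟨a, ch, by rw [eq_nil_of_roots f h.2], h.1⟩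

@[simp] theorem ev_nil : (nil : DF V).ev = nilF V := rfl

@[simp] theorem ev_leaf (e : E) (f : DF V) : (leaf e f).ev = leafOp V e f.ev :=
  (elimF_ofF (fun f => (ofF V (PForest.leaf e f) : f.mod V →ₗ[k] Forests V)) _ _).symm

@[simp] theorem ev_node (a : HEl V) (ch f : DF V) :
    (node a ch f).ev = nodeOp V (a.tot ⊗ₜ (ch.ev ⊗ₜ f.ev)) := by
  rw [HEl.tot, ev, ev, ev, nodeOp_apply]
  rfl

end DF

variable {V : Fam k E}

theorem elimF_ev {N : Type u} [AddCommGroup N] [Module k N] (φ : ∀ f : PForest E, f.mod V →ₗ[k] N)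
    (x : DF V) : elimF φ x.ev = φ x.shape x.val :=
  elimF_ofF ..

theorem elimF₂_ofF {P N : Type u} [AddCommGroup P] [Module k P] [AddCommGroup N] [Module k N]
    (φ : ∀ f : PForest E, f.mod V ⊗[k] P →ₗ[k] N) (f : PForest E) (x : f.mod V) (y : P) :
    elimF₂ φ (ofF V f x ⊗ₜ y) = φ f (x ⊗ₜ y) := by
  simp only [elimF₂, TensorProduct.lift.tmul]
  rw [elimF_ofF]
  rfl

theorem elimF₂_ev {P N : Type u} [AddCommGroup P] [Module k P] [AddCommGroup N] [Module k N]
    (φ : ∀ f : PForest E, f.mod V ⊗[k] P →ₗ[k] N) (x : DF V) (y : P) :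
    elimF₂ φ (x.ev ⊗ₜ y) = φ x.shape (x.val ⊗ₜ y) :=
  elimF₂_ofF ..

/-- The pure tensors of shape `f` span the summand of `f`. -/
theorem span_val (f : PForest E) (x : f.mod V) :
    ofF V f x ∈ Submodule.span k {z | ∃ y : DF V, y.shape = f ∧ y.ev = z} := by
  induction f with
  | nil =>
    have : ofF V PForest.nil x = (show k from x) • (DF.nil : DF V).ev := by
      refine Eq.trans ?_ ((ofF V PForest.nil).map_smul (show k from x) _)
      exact congrArg (ofF V PForest.nil) (mul_one (show k from x)).symm
    rw [this]
    exact Submodule.smul_mem _ _ (subset_span ⟨_, rfl, rfl⟩)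
  | leaf e f ih =>
    have h1 : ofF V (PForest.leaf e f) x = leafOp V e (ofF V f x) :=
      (elimF_ofF (fun f => (ofF V (PForest.leaf e f) : f.mod V →ₗ[k] Forests V)) _ _).symm
    rw [h1]
    refine Submodule.span_le.2 ?_ (Submodule.apply_mem_span_image_of_mem_span (leafOp V e) (ih x))
    rintro _ ⟨_, ⟨y, rfl, rfl⟩, rfl⟩
    exact subset_span ⟨DF.leaf e y, rfl, DF.ev_leaf e y⟩
  | node p ch f ih1 ih2 =>
    let φ : V p ⊗[k] (ch.mod V ⊗[k] f.mod V) →ₗ[k] Forests V := ofF V (PForest.node p ch f)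
    suffices h : ∀ x, φ x ∈ Submodule.span k
      {z | ∃ y : DF V, y.shape = PForest.node p ch f ∧ y.ev = z} from h x
    intro x
    induction x using induction_on with
    | zero => rw [map_zero]; exact Submodule.zero_mem _
    | add a b ha hb => rw [map_add]; exact Submodule.add_mem _ ha hb
    | tmul v x =>
    induction x using induction_on with
    | zero => rw [tmul_zero, map_zero]; exact Submodule.zero_mem _
    | add a b ha hb => rw [tmul_add, map_add]; exact Submodule.add_mem _ ha hb
    | tmul x y =>
    rw [show φ (v ⊗ₜ (x ⊗ₜ y)) = _ from (nodeOp_apply V p ch f v x y).symm]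
    have h1 := ih1 x
    have h2 := ih2 y
    generalize ofF V ch x = x' at h1 ⊢
    generalize ofF V f y = y' at h2 ⊢
    induction h1 using Submodule.span_induction with
    | zero => simp
    | add a b _ _ ha hb =>
      rw [add_tmul, tmul_add, map_add]; exact Submodule.add_mem _ ha hb
    | smul c a _ ha =>
      rw [← smul_tmul', tmul_smul, map_smul]
      exact Submodule.smul_mem _ _ ha
    | mem a ha =>
    obtain ⟨a, rfl, rfl⟩ := ha
    induction h2 using Submodule.span_induction with
    | zero => simp
    | add a b _ _ ha hb =>
      rw [tmul_add, tmul_add, map_add]; exact Submodule.add_mem _ ha hb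
    | smul c a _ ha =>
      rw [tmul_smul, tmul_smul, map_smul]
      exact Submodule.smul_mem _ _ ha
    | mem b hb =>
    obtain ⟨b, rfl, rfl⟩ := hb
    exact subset_span ⟨DF.node ⟨p, v⟩ a b, rfl, DF.ev_node _ _ _⟩

/-- Induction on the elements of `Forests V`, starting with the decorated forests. -/
theorem forests_induction {P : Forests V → Prop} (z : Forests V) (ev : ∀ x : DF V, P x.ev)
    (add : ∀ x y, P x → P y → P (x + y)) (smul : ∀ (c : k) x, P x → P (c • x)) : P z := by
  have h0 : P 0 := by simpa using smul 0 _ (ev DF.nil)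
  induction z using DirectSum.induction_on with
  | zero => exact h0
  | of f x =>
    have h := span_val f x
    change P (ofF V f x)
    generalize ofF V f x = x' at h ⊢
    induction h using Submodule.span_induction with
    | zero => exact h0
    | add a b _ _ ha hb => exact add a b ha hb
    | smul c a _ ha => exact smul c a ha
    | mem a ha =>
      obtain ⟨a, rfl, rfl⟩ := ha
      exact ev a
  | add x y hx hy => exact add x y hx hy

theorem forests_ext {N : Type u} [AddCommGroup N] [Module k N] {f g : Forests V →ₗ[k] N}
    (h : ∀ x : DF V, f x.ev = g x.ev) (z : Forests V) : f z = g z := by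
  induction z using forests_induction with
  | ev x => exact h x
  | add x y hx hy => rw [map_add, map_add, hx, hy]
  | smul c x hx => rw [map_smul, map_smul, hx]

theorem tot_induction {P : Tot V → Prop} (z : Tot V) (zero : P 0) (tot : ∀ a : HEl V, P a.tot)
    (add : ∀ x y, P x → P y → P (x + y)) : P z := by
  induction z using DirectSum.induction_on with
  | zero => exact zero
  | of p x => exact tot ⟨p, x⟩
  | add x y hx hy => exact add x y hx hy

theorem tot_ext {N : Type u} [AddCommGroup N] [Module k N] {f g : Tot V →ₗ[k] N}
    (h : ∀ a : HEl V, f a.tot = g a.tot) (z : Tot V) : f z = g z := by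
  induction z using tot_induction with
  | zero => rw [map_zero, map_zero]
  | tot a => exact h a
  | add x y hx hy => rw [map_add, map_add, hx, hy]

theorem node_ext {N : Type u} [AddCommGroup N] [Module k N]
    {f g : Tot V ⊗[k] (Forests V ⊗[k] Forests V) →ₗ[k] N}
    (h : ∀ (a : HEl V) (x y : DF V), f (a.tot ⊗ₜ (x.ev ⊗ₜ y.ev)) = g (a.tot ⊗ₜ (x.ev ⊗ₜ y.ev)))
    (z : Tot V ⊗[k] (Forests V ⊗[k] Forests V)) : f z = g z := by
  refine tensor_ext (fun v w => ?_) z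
  induction w using induction_on with
  | zero => simp
  | add a b ha hb => rw [tmul_add, map_add, map_add, ha, hb]
  | tmul x y =>
  induction v using tot_induction with
  | zero => simp
  | add a b ha hb => rw [add_tmul, map_add, map_add, ha, hb]
  | tot a =>
  induction x using forests_induction with
  | add c d hc hd =>
    rw [add_tmul, tmul_add, map_add, map_add, hc, hd]
  | smul c d hd =>
    rw [← smul_tmul', tmul_smul, map_smul, map_smul, hd]
  | ev x =>
  induction y using forests_induction with
  | add c d hc hd =>
    rw [tmul_add, tmul_add, map_add, map_add, hc, hd]
  | smul c d hd => rw [tmul_smul, tmul_smul, map_smul, map_smul, hd]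
  | ev y => exact h a x y

/-! ### Concatenation of forests -/

variable (V) in
theorem catOp_nil (y : Forests V) : catOp V (nilF V ⊗ₜ y) = y := by
  refine (elimF₂_ofF (cat V) PForest.nil _ y).trans ?_
  exact (lid_tmul _ _).trans (one_smul _ _)

theorem catOp_ev_leaf (e : E) (x : DF V) (y : Forests V) :
    catOp V ((DF.leaf e x).ev ⊗ₜ y) = leafOp V e (catOp V (x.ev ⊗ₜ y)) := by
  rw [catOp, elimF₂_ev, elimF₂_ev]
  rfl

theorem catOp_ev_node (a : HEl V) (x x' : DF V) (y : Forests V) :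
    catOp V ((DF.node a x x').ev ⊗ₜ y) =
      nodeOp V (a.tot ⊗ₜ (x.ev ⊗ₜ catOp V (x'.ev ⊗ₜ y))) := by
  rw [catOp, elimF₂_ev, elimF₂_ev]
  rfl

theorem catOp_leafOp (e : E) (x y : Forests V) :
    catOp V (leafOp V e x ⊗ₜ y) = leafOp V e (catOp V (x ⊗ₜ y)) := by
  induction x using forests_induction with
  | ev x => rw [← DF.ev_leaf, catOp_ev_leaf]
  | add c d hc hd => simp only [map_add, add_tmul, hc, hd]
  | smul c d hd => simp only [map_smul, ← smul_tmul', hd]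

theorem catOp_nodeOp (v : Tot V) (x x' y : Forests V) :
    catOp V (nodeOp V (v ⊗ₜ (x ⊗ₜ x')) ⊗ₜ y) = nodeOp V (v ⊗ₜ (x ⊗ₜ catOp V (x' ⊗ₜ y))) := by
  refine node_ext (f := catOp V ∘ₗ (tmk k (Forests V) _).flip y ∘ₗ nodeOp V)
    (g := nodeOp V ∘ₗ lTensor _ (lTensor _
      (catOp V ∘ₗ (tmk k (Forests V) _).flip y))) (fun a x x' => ?_) (v ⊗ₜ (x ⊗ₜ x'))
  have := catOp_ev_node a x x' y
  rw [DF.ev_node] at this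
  exact this

theorem catOp_ev (x y : DF V) : catOp V (x.ev ⊗ₜ y.ev) = (x.append y).ev := by
  induction x with
  | nil => exact catOp_nil V _
  | leaf e f ih => rw [catOp_ev_leaf, ih]; simp
  | node a ch f _ ih => rw [catOp_ev_node, ih]; simp

variable (V) in
theorem catOp_nil_right (x : Forests V) : catOp V (x ⊗ₜ nilF V) = x := by
  induction x using forests_induction with
  | ev x => rw [← DF.ev_nil, catOp_ev, DF.append_nil]
  | add c d hc hd => simp only [map_add, add_tmul, hc, hd]
  | smul c d hd => simp only [map_smul, ← smul_tmul', hd]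

theorem catOp_assoc (x y z : Forests V) :
    catOp V (catOp V (x ⊗ₜ y) ⊗ₜ z) = catOp V (x ⊗ₜ catOp V (y ⊗ₜ z)) := by
  induction x using forests_induction with
  | add c d hc hd => simp only [map_add, add_tmul, hc, hd]
  | smul c d hd => simp only [map_smul, ← smul_tmul', hd]
  | ev x =>
  induction x with
  | nil => simp only [DF.ev_nil, catOp_nil]
  | leaf e f ih => simp only [DF.ev_leaf, catOp_leafOp, ih]
  | node a ch f _ ih => simp only [DF.ev_node, catOp_nodeOp, ih]

theorem treeOp_tmul (v : Tot V) (x : Forests V) :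
    treeOp V (v ⊗ₜ x) = nodeOp V (v ⊗ₜ (x ⊗ₜ nilF V)) := rfl

theorem nodeOp_eq_catOp (v : Tot V) (x y : Forests V) :
    nodeOp V (v ⊗ₜ (x ⊗ₜ y)) = catOp V (treeOp V (v ⊗ₜ x) ⊗ₜ y) := by
  rw [treeOp_tmul, catOp_nodeOp, catOp_nil]

theorem leafOp_eq_catOp (e : E) (x : Forests V) :
    leafOp V e x = catOp V (leafTree V e ⊗ₜ x) := by
  rw [leafTree, catOp_leafOp, catOp_nil]

theorem leafTree_eq_ev (e : E) : leafTree V e = (DF.leaf e DF.nil).ev := by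
  rw [DF.ev_leaf]; rfl

theorem treeOp_ev (a : HEl V) (x : DF V) : treeOp V (a.tot ⊗ₜ x.ev) = (DF.node a x DF.nil).ev := by
  rw [DF.ev_node]; rfl

/-- The decorated forest without vertices. -/
def leavesDF (V : Fam k E) : List E → DF V
  | [] => DF.nil
  | e :: l => DF.leaf e (leavesDF V l)

theorem leavesF_eq_ev (l : List E) : leavesF V l = (leavesDF V l).ev := by
  induction l with
  | nil => rfl
  | cons e l ih => rw [leavesF, ih, leavesDF, DF.ev_leaf]

@[simp] theorem leaves_leavesDF (l : List E) : (leavesDF V l).leaves = l := by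
  induction l <;> simp_all [leavesDF]

@[simp] theorem roots_leavesDF (l : List E) : (leavesDF V l).roots = l := by
  induction l <;> simp_all [leavesDF]

@[simp] theorem wf_leavesDF (l : List E) : (leavesDF V l).WF := by
  induction l <;> simp_all [leavesDF]

@[simp] theorem deg_leavesDF (s : ℤ) (l : List E) : (leavesDF V l).deg s = 0 := by
  induction l <;> simp_all [leavesDF]

theorem leavesF_append (l m : List E) :
    leavesF V (l ++ m) = catOp V (leavesF V l ⊗ₜ leavesF V m) := by
  induction l with
  | nil => exact (catOp_nil V _).symm
  | cons e l ih => rw [List.cons_append, leavesF, ih, leavesF, catOp_leafOp]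

theorem corolla_tot (a : HEl V) : corolla V a.tot = treeOp V (a.tot ⊗ₜ leavesF V a.1.top) := by
  simp only [corolla, HEl.tot]
  rw [DirectSum.toModule_lof]
  rfl

/-! ### Homogeneous elements of sums over forests -/

theorem sgF_ev (s n : ℤ) (x : DF V) : sgF V s n x.ev = sgn k (n * x.deg s) • x.ev := by
  rw [sgF, elimF_ev, lsmul_apply, negOnePow_smul (k := k)]
  rfl

theorem oddF_ev (s : ℤ) (x : DF V) : oddF V s x.ev = if Odd (x.deg s) then x.ev else 0 := by
  rw [oddF, elimF_ev]
  change (if Odd (x.deg s) then ofF V x.shape else 0) x.val = _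
  split_ifs <;> rfl

theorem ksMul_ev (s : ℤ) (a b c d : DF V) :
    ksMul (catOp V) (oddF V s) ((a.ev ⊗ₜ b.ev) ⊗ₜ (c.ev ⊗ₜ d.ev)) =
      sgn k (b.deg s * c.deg s) • ((a.append c).ev ⊗ₜ[k] (b.append d).ev) := by
  rw [ksMul_tmul _ _ _ _ _ _ _ _ (oddF_ev s b) (oddF_ev s c), catOp_ev, catOp_ev]

/-- The span of the forests with matching labels, with given leaves, roots and degree. -/
def FS (V : Fam k E) (s : ℤ) (t b : List E) (n : ℤ) : Submodule k (Forests V) :=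
  Submodule.span k {z | ∃ x : DF V, x.WF ∧ x.leaves = t ∧ x.roots = b ∧ x.deg s = n ∧ x.ev = z}

theorem ev_mem (s : ℤ) (x : DF V) (h : x.WF) : x.ev ∈ FS V s x.leaves x.roots (x.deg s) :=
  subset_span ⟨x, h, rfl, rfl, rfl, rfl⟩

theorem ev_mem' {s : ℤ} {t b : List E} {n : ℤ} (x : DF V) (h : x.WF) (ht : x.leaves = t)
    (hb : x.roots = b) (hn : x.deg s = n) : x.ev ∈ FS V s t b n :=
  subset_span ⟨x, h, ht, hb, hn, rfl⟩

theorem FS_ext {s : ℤ} {t b : List E} {n : ℤ} {N : Type u} [AddCommGroup N] [Module k N]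
    {f g : Forests V →ₗ[k] N}
    (h : ∀ x : DF V, x.WF → x.leaves = t → x.roots = b → x.deg s = n → f x.ev = g x.ev)
    {z : Forests V} (hz : z ∈ FS V s t b n) : f z = g z := by
  refine span_ext ?_ hz
  rintro _ ⟨x, h1, h2, h3, h4, rfl⟩
  exact h x h1 h2 h3 h4

theorem FS_map_le {s : ℤ} {t b : List E} {n : ℤ} {N : Type u} [AddCommGroup N] [Module k N]
    (f : Forests V →ₗ[k] N) (p : Submodule k N)
    (h : ∀ x : DF V, x.WF → x.leaves = t → x.roots = b → x.deg s = n → f x.ev ∈ p)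
    {z : Forests V} (hz : z ∈ FS V s t b n) : f z ∈ p := by
  change z ∈ p.comap f
  refine Submodule.span_le.2 ?_ hz
  rintro _ ⟨x, h1, h2, h3, h4, rfl⟩
  exact h x h1 h2 h3 h4

/-- The membership criterion for bilinear operations. -/
theorem FS_map₂_le {V' : Fam k E} {s : ℤ} {t b : List E} {n : ℤ} {s' : ℤ} {t' b' : List E} {n' : ℤ}
    {N : Type u} [AddCommGroup N] [Module k N]
    (f : Forests V ⊗[k] Forests V' →ₗ[k] N) (p : Submodule k N)
    (h : ∀ x : DF V, x.WF → x.leaves = t → x.roots = b → x.deg s = n →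
      ∀ y : DF V', y.WF → y.leaves = t' → y.roots = b' → y.deg s' = n' → f (x.ev ⊗ₜ y.ev) ∈ p)
    {z : Forests V} (hz : z ∈ FS V s t b n) {w : Forests V'} (hw : w ∈ FS V' s' t' b' n') :
    f (z ⊗ₜ w) ∈ p :=
  FS_map_le (f ∘ₗ (tmk k (Forests V) _).flip w) p (fun x h1 h2 h3 h4 =>
    FS_map_le (f ∘ₗ tmk k (Forests V) (Forests V') x.ev) p (h x h1 h2 h3 h4) hw) hz

theorem nilF_mem (s : ℤ) : nilF V ∈ FS V s [] [] 0 := ev_mem s DF.nil trivial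

theorem leafTree_mem (s : ℤ) (e : E) : leafTree V e ∈ FS V s [e] [e] 0 := by
  rw [leafTree_eq_ev]
  exact ev_mem' _ (by simp) (by simp) (by simp) (by simp)

theorem leavesF_mem (s : ℤ) (l : List E) : leavesF V l ∈ FS V s l l 0 := by
  rw [leavesF_eq_ev]
  exact ev_mem' _ (by simp) (by simp) (by simp) (by simp)

theorem catOp_mem {s : ℤ} {t b t' b' : List E} {n n' : ℤ} {x y : Forests V}
    (hx : x ∈ FS V s t b n) (hy : y ∈ FS V s t' b' n') :
    catOp V (x ⊗ₜ y) ∈ FS V s (t ++ t') (b ++ b') (n + n') := by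
  refine FS_map₂_le (catOp V) _ (fun x h1 h2 h3 h4 y h1' h2' h3' h4' => ?_) hx hy
  rw [catOp_ev]
  exact ev_mem' _ (by simp_all) (by simp_all) (by simp_all) (by simp_all)

theorem treeOp_mem {s : ℤ} {t t' : List E} {b : E} {n m : ℤ} {v : Tot V} {x : Forests V}
    (hv : IsIn V t b n v) (hx : x ∈ FS V s t' t m) :
    treeOp V (v ⊗ₜ x) ∈ FS V s t' [b] (n + s + m) := by
  obtain ⟨v, rfl⟩ := hv
  refine FS_map_le (treeOp V ∘ₗ tmk k (Tot V) (Forests V) (of V ⟨t, b, n⟩ v)) _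
    (fun x h1 h2 h3 h4 => ?_) hx
  have := treeOp_ev ⟨⟨t, b, n⟩, v⟩ x
  rw [lcomp_apply, mk_apply]
  erw [this]
  exact ev_mem' _ (by simp_all) (by simp_all) (by simp_all) (by simp_all)

theorem leafOp_mem {s : ℤ} {t b : List E} {n : ℤ} {x : Forests V} (e : E)
    (hx : x ∈ FS V s t b n) : leafOp V e x ∈ FS V s (e :: t) (e :: b) n := by
  rw [leafOp_eq_catOp]
  simpa using catOp_mem (leafTree_mem s e) hx

theorem corolla_mem (s : ℤ) {t : List E} {b : E} {n : ℤ} {v : Tot V} (hv : IsIn V t b n v) :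
    corolla V v ∈ FS V s t [b] (n + s) := by
  obtain ⟨v, rfl⟩ := hv
  rw [show of V ⟨t, b, n⟩ v = HEl.tot ⟨⟨t, b, n⟩, v⟩ from rfl, corolla_tot]
  simpa using treeOp_mem (s := s) ⟨v, rfl⟩ (leavesF_mem s t)

theorem sgF_of_mem {s : ℤ} {t b : List E} {n : ℤ} {x : Forests V} (m : ℤ)
    (hx : x ∈ FS V s t b n) : sgF V s m x = sgn k (m * n) • x := by
  refine FS_ext (f := sgF V s m) (g := sgn k (m * n) • LinearMap.id) (fun x _ _ _ h => ?_) hx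
  rw [sgF_ev, h]
  rfl

theorem oddF_of_mem {s : ℤ} {t b : List E} {n : ℤ} {x : Forests V}
    (hx : x ∈ FS V s t b n) : oddF V s x = if Odd n then x else 0 := by
  refine FS_ext (f := oddF V s) (g := if Odd n then LinearMap.id else 0) (fun x _ _ _ h => ?_) hx
    |>.trans ?_
  · rw [oddF_ev, h]
    split_ifs <;> rfl
  · split_ifs <;> rfl

theorem ksMul_of_mem {s : ℤ} {t b t' b' : List E} {n n' : ℤ} (a : Forests V) {x y : Forests V}
    (d : Forests V) (hx : x ∈ FS V s t b n) (hy : y ∈ FS V s t' b' n') :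
    ksMul (catOp V) (oddF V s) ((a ⊗ₜ x) ⊗ₜ (y ⊗ₜ d)) =
      sgn k (n * n') • (catOp V (a ⊗ₜ y) ⊗ₜ[k] catOp V (x ⊗ₜ d)) :=
  ksMul_tmul _ _ _ _ _ _ _ _ (oddF_of_mem hx) (oddF_of_mem hy)

end Decorated

/-! ### Homogeneous words -/

section WordSpan

variable {k : Type u} [Field k] {E : Type u} {X : Fam k E}

theorem isIn_tot (a : HEl X) : IsIn X a.1.top a.1.bot a.1.deg a.tot := ⟨a.2, rfl⟩

theorem isIn_of (p : GCell E) (x : X p) : IsIn X p.top p.bot p.deg (of X p x) := ⟨x, rfl⟩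

theorem IsIn.exists_tot {s : List E} {t : E} {n : ℤ} {x : Tot X} (h : IsIn X s t n x) :
    ∃ a : HEl X, a.1 = ⟨s, t, n⟩ ∧ a.tot = x := by
  obtain ⟨y, rfl⟩ := h
  exact ⟨⟨_, y⟩, rfl, rfl⟩

theorem IsIn.smul {s : List E} {t : E} {n : ℤ} {x : Tot X} (c : k) (hx : IsIn X s t n x) :
    IsIn X s t n (c • x) := Submodule.smul_mem _ c hx

theorem IsIn.zero (s : List E) (t : E) (n : ℤ) : IsIn X s t n 0 := Submodule.zero_mem _

theorem sg_tot (a : HEl X) : sg X a.tot = sgn k a.1.deg • a.tot := by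
  simp only [sg, HEl.tot]
  rw [DirectSum.toModule_lof, lsmul_apply, negOnePow_smul (k := k)]

theorem odd_tot (a : HEl X) : odd X a.tot = if Odd a.1.deg then a.tot else 0 := by
  simp only [odd, HEl.tot]
  rw [DirectSum.toModule_lof]
  split_ifs <;> rfl

theorem IsIn.sg {s : List E} {t : E} {n : ℤ} {x : Tot X} (h : IsIn X s t n x) :
    sg X x = sgn k n • x := by
  obtain ⟨y, rfl⟩ := h
  exact sg_tot ⟨⟨s, t, n⟩, y⟩

theorem IsIn.sg_mem {s : List E} {t : E} {n : ℤ} {x : Tot X} (h : IsIn X s t n x) :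
    IsIn X s t n (BarCobar.sg X x) := by
  rw [h.sg]; exact h.smul _

theorem sg_sg (x : Tot X) : sg X (sg X x) = x := by
  refine tot_ext (f := sg X ∘ₗ sg X) (g := LinearMap.id) (fun a => ?_) x
  rw [lcomp_apply, sg_tot, map_smul, sg_tot, smul_smul, sgn_mul_self, one_smul]
  rfl

theorem word_nil : word ([] : List (HEl X)) = 1 := rfl

theorem word_cons (a : HEl X) (l : List (HEl X)) : word (a :: l) = letter X a.tot * word l := rfl

theorem word_append (l m : List (HEl X)) : word (l ++ m) = word l * word m := by
  simp [word]

@[simp] theorem tops_nil : tops ([] : List (HEl X)) = [] := rfl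
@[simp] theorem bots_nil : bots ([] : List (HEl X)) = [] := rfl
@[simp] theorem degs_nil : degs ([] : List (HEl X)) = 0 := rfl
@[simp] theorem tops_cons (a : HEl X) (l : List (HEl X)) : tops (a :: l) = a.1.top ++ tops l := rfl
@[simp] theorem bots_cons (a : HEl X) (l : List (HEl X)) : bots (a :: l) = a.1.bot :: bots l := rfl
@[simp] theorem degs_cons (a : HEl X) (l : List (HEl X)) : degs (a :: l) = a.1.deg + degs l := by
  simp [degs]
@[simp] theorem tops_append (l m : List (HEl X)) : tops (l ++ m) = tops l ++ tops m := by
  simp [tops]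
@[simp] theorem bots_append (l m : List (HEl X)) : bots (l ++ m) = bots l ++ bots m := by
  simp [bots]
@[simp] theorem degs_append (l m : List (HEl X)) : degs (l ++ m) = degs l + degs m := by
  simp [degs]

/-- The span of the words `b₁ ⊗ ⋯ ⊗ b_r` with given concatenated path, given path of targets and
given degree. -/
def WS (X : Fam k E) (t b : List E) (n : ℤ) : Submodule k (Words X) :=
  Submodule.span k {z | ∃ l : List (HEl X), tops l = t ∧ bots l = b ∧ degs l = n ∧ word l = z}

theorem word_mem (l : List (HEl X)) : word l ∈ WS X (tops l) (bots l) (degs l) :=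
  subset_span ⟨l, rfl, rfl, rfl, rfl⟩

theorem one_mem_WS : (1 : Words X) ∈ WS X [] [] 0 := word_mem []

theorem letter_mem {s : List E} {t : E} {n : ℤ} {x : Tot X} (h : IsIn X s t n x) :
    letter X x ∈ WS X s [t] n := by
  obtain ⟨a, ha, rfl⟩ := h.exists_tot
  have := word_mem [a]
  rw [word_cons, word_nil, mul_one] at this
  simpa [ha] using this

theorem mul_mem_WS {t b t' b' : List E} {n n' : ℤ} {x y : Words X} (hx : x ∈ WS X t b n)
    (hy : y ∈ WS X t' b' n') : x * y ∈ WS X (t ++ t') (b ++ b') (n + n') := by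
  have := Submodule.mul_mem_mul hx hy
  rw [WS, WS, Submodule.span_mul_span] at this
  refine Submodule.span_mono ?_ this
  rintro _ ⟨_, ⟨l, rfl, rfl, rfl, rfl⟩, _, ⟨m, rfl, rfl, rfl, rfl⟩, rfl⟩
  exact ⟨l ++ m, by simp, by simp, by simp, word_append l m⟩

theorem WS_ext {t b : List E} {n : ℤ} {N : Type u} [AddCommGroup N] [Module k N]
    {f g : Words X →ₗ[k] N}
    (h : ∀ l : List (HEl X), tops l = t → bots l = b → degs l = n → f (word l) = g (word l))
    {z : Words X} (hz : z ∈ WS X t b n) : f z = g z := by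
  refine span_ext ?_ hz
  rintro _ ⟨x, h1, h2, h3, rfl⟩
  exact h x h1 h2 h3

theorem WS_map_le {t b : List E} {n : ℤ} {N : Type u} [AddCommGroup N] [Module k N]
    (f : Words X →ₗ[k] N) (p : Submodule k N)
    (h : ∀ l : List (HEl X), tops l = t → bots l = b → degs l = n → f (word l) ∈ p)
    {z : Words X} (hz : z ∈ WS X t b n) : f z ∈ p := by
  change z ∈ p.comap f
  refine Submodule.span_le.2 ?_ hz
  rintro _ ⟨x, h1, h2, h3, rfl⟩
  exact h x h1 h2 h3

/-- Linear maps on words that agree on words in homogeneous elements are equal. -/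
theorem words_ext {N : Type u} [AddCommGroup N] [Module k N] {f g : Words X →ₗ[k] N}
    (h : ∀ l : List (HEl X), f (word l) = g (word l)) (z : Words X) : f z = g z := by
  have : z ∈ Submodule.span k (Set.range (word (X := X))) := by
    refine tensorAlgebra_le _ (subset_span (s := Set.range word) ⟨[], rfl⟩) (fun c x hx => ?_) z
    induction c using tot_induction with
    | zero => simp
    | add c d hc hd => rw [map_add, add_mul]; exact Submodule.add_mem _ hc hd
    | tot a =>
      change x ∈ (Submodule.span k (Set.range word)).comap (mulLeft k (letter X a.tot))
      refine Submodule.span_le.2 ?_ hx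
      rintro _ ⟨l, rfl⟩
      exact subset_span ⟨a :: l, rfl⟩
  refine span_ext ?_ this
  rintro _ ⟨l, rfl⟩
  exact h l

theorem wordOdd_word (l : List (HEl X)) :
    wordOdd X (word l) = if Odd (degs l) then word l else 0 := by
  induction l with
  | nil => rw [word_nil, wordOdd, insertOne_one]; simp
  | cons a l ih =>
    have h : TensorAlgebra.lift k (letter X) (word l) = word l := by
      rw [show TensorAlgebra.lift k (letter X) = AlgHom.id k (Words X) by ext; simp]; rfl
    rw [wordOdd] at ih ⊢
    rw [word_cons, insertOne_ι_mul, ih, h, lcomp_apply, lcomp_apply, odd_tot, sg_tot, degs_cons,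
      map_smul]
    rcases Int.even_or_odd a.1.deg with h1 | h1 <;> rcases Int.even_or_odd (degs l) with h2 | h2
    · simp [sgn_even h1, Int.not_odd_iff_even.2 h1, Int.not_odd_iff_even.2 h2,
        Int.not_odd_iff_even.2 (h1.add h2)]
    · simp [sgn_even h1, Int.not_odd_iff_even.2 h1, h2, h1.add_odd h2]
    · simp [h1, Int.not_odd_iff_even.2 h2, h1.add_even h2]
    · simp [sgn_odd h1, h1, h2, Int.not_odd_iff_even.2 (h1.add_odd h2)]

theorem wordOdd_of_mem {t b : List E} {n : ℤ} {x : Words X} (hx : x ∈ WS X t b n) :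
    wordOdd X x = if Odd n then x else 0 := by
  refine (WS_ext (f := wordOdd X) (g := if Odd n then LinearMap.id else 0)
    (fun l _ _ h => ?_) hx).trans ?_
  · rw [wordOdd_word, h]
    split_ifs <;> rfl
  · split_ifs <;> rfl

theorem ksMul_word {t b t' b' : List E} {n n' : ℤ} (a : Words X) {x y : Words X}
    (d : Words X) (hx : x ∈ WS X t b n) (hy : y ∈ WS X t' b' n') :
    ksMul (LinearMap.mul' k (Words X)) (wordOdd X) ((a ⊗ₜ x) ⊗ₜ (y ⊗ₜ d)) =
      sgn k (n * n') • ((a * y) ⊗ₜ[k] (x * d)) :=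
  ksMul_tmul _ _ _ _ _ _ _ _ (wordOdd_of_mem hx) (wordOdd_of_mem hy)

section Map

variable {E' : Type u} {X' : Fam k E'} (f : Tot X →ₗ[k] Tot X')

@[simp] theorem wordMap_one : wordMap f 1 = 1 := by simp [wordMap]

@[simp] theorem wordMap_mul (x y : Words X) : wordMap f (x * y) = wordMap f x * wordMap f y := by
  simp [wordMap]

@[simp] theorem wordMap_letter (c : Tot X) : wordMap f (letter X c) = letter X' (f c) := by
  simp [wordMap]

theorem lift_letter (x : Words X) : TensorAlgebra.lift k (letter X) x = x := by
  rw [show TensorAlgebra.lift k (letter X) = AlgHom.id k (Words X) by ext; simp]; rfl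

theorem wordD_one (d : Tot X →ₗ[k] Tot X) : wordD X d 1 = 0 := insertOne_one ..

theorem wordD_letter_mul (d : Tot X →ₗ[k] Tot X) (c : Tot X) (x : Words X) :
    wordD X d (letter X c * x) = letter X (sg X c) * wordD X d x + letter X (d c) * x := by
  rw [wordD, insertOne_ι_mul, lift_letter]
  rfl

theorem wordMap_sg_word (l : List (HEl X)) : wordMap (sg X) (word l) = sgn k (degs l) • word l := by
  induction l with
  | nil => simp [word_nil]
  | cons a l ih =>
    rw [word_cons, wordMap_mul, wordMap_letter, ih, sg_tot, degs_cons, sgn_add, map_smul,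
      smul_mul_assoc, mul_smul_comm, smul_smul]

theorem wordMap_sg_of_mem {t b : List E} {n : ℤ} {x : Words X} (hx : x ∈ WS X t b n) :
    wordMap (sg X) x = sgn k n • x := by
  refine WS_ext (f := wordMap (sg X)) (g := sgn k n • LinearMap.id) (fun l _ _ h => ?_) hx
  rw [wordMap_sg_word, h]
  rfl

end Map

end WordSpan

/-! ### Maps from words to forests -/

section CatLift

variable {k : Type u} [Field k] {E : Type u} {V : Fam k E} {M : Type u} [AddCommGroup M]
  [Module k M]

/-- The multiplicative extension of a linear map from letters to forests. -/
def catLift (g : M →ₗ[k] Forests V) : TensorAlgebra k M →ₗ[k] Forests V :=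
  tfold (catOp V ∘ₗ rTensor _ g) (nilF V)

/-- The map `c₁ ⋯ c_n ↦ ∑ i, u(c₁) ⋯ u(c_{i-1}) v(c_i) w(c_{i+1}) ⋯ w(c_n)` with values in
forests. -/
def catInsert (u v w : M →ₗ[k] Forests V) : TensorAlgebra k M →ₗ[k] Forests V :=
  tfold (catOp V) (nilF V) ∘ₗ
    insertOne (TensorAlgebra.ι k ∘ₗ u) (TensorAlgebra.ι k ∘ₗ v) (TensorAlgebra.ι k ∘ₗ w)

variable (g u v w : M →ₗ[k] Forests V)

@[simp] theorem catLift_one : catLift g 1 = nilF V := tfold_one ..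

theorem catLift_ι_mul (c : M) (x : TensorAlgebra k M) :
    catLift g (TensorAlgebra.ι k c * x) = catOp V (g c ⊗ₜ catLift g x) := by
  rw [catLift, tfold_ι_mul]; rfl

@[simp] theorem catLift_ι (c : M) : catLift g (TensorAlgebra.ι k c) = g c := by
  have := catLift_ι_mul g c 1
  rwa [mul_one, catLift_one, catOp_nil_right] at this

theorem catLift_mul (x y : TensorAlgebra k M) :
    catLift g (x * y) = catOp V (catLift g x ⊗ₜ catLift g y) := by
  refine tensorAlgebra_ext (f := catLift g ∘ₗ mulRight k y)
    (g := catOp V ∘ₗ (tmk k (Forests V) _).flip (catLift g y) ∘ₗ catLift g)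
    ?_ (fun c x h => ?_) x
  · change catLift g (1 * y) = catOp V (catLift g 1 ⊗ₜ catLift g y)
    rw [one_mul, catLift_one, catOp_nil]
  · change catLift g (x * y) = catOp V (catLift g x ⊗ₜ catLift g y) at h
    change catLift g (TensorAlgebra.ι k c * x * y) =
      catOp V (catLift g (TensorAlgebra.ι k c * x) ⊗ₜ catLift g y)
    rw [mul_assoc, catLift_ι_mul, h, catLift_ι_mul, catOp_assoc]

theorem tfold_lift (x : TensorAlgebra k M) :
    tfold (catOp V) (nilF V) (TensorAlgebra.lift k (TensorAlgebra.ι k ∘ₗ w) x) = catLift w x := by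
  refine tensorAlgebra_ext (f := tfold (catOp V) (nilF V) ∘ₗ
    (TensorAlgebra.lift k (TensorAlgebra.ι k ∘ₗ w)).toLinearMap) (g := catLift w)
    ?_ (fun c x h => ?_) x
  · simp [tfold_one]
  · rw [catLift_ι_mul, ← h]
    simp [tfold_ι_mul]

@[simp] theorem catInsert_one : catInsert u v w 1 = 0 := by
  rw [catInsert, lcomp_apply, insertOne_one, map_zero]

theorem catInsert_ι_mul (c : M) (x : TensorAlgebra k M) :
    catInsert u v w (TensorAlgebra.ι k c * x) =
      catOp V (u c ⊗ₜ catInsert u v w x) + catOp V (v c ⊗ₜ catLift w x) := by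
  rw [catInsert, lcomp_apply, insertOne_ι_mul, map_add, lcomp_apply, lcomp_apply, tfold_ι_mul,
    tfold_ι_mul, tfold_lift]
  rfl

theorem catLift_congr_adjoin {g g' : M →ₗ[k] Forests V} {S : Set M} (h : ∀ c ∈ S, g c = g' c)
    {x : TensorAlgebra k M} (hx : x ∈ Algebra.adjoin k (TensorAlgebra.ι k '' S)) :
    catLift g x = catLift g' x := by
  refine adjoin_ι_ext S ?_ (fun c hc x ih => ?_) hx
  · simp
  · rw [catLift_ι_mul, catLift_ι_mul, h c hc, ih]

theorem catLift_wordMap {E₁ E₂ : Type u} {X : Fam k E₁} {X' : Fam k E₂} (f : Tot X →ₗ[k] Tot X')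
    (g : Tot X' →ₗ[k] Forests V) (x : Words X) :
    catLift g (wordMap f x) = catLift (g ∘ₗ f) x := by
  refine tensorAlgebra_ext (f := catLift g ∘ₗ wordMap f) (g := catLift (g ∘ₗ f)) ?_
    (fun c x h => ?_) x
  · simp
  · rw [lcomp_apply] at h
    rw [lcomp_apply, wordMap_mul, wordMap_letter, catLift_ι_mul, h, catLift_ι_mul]
    rfl

/-- A degree-preserving map of cells induces a degree-preserving map of words. -/
theorem catLift_word_mem {E₁ : Type u} {X : Fam k E₁} (col : E₁ → E) (s : ℤ)
    (g : Tot X →ₗ[k] Forests V) (l : List (HEl X))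
    (h : ∀ a ∈ l, g a.tot ∈ FS V s (a.1.top.map col) [col a.1.bot] a.1.deg) :
    catLift g (word l) ∈ FS V s ((tops l).map col) ((bots l).map col) (degs l) := by
  induction l with
  | nil => rw [word_nil, catLift_one]; exact nilF_mem s
  | cons a l ih =>
    rw [word_cons, catLift_ι_mul]
    simp only [List.forall_mem_cons] at h
    simpa using catOp_mem h.1 (ih h.2)

end CatLift

/-! ### Trees with matching labels inside all forests -/

section FreeFam

variable {k : Type u} [Field k] {E : Type u} {V : Fam k E} {s : ℤ}

theorem projF_ofF (f : PForest E) (x : f.mod V) (hw : f.WF) (t : E) (ht : f.roots = [t]) :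
    projF V s (ofF V f x) = of (freeFam V s) ⟨f.leaves, t, f.deg s⟩
      (DirectSum.lof k {g : PForest E // g.WF ∧ g.leaves = f.leaves ∧ g.roots = [t] ∧
          g.deg s = f.deg s} (fun g => g.1.mod V) ⟨f, hw, rfl, ht, rfl⟩ x) := by
  have h : f.WF ∧ ∃ t, f.roots = [t] := ⟨hw, t, ht⟩
  rw [projF, elimF_ofF, dif_pos h]
  have hc : h.2.choose = t := (List.singleton_inj.1 (ht.symm.trans h.2.choose_spec)).symm
  have key : ∀ c (hc : f.roots = [c]), c = t → (of (freeFam V s) ⟨f.leaves, c, f.deg s⟩)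
      (DirectSum.lof k {g : PForest E // g.WF ∧ g.leaves = f.leaves ∧ g.roots = [c] ∧
          g.deg s = f.deg s} (fun g => g.1.mod V) ⟨f, hw, rfl, hc, rfl⟩ x) =
      of (freeFam V s) ⟨f.leaves, t, f.deg s⟩
      (DirectSum.lof k {g : PForest E // g.WF ∧ g.leaves = f.leaves ∧ g.roots = [t] ∧
          g.deg s = f.deg s} (fun g => g.1.mod V) ⟨f, hw, rfl, ht, rfl⟩ x) := by
    rintro c hc rfl; rfl
  exact key _ h.2.choose_spec hc

theorem inclF_of (p : GCell E)
    (f : {f : PForest E // f.WF ∧ f.leaves = p.top ∧ f.roots = [p.bot] ∧ f.deg s = p.deg})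
    (x : f.1.mod V) :
    inclF V s (of (freeFam V s) p (DirectSum.lof k _ (fun f => f.1.mod V) f x)) = ofF V f.1 x := by
  rw [inclF]
  erw [DirectSum.toModule_lof, DirectSum.toModule_lof]

theorem freeFam_induction {P : Tot (freeFam V s) → Prop} (z : Tot (freeFam V s)) (zero : P 0)
    (of : ∀ (p : GCell E)
      (f : {f : PForest E // f.WF ∧ f.leaves = p.top ∧ f.roots = [p.bot] ∧ f.deg s = p.deg})
      (x : f.1.mod V), P (of (freeFam V s) p (DirectSum.lof k _ (fun f => f.1.mod V) f x)))
    (add : ∀ x y, P x → P y → P (x + y)) : P z := by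
  induction z using DirectSum.induction_on with
  | zero => exact zero
  | add x y hx hy => exact add x y hx hy
  | of p x =>
    change P (BarCobar.of (freeFam V s) p x)
    change DirectSum _ _ at x
    induction x using DirectSum.induction_on with
    | zero => exact (map_zero (BarCobar.of (freeFam V s) p)).symm ▸ zero
    | add x y hx hy => exact ((BarCobar.of (freeFam V s) p).map_add x y).symm ▸ add _ _ hx hy
    | of f x => exact of p f x

theorem projF_inclF (z : Tot (freeFam V s)) : projF V s (inclF V s z) = z := by
  induction z using freeFam_induction with
  | zero => simp
  | add x y hx hy => rw [map_add, map_add, hx, hy]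
  | of p f x =>
    rw [inclF_of]
    obtain ⟨f, h1, h2, h3, h4⟩ := f
    obtain ⟨t, b, n⟩ := p
    dsimp only at h2 h3 h4 x ⊢
    subst h2 h4
    rw [projF_ofF f x h1 b h3]

theorem inclF_injective : Function.Injective (inclF V s) :=
  Function.LeftInverse.injective projF_inclF

theorem projF_eq_zero (x : DF V) (h : ¬ (x.WF ∧ ∃ t, x.roots = [t])) : projF V s x.ev = 0 := by
  have h' : ¬ (x.shape.WF ∧ ∃ t, x.shape.roots = [t]) := h
  rw [projF, elimF_ev, dif_neg h']
  rfl

theorem inclF_projF_ev (x : DF V) (h : x.WF) (t : E) (ht : x.roots = [t]) :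
    inclF V s (projF V s x.ev) = x.ev := by
  rw [DF.ev, projF_ofF _ _ h t ht, inclF_of]

theorem inclF_projF {t : List E} {b : E} {n : ℤ} {z : Forests V} (hz : z ∈ FS V s t [b] n) :
    inclF V s (projF V s z) = z :=
  FS_ext (f := inclF V s ∘ₗ projF V s) (g := LinearMap.id)
    (fun x h1 _ h3 _ => inclF_projF_ev x h1 b h3) hz

theorem projF_isIn {t : List E} {b : E} {n : ℤ} {z : Forests V} (hz : z ∈ FS V s t [b] n) :
    IsIn (freeFam V s) t b n (projF V s z) := by
  refine FS_map_le (projF V s) _ (fun x h1 h2 h3 h4 => ?_) hz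
  subst h2 h4
  rw [DF.ev, projF_ofF _ _ h1 b h3]
  exact ⟨_, rfl⟩

theorem inclF_mem {t : List E} {b : E} {n : ℤ} {z : Tot (freeFam V s)}
    (hz : IsIn (freeFam V s) t b n z) : inclF V s z ∈ FS V s t [b] n := by
  obtain ⟨y, rfl⟩ := hz
  change DirectSum _ _ at y
  induction y using DirectSum.induction_on with
  | zero =>
    have : of (freeFam V s) ⟨t, b, n⟩ 0 = 0 := map_zero _
    exact (congrArg (inclF V s) this).symm ▸ (map_zero (inclF V s)).symm ▸ Submodule.zero_mem _
  | add x y hx hy =>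
    have := (of (freeFam V s) ⟨t, b, n⟩).map_add x y
    refine (congrArg (inclF V s) this).symm ▸ ?_
    rw [map_add]
    exact Submodule.add_mem _ hx hy
  | of f x =>
    have h := inclF_of (V := V) ⟨t, b, n⟩ f x
    obtain ⟨f, h1, h2, h3, h4⟩ := f
    refine h.symm ▸ ?_
    refine Submodule.span_mono ?_ (span_val f x)
    rintro _ ⟨y, rfl, rfl⟩
    exact ⟨y, h1, h2, h3, h4, rfl⟩

theorem isIn_freeFam_iff {t : List E} {b : E} {n : ℤ} {z : Tot (freeFam V s)} :
    IsIn (freeFam V s) t b n z ↔ inclF V s z ∈ FS V s t [b] n :=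
  ⟨inclF_mem, fun h => by simpa only [projF_inclF] using projF_isIn h⟩

theorem inclF_tot_mem (a : HEl (freeFam V s)) :
    inclF V s a.tot ∈ FS V s a.1.top [a.1.bot] a.1.deg := inclF_mem (isIn_tot a)

/-- Linear maps on the span of all trees agree if they agree on decorated trees. -/
theorem freeFam_ext {N : Type u} [AddCommGroup N] [Module k N] {f g : Tot (freeFam V s) →ₗ[k] N}
    (h : ∀ (x : DF V) (e : E), x.WF → x.roots = [e] → f (projF V s x.ev) = g (projF V s x.ev))
    (z : Tot (freeFam V s)) : f z = g z := by
  refine tot_ext (fun a => ?_) z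
  have := FS_ext (f := f ∘ₗ projF V s) (g := g ∘ₗ projF V s)
    (fun x h1 _ h3 _ => h x a.1.bot h1 h3) (inclF_tot_mem a)
  simpa only [lcomp_apply, projF_inclF] using this

theorem inclF_sg (z : Tot (freeFam V s)) : inclF V s (sg _ z) = sgF V s 1 (inclF V s z) := by
  refine tot_ext (f := inclF V s ∘ₗ sg _) (g := sgF V s 1 ∘ₗ inclF V s) (fun a => ?_) z
  rw [lcomp_apply, lcomp_apply, sg_tot, sgF_of_mem 1 (inclF_tot_mem a), map_smul, one_mul]

/-! ### Forests as words of trees -/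

theorem wordToForest_eq : wordToForest V s = catLift (inclF V s) := rfl

theorem wordToForest_mem {t b : List E} {n : ℤ} {x : Words (freeFam V s)}
    (hx : x ∈ WS (freeFam V s) t b n) : wordToForest V s x ∈ FS V s t b n := by
  refine WS_map_le (wordToForest V s) _ (fun l h1 h2 h3 => ?_) hx
  subst h1 h2 h3
  have := catLift_word_mem (V := V) id s (inclF V s) l (fun a _ => by simpa using inclF_tot_mem a)
  simpa [wordToForest_eq] using this

theorem wordToForest_odd (x : Words (freeFam V s)) :
    wordToForest V s (wordOdd _ x) = oddF V s (wordToForest V s x) := by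
  refine words_ext (f := wordToForest V s ∘ₗ wordOdd _) (g := oddF V s ∘ₗ wordToForest V s)
    (fun l => ?_) x
  rw [lcomp_apply, lcomp_apply, wordOdd_word, oddF_of_mem (wordToForest_mem (word_mem l))]
  split_ifs <;> simp

variable (V s) in
/-- A sum of forests as a sum of words of trees. -/
abbrev ftw : Forests V →ₗ[k] Words (freeFam V s) := elimF (forestToWord V s)

theorem ftw_nil : ftw V s (nilF V) = 1 := by
  refine (elimF_ofF (forestToWord V s) PForest.nil _).trans ?_
  exact one_smul k (1 : Words (freeFam V s))

theorem ftw_leafOp (e : E) (x : Forests V) :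
    ftw V s (leafOp V e x) = letter _ (projF V s (leafTree V e)) * ftw V s x := by
  refine forests_ext (f := ftw V s ∘ₗ leafOp V e)
    (g := mulLeft k (letter _ (projF V s (leafTree V e))) ∘ₗ ftw V s) (fun x => ?_) x
  rw [lcomp_apply, ← DF.ev_leaf, ftw, elimF_ev, lcomp_apply, elimF_ev]
  rfl

theorem ftw_nodeOp (v : Tot V) (x y : Forests V) :
    ftw V s (nodeOp V (v ⊗ₜ (x ⊗ₜ y))) =
      letter _ (projF V s (treeOp V (v ⊗ₜ x))) * ftw V s y := by
  refine node_ext (f := ftw V s ∘ₗ nodeOp V)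
    (g := LinearMap.mul' k _ ∘ₗ tmap (letter _ ∘ₗ projF V s ∘ₗ treeOp V) (ftw V s) ∘ₗ
      (tassoc k _ _ _).symm.toLinearMap) (fun a x y => ?_) (v ⊗ₜ (x ⊗ₜ y))
  rw [lcomp_apply, ← DF.ev_node, ftw, elimF_ev]
  simp only [lcomp_apply, LinearEquiv.coe_coe, assoc_symm_tmul, map_tmul, elimF_ev]
  rfl

theorem ftw_catOp (x y : Forests V) : ftw V s (catOp V (x ⊗ₜ y)) = ftw V s x * ftw V s y := by
  induction x using forests_induction with
  | add c d hc hd => simp only [map_add, add_tmul, hc, hd, add_mul]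
  | smul c d hd => simp only [map_smul, ← smul_tmul', hd, smul_mul_assoc]
  | ev x =>
  induction x with
  | nil => rw [DF.ev_nil, catOp_nil, ftw_nil, one_mul]
  | leaf e f ih => rw [DF.ev_leaf, catOp_leafOp, ftw_leafOp, ftw_leafOp, ih, mul_assoc]
  | node a ch f _ ih => rw [DF.ev_node, catOp_nodeOp, ftw_nodeOp, ftw_nodeOp, ih, mul_assoc]

theorem ftw_of_tree {t : List E} {b : E} {n : ℤ} {z : Forests V} (hz : z ∈ FS V s t [b] n) :
    ftw V s z = letter _ (projF V s z) := by
  refine FS_ext (f := ftw V s) (g := letter _ ∘ₗ projF V s) (fun x _ _ h3 _ => ?_) hz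
  rw [lcomp_apply]
  rcases x.tree_cases b h3 with rfl | ⟨a, ch, rfl, -⟩
  · rw [DF.ev_leaf, ftw_leafOp, DF.ev_nil, ftw_nil, mul_one]; rfl
  · rw [DF.ev_node, ftw_nodeOp, DF.ev_nil, ftw_nil, mul_one]; rfl

theorem ftw_wordToForest (x : Words (freeFam V s)) : ftw V s (wordToForest V s x) = x := by
  refine words_ext (f := ftw V s ∘ₗ wordToForest V s) (g := LinearMap.id) (fun l => ?_) x
  rw [lcomp_apply, LinearMap.id_apply, wordToForest_eq]
  induction l with
  | nil => rw [word_nil, catLift_one, ftw_nil]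
  | cons a l ih =>
    rw [word_cons, catLift_ι_mul, ftw_catOp, ih, ftw_of_tree (inclF_tot_mem a), projF_inclF]

theorem wordToForest_ftw {t b : List E} {n : ℤ} {z : Forests V} (hz : z ∈ FS V s t b n) :
    wordToForest V s (ftw V s z) = z := by
  refine FS_ext (f := wordToForest V s ∘ₗ ftw V s) (g := LinearMap.id) (fun x h h2 h3 h4 => ?_) hz
  clear h2 h3 h4
  rw [lcomp_apply, LinearMap.id_apply, wordToForest_eq]
  induction x with
  | nil => rw [DF.ev_nil, ftw_nil, catLift_one]
  | leaf e f ih =>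
    rw [DF.ev_leaf, ftw_leafOp, catLift_ι_mul, ih h, inclF_projF (leafTree_mem s e),
      leafOp_eq_catOp]
  | node a ch f _ ih =>
    have := inclF_projF (s := s) (ev_mem (s := s) (DF.node a ch DF.nil) ⟨h.1, h.2.1, trivial⟩)
    rw [DF.ev_node, ftw_nodeOp, catLift_ι_mul, ih h.2.2, treeOp_ev, this, ← treeOp_ev,
      nodeOp_eq_catOp]

theorem ftw_mem {t b : List E} {n : ℤ} {z : Forests V} (hz : z ∈ FS V s t b n) :
    ftw V s z ∈ WS (freeFam V s) t b n := by
  refine FS_map_le (ftw V s) _ (fun x h h2 h3 h4 => ?_) hz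
  subst h2 h3 h4
  clear hz
  induction x with
  | nil => rw [DF.ev_nil, ftw_nil]; exact one_mem_WS
  | leaf e f ih =>
    rw [DF.ev_leaf, ftw_leafOp]
    simpa using mul_mem_WS (letter_mem (projF_isIn (leafTree_mem s e))) (ih h)
  | node a ch f _ ih =>
    have := projF_isIn (s := s) (b := a.1.bot)
      (ev_mem (s := s) (DF.node a ch DF.nil) ⟨h.1, h.2.1, trivial⟩)
    rw [DF.ev_node, ftw_nodeOp, treeOp_ev]
    simpa [add_assoc] using mul_mem_WS (letter_mem this) (ih h.2.2)

end FreeFam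

/-! ### Grafting -/

section Graft

variable {k : Type u} [Field k] {E : Type u} {V : Fam k E} {s : ℤ}

theorem FS_ext₂ {V' : Fam k E} {t b : List E} {n : ℤ} {s' : ℤ} {t' b' : List E} {n' : ℤ}
    {N : Type u} [AddCommGroup N] [Module k N] {f g : Forests V ⊗[k] Forests V' →ₗ[k] N}
    (h : ∀ x : DF V, x.WF → x.leaves = t → x.roots = b → x.deg s = n →
      ∀ y : DF V', y.WF → y.leaves = t' → y.roots = b' → y.deg s' = n' →
      f (x.ev ⊗ₜ y.ev) = g (x.ev ⊗ₜ y.ev))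
    {z : Forests V} (hz : z ∈ FS V s t b n) {w : Forests V'} (hw : w ∈ FS V' s' t' b' n') :
    f (z ⊗ₜ w) = g (z ⊗ₜ w) := by
  have := FS_map₂_le (f - g) ⊥ (fun x h1 h2 h3 h4 y h1' h2' h3' h4' => ?_) hz hw
  · simpa [sub_eq_zero] using this
  · simpa [sub_eq_zero] using h x h1 h2 h3 h4 y h1' h2' h3' h4'

variable (V) in
theorem uncons_append (e : E) (t m : DF V) (ht : t.roots = [e]) :
    uncons V e (t.append m).ev = t.ev ⊗ₜ m.ev := by
  rcases t.tree_cases e ht with rfl | ⟨a, ch, rfl, rfl⟩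
  · rw [uncons, elimF_ev]
    change (if e = e then (tmk k _ _ (leafTree V e) ∘ₗ ofF V m.shape :
      m.shape.mod V →ₗ[k] Forests V ⊗[k] Forests V) else 0) m.val = _
    rw [if_pos rfl, ← leafTree_eq_ev]
    rfl
  · rw [uncons, elimF_ev, ← treeOp_ev]
    change (if a.1.bot = a.1.bot then
      tmap (treeOp V ∘ₗ tmap (of V a.1) (ofF V ch.shape))
        (ofF V m.shape) ∘ₗ
        (tassoc k (V a.1) (ch.shape.mod V) (m.shape.mod V)).symm.toLinearMap
      else 0) (a.2 ⊗ₜ (ch.val ⊗ₜ m.val)) = _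
    rw [if_pos rfl]
    rfl

theorem uncons_eq_zero (e : E) (l : DF V) (h : ∀ b, l.roots ≠ e :: b) : uncons V e l.ev = 0 := by
  rw [uncons, elimF_ev]
  cases l with
  | nil => rfl
  | leaf e' f =>
    have : ¬ e' = e := fun h' => h f.roots (by simp [h'])
    change (if e' = e then (tmk k _ _ (leafTree V e) ∘ₗ ofF V f.shape :
      f.shape.mod V →ₗ[k] Forests V ⊗[k] Forests V) else 0) f.val = _
    rw [if_neg this]
    rfl
  | node a ch f =>
    have : ¬ a.1.bot = e := fun h' => h f.roots (by simp [h'])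
    change (if a.1.bot = e then
      tmap (treeOp V ∘ₗ tmap (of V a.1) (ofF V ch.shape))
        (ofF V f.shape) ∘ₗ
        (tassoc k (V a.1) (ch.shape.mod V) (f.shape.mod V)).symm.toLinearMap
      else 0) (a.2 ⊗ₜ (ch.val ⊗ₜ f.val)) = _
    rw [if_neg this]
    rfl

/-- The grafting with remainder, as a bilinear map. -/
abbrev graftR (V : Fam k E) (s : ℤ) : Forests V ⊗[k] Forests V →ₗ[k] Forests V ⊗[k] Forests V :=
  elimF₂ (graft V s)

theorem graftR_nil (l : Forests V) : graftR V s (nilF V ⊗ₜ l) = nilF V ⊗ₜ l := by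
  refine (elimF₂_ofF (graft V s) PForest.nil _ l).trans ?_
  change nilF V ⊗ₜ ((1 : k) • l) = _
  rw [one_smul]

theorem graftR_leaf (e : E) (f : DF V) (l : Forests V) (t m : Forests V)
    (h : uncons V e l = t ⊗ₜ m) :
    graftR V s ((DF.leaf e f).ev ⊗ₜ l) = rTensor _ (catOp V)
      ((tassoc k _ _ _).symm (sgF V s (f.deg s) t ⊗ₜ graftR V s (f.ev ⊗ₜ m))) := by
  rw [elimF₂_ev, elimF₂_ev]
  change rTensor _ (catOp V) ((tassoc k _ _ _).symm (
      lTensor _ (graft V s f.shape) (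
      (TensorProduct.leftComm k (f.shape.mod V) (Forests V) (Forests V)) (
      f.val ⊗ₜ (rTensor _ (sgF V s (f.deg s)) (uncons V e l)))))) = _
  rw [h]
  rfl

theorem graftR_leaf_zero (e : E) (f : DF V) (l : Forests V) (h : uncons V e l = 0) :
    graftR V s ((DF.leaf e f).ev ⊗ₜ l) = 0 := by
  rw [elimF₂_ev]
  change rTensor _ (catOp V) ((tassoc k _ _ _).symm (
      lTensor _ (graft V s f.shape) (
      (TensorProduct.leftComm k (f.shape.mod V) (Forests V) (Forests V)) (
      f.val ⊗ₜ (rTensor _ (sgF V s (f.deg s)) (uncons V e l)))))) = _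
  rw [h]
  simp only [map_zero, tmul_zero]

theorem graftR_node_aux (a : HEl V) (ch f : DF V) (l : Forests V) :
    graftR V s ((DF.node a ch f).ev ⊗ₜ l) = rTensor _ (nodeOp V)
      ((tassoc k _ _ _).symm (a.tot ⊗ₜ (tassoc k _ _ _).symm
        (lTensor _ (graft V s f.shape ∘ₗ (TensorProduct.comm k _ _).toLinearMap ∘ₗ
          rTensor _ (sgF V s (f.deg s))) (tassoc k _ _ _
          (graftR V s (ch.ev ⊗ₜ sgF V s (f.deg s) l) ⊗ₜ f.val))))) := by
  rw [elimF₂_ev, elimF₂_ev]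
  rfl

theorem graftR_node (a : HEl V) (ch f : DF V) (l u l' : Forests V)
    (h : graftR V s (ch.ev ⊗ₜ sgF V s (f.deg s) l) = u ⊗ₜ l') :
    graftR V s ((DF.node a ch f).ev ⊗ₜ l) = rTensor _ (nodeOp V)
      ((tassoc k _ _ _).symm (a.tot ⊗ₜ (tassoc k _ _ _).symm
        (u ⊗ₜ graftR V s (f.ev ⊗ₜ sgF V s (f.deg s) l')))) := by
  rw [graftR_node_aux, h, elimF₂_ev]
  rfl

theorem graftR_node_zero (a : HEl V) (ch f : DF V) (l : Forests V)
    (h : graftR V s (ch.ev ⊗ₜ sgF V s (f.deg s) l) = 0) :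
    graftR V s ((DF.node a ch f).ev ⊗ₜ l) = 0 := by
  rw [graftR_node_aux, h]
  simp only [map_zero, tmul_zero, zero_tmul]

theorem nilCoeff_nil : nilCoeff V (nilF V) = 1 := by
  refine (elimF_ofF _ PForest.nil _).trans ?_
  rfl

theorem nilCoeff_ev (x : DF V) (h : x ≠ DF.nil) : nilCoeff V x.ev = 0 := by
  rw [nilCoeff, elimF_ev]
  cases x with
  | nil => exact absurd rfl h
  | leaf e f => rfl
  | node a ch f => rfl

theorem graftOp_eq_graftR (z : Forests V ⊗[k] Forests V) : graftOp V s z =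
    TensorProduct.rid k _ (lTensor _ (nilCoeff V) (graftR V s z)) := rfl

theorem FS_cast {t t' b b' : List E} {n n' : ℤ} {z : Forests V} (hz : z ∈ FS V s t b n)
    (ht : t = t') (hb : b = b') (hn : n = n') : z ∈ FS V s t' b' n' := by
  subst ht hb hn; exact hz

theorem graftOp_of_graftR (z r : Forests V) (l m : DF V)
    (h : graftR V s (z ⊗ₜ l.ev) = r ⊗ₜ m.ev) :
    graftOp V s (z ⊗ₜ l.ev) = nilCoeff V m.ev • r := by
  rw [graftOp_eq_graftR, h, lTensor_tmul, rid_tmul]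

/-- Grafting uses up the first trees of the second forest, as many as there are leaves, and leaves
the other trees alone. -/
theorem graftR_append (x l : DF V) (h : l.roots = x.leaves) (m : DF V) :
    graftR V s (x.ev ⊗ₜ (l.append m).ev) = graftOp V s (x.ev ⊗ₜ l.ev) ⊗ₜ m.ev := by
  suffices H : ∃ r, ∀ m : DF V, graftR V s (x.ev ⊗ₜ (l.append m).ev) = r ⊗ₜ m.ev by
    obtain ⟨r, hr⟩ := H
    have := graftOp_of_graftR x.ev r l DF.nil (by simpa using hr DF.nil)
    rw [this, hr, DF.ev_nil, nilCoeff_nil, one_smul]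
  induction x generalizing l with
  | nil =>
    obtain rfl := l.eq_nil_of_roots h
    exact ⟨nilF V, fun m => graftR_nil _⟩
  | leaf e f ih =>
    obtain ⟨t, l, rfl, ht, hl⟩ := l.exists_append [e] f.leaves h
    obtain ⟨r, hr⟩ := ih l hl
    refine ⟨catOp V (sgF V s (f.deg s) t.ev ⊗ₜ r), fun m => ?_⟩
    rw [DF.append_assoc, graftR_leaf e f _ _ _ (uncons_append V e t _ ht), hr]
    simp
  | node a ch f ih1 ih2 =>
    obtain ⟨l1, l2, rfl, h1, h2⟩ := l.exists_append ch.leaves f.leaves h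
    obtain ⟨r1, hr1⟩ := ih1 l1 h1
    obtain ⟨r2, hr2⟩ := ih2 l2 h2
    refine ⟨sgn k (f.deg s * l1.deg s) • nodeOp V (a.tot ⊗ₜ (r1 ⊗ₜ r2)), fun m => ?_⟩
    rw [DF.append_assoc, graftR_node a ch f _ r1
      (sgn k (f.deg s * (l1.append (l2.append m)).deg s) • (l2.append m).ev)
      (by rw [sgF_ev, tmul_smul, map_smul, hr1, tmul_smul]),
      map_smul, sgF_ev, smul_smul, tmul_smul, map_smul, hr2]
    simp only [tmul_smul, map_smul, assoc_symm_tmul, rTensor_tmul, ← smul_tmul', ← sgn_add]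
    congr 1
    apply sgn_congr
    simp only [DF.deg_append]
    push_cast
    grind

theorem graftOp_nil : graftOp V s (nilF V ⊗ₜ nilF V) = nilF V := by
  have := graftOp_of_graftR (s := s) (nilF V) (nilF V) DF.nil DF.nil (graftR_nil _)
  rwa [DF.ev_nil, nilCoeff_nil, one_smul] at this

theorem graftOp_leaf (e : E) (f t l : DF V) (ht : t.roots = [e]) (hl : l.roots = f.leaves) :
    graftOp V s ((DF.leaf e f).ev ⊗ₜ (t.append l).ev) =
      sgn k (f.deg s * t.deg s) • catOp V (t.ev ⊗ₜ graftOp V s (f.ev ⊗ₜ l.ev)) := by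
  have h := graftR_leaf (s := s) e f _ _ _ (uncons_append V e t l ht)
  have h2 := graftR_append (s := s) f l hl DF.nil
  rw [DF.append_nil] at h2
  rw [h2, sgF_ev] at h
  have := graftOp_of_graftR _ (sgn k (f.deg s * t.deg s) • catOp V
    (t.ev ⊗ₜ graftOp V s (f.ev ⊗ₜ l.ev))) _ DF.nil (h.trans (by
      simp [← smul_tmul']))
  rwa [DF.ev_nil, nilCoeff_nil, one_smul] at this

theorem graftOp_node (a : HEl V) (ch f l m : DF V) (hl : l.roots = ch.leaves)
    (hm : m.roots = f.leaves) :
    graftOp V s ((DF.node a ch f).ev ⊗ₜ (l.append m).ev) = sgn k (f.deg s * l.deg s) •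
      nodeOp V (a.tot ⊗ₜ (graftOp V s (ch.ev ⊗ₜ l.ev) ⊗ₜ graftOp V s (f.ev ⊗ₜ m.ev))) := by
  have h1 := graftR_append (s := s) ch l hl m
  have h2 := graftR_append (s := s) f m hm DF.nil
  rw [DF.append_nil] at h2
  have h := graftR_node (s := s) a ch f (l.append m).ev (graftOp V s (ch.ev ⊗ₜ l.ev))
      (sgn k (f.deg s * (l.append m).deg s) • m.ev)
      (by rw [sgF_ev, tmul_smul, map_smul, h1, tmul_smul])
  rw [map_smul, sgF_ev, smul_smul, tmul_smul, map_smul, h2] at h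
  have := graftOp_of_graftR _ (sgn k (f.deg s * l.deg s) •
      nodeOp V (a.tot ⊗ₜ (graftOp V s (ch.ev ⊗ₜ l.ev) ⊗ₜ graftOp V s (f.ev ⊗ₜ m.ev)))) _ DF.nil
      (h.trans ?_)
  · rwa [DF.ev_nil, nilCoeff_nil, one_smul] at this
  · simp only [tmul_smul, map_smul, assoc_symm_tmul, rTensor_tmul, ← smul_tmul', ← sgn_add,
      DF.ev_nil]
    congr 1
    apply sgn_congr
    simp only [DF.deg_append]
    push_cast
    grind

theorem graftR_eq_zero (x l : DF V) (h : ∀ b, l.roots ≠ x.leaves ++ b) :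
    graftR V s (x.ev ⊗ₜ l.ev) = 0 := by
  induction x generalizing l with
  | nil => exact absurd rfl (h l.roots)
  | leaf e f ih =>
    by_cases he : ∃ b, l.roots = [e] ++ b
    · obtain ⟨b, hb⟩ := he
      obtain ⟨t, m, rfl, ht, hm⟩ := l.exists_append _ _ hb
      rw [graftR_leaf e f _ _ _ (uncons_append V e t m ht), ih m]
      · simp
      · intro b' hb'
        exact h b' (by simp [ht, hb'])
    · exact graftR_leaf_zero _ _ _ (uncons_eq_zero _ _ fun b hb => he ⟨b, hb⟩)
  | node a ch f ih1 ih2 =>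
    by_cases hc : ∃ b, l.roots = ch.leaves ++ b
    · obtain ⟨b, hb⟩ := hc
      obtain ⟨l, m, rfl, hl, hm⟩ := l.exists_append _ _ hb
      rw [graftR_node a ch f _ (graftOp V s (ch.ev ⊗ₜ l.ev))
        (sgn k (f.deg s * (l.append m).deg s) • m.ev)
        (by rw [sgF_ev, tmul_smul, map_smul, graftR_append _ _ hl,
          tmul_smul]), map_smul, sgF_ev, tmul_smul,
          tmul_smul, map_smul, map_smul, ih2 m]
      · simp
      · intro b' hb'
        exact h b' (by simp [hl, hb'])
    · refine graftR_node_zero _ _ _ _ ?_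
      rw [sgF_ev, tmul_smul, map_smul, ih1 l fun b hb => hc ⟨b, hb⟩, smul_zero]

theorem graftOp_eq_zero (x l : DF V) (h : l.roots ≠ x.leaves) :
    graftOp V s (x.ev ⊗ₜ l.ev) = 0 := by
  by_cases hb : ∃ b, l.roots = x.leaves ++ b
  · obtain ⟨b, hb⟩ := hb
    obtain ⟨l, m, rfl, hl, hm⟩ := l.exists_append _ _ hb
    rw [graftOp_of_graftR _ _ _ m (graftR_append x l hl m), nilCoeff_ev, zero_smul]
    rintro rfl
    exact h (by simpa using hl)
  · rw [graftOp_eq_graftR, graftR_eq_zero x l fun b h' => hb ⟨b, h'⟩, map_zero, map_zero]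

theorem graftOp_eq_zero_of_mem {t b t' b' : List E} {n n' : ℤ} {x y : Forests V}
    (hx : x ∈ FS V s t b n) (hy : y ∈ FS V s t' b' n') (h : b' ≠ t) :
    graftOp V s (x ⊗ₜ y) = 0 := by
  refine FS_ext₂ (f := graftOp V s) (g := 0)
    (fun x _ h2 _ _ y _ _ h3' _ => ?_) hx hy
  exact graftOp_eq_zero x y (by rw [h2, h3']; exact h)

theorem graftOp_ev_mem (x y : DF V) (hx : x.WF) (hy : y.WF) (h : y.roots = x.leaves) :
    graftOp V s (x.ev ⊗ₜ y.ev) ∈ FS V s y.leaves x.roots (x.deg s + y.deg s) := by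
  induction x generalizing y with
  | nil =>
    obtain rfl := y.eq_nil_of_roots h
    rw [DF.ev_nil, graftOp_nil]
    exact nilF_mem s
  | leaf e f ih =>
    obtain ⟨t, m, rfl, ht, hm⟩ := y.exists_append [e] f.leaves h
    rw [graftOp_leaf e f t m ht hm]
    simp only [DF.wf_append] at hy
    have := catOp_mem (ev_mem s t hy.1) (ih m hx hy.2 hm)
    refine Submodule.smul_mem _ _ ?_
    exact FS_cast this (by simp) (by simp [ht]) (by simp; ring)
  | node a ch f ih1 ih2 =>
    obtain ⟨l, m, rfl, hl, hm⟩ := y.exists_append ch.leaves f.leaves h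
    rw [graftOp_node a ch f l m hl hm, nodeOp_eq_catOp]
    simp only [DF.wf_append] at hy
    have h1 := ih1 l hx.2.1 hy.1 hl
    rw [show ch.roots = a.1.top from hx.1] at h1
    have := catOp_mem (treeOp_mem (isIn_tot a) h1) (ih2 m hx.2.2 hy.2 hm)
    refine Submodule.smul_mem _ _ ?_
    exact FS_cast this (by simp) (by simp) (by simp; ring)

theorem graftOp_mem {t b t' : List E} {n n' : ℤ} {x y : Forests V}
    (hx : x ∈ FS V s t b n) (hy : y ∈ FS V s t' t n') :
    graftOp V s (x ⊗ₜ y) ∈ FS V s t' b (n + n') := by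
  refine FS_map₂_le (graftOp V s) _ (fun x h1 h2 h3 h4 y h1' h2' h3' h4' => ?_) hx hy
  have := graftOp_ev_mem (s := s) x y h1 h1' (by rw [h2, h3'])
  rwa [h2', h3, h4, h4'] at this

theorem graftOp_append (x x' y y' : DF V) (h : y.roots = x.leaves) (h' : y'.roots = x'.leaves) :
    graftOp V s ((x.append x').ev ⊗ₜ (y.append y').ev) = sgn k (x'.deg s * y.deg s) •
      catOp V (graftOp V s (x.ev ⊗ₜ y.ev) ⊗ₜ graftOp V s (x'.ev ⊗ₜ y'.ev)) := by
  induction x generalizing y with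
  | nil =>
    obtain rfl := y.eq_nil_of_roots h
    simp [graftOp_nil, catOp_nil]
  | leaf e f ih =>
    obtain ⟨t, m, rfl, ht, hm⟩ := y.exists_append [e] f.leaves h
    rw [graftOp_leaf e f t m ht hm, DF.append_assoc, DF.leaf_append,
      graftOp_leaf e _ t _ ht (by simp [hm, h']), ih m hm, tmul_smul, map_smul,
      ← smul_tmul', map_smul, catOp_assoc, smul_smul, smul_smul, ← sgn_add,
      ← sgn_add]
    congr 1
    apply sgn_congr
    simp only [DF.deg_append]
    push_cast
    grind
  | node a ch f _ ih =>
    obtain ⟨l, m, rfl, hl, hm⟩ := y.exists_append ch.leaves f.leaves h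
    rw [graftOp_node a ch f l m hl hm, DF.append_assoc, DF.node_append,
      graftOp_node a ch _ l _ hl (by simp [hm, h']), ih m hm, tmul_smul,
      tmul_smul, map_smul, ← smul_tmul', map_smul, catOp_nodeOp,
      smul_smul, smul_smul, ← sgn_add, ← sgn_add]
    congr 1
    apply sgn_congr
    simp only [DF.deg_append]
    push_cast
    grind

/-- The interchange law between grafting and concatenation. -/
theorem graftOp_catOp {t b t' b' u u' : List E} {n n' m m' : ℤ} {x x' y y' : Forests V}
    (hx : x ∈ FS V s t b n) (hx' : x' ∈ FS V s t' b' n') (hy : y ∈ FS V s u t m)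
    (hy' : y' ∈ FS V s u' t' m') :
    graftOp V s (catOp V (x ⊗ₜ x') ⊗ₜ catOp V (y ⊗ₜ y')) = sgn k (n' * m) •
      catOp V (graftOp V s (x ⊗ₜ y) ⊗ₜ graftOp V s (x' ⊗ₜ y')) := by
  let f := graftOp V s ∘ₗ tmap (catOp V) (catOp V)
  let g := sgn k (n' * m) • (catOp V ∘ₗ tmap (graftOp V s) (graftOp V s) ∘ₗ
    (TensorProduct.tensorTensorTensorComm k _ _ _ _).toLinearMap)
  change f ((x ⊗ₜ x') ⊗ₜ (y ⊗ₜ y')) = g ((x ⊗ₜ x') ⊗ₜ (y ⊗ₜ y'))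
  refine FS_ext₂ (f := f ∘ₗ (tmk k (Forests V ⊗[k] Forests V) _).flip (y ⊗ₜ y'))
    (g := g ∘ₗ (tmk k (Forests V ⊗[k] Forests V) _).flip (y ⊗ₜ y'))
    (fun x _ h2 _ _ x' _ h2' _ h4' => ?_) hx hx'
  refine FS_ext₂ (f := f ∘ₗ tmk k _ _ (x.ev ⊗ₜ x'.ev))
    (g := g ∘ₗ tmk k _ _ (x.ev ⊗ₜ x'.ev))
    (fun y _ _ h3 h4 y' _ _ h3' _ => ?_) hy hy'
  change graftOp V s (catOp V (x.ev ⊗ₜ x'.ev) ⊗ₜ catOp V (y.ev ⊗ₜ y'.ev)) = sgn k (n' * m) •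
      catOp V (graftOp V s (x.ev ⊗ₜ y.ev) ⊗ₜ graftOp V s (x'.ev ⊗ₜ y'.ev))
  rw [catOp_ev, catOp_ev, graftOp_append x x' y y' (by rw [h2, h3]) (by rw [h2', h3']), h4, h4']

theorem graftOp_treeOp {t b u : List E} {n m : ℤ} (v : Tot V) {x y : Forests V}
    (hx : x ∈ FS V s t b n) (hy : y ∈ FS V s u t m) :
    graftOp V s (treeOp V (v ⊗ₜ x) ⊗ₜ y) = treeOp V (v ⊗ₜ graftOp V s (x ⊗ₜ y)) := by
  induction v using tot_induction with
  | zero => simp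
  | add a b ha hb => simp only [add_tmul, map_add, ha, hb]
  | tot a =>
  let f : Forests V ⊗[k] Forests V →ₗ[k] Forests V := graftOp V s ∘ₗ rTensor _
    (treeOp V ∘ₗ tmk k (Tot V) (Forests V) a.tot)
  let g : Forests V ⊗[k] Forests V →ₗ[k] Forests V := treeOp V ∘ₗ
    tmk k (Tot V) (Forests V) a.tot ∘ₗ graftOp V s
  refine FS_ext₂ (f := f) (g := g) (fun x _ h2 _ _ y _ _ h3' _ => ?_) hx hy
  change graftOp V s (treeOp V (a.tot ⊗ₜ x.ev) ⊗ₜ y.ev) =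
    treeOp V (a.tot ⊗ₜ graftOp V s (x.ev ⊗ₜ y.ev))
  have := graftOp_node (s := s) a x DF.nil y DF.nil (by rw [h2, h3']) rfl
  rw [DF.append_nil, DF.ev_nil, graftOp_nil] at this
  rw [treeOp_ev, this, treeOp_tmul]
  simp

theorem graftOp_leavesF {t : List E} (l : List E) {n : ℤ} {y : Forests V}
    (hy : y ∈ FS V s t l n) : graftOp V s (leavesF V l ⊗ₜ y) = y := by
  refine FS_ext (f := graftOp V s ∘ₗ tmk k _ _ (leavesF V l)) (g := LinearMap.id)
    (fun y h1 h2 h3 h4 => ?_) hy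
  change graftOp V s (leavesF V l ⊗ₜ y.ev) = y.ev
  rw [leavesF_eq_ev]
  clear hy h1 h2 h4
  induction l generalizing y with
  | nil => rw [y.eq_nil_of_roots h3]; exact graftOp_nil
  | cons e l ih =>
    obtain ⟨t, m, rfl, ht, hm⟩ := y.exists_append [e] l h3
    rw [leavesDF, graftOp_leaf e _ t m ht (by simpa using hm), ih _ hm, catOp_ev]
    simp

theorem graftOp_leavesF_right {b : List E} (l : List E) {n : ℤ} {x : Forests V}
    (hx : x ∈ FS V s l b n) : graftOp V s (x ⊗ₜ leavesF V l) = x := by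
  refine FS_ext (f := graftOp V s ∘ₗ (tmk k (Forests V) _).flip (leavesF V l))
    (g := LinearMap.id) (fun x h1 h2 h3 h4 => ?_) hx
  change graftOp V s (x.ev ⊗ₜ leavesF V l) = x.ev
  rw [← h2]
  clear hx h1 h2 h3 h4
  induction x with
  | nil => exact graftOp_nil
  | leaf e f ih =>
    have := graftOp_leaf (s := s) e f (DF.leaf e DF.nil) (leavesDF V f.leaves) rfl (by simp)
    rw [leavesF_eq_ev] at ih ⊢
    rw [ih] at this
    simpa [leavesDF, catOp_leafOp, catOp_nil] using this
  | node a ch f ih1 ih2 =>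
    have := graftOp_node (s := s) a ch f (leavesDF V ch.leaves) (leavesDF V f.leaves) (by simp)
      (by simp)
    rw [← leavesF_eq_ev, ← leavesF_eq_ev, ih1, ih2, deg_leavesDF] at this
    rw [DF.leaves_node, leavesF_append, leavesF_eq_ev, leavesF_eq_ev, catOp_ev, this]
    simp

theorem corolla_graftOp {t u : List E} {b : E} {n m : ℤ} {v : Tot V} {y : Forests V}
    (hv : IsIn V t b n v) (hy : y ∈ FS V s u t m) :
    graftOp V s (corolla V v ⊗ₜ y) = treeOp V (v ⊗ₜ y) := by
  obtain ⟨v, hv', rfl⟩ := hv.exists_tot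
  rw [corolla_tot, hv', graftOp_treeOp _ (leavesF_mem s t) hy, graftOp_leavesF _ hy]

/-- Grafting is associative. -/
theorem graftOp_assoc {t b u w : List E} {n m l : ℤ} {x y z : Forests V}
    (hx : x ∈ FS V s t b n) (hy : y ∈ FS V s u t m) (hz : z ∈ FS V s w u l) :
    graftOp V s (graftOp V s (x ⊗ₜ y) ⊗ₜ z) = graftOp V s (x ⊗ₜ graftOp V s (y ⊗ₜ z)) := by
  refine FS_ext (f := graftOp V s ∘ₗ (tmk k (Forests V) _).flip z ∘ₗ graftOp V s ∘ₗ
      (tmk k (Forests V) _).flip y)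
    (g := graftOp V s ∘ₗ (tmk k (Forests V) _).flip (graftOp V s (y ⊗ₜ z)))
    (fun x h1 h2 h3 h4 => ?_) hx
  change graftOp V s (graftOp V s (x.ev ⊗ₜ y) ⊗ₜ z) =
    graftOp V s (x.ev ⊗ₜ graftOp V s (y ⊗ₜ z))
  let f : Forests V ⊗[k] Forests V →ₗ[k] Forests V := graftOp V s ∘ₗ
    rTensor _ (graftOp V s ∘ₗ tmk k (Forests V) (Forests V) x.ev)
  let g : Forests V ⊗[k] Forests V →ₗ[k] Forests V := graftOp V s ∘ₗ
    tmk k _ _ x.ev ∘ₗ graftOp V s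
  refine FS_ext₂ (f := f) (g := g) (fun y h1' h2' h3' h4' z h1'' h2'' h3'' h4'' => ?_) hy hz
  change graftOp V s (graftOp V s (x.ev ⊗ₜ y.ev) ⊗ₜ z.ev) =
    graftOp V s (x.ev ⊗ₜ graftOp V s (y.ev ⊗ₜ z.ev))
  have hyx : y.roots = x.leaves := by rw [h2, h3']
  have hzy : z.roots = y.leaves := by rw [h2', h3'']
  clear h2 h3 h4 h3' h2' h4' h2'' h3'' h4'' hx hy hz f g
  induction x generalizing y z with
  | nil =>
    obtain rfl := y.eq_nil_of_roots hyx
    obtain rfl := z.eq_nil_of_roots hzy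
    rw [DF.ev_nil, graftOp_nil, graftOp_nil]
  | leaf e f ih =>
    obtain ⟨y1, y2, rfl, hy1, hy2⟩ := y.exists_append [e] f.leaves hyx
    rw [DF.leaves_append] at hzy
    obtain ⟨z1, z2, rfl, hz1, hz2⟩ := z.exists_append _ _ hzy
    rw [DF.wf_append] at h1' h1''
    have hf := ev_mem s f h1
    have H1 := graftOp_ev_mem (s := s) f y2 h1 h1'.2 hy2
    have H2 := graftOp_ev_mem (s := s) y1 z1 h1'.1 h1''.1 hz1
    have H3 := graftOp_ev_mem (s := s) y2 z2 h1'.2 h1''.2 hz2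
    rw [graftOp_leaf e f y1 y2 hy1 hy2, graftOp_append _ _ _ _ hz1 hz2, ← smul_tmul', map_smul, ←
      catOp_ev, tmul_smul, map_smul, DF.ev_leaf, leafOp_eq_catOp, graftOp_catOp (ev_mem s y1 h1'.1)
      H1 (hz1 ▸ ev_mem s z1 h1''.1) (hz2 ▸ ev_mem s z2 h1''.2), ih h1 y2 h1'.2 z2 h1''.2 hy2 hz2,
      graftOp_catOp (leafTree_mem s e) hf (hy1 ▸ H2) (hy2 ▸ H3), smul_smul, smul_smul, ← sgn_add, ←
      sgn_add]
    have hl := graftOp_leavesF (s := s) [e] (hy1 ▸ H2)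
    rw [show leavesF V [e] = leafTree V e from rfl] at hl
    rw [hl]
    congr 1
    apply sgn_congr
    push_cast
    grind
  | node a ch f ih1 ih2 =>
    obtain ⟨y1, y2, rfl, hy1, hy2⟩ := y.exists_append _ _ hyx
    rw [DF.leaves_append] at hzy
    obtain ⟨z1, z2, rfl, hz1, hz2⟩ := z.exists_append _ _ hzy
    rw [DF.wf_append] at h1' h1''
    have hc := ev_mem s ch h1.2.1
    have hf := ev_mem s f h1.2.2
    have H0 := graftOp_ev_mem (s := s) ch y1 h1.2.1 h1'.1 hy1
    have H1 := graftOp_ev_mem (s := s) f y2 h1.2.2 h1'.2 hy2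
    have H2 := graftOp_ev_mem (s := s) y1 z1 h1'.1 h1''.1 hz1
    have H3 := graftOp_ev_mem (s := s) y2 z2 h1'.2 h1''.2 hz2
    have hz1' := hz1 ▸ ev_mem s z1 h1''.1
    have ha : treeOp V (a.tot ⊗ₜ ch.ev) ∈ FS V s ch.leaves [a.1.bot] (a.1.deg + s + ch.deg s) :=
      treeOp_mem (isIn_tot a) (h1.1 ▸ hc)
    have ha' : treeOp V (a.tot ⊗ₜ graftOp V s (ch.ev ⊗ₜ y1.ev)) ∈
        FS V s y1.leaves [a.1.bot] (a.1.deg + s + (ch.deg s + y1.deg s)) :=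
      treeOp_mem (isIn_tot a) (h1.1 ▸ H0)
    rw [graftOp_node a ch f y1 y2 hy1 hy2, graftOp_append _ _ _ _ hz1 hz2, ← smul_tmul', map_smul,
      nodeOp_eq_catOp, ← catOp_ev, tmul_smul, map_smul, DF.ev_node, nodeOp_eq_catOp, graftOp_catOp
      ha' H1 hz1' (hz2 ▸ ev_mem s z2 h1''.2), graftOp_treeOp _ H0 hz1', ih1 h1.2.1 y1 h1'.1 z1
      h1''.1 hy1 hz1, ih2 h1.2.2 y2 h1'.2 z2 h1''.2 hy2 hz2, graftOp_catOp ha hf (hy1 ▸ H2) (hy2 ▸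
      H3), graftOp_treeOp _ hc (hy1 ▸ H2), smul_smul, smul_smul, ← sgn_add, ← sgn_add]
    congr 1
    apply sgn_congr
    push_cast
    grind

end Graft

/-! ### Cutting -/

section Cut

variable {k : Type u} [Field k] {E : Type u} {V : Fam k E} {s : ℤ}

/-- Induction on the elements of `Forests V ⊗ Forests V`, starting with pairs of decorated
forests. -/
theorem forests₂_induction {P : Forests V ⊗[k] Forests V → Prop} (z : Forests V ⊗[k] Forests V)
    (ev : ∀ x y : DF V, P (x.ev ⊗ₜ y.ev)) (add : ∀ x y, P x → P y → P (x + y))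
    (smul : ∀ (c : k) x, P x → P (c • x)) : P z := by
  induction z using induction_on with
  | zero => simpa using smul 0 _ (ev DF.nil DF.nil)
  | add x y hx hy => exact add x y hx hy
  | tmul x y =>
  induction x using forests_induction with
  | add c d hc hd => rw [add_tmul]; exact add _ _ hc hd
  | smul c d hd => rw [← smul_tmul']; exact smul _ _ hd
  | ev x =>
  induction y using forests_induction with
  | add c d hc hd => rw [tmul_add]; exact add _ _ hc hd
  | smul c d hd => rw [tmul_smul]; exact smul _ _ hd
  | ev y => exact ev x y

theorem forests₂_ext {N : Type u} [AddCommGroup N] [Module k N]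
    {f g : Forests V ⊗[k] Forests V →ₗ[k] N} (h : ∀ x y : DF V, f (x.ev ⊗ₜ y.ev) = g (x.ev ⊗ₜ y.ev))
    (z : Forests V ⊗[k] Forests V) : f z = g z := by
  induction z using forests₂_induction with
  | ev x y => exact h x y
  | add x y hx hy => rw [map_add, map_add, hx, hy]
  | smul c x hx => rw [map_smul, map_smul, hx]

variable (V s) in
/-- The product of `Forests V ⊗ Forests V` with Koszul signs. -/
abbrev ks : (Forests V ⊗[k] Forests V) ⊗[k] (Forests V ⊗[k] Forests V) →ₗ[k]
    Forests V ⊗[k] Forests V := ksMul (catOp V) (oddF V s)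

theorem ks_one_left (p : Forests V ⊗[k] Forests V) : ks V s ((nilF V ⊗ₜ nilF V) ⊗ₜ p) = p := by
  refine forests₂_ext (f := ks V s ∘ₗ tmk k _ _ (nilF V ⊗ₜ nilF V))
    (g := LinearMap.id) (fun x y => ?_) p
  change ks V s (((DF.nil : DF V).ev ⊗ₜ (DF.nil : DF V).ev) ⊗ₜ (x.ev ⊗ₜ y.ev)) = x.ev ⊗ₜ y.ev
  rw [ksMul_ev]
  simp

theorem ks_one_right (p : Forests V ⊗[k] Forests V) : ks V s (p ⊗ₜ (nilF V ⊗ₜ nilF V)) = p := by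
  refine forests₂_ext (f := ks V s ∘ₗ
    (tmk k (Forests V ⊗[k] Forests V) _).flip (nilF V ⊗ₜ nilF V))
    (g := LinearMap.id) (fun x y => ?_) p
  change ks V s ((x.ev ⊗ₜ y.ev) ⊗ₜ ((DF.nil : DF V).ev ⊗ₜ (DF.nil : DF V).ev)) = x.ev ⊗ₜ y.ev
  rw [ksMul_ev]
  simp

theorem ks_assoc (p q r : Forests V ⊗[k] Forests V) :
    ks V s (ks V s (p ⊗ₜ q) ⊗ₜ r) = ks V s (p ⊗ₜ ks V s (q ⊗ₜ r)) := by
  induction p using forests₂_induction with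
  | add c d hc hd => simp only [add_tmul, map_add, hc, hd]
  | smul c d hd => simp only [← smul_tmul', map_smul, hd]
  | ev a b =>
  induction q using forests₂_induction with
  | add c d hc hd => simp only [add_tmul, tmul_add, map_add, hc, hd]
  | smul c d hd =>
    simp only [← smul_tmul', tmul_smul, map_smul, hd]
  | ev a' b' =>
  induction r using forests₂_induction with
  | add c d hc hd => simp only [tmul_add, map_add, hc, hd]
  | smul c d hd => simp only [tmul_smul, map_smul, hd]
  | ev a'' b'' =>
  rw [ksMul_ev, ksMul_ev, ← smul_tmul', map_smul, ksMul_ev, tmul_smul, map_smul, ksMul_ev,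
    smul_smul, smul_smul, ← sgn_add, ← sgn_add, DF.append_assoc, DF.append_assoc]
  congr 1
  apply sgn_congr
  simp only [DF.deg_append]
  push_cast
  grind

variable (V s) in
/-- The sum over the cuts of a forest. -/
abbrev cutOp : Forests V →ₗ[k] Forests V ⊗[k] Forests V := elimF (cut V s)

theorem cutOp_nil : cutOp V s (nilF V) = nilF V ⊗ₜ nilF V := by
  refine (elimF_ofF (cut V s) PForest.nil _).trans ?_
  exact one_smul k (nilF V ⊗ₜ[k] nilF V)

theorem cutOp_leafOp (e : E) (x : Forests V) :
    cutOp V s (leafOp V e x) = tmap (leafOp V e) (leafOp V e) (cutOp V s x) := by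
  refine forests_ext (f := cutOp V s ∘ₗ leafOp V e)
    (g := tmap (leafOp V e) (leafOp V e) ∘ₗ cutOp V s) (fun x => ?_) x
  rw [lcomp_apply, ← DF.ev_leaf, cutOp, elimF_ev, lcomp_apply, elimF_ev]
  rfl

variable (V) in
/-- The map `x ↦` the tree with root vertex `v` and `x` above it. -/
abbrev treeMap (v : Tot V) : Forests V →ₗ[k] Forests V :=
  treeOp V ∘ₗ tmk k (Tot V) (Forests V) v

theorem treeMap_apply (v : Tot V) (x : Forests V) : treeMap V v x = treeOp V (v ⊗ₜ x) := rfl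

theorem cutOp_node_aux (a : HEl V) (x y : DF V) :
    cutOp V s (DF.node a x y).ev = ks V s ((leafTree V a.1.bot ⊗ₜ treeMap V a.tot x.ev +
      rTensor _ (treeMap V a.tot) (cutOp V s x.ev)) ⊗ₜ cutOp V s y.ev) := by
  have h : ∀ z : Forests V ⊗[k] Forests V, rTensor _ (treeMap V a.tot) z =
      rTensor _ (treeOp V) ((tassoc k _ _ _).symm (a.tot ⊗ₜ z)) := by
    intro z
    induction z using forests₂_induction with
    | ev x y => simp
    | add x y hx hy => simp only [map_add, tmul_add, hx, hy]
    | smul c x hx => simp only [map_smul, tmul_smul, hx]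
  rw [h, cutOp, elimF_ev, elimF_ev, elimF_ev]
  rfl

theorem cutOp_tree_ev (a : HEl V) (x : DF V) :
    cutOp V s (treeOp V (a.tot ⊗ₜ x.ev)) = leafTree V a.1.bot ⊗ₜ treeOp V (a.tot ⊗ₜ x.ev) +
      rTensor _ (treeMap V a.tot) (cutOp V s x.ev) := by
  rw [treeOp_ev, cutOp_node_aux, DF.ev_nil, cutOp_nil, ks_one_right, ← treeOp_ev]
  rfl

/-- The cuts of a tree: below the root vertex, or above it. -/
theorem cutOp_tree (a : HEl V) (x : Forests V) :
    cutOp V s (treeOp V (a.tot ⊗ₜ x)) = leafTree V a.1.bot ⊗ₜ treeOp V (a.tot ⊗ₜ x) +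
      rTensor _ (treeMap V a.tot) (cutOp V s x) :=
  forests_ext (f := cutOp V s ∘ₗ treeMap V a.tot)
    (g := tmk k _ _ (leafTree V a.1.bot) ∘ₗ treeMap V a.tot +
      rTensor _ (treeMap V a.tot) ∘ₗ cutOp V s) (fun x => cutOp_tree_ev a x) x

theorem cutOp_node (a : HEl V) (x y : DF V) :
    cutOp V s (DF.node a x y).ev =
      ks V s (cutOp V s (treeOp V (a.tot ⊗ₜ x.ev)) ⊗ₜ cutOp V s y.ev) := by
  rw [cutOp_tree_ev, cutOp_node_aux]
  rfl

theorem cutOp_leafTree (e : E) : cutOp V s (leafTree V e) = leafTree V e ⊗ₜ leafTree V e := by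
  rw [leafTree, cutOp_leafOp, cutOp_nil]
  rfl

theorem cutOp_leaf (e : E) (x : Forests V) :
    cutOp V s (leafOp V e x) = ks V s ((leafTree V e ⊗ₜ leafTree V e) ⊗ₜ cutOp V s x) := by
  rw [cutOp_leafOp]
  refine forests₂_ext (f := tmap (leafOp V e) (leafOp V e))
    (g := ks V s ∘ₗ tmk k _ _ (leafTree V e ⊗ₜ leafTree V e)) (fun x y => ?_) _
  change leafOp V e x.ev ⊗ₜ leafOp V e y.ev =
    ks V s ((leafTree V e ⊗ₜ leafTree V e) ⊗ₜ (x.ev ⊗ₜ y.ev))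
  rw [leafTree_eq_ev, ksMul_ev]
  simp

theorem cutOp_catOp (x y : Forests V) :
    cutOp V s (catOp V (x ⊗ₜ y)) = ks V s (cutOp V s x ⊗ₜ cutOp V s y) := by
  induction x using forests_induction with
  | add c d hc hd => simp only [map_add, add_tmul, hc, hd]
  | smul c d hd => simp only [map_smul, ← smul_tmul', hd]
  | ev x =>
  induction y using forests_induction with
  | add c d hc hd => simp only [map_add, tmul_add, hc, hd]
  | smul c d hd => simp only [map_smul, tmul_smul, hd]
  | ev y =>
  induction x with
  | nil => rw [DF.ev_nil, catOp_nil, cutOp_nil, ks_one_left]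
  | leaf e f ih => rw [DF.ev_leaf, catOp_leafOp, cutOp_leaf, ih, cutOp_leaf, ks_assoc]
  | node a ch f _ ih =>
    rw [cutOp_node, ks_assoc, ← ih, catOp_ev, catOp_ev, DF.node_append, cutOp_node]

/-- The span of the pairs of forests that may occur in the cuts of `x`. -/
def cutSpan (x : DF V) : Submodule k (Forests V ⊗[k] Forests V) :=
  Submodule.span k {z | ∃ y y' : DF V, (∀ j, y.deg j + y'.deg j = x.deg j) ∧ y.roots = x.roots ∧
    (x.WF → y.WF ∧ y'.WF ∧ y.leaves = y'.roots ∧ y'.leaves = x.leaves) ∧ z = y.ev ⊗ₜ y'.ev}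

theorem ks_mem_cutSpan {x x' z : DF V} {p q : Forests V ⊗[k] Forests V} (hp : p ∈ cutSpan x)
    (hq : q ∈ cutSpan x') (hd : ∀ j, z.deg j = x.deg j + x'.deg j)
    (hr : z.roots = x.roots ++ x'.roots)
    (hw : z.WF → x.WF ∧ x'.WF ∧ z.leaves = x.leaves ++ x'.leaves) :
    ks V s (p ⊗ₜ q) ∈ cutSpan z := by
  refine Submodule.span_induction (p := fun p _ => ks V s (p ⊗ₜ q) ∈ cutSpan z)
    ?_ (by simp) (fun a b _ _ ha hb => by
      rw [add_tmul, map_add]; exact Submodule.add_mem _ ha hb)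
    (fun c a _ ha => by
      rw [← smul_tmul', map_smul]; exact Submodule.smul_mem _ _ ha) hp
  rintro _ ⟨y, y', h1, h2, h3, rfl⟩
  refine Submodule.span_induction (p := fun q _ => ks V s ((y.ev ⊗ₜ y'.ev) ⊗ₜ q) ∈ cutSpan z)
    ?_ (by simp) (fun a b _ _ ha hb => by
      rw [tmul_add, map_add]; exact Submodule.add_mem _ ha hb)
    (fun c a _ ha => by
      rw [tmul_smul, map_smul]; exact Submodule.smul_mem _ _ ha) hq
  rintro _ ⟨w, w', h1', h2', h3', rfl⟩
  rw [ksMul_ev]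
  refine Submodule.smul_mem _ _ (subset_span ⟨_, _, ?_, ?_, fun h => ?_, rfl⟩)
  · intro j; simp only [DF.deg_append, hd, ← h1, ← h1']; ring
  · simp [hr, h2, h2']
  · obtain ⟨ha, hb, hc⟩ := hw h
    obtain ⟨a1, a2, a3, a4⟩ := h3 ha
    obtain ⟨b1, b2, b3, b4⟩ := h3' hb
    simp [*]

theorem cutOp_ev_mem (x : DF V) : cutOp V s x.ev ∈ cutSpan x := by
  induction x with
  | nil =>
    rw [DF.ev_nil, cutOp_nil]
    exact subset_span ⟨DF.nil, DF.nil, by simp, rfl, by simp, rfl⟩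
  | leaf e f ih =>
    rw [DF.ev_leaf, cutOp_leaf]
    refine ks_mem_cutSpan (x := DF.leaf e DF.nil) ?_ ih (by simp) (by simp) (by simp)
    exact subset_span ⟨DF.leaf e DF.nil, DF.leaf e DF.nil, by simp, rfl, by simp,
      by rw [leafTree_eq_ev]⟩
  | node a ch f ih1 ih2 =>
    rw [cutOp_node]
    refine ks_mem_cutSpan (x := DF.node a ch DF.nil) ?_ ih2 (by simp [add_assoc]) (by simp)
      (fun h => ⟨⟨h.1, h.2.1, trivial⟩, h.2.2, by simp⟩)
    rw [cutOp_tree_ev]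
    refine Submodule.add_mem _ ?_ ?_
    · exact subset_span ⟨DF.leaf a.1.bot DF.nil, DF.node a ch DF.nil, by simp, rfl,
        fun h => by simp_all, by rw [leafTree_eq_ev, treeOp_ev]⟩
    · change _ ∈ (cutSpan (DF.node a ch DF.nil)).comap (rTensor _ (treeMap V a.tot))
      refine Submodule.span_le.2 ?_ ih1
      rintro _ ⟨y, y', h1, h2, h3, rfl⟩
      refine subset_span ⟨DF.node a y DF.nil, y', ?_, by simp, fun h => ?_, ?_⟩
      · intro j; simp only [DF.deg_node, DF.deg_nil, ← h1]; ring
      · obtain ⟨g1, g2, g3, g4⟩ := h3 h.2.1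
        have := h.1
        change ch.roots = a.1.top at this
        simp [*]
      · rw [rTensor_tmul, treeMap_apply, treeOp_ev]

/-- Extension of a linear identity from decorated forests to the cuts of `x`. -/
theorem cutSpan_ext {N : Type u} [AddCommGroup N] [Module k N]
    {f g : Forests V ⊗[k] Forests V →ₗ[k] N} {x : DF V}
    (h : ∀ y y' : DF V, (∀ j, y.deg j + y'.deg j = x.deg j) → y.roots = x.roots →
      (x.WF → y.WF ∧ y'.WF ∧ y.leaves = y'.roots ∧ y'.leaves = x.leaves) →
      f (y.ev ⊗ₜ y'.ev) = g (y.ev ⊗ₜ y'.ev)) {z : Forests V ⊗[k] Forests V}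
    (hz : z ∈ cutSpan x) : f z = g z := by
  refine span_ext ?_ hz
  rintro _ ⟨y, y', h1, h2, h3, rfl⟩
  exact h y y' h1 h2 h3

/-! ### Coassociativity of cutting -/

/-- The product `(a ⊗ b)(c ⊗ d) = (-1)^{|b||c|} ac ⊗ bd` on `M ⊗ N`, where the projections to the
odd parts are given. -/
def ksMul₂ {M N : Type u} [AddCommGroup M] [Module k M] [AddCommGroup N] [Module k N]
    (m : M ⊗[k] M →ₗ[k] M) (o : M →ₗ[k] M) (m' : N ⊗[k] N →ₗ[k] N) (o' : N →ₗ[k] N) :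
    (M ⊗[k] N) ⊗[k] (M ⊗[k] N) →ₗ[k] M ⊗[k] N :=
  tmap m m' ∘ₗ (TensorProduct.tensorTensorTensorComm k M N M N).toLinearMap ∘ₗ
    (LinearMap.id - (2 : k) • tmap (tmap LinearMap.id o')
      (tmap o LinearMap.id))

theorem ksMul₂_tmul {M N : Type u} [AddCommGroup M] [Module k M] [AddCommGroup N] [Module k N]
    (m : M ⊗[k] M →ₗ[k] M) (o : M →ₗ[k] M) (m' : N ⊗[k] N →ₗ[k] N) (o' : N →ₗ[k] N)
    (a c : M) (b d : N) (i j : ℤ)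
    (hb : o' b = if Odd i then b else 0) (hc : o c = if Odd j then c else 0) :
    ksMul₂ m o m' o' ((a ⊗ₜ b) ⊗ₜ (c ⊗ₜ d)) = sgn k (i * j) • (m (a ⊗ₜ c) ⊗ₜ[k] m' (b ⊗ₜ d)) := by
  simp only [ksMul₂, lcomp_apply, LinearMap.sub_apply, lsmul_apply, map_tmul, LinearMap.id_apply,
    map_sub, map_smul, hb, hc, LinearEquiv.coe_coe, TensorProduct.tensorTensorTensorComm_tmul]
  rcases Int.even_or_odd i with hi | hi
  · rw [sgn_even (hi.mul_right j), if_neg (Int.not_odd_iff_even.2 hi)]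
    simp
  · rcases Int.even_or_odd j with hj | hj
    · rw [sgn_even (hj.mul_left i), if_neg (Int.not_odd_iff_even.2 hj)]
      simp
    · rw [sgn_odd (hi.mul hj), if_pos hi, if_pos hj, neg_one_smul, two_smul]
      abel

variable (V s) in
/-- The projection of `Forests V ⊗ Forests V` to its odd part. -/
def oddF₂ : Forests V ⊗[k] Forests V →ₗ[k] Forests V ⊗[k] Forests V :=
  lTensor _ (oddF V s) + rTensor _ (oddF V s) -
    (2 : k) • tmap (oddF V s) (oddF V s)

theorem oddF₂_ev (x y : DF V) : oddF₂ V s (x.ev ⊗ₜ y.ev) =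
    if Odd (x.deg s + y.deg s) then x.ev ⊗ₜ y.ev else 0 := by
  simp only [oddF₂, ladd_apply, LinearMap.sub_apply, lsmul_apply, lTensor_tmul, rTensor_tmul,
    map_tmul, oddF_ev]
  rcases Int.even_or_odd (x.deg s) with h1 | h1 <;> rcases Int.even_or_odd (y.deg s) with h2 | h2
  · simp [Int.not_odd_iff_even.2 h1, Int.not_odd_iff_even.2 h2,
        Int.not_odd_iff_even.2 (h1.add h2)]
  · simp [Int.not_odd_iff_even.2 h1, h2, h1.add_odd h2]
  · simp [h1, Int.not_odd_iff_even.2 h2, h1.add_even h2]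
  · simp [h1, h2, Int.not_odd_iff_even.2 (h1.add_odd h2), two_smul]

theorem oddF₂_cut (x : DF V) : oddF₂ V s (cutOp V s x.ev) =
    if Odd (x.deg s) then cutOp V s x.ev else 0 := by
  refine (cutSpan_ext (f := oddF₂ V s) (g := if Odd (x.deg s) then LinearMap.id else 0)
    (fun y y' h _ _ => ?_) (cutOp_ev_mem x)).trans ?_
  · rw [oddF₂_ev, h]
    split_ifs <;> rfl
  · split_ifs <;> rfl

variable (V s) in
/-- The product on triples of forests with Koszul signs. -/
abbrev ks₃ : (Forests V ⊗[k] (Forests V ⊗[k] Forests V)) ⊗[k]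
    (Forests V ⊗[k] (Forests V ⊗[k] Forests V)) →ₗ[k] Forests V ⊗[k] (Forests V ⊗[k] Forests V) :=
  ksMul₂ (catOp V) (oddF V s) (ks V s) (oddF₂ V s)

theorem lTensor_cut_ks (p q : Forests V ⊗[k] Forests V) :
    lTensor _ (cutOp V s) (ks V s (p ⊗ₜ q)) =
      ks₃ V s (lTensor _ (cutOp V s) p ⊗ₜ lTensor _ (cutOp V s) q) := by
  induction p using forests₂_induction with
  | add c d hc hd => simp only [add_tmul, map_add, hc, hd]
  | smul c d hd => simp only [← smul_tmul', map_smul, hd]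
  | ev a b =>
  induction q using forests₂_induction with
  | add c d hc hd => simp only [tmul_add, map_add, hc, hd]
  | smul c d hd => simp only [tmul_smul, map_smul, hd]
  | ev a' b' =>
  rw [lTensor_tmul, lTensor_tmul, ksMul₂_tmul _ _ _ _ _ _ _ _ _ _ (oddF₂_cut b) (oddF_ev s a'),
    ksMul_ev, map_smul, lTensor_tmul, ← catOp_ev, ← catOp_ev, cutOp_catOp]

theorem rTensor_cut_ks (p q : Forests V ⊗[k] Forests V) :
    tassoc k _ _ _ (rTensor _ (cutOp V s) (ks V s (p ⊗ₜ q))) =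
      ks₃ V s (tassoc k _ _ _ (rTensor _ (cutOp V s) p) ⊗ₜ
        tassoc k _ _ _ (rTensor _ (cutOp V s) q)) := by
  induction p using forests₂_induction with
  | add c d hc hd => simp only [add_tmul, map_add, hc, hd]
  | smul c d hd => simp only [← smul_tmul', map_smul, hd]
  | ev x x' =>
  induction q using forests₂_induction with
  | add c d hc hd => simp only [tmul_add, map_add, hc, hd]
  | smul c d hd => simp only [tmul_smul, map_smul, hd]
  | ev y y' =>
  rw [ksMul_ev, map_smul, map_smul, rTensor_tmul, rTensor_tmul, rTensor_tmul, ← catOp_ev, ←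
    catOp_ev, cutOp_catOp]
  let F := Forests V
  let A : F ⊗[k] F → F ⊗[k] F →ₗ[k] F ⊗[k] (F ⊗[k] F) := fun p =>
    sgn k (x'.deg s * y.deg s) • ((tassoc k F F F).toLinearMap ∘ₗ
      (tmk k (F ⊗[k] F) F).flip (catOp V (x'.ev ⊗ₜ y'.ev)) ∘ₗ ks V s ∘ₗ
      tmk k (F ⊗[k] F) (F ⊗[k] F) p)
  let B : F ⊗[k] F → F ⊗[k] F →ₗ[k] F ⊗[k] (F ⊗[k] F) := fun p =>
    ks₃ V s ∘ₗ tmk k (F ⊗[k] (F ⊗[k] F)) (F ⊗[k] (F ⊗[k] F))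
      (tassoc k F F F (p ⊗ₜ x'.ev)) ∘ₗ (tassoc k F F F).toLinearMap ∘ₗ
      (tmk k (F ⊗[k] F) F).flip y'.ev
  change A (cutOp V s x.ev) (cutOp V s y.ev) = B (cutOp V s x.ev) (cutOp V s y.ev)
  refine cutSpan_ext (fun z z' h _ _ => ?_) (cutOp_ev_mem y)
  change sgn k (x'.deg s * y.deg s) • tassoc k F F F
      (ks V s (cutOp V s x.ev ⊗ₜ (z.ev ⊗ₜ z'.ev)) ⊗ₜ (catOp V (x'.ev ⊗ₜ y'.ev))) =
    ks₃ V s (tassoc k F F F (cutOp V s x.ev ⊗ₜ x'.ev) ⊗ₜ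
      (z.ev ⊗ₜ (z'.ev ⊗ₜ y'.ev)))
  generalize cutOp V s x.ev = p
  induction p using forests₂_induction with
  | add c d hc hd => simp only [add_tmul, map_add, smul_add, hc, hd]
  | smul c d hd =>
    simp only [← smul_tmul', map_smul, ← hd]
    rw [smul_comm]
  | ev w w' =>
  change sgn k (x'.deg s * y.deg s) • tassoc k F F F
      (ks V s ((w.ev ⊗ₜ w'.ev) ⊗ₜ (z.ev ⊗ₜ z'.ev)) ⊗ₜ (catOp V (x'.ev ⊗ₜ y'.ev))) =
    ks₃ V s ((w.ev ⊗ₜ (w'.ev ⊗ₜ x'.ev)) ⊗ₜ (z.ev ⊗ₜ (z'.ev ⊗ₜ y'.ev)))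
  rw [ksMul₂_tmul _ _ _ _ _ _ _ _ _ _ (oddF₂_ev w' x') (oddF_ev s z), ksMul_ev, ksMul_ev, ←
    smul_tmul', map_smul, assoc_tmul, catOp_ev, catOp_ev, tmul_smul, smul_smul, smul_smul, ←
    sgn_add, ← sgn_add, ← h]
  refine congrArg (· • _) ?_
  apply sgn_congr
  push_cast
  grind

theorem assoc_rTensor {M M' N P : Type u} [AddCommGroup M] [Module k M] [AddCommGroup M']
    [Module k M'] [AddCommGroup N] [Module k N] [AddCommGroup P] [Module k P] (f : M →ₗ[k] M')
    (w : M ⊗[k] N) (y : P) : tassoc k M' N P (rTensor N f w ⊗ₜ y) =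
      rTensor (N ⊗[k] P) f (tassoc k M N P (w ⊗ₜ y)) := by
  induction w using induction_on with
  | zero => simp
  | add x y hx hy => simp only [map_add, hx, hy, add_tmul]
  | tmul x y => simp

theorem lTensor_rTensor_comm {M M' N N' : Type u} [AddCommGroup M] [Module k M] [AddCommGroup M']
    [Module k M'] [AddCommGroup N] [Module k N] [AddCommGroup N'] [Module k N'] (f : M →ₗ[k] M')
    (g : N →ₗ[k] N') (w : M ⊗[k] N) :
    lTensor M' g (rTensor N f w) =
      rTensor N' f (lTensor M g w) := by
  rw [← lcomp_apply, ← lcomp_apply, LinearMap.lTensor_comp_rTensor, LinearMap.rTensor_comp_lTensor]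

/-- If `Δ(τ x) = l ⊗ τ x + (τ ⊗ 1) Δ x`, then `(Δ ⊗ 1)(τ ⊗ 1)` is given by a similar formula. -/
theorem assoc_rTensor_comp {M : Type u} [AddCommGroup M] [Module k M] (Δ : M →ₗ[k] M ⊗[k] M)
    (τ : M →ₗ[k] M) (l : M) (h : ∀ x, Δ (τ x) = l ⊗ₜ τ x + rTensor M τ (Δ x))
    (z : M ⊗[k] M) :
    tassoc k M M M (rTensor M Δ (rTensor M τ z)) =
      l ⊗ₜ rTensor M τ z +
        rTensor _ τ (tassoc k M M M (rTensor M Δ z)) := by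
  induction z using induction_on with
  | zero => simp
  | add x y hx hy =>
    simp only [map_add, hx, hy, tmul_add]
    abel
  | tmul x y =>
    rw [rTensor_tmul, rTensor_tmul, rTensor_tmul, h, add_tmul, map_add, assoc_rTensor, assoc_tmul]

theorem coassoc_of_recursion {M : Type u} [AddCommGroup M] [Module k M] (Δ : M →ₗ[k] M ⊗[k] M)
    (τ : M →ₗ[k] M) (l : M) (h : ∀ x, Δ (τ x) = l ⊗ₜ τ x + rTensor M τ (Δ x))
    (hl : Δ l = l ⊗ₜ l) (x : M) (hx : tassoc k M M M (rTensor M Δ (Δ x)) =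
      lTensor M Δ (Δ x)) :
    tassoc k M M M (rTensor M Δ (Δ (τ x))) =
      lTensor M Δ (Δ (τ x)) := by
  have h1 := assoc_rTensor_comp Δ τ l h (Δ x)
  have h2 := lTensor_rTensor_comm τ Δ (Δ x)
  rw [h, map_add, map_add, map_add, h1, h2, hx, rTensor_tmul, lTensor_tmul, hl, h, assoc_tmul,
    tmul_add, add_assoc]

/-- Cutting a forest into three layers does not depend on which of the two cuts comes first. -/
theorem cutOp_coassoc (x : Forests V) :
    tassoc k _ _ _ (rTensor _ (cutOp V s) (cutOp V s x)) =
      lTensor _ (cutOp V s) (cutOp V s x) := by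
  refine forests_ext (f := (tassoc k _ _ _).toLinearMap ∘ₗ
    rTensor _ (cutOp V s) ∘ₗ cutOp V s)
    (g := lTensor _ (cutOp V s) ∘ₗ cutOp V s) (fun x => ?_) x
  change tassoc k _ _ _ (rTensor _ (cutOp V s) (cutOp V s x.ev)) =
      lTensor _ (cutOp V s) (cutOp V s x.ev)
  induction x with
  | nil => simp only [DF.ev_nil, cutOp_nil, rTensor_tmul, lTensor_tmul, assoc_tmul]
  | leaf e f ih =>
    rw [DF.ev_leaf, cutOp_leaf, lTensor_cut_ks, rTensor_cut_ks, ih]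
    simp only [rTensor_tmul, lTensor_tmul, cutOp_leafTree, assoc_tmul]
  | node a ch f ih1 ih2 =>
    rw [cutOp_node, lTensor_cut_ks, rTensor_cut_ks, ih2]
    refine congrArg (fun z => ks₃ V s (z ⊗ₜ _)) ?_
    have hh : ∀ x, cutOp V s (treeMap V a.tot x) = leafTree V a.1.bot ⊗ₜ treeMap V a.tot x +
        rTensor _ (treeMap V a.tot) (cutOp V s x) := fun x => by
      rw [treeMap_apply]; exact cutOp_tree (s := s) a x
    exact coassoc_of_recursion _ _ _ hh (cutOp_leafTree _) ch.ev ih1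

/-! ### Counits for cutting -/

variable (V) in
/-- The sum of the coefficients of the forests without vertices. -/
abbrev leavesCoeffF : Forests V →ₗ[k] k := elimF (leavesCoeff V)

theorem leavesCoeffF_nil : leavesCoeffF V (nilF V) = 1 :=
  (elimF_ofF (leavesCoeff V) PForest.nil _).trans rfl

theorem leavesCoeffF_leafOp (e : E) (x : Forests V) :
    leavesCoeffF V (leafOp V e x) = leavesCoeffF V x := by
  refine forests_ext (f := leavesCoeffF V ∘ₗ leafOp V e) (g := leavesCoeffF V) (fun x => ?_) x
  rw [lcomp_apply, ← DF.ev_leaf, leavesCoeffF, elimF_ev, elimF_ev]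
  rfl

theorem leavesCoeffF_node (a : HEl V) (x y : DF V) :
    leavesCoeffF V (DF.node a x y).ev = 0 := by
  rw [leavesCoeffF, elimF_ev]
  rfl

theorem leavesCoeffF_append (x y : DF V) :
    leavesCoeffF V (x.append y).ev = leavesCoeffF V x.ev * leavesCoeffF V y.ev := by
  induction x with
  | nil => rw [DF.ev_nil, leavesCoeffF_nil, one_mul]; rfl
  | leaf e f ih => rw [DF.leaf_append, DF.ev_leaf, leavesCoeffF_leafOp, ih, DF.ev_leaf,
      leavesCoeffF_leafOp]
  | node a ch f => rw [DF.node_append, leavesCoeffF_node, leavesCoeffF_node, zero_mul]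

theorem leavesCoeffF_eq_zero (x : DF V) (h : x.deg s ≠ 0) : leavesCoeffF V x.ev = 0 := by
  induction x with
  | nil => exact absurd rfl h
  | leaf e f ih => rw [DF.ev_leaf, leavesCoeffF_leafOp, ih h]
  | node a ch f => rw [leavesCoeffF_node]

theorem leavesCoeffF_tree (v : Tot V) (x : Forests V) :
    leavesCoeffF V (treeOp V (v ⊗ₜ x)) = 0 := by
  rw [treeOp_tmul]
  refine node_ext (f := leavesCoeffF V ∘ₗ nodeOp V) (g := 0) (fun a x y => ?_) (v ⊗ₜ (x ⊗ₜ nilF V))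
  rw [lcomp_apply, ← DF.ev_node, leavesCoeffF_node]
  rfl

theorem leavesCoeff_ks_left (p q : Forests V ⊗[k] Forests V) :
    TensorProduct.lid k _ (rTensor _ (leavesCoeffF V) (ks V s (p ⊗ₜ q))) =
      catOp V (TensorProduct.lid k _ (rTensor _ (leavesCoeffF V) p) ⊗ₜ
        TensorProduct.lid k _ (rTensor _ (leavesCoeffF V) q)) := by
  induction p using forests₂_induction with
  | add c d hc hd => simp only [add_tmul, map_add, hc, hd]
  | smul c d hd => simp only [← smul_tmul', map_smul, hd]
  | ev x x' =>
  induction q using forests₂_induction with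
  | add c d hc hd => simp only [tmul_add, map_add, hc, hd]
  | smul c d hd => simp only [tmul_smul, map_smul, hd]
  | ev y y' =>
  rw [ksMul_ev, map_smul, map_smul, rTensor_tmul, rTensor_tmul, rTensor_tmul, lid_tmul, lid_tmul,
    lid_tmul, leavesCoeffF_append, ← smul_tmul', tmul_smul, map_smul, map_smul, catOp_ev, smul_smul,
    smul_smul]
  by_cases h : y.deg s = 0
  · simp [h]
  · simp [leavesCoeffF_eq_zero y h]

theorem leavesCoeff_ks_right (p q : Forests V ⊗[k] Forests V) :
    TensorProduct.rid k _ (lTensor _ (leavesCoeffF V) (ks V s (p ⊗ₜ q))) =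
      catOp V (TensorProduct.rid k _ (lTensor _ (leavesCoeffF V) p) ⊗ₜ
        TensorProduct.rid k _ (lTensor _ (leavesCoeffF V) q)) := by
  induction p using forests₂_induction with
  | add c d hc hd => simp only [add_tmul, map_add, hc, hd]
  | smul c d hd => simp only [← smul_tmul', map_smul, hd]
  | ev x x' =>
  induction q using forests₂_induction with
  | add c d hc hd => simp only [tmul_add, map_add, hc, hd]
  | smul c d hd => simp only [tmul_smul, map_smul, hd]
  | ev y y' =>
  rw [ksMul_ev, map_smul, map_smul, lTensor_tmul, lTensor_tmul, lTensor_tmul, rid_tmul, rid_tmul,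
    rid_tmul, leavesCoeffF_append, ← smul_tmul', tmul_smul, map_smul, map_smul, catOp_ev, smul_smul,
    smul_smul]
  by_cases h : x'.deg s = 0
  · simp [h]
  · simp [leavesCoeffF_eq_zero x' h]

theorem leavesCoeff_cut_left (x : Forests V) :
    TensorProduct.lid k _ (rTensor _ (leavesCoeffF V) (cutOp V s x)) = x := by
  refine forests_ext (f := (TensorProduct.lid k _).toLinearMap ∘ₗ
    rTensor _ (leavesCoeffF V) ∘ₗ cutOp V s) (g := LinearMap.id) (fun x => ?_) x
  change TensorProduct.lid k _ (rTensor _ (leavesCoeffF V) (cutOp V s x.ev)) = x.ev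
  induction x with
  | nil => simp [cutOp_nil, leavesCoeffF_nil]
  | leaf e f ih =>
    rw [DF.ev_leaf, cutOp_leaf, leavesCoeff_ks_left, ih, rTensor_tmul, leafTree,
      leavesCoeffF_leafOp, leavesCoeffF_nil, lid_tmul, one_smul, ← leafTree, ← leafOp_eq_catOp]
  | node a ch f _ ih =>
    have h : ∀ z : Forests V ⊗[k] Forests V, TensorProduct.lid k _
        (rTensor _ (leavesCoeffF V) (rTensor _ (treeMap V a.tot) z)) = 0 := by
      intro z
      induction z using induction_on with
      | zero => simp
      | add x y hx hy => simp only [map_add, hx, hy, add_zero]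
      | tmul x y => rw [rTensor_tmul, rTensor_tmul, treeMap_apply, leavesCoeffF_tree]; simp
    rw [cutOp_node, leavesCoeff_ks_left, ih, cutOp_tree, map_add, map_add, h, rTensor_tmul,
      leafTree, leavesCoeffF_leafOp, leavesCoeffF_nil, lid_tmul, one_smul, add_zero, DF.ev_node,
      nodeOp_eq_catOp]

theorem leavesCoeff_cut_right (x : Forests V) :
    TensorProduct.rid k _ (lTensor _ (leavesCoeffF V) (cutOp V s x)) = x := by
  refine forests_ext (f := (TensorProduct.rid k _).toLinearMap ∘ₗ
    lTensor _ (leavesCoeffF V) ∘ₗ cutOp V s) (g := LinearMap.id) (fun x => ?_) x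
  change TensorProduct.rid k _ (lTensor _ (leavesCoeffF V) (cutOp V s x.ev)) = x.ev
  induction x with
  | nil => simp [cutOp_nil, leavesCoeffF_nil]
  | leaf e f ih =>
    rw [DF.ev_leaf, cutOp_leaf, leavesCoeff_ks_right, ih, lTensor_tmul,
      show leavesCoeffF V (leafTree V e) = 1 by rw [leafTree, leavesCoeffF_leafOp,
      leavesCoeffF_nil], rid_tmul, one_smul, ← leafOp_eq_catOp]
  | node a ch f ih1 ih =>
    have h : ∀ z : Forests V ⊗[k] Forests V, TensorProduct.rid k _
        (lTensor _ (leavesCoeffF V) (rTensor _ (treeMap V a.tot) z)) =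
        treeMap V a.tot (TensorProduct.rid k _ (lTensor _ (leavesCoeffF V) z)) := by
      intro z
      induction z using induction_on with
      | zero => simp
      | add x y hx hy => simp only [map_add, hx, hy]
      | tmul x y => simp
    rw [cutOp_node, leavesCoeff_ks_right, ih, cutOp_tree, map_add, map_add, h, ih1, lTensor_tmul,
      leavesCoeffF_tree, rid_tmul, zero_smul, zero_add, DF.ev_node, nodeOp_eq_catOp]
    rfl

theorem cogen_tree_ev (a : HEl V) (x : DF V) :
    cogen V (treeOp V (a.tot ⊗ₜ x.ev)) = leavesCoeffF V x.ev • a.tot := by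
  rw [treeOp_ev, cogen, elimF_ev, elimF_ev]
  change of V a.1 (TensorProduct.rid k (V a.1) (lTensor (V a.1)
    ((TensorProduct.rid k k).toLinearMap ∘ₗ rTensor k (leavesCoeff V x.shape))
    (a.2 ⊗ₜ (x.val ⊗ₜ (1 : k))))) = _
  rw [lTensor_tmul, lcomp_apply, rTensor_tmul, rid_tmul]
  simp

theorem cogen_tree (v : Tot V) (x : Forests V) :
    cogen V (treeOp V (v ⊗ₜ x)) = leavesCoeffF V x • v := by
  induction v using tot_induction with
  | zero => simp
  | add a b ha hb => rw [add_tmul, map_add, map_add, ha, hb, smul_add]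
  | tot a =>
    exact forests_ext (f := cogen V ∘ₗ treeMap V a.tot)
      (g := LinearMap.smulRight (leavesCoeffF V) a.tot) (fun x => cogen_tree_ev a x) x

theorem cogen_leafTree (e : E) : cogen V (leafTree V e) = 0 := by
  rw [leafTree_eq_ev, cogen, elimF_ev]
  rfl

/-- Cutting above the root vertex recovers the vertex and the forest above it. -/
theorem cogen_cut_tree (v : Tot V) (x : Forests V) :
    rTensor _ (cogen V) (cutOp V s (treeOp V (v ⊗ₜ x))) = v ⊗ₜ x := by
  induction v using tot_induction with
  | zero => simp
  | add a b ha hb => simp only [add_tmul, map_add, ha, hb]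
  | tot a =>
  have h : ∀ z : Forests V ⊗[k] Forests V, rTensor _ (cogen V)
      (rTensor _ (treeMap V a.tot) z) =
      a.tot ⊗ₜ TensorProduct.lid k _ (rTensor _ (leavesCoeffF V) z) := by
    intro z
    induction z using induction_on with
    | zero => simp
    | add x y hx hy => simp only [map_add, hx, hy, tmul_add]
    | tmul x y => rw [rTensor_tmul, rTensor_tmul, treeMap_apply, cogen_tree, rTensor_tmul, lid_tmul,
        TensorProduct.smul_tmul]
  rw [cutOp_tree, map_add, rTensor_tmul, cogen_leafTree, h, leavesCoeff_cut_left]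
  simp

theorem cogen_cut_leafTree (e : E) :
    rTensor _ (cogen V) (cutOp V s (leafTree V e)) = 0 := by
  rw [cutOp_leafTree, rTensor_tmul, cogen_leafTree, zero_tmul]

theorem leafCoeff_leafTree (e : E) : leafCoeff V (leafTree V e) = 1 := by
  rw [leafTree_eq_ev, leafCoeff, elimF_ev]
  rfl

theorem leafCoeff_tree (v : Tot V) (x : Forests V) : leafCoeff V (treeOp V (v ⊗ₜ x)) = 0 := by
  rw [treeOp_tmul]
  refine node_ext (f := leafCoeff V ∘ₗ nodeOp V) (g := 0) (fun a x y => ?_) (v ⊗ₜ (x ⊗ₜ nilF V))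
  rw [lcomp_apply, ← DF.ev_node, leafCoeff, elimF_ev]
  rfl

end Cut

/-! ### Composition of words with words -/

section PairRel

variable {k : Type u} [Field k] {I : Type w}

/-- The laws of an algebra for `⊙` with a derivation `d` that is not assumed to satisfy
`d ∘ d = 0`. -/
structure PreCat (A : TwoCatData k I) : Prop where
  unit_mem : ∀ e : A.E, IsIn A.X [e] e 0 (A.unit e)
  d_unit : ∀ e : A.E, A.d (A.unit e) = 0
  mul_assoc : ∀ (a : HEl A.X) (m : List (HEl A.X × List (HEl A.X))),
    bots (m.map Prod.fst) = a.1.top → (∀ x ∈ m, bots x.2 = x.1.1.top) →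
    A.mul (A.mul a.tot (word (m.map Prod.fst))) (word (m.flatMap Prod.snd)) =
      koszul m • A.mul a.tot (m.map fun x => letter A.X (A.mul x.1.tot (word x.2))).prod
  unit_mul : ∀ a : HEl A.X, A.mul (A.unit a.1.bot) (letter A.X a.tot) = a.tot
  mul_unit : ∀ a : HEl A.X,
    A.mul a.tot (a.1.top.map fun e => letter A.X (A.unit e)).prod = a.tot
  d_mul : ∀ (a : Tot A.X) (x : Words A.X),
    A.d (A.mul a x) = A.mul (A.d a) x + A.mul (sg A.X a) (wordD A.X A.d x)

theorem TwoCatData.IsTwoCat.preCat {A : TwoCatData k I} (h : A.IsTwoCat) : PreCat A where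
  unit_mem := h.isComplex.unit_mem
  d_unit := h.isComplex.d_unit
  mul_assoc := h.mul_assoc
  unit_mul := h.unit_mul
  mul_unit := h.mul_unit
  d_mul := h.d_mul

theorem PreCat.unit_mul' {A : TwoCatData k I} (h : PreCat A) {t : List A.E} {b : A.E} {n : ℤ}
    {x : Tot A.X} (hx : IsIn A.X t b n x) : A.mul (A.unit b) (letter A.X x) = x := by
  obtain ⟨y, rfl⟩ := hx
  exact h.unit_mul ⟨⟨t, b, n⟩, y⟩

theorem PreCat.mul_unit' {A : TwoCatData k I} (h : PreCat A) {t : List A.E} {b : A.E} {n : ℤ}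
    {x : Tot A.X} (hx : IsIn A.X t b n x) :
    A.mul x (t.map fun e => letter A.X (A.unit e)).prod = x := by
  obtain ⟨y, rfl⟩ := hx
  exact h.mul_unit ⟨⟨t, b, n⟩, y⟩

/-- The product of `Words X ⊗ Words X` with Koszul signs. -/
abbrev ksW {E : Type u} (X : Fam k E) :
    (Words X ⊗[k] Words X) ⊗[k] (Words X ⊗[k] Words X) →ₗ[k] Words X ⊗[k] Words X :=
  ksMul (LinearMap.mul' k (Words X)) (wordOdd X)

/-- The graph of the componentwise composition `b₁ ⋯ b_r ⊗ c₁ ⋯ c_r ↦ ± (b₁ ∘ c₁) ⋯ (b_r ∘ c_r)`,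
where `t` is the path of the targets of the `b_i` and the words `c_i` match the `b_i`. It is a
relation, since the word `c₁ ⋯ c_r` does not determine the `c_i`. -/
def pairRel (A : TwoCatData k I) (t : List A.E) :
    Submodule k ((Words A.X ⊗[k] Words A.X) × Words A.X) :=
  Submodule.span k {z | ∃ m : List (HEl A.X × List (HEl A.X)), bots (m.map Prod.fst) = t ∧
    (∀ x ∈ m, bots x.2 = x.1.1.top) ∧
    z = (word (m.map Prod.fst) ⊗ₜ word (m.flatMap Prod.snd),
      koszul m • (m.map fun x => letter A.X (A.mul x.1.tot (word x.2))).prod)}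

/-- Associativity of the composition, in terms of `pairRel`. -/
theorem PreCat.mul_pairRel {A : TwoCatData k I} (h : PreCat A) {s : List A.E} {b : A.E}
    {n : ℤ} {a : Tot A.X} (ha : IsIn A.X s b n a) {z : Words A.X ⊗[k] Words A.X} {y : Words A.X}
    (hz : (z, y) ∈ pairRel A s) :
    TensorProduct.lift A.mul (rTensor _ (A.mul a) z) = A.mul a y := by
  obtain ⟨a, ha', rfl⟩ := ha.exists_tot
  refine span_ext (M := (Words A.X ⊗[k] Words A.X) × Words A.X)
    (f := TensorProduct.lift A.mul ∘ₗ rTensor _ (A.mul a.tot) ∘ₗ LinearMap.fst k _ _)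
    (g := A.mul a.tot ∘ₗ LinearMap.snd k _ _) ?_ hz
  rintro _ ⟨m, h1, h2, rfl⟩
  simp only [lcomp_apply, LinearMap.fst_apply, LinearMap.snd_apply, rTensor_tmul,
    TensorProduct.lift.tmul]
  rw [h.mul_assoc a m (by rw [h1, ha']) h2, Units.smul_def, Units.smul_def, map_zsmul]

theorem pairRel_nil (A : TwoCatData k I) : (1 ⊗ₜ 1, 1) ∈ pairRel A [] :=
  subset_span ⟨[], rfl, by simp, by simp [word_nil, koszul]⟩

theorem pairRel_smul {A : TwoCatData k I} {t : List A.E} {z : Words A.X ⊗[k] Words A.X}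
    {y : Words A.X} (c : k) (h : (z, y) ∈ pairRel A t) : (c • z, c • y) ∈ pairRel A t :=
  Submodule.smul_mem _ c h

theorem pairRel_add {A : TwoCatData k I} {t : List A.E} {z z' : Words A.X ⊗[k] Words A.X}
    {y y' : Words A.X} (h : (z, y) ∈ pairRel A t) (h' : (z', y') ∈ pairRel A t) :
    (z + z', y + y') ∈ pairRel A t :=
  Submodule.add_mem _ h h'

theorem pairRel_sub {A : TwoCatData k I} {t : List A.E} {z z' : Words A.X ⊗[k] Words A.X}
    {y y' : Words A.X} (h : (z, y) ∈ pairRel A t) (h' : (z', y') ∈ pairRel A t) :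
    (z - z', y - y') ∈ pairRel A t :=
  Submodule.sub_mem _ h h'

theorem pairRel_zero (A : TwoCatData k I) (t : List A.E) : (0, 0) ∈ pairRel A t :=
  Submodule.zero_mem _

theorem pairRel_cons_word {A : TwoCatData k I} (b : HEl A.X) (l : List (HEl A.X))
    (hl : bots l = b.1.top) {t : List A.E} {z : Words A.X ⊗[k] Words A.X} {y : Words A.X}
    (h : (z, y) ∈ pairRel A t) :
    (ksW A.X ((letter A.X b.tot ⊗ₜ word l) ⊗ₜ z),
      letter A.X (A.mul b.tot (word l)) * y) ∈ pairRel A (b.1.bot :: t) := by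
  let f : (Words A.X ⊗[k] Words A.X) × Words A.X →ₗ[k] (Words A.X ⊗[k] Words A.X) × Words A.X :=
    LinearMap.prodMap (ksW A.X ∘ₗ tmk k _ _ (letter A.X b.tot ⊗ₜ word l))
      (mulLeft k (letter A.X (A.mul b.tot (word l))))
  change f (z, y) ∈ _
  change (z, y) ∈ (pairRel A (b.1.bot :: t)).comap f
  refine Submodule.span_le.2 ?_ h
  rintro _ ⟨m, h1, h2, rfl⟩
  have hs : ∀ x : Words A.X, koszul ((b, l) :: m) • x =
      sgn k (degs l * degs (m.map Prod.fst)) • koszul m • x := fun x => by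
    rw [koszul, mul_smul, negOnePow_smul (k := k)]
  have key : f (word (m.map Prod.fst) ⊗ₜ word (m.flatMap Prod.snd),
      koszul m • (m.map fun x => letter A.X (A.mul x.1.tot (word x.2))).prod) =
      sgn k (degs l * degs (m.map Prod.fst)) •
      (word (((b, l) :: m).map Prod.fst) ⊗ₜ word (((b, l) :: m).flatMap Prod.snd),
      koszul ((b, l) :: m) •
        (((b, l) :: m).map fun x => letter A.X (A.mul x.1.tot (word x.2))).prod) := by
    refine Prod.ext ?_ ?_
    · change ksW A.X ((letter A.X b.tot ⊗ₜ word l) ⊗ₜ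
        (word (m.map Prod.fst) ⊗ₜ word (m.flatMap Prod.snd))) = sgn k _ • (_ ⊗ₜ _)
      rw [ksMul_word _ _ (word_mem _) (word_mem _), List.map_cons, word_cons, List.flatMap_cons,
        word_append]
    · change letter A.X (A.mul b.tot (word l)) * (koszul m • _) = sgn k _ • (koszul _ • _)
      rw [hs, smul_smul, sgn_mul_self, one_smul, List.map_cons, List.prod_cons, Units.smul_def,
        Units.smul_def, mul_smul_comm]
  change f _ ∈ pairRel A (b.1.bot :: t)
  rw [key]
  refine Submodule.smul_mem _ _ (subset_span ⟨(b, l) :: m, ?_, ?_, rfl⟩)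
  · simp [← h1]
  · simpa [hl] using h2

/-- `pairRel` is closed under adding a composable pair in front. -/
theorem pairRel_cons {A : TwoCatData k I} {s s' t : List A.E} {b : A.E} {n n' : ℤ}
    {a : Tot A.X} (ha : IsIn A.X s b n a) {v : Words A.X} (hv : v ∈ WS A.X s' s n')
    {z : Words A.X ⊗[k] Words A.X} {y : Words A.X} (h : (z, y) ∈ pairRel A t) :
    (ksW A.X ((letter A.X a ⊗ₜ v) ⊗ₜ z), letter A.X (A.mul a v) * y) ∈ pairRel A (b :: t) := by
  obtain ⟨a, ha', rfl⟩ := ha.exists_tot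
  let f : Words A.X →ₗ[k] (Words A.X ⊗[k] Words A.X) × Words A.X :=
    LinearMap.prod (ksW A.X ∘ₗ (tmk k (Words A.X ⊗[k] Words A.X) _).flip z ∘ₗ
      tmk k _ _ (letter A.X a.tot))
      (mulRight k y ∘ₗ letter A.X ∘ₗ A.mul a.tot)
  change f v ∈ _
  refine WS_map_le f _ (fun l _ h2 _ => ?_) hv
  have := pairRel_cons_word a l (by rw [h2, ha']) h
  rw [ha'] at this
  exact this

end PairRel

/-! ### The Bianchi identity -/

section Bianchi

variable {k : Type u} [Field k] {I : Type w}

/-- The laws of a coalgebra for `⊙` with a coderivation `d` that is not assumed to satisfy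
`d ∘ d = 0`. -/
structure PreCocat (C : TwoCoCatData k I) : Prop where
  d_mem : ∀ (p : GCell C.E) (x : C.X p), IsIn C.X p.top p.bot (p.deg - 1) (C.d (of C.X p x))
  aug_off : ∀ (p : GCell C.E) (x : C.X p), p ≠ ⟨[p.bot], p.bot, 0⟩ → C.aug (of C.X p x) = 0
  aug_d : C.aug ∘ₗ C.d = 0
  comul_mem : ∀ (p : GCell C.E) (x : C.X p), C.comul (of C.X p x) ∈ Submodule.span k
    {y | ∃ (a : HEl C.X) (l : List (HEl C.X)), bots l = a.1.top ∧ tops l = p.top ∧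
      a.1.bot = p.bot ∧ a.1.deg + degs l = p.deg ∧ y = a.tot ⊗ₜ[k] word l}
  coassoc : (tassoc k _ _ _).toLinearMap ∘ₗ C.comul.rTensor _ ∘ₗ C.comul =
    C.wordComul.lTensor _ ∘ₗ C.comul
  counit_comul : (TensorProduct.lid k _).toLinearMap ∘ₗ C.aug.rTensor _ ∘ₗ C.comul = letter C.X
  comul_counit : (TensorProduct.rid k _).toLinearMap ∘ₗ
    (TensorAlgebra.lift k C.aug).toLinearMap.lTensor _ ∘ₗ C.comul = LinearMap.id
  comul_d : C.comul ∘ₗ C.d =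
    (C.d.rTensor _ + tmap (sg C.X) (wordD C.X C.d)) ∘ₗ C.comul

theorem TwoCoCatData.IsTwoCoCat.preCocat {C : TwoCoCatData k I} (h : C.IsTwoCoCat) :
    PreCocat C where
  d_mem := h.isComplex.d_mem
  aug_off := h.isComplex.aug_off
  aug_d := h.isComplex.aug_d
  comul_mem := h.comul_mem
  coassoc := h.coassoc
  counit_comul := h.counit_comul
  comul_counit := h.comul_counit
  comul_d := h.comul_d

/-- Two linear maps agree on `Δ c` if they agree on the matching tensors `a ⊗ (word)`. -/
theorem PreCocat.comul_ext {C : TwoCoCatData k I} (h : PreCocat C) (c : HEl C.X)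
    {N : Type u} [AddCommGroup N] [Module k N] {f g : Tot C.X ⊗[k] Words C.X →ₗ[k] N}
    (hfg : ∀ (a : HEl C.X) (l : List (HEl C.X)), bots l = a.1.top → tops l = c.1.top →
      a.1.bot = c.1.bot → a.1.deg + degs l = c.1.deg → f (a.tot ⊗ₜ word l) = g (a.tot ⊗ₜ word l)) :
    f (C.comul c.tot) = g (C.comul c.tot) := by
  refine span_ext ?_ (h.comul_mem c.1 c.2)
  rintro _ ⟨a, l, h1, h2, h3, h4, rfl⟩
  exact hfg a l h1 h2 h3 h4

theorem PreCocat.comul_map_le {C : TwoCoCatData k I} (h : PreCocat C) (c : HEl C.X)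
    {N : Type u} [AddCommGroup N] [Module k N] (f : Tot C.X ⊗[k] Words C.X →ₗ[k] N)
    (p : Submodule k N)
    (hf : ∀ (a : HEl C.X) (l : List (HEl C.X)), bots l = a.1.top → tops l = c.1.top →
      a.1.bot = c.1.bot → a.1.deg + degs l = c.1.deg → f (a.tot ⊗ₜ word l) ∈ p) :
    f (C.comul c.tot) ∈ p := by
  change C.comul (of C.X c.1 c.2) ∈ p.comap f
  refine Submodule.span_le.2 ?_ (h.comul_mem c.1 c.2)
  rintro _ ⟨a, l, h1, h2, h3, h4, rfl⟩
  exact hf a l h1 h2 h3 h4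

theorem PreCocat.counit_comul' {C : TwoCoCatData k I} (h : PreCocat C) (c : Tot C.X) :
    TensorProduct.lid k _ (C.aug.rTensor _ (C.comul c)) = letter C.X c :=
  congrArg (fun f => f c) h.counit_comul

theorem PreCocat.comul_counit' {C : TwoCoCatData k I} (h : PreCocat C) (c : Tot C.X) :
    TensorProduct.rid k _ ((TensorAlgebra.lift k C.aug).toLinearMap.lTensor _ (C.comul c)) = c :=
  congrArg (fun f => f c) h.comul_counit

theorem PreCocat.coassoc' {C : TwoCoCatData k I} (h : PreCocat C) (c : Tot C.X) :
    tassoc k _ _ _ (C.comul.rTensor _ (C.comul c)) =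
      C.wordComul.lTensor _ (C.comul c) :=
  congrArg (fun f => f c) h.coassoc

theorem PreCocat.comul_d' {C : TwoCoCatData k I} (h : PreCocat C) (c : Tot C.X) :
    C.comul (C.d c) = C.d.rTensor _ (C.comul c) +
      tmap (sg C.X) (wordD C.X C.d) (C.comul c) :=
  congrArg (fun f => f c) h.comul_d

theorem PreCocat.comul_sg {C : TwoCoCatData k I} (h : PreCocat C) (c : Tot C.X) :
    C.comul (sg C.X c) = tmap (sg C.X) (wordMap (sg C.X)) (C.comul c) := by
  refine tot_ext (f := C.comul ∘ₗ sg C.X)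
    (g := tmap (sg C.X) (wordMap (sg C.X)) ∘ₗ C.comul) (fun c => ?_) c
  rw [lcomp_apply, lcomp_apply, sg_tot, map_smul]
  refine h.comul_ext c (f := sgn k c.1.deg • LinearMap.id) (fun a l _ _ _ h4 => ?_)
  rw [map_tmul, sg_tot, wordMap_sg_word, smul_tmul_smul, ← sgn_add, h4]
  rfl

theorem wordComul_one (C : TwoCoCatData k I) : C.wordComul 1 = 1 ⊗ₜ 1 := tfold_one ..

theorem wordComul_letter_mul (C : TwoCoCatData k I) (c : Tot C.X) (x : Words C.X) :
    C.wordComul (letter C.X c * x) =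
      ksW C.X (rTensor _ (letter C.X) (C.comul c) ⊗ₜ C.wordComul x) := by
  rw [TwoCoCatData.wordComul, tfold_ι_mul]
  rfl

variable (C : TwoCoCatData k I) (A : TwoCatData k I) (col : C.E → A.E)

/-- The map `C → k_E → A` given by counit and unit. -/
def augUnit : Tot C.X →ₗ[k] Tot A.X := DirectSum.toModule k _ _ fun p =>
  (C.aug ∘ₗ of C.X p).smulRight (A.unit (col p.bot))

/-- The multiplicative extension of `augUnit` to words. -/
abbrev augUnits : Words C.X →ₗ[k] Words A.X := wordMap (augUnit C A col)

/-- The map `c₁ ⋯ c_r ↦ ∑ i, 1 ⋯ 1 α(c_i) 1 ⋯ 1` with coefficients `∏ j ≠ i, aug(c_j)`. -/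
abbrev insertAug (α : Tot C.X →ₗ[k] Tot A.X) : Words C.X →ₗ[k] Words A.X :=
  insertOne (letter A.X ∘ₗ augUnit C A col) (letter A.X ∘ₗ α) (letter A.X ∘ₗ augUnit C A col)

/-- The operation `α ⋆ α` of the Maurer–Cartan equation. -/
def starOp (α : Tot C.X →ₗ[k] Tot A.X) : Tot C.X →ₗ[k] Tot A.X :=
  TensorProduct.lift A.mul ∘ₗ tmap (α ∘ₗ sg C.X) (insertAug C A col α) ∘ₗ C.comul

theorem star_eq_starOp (C : TwoCoCat k I) (A : TwoCat k I)
    (α : SeqData.PreHom C.seq A.seq) : star C A α = starOp C.data A.data α.col α.lin := rfl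

variable {C A col}

local notation "𝐔" => augUnits C A col
local notation "𝐈" => insertAug C A col

theorem augUnit_tot (c : HEl C.X) :
    augUnit C A col c.tot = C.aug c.tot • A.unit (col c.1.bot) := by
  rw [augUnit, HEl.tot, DirectSum.toModule_lof]
  rfl

theorem insertAug_one (α : Tot C.X →ₗ[k] Tot A.X) : 𝐈 α 1 = 0 := insertOne_one ..

theorem insertAug_letter_mul (α : Tot C.X →ₗ[k] Tot A.X) (c : Tot C.X) (x : Words C.X) :
    𝐈 α (letter C.X c * x) =
      letter A.X (augUnit C A col c) * 𝐈 α x +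
        letter A.X (α c) * 𝐔 x := insertOne_ι_mul ..

theorem insertAug_letter (α : Tot C.X →ₗ[k] Tot A.X) (c : Tot C.X) :
    𝐈 α (letter C.X c) = letter A.X (α c) := insertOne_ι ..

theorem insertAug_mul (α : Tot C.X →ₗ[k] Tot A.X) (x y : Words C.X) :
    𝐈 α (x * y) =
      𝐈 α x * 𝐔 y + 𝐔 x * 𝐈 α y := by
  refine tensorAlgebra_ext (f := 𝐈 α ∘ₗ mulRight k y)
    (g := mulRight k (𝐔 y) ∘ₗ 𝐈 α +
      mulRight k (𝐈 α y) ∘ₗ 𝐔) ?_ (fun c x h => ?_) x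
  · simp [insertAug_one]
  · simp only [lcomp_apply, ladd_apply, mulRight_apply] at h ⊢
    rw [mul_assoc, insertAug_letter_mul, h, insertAug_letter_mul, wordMap_mul, wordMap_mul,
      wordMap_letter]
    simp only [mul_add, add_mul, mul_assoc]
    abel

theorem insertAug_add (α β : Tot C.X →ₗ[k] Tot A.X) (x : Words C.X) :
    𝐈 (α + β) x = 𝐈 α x + 𝐈 β x := by
  refine tensorAlgebra_ext (f := 𝐈 (α + β))
    (g := 𝐈 α + 𝐈 β) ?_ (fun c x h => ?_) x
  · simp [insertAug_one]
  · rw [ladd_apply] at h ⊢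
    rw [insertAug_letter_mul, insertAug_letter_mul, insertAug_letter_mul, h, ladd_apply, map_add]
    simp only [mul_add, add_mul]
    abel

variable (hC : PreCocat C) (hA : PreCat A)

include hC in
theorem augUnit_eq_zero (c : HEl C.X) (h : c.1 ≠ ⟨[c.1.bot], c.1.bot, 0⟩) :
    augUnit C A col c.tot = 0 := by
  rw [augUnit_tot, hC.aug_off c.1 c.2 h, zero_smul]

include hC hA in
theorem augUnit_mem (c : HEl C.X) :
    IsIn A.X (c.1.top.map col) (col c.1.bot) c.1.deg (augUnit C A col c.tot) := by
  by_cases h : c.1 = ⟨[c.1.bot], c.1.bot, 0⟩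
  · rw [augUnit_tot, h]
    exact (hA.unit_mem _).smul _
  · rw [augUnit_eq_zero hC c h]
    exact IsIn.zero _ _ _

include hC hA in
theorem augUnits_mem (l : List (HEl C.X)) :
    𝐔 (word l) ∈ WS A.X ((tops l).map col) ((bots l).map col) (degs l) := by
  induction l with
  | nil => rw [word_nil, wordMap_one]; exact one_mem_WS
  | cons c l ih =>
    rw [word_cons, wordMap_mul, wordMap_letter]
    simpa using mul_mem_WS (letter_mem (augUnit_mem hC hA c)) ih

include hC in
theorem augUnits_eq_zero_or (l : List (HEl C.X)) :
    𝐔 (word l) = 0 ∨ degs l = 0 := by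
  induction l with
  | nil => exact Or.inr rfl
  | cons c l ih =>
    rw [word_cons, wordMap_mul, wordMap_letter]
    by_cases h : c.1 = ⟨[c.1.bot], c.1.bot, 0⟩
    · refine ih.imp (fun h => by rw [h, mul_zero]) fun h' => ?_
      rw [degs_cons, h, h', add_zero]
    · rw [augUnit_eq_zero hC c h, map_zero, zero_mul]
      exact Or.inl rfl

include hC in
theorem augUnit_sg (c : Tot C.X) : augUnit C A col (sg C.X c) = augUnit C A col c := by
  refine tot_ext (f := augUnit C A col ∘ₗ sg C.X) (g := augUnit C A col) (fun c => ?_) c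
  rw [lcomp_apply, sg_tot, map_smul]
  by_cases h : c.1 = ⟨[c.1.bot], c.1.bot, 0⟩
  · rw [h, sgn_zero, one_smul]
  · rw [augUnit_eq_zero hC c h, smul_zero]

include hC in
theorem augUnit_d (c : Tot C.X) : augUnit C A col (C.d c) = 0 := by
  refine tot_ext (f := augUnit C A col ∘ₗ C.d) (g := 0) (fun c => ?_) c
  obtain ⟨b, hb, hb'⟩ := (hC.d_mem c.1 c.2).exists_tot
  rw [lcomp_apply, HEl.tot, ← hb', augUnit_tot, hb', ← lcomp_apply, hC.aug_d, lzero_apply,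
    zero_smul, lzero_apply]

theorem sg_unit (hA : PreCat A) (e : A.E) : sg A.X (A.unit e) = A.unit e := by
  rw [(hA.unit_mem e).sg, sgn_zero, one_smul]

include hA in
theorem sg_augUnit (c : Tot C.X) : sg A.X (augUnit C A col c) = augUnit C A col c := by
  refine tot_ext (f := sg A.X ∘ₗ augUnit C A col) (g := augUnit C A col) (fun c => ?_) c
  rw [lcomp_apply, augUnit_tot, map_smul, sg_unit hA]

include hA in
theorem d_augUnit (c : Tot C.X) : A.d (augUnit C A col c) = 0 := by
  refine tot_ext (f := A.d ∘ₗ augUnit C A col) (g := 0) (fun c => ?_) c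
  rw [lcomp_apply, augUnit_tot, map_smul, hA.d_unit, smul_zero, lzero_apply]

variable (α : Tot C.X →ₗ[k] Tot A.X)

include hC in
theorem insertAug_wordMap_sg (x : Words C.X) :
    𝐈 α (wordMap (sg C.X) x) = 𝐈 (α ∘ₗ sg C.X) x := by
  have hU : ∀ x, 𝐔 (wordMap (sg C.X) x) = 𝐔 x := fun x => by
    refine tensorAlgebra_ext (f := 𝐔 ∘ₗ wordMap (sg C.X)) (g := 𝐔)
      (by simp) (fun c x h => ?_) x
    rw [lcomp_apply] at h ⊢
    rw [wordMap_mul, wordMap_mul, h, wordMap_letter, wordMap_letter, augUnit_sg hC, wordMap_mul,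
      wordMap_letter]
  refine tensorAlgebra_ext (f := 𝐈 α ∘ₗ wordMap (sg C.X))
    (g := 𝐈 (α ∘ₗ sg C.X)) ?_ (fun c x h => ?_) x
  · simp [insertAug_one]
  · rw [lcomp_apply] at h ⊢
    rw [wordMap_mul, wordMap_letter, insertAug_letter_mul, h, insertAug_letter_mul, hU, augUnit_sg
      hC]
    rfl

include hC in
theorem augUnits_wordD (x : Words C.X) : 𝐔 (wordD C.X C.d x) = 0 := by
  refine tensorAlgebra_ext (f := 𝐔 ∘ₗ wordD C.X C.d) (g := 0)
    (by simp [wordD_one]) (fun c x h => ?_) x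
  rw [lcomp_apply, lzero_apply] at h ⊢
  rw [wordD_letter_mul, map_add, wordMap_mul, h, wordMap_mul, wordMap_letter (c := C.d c), augUnit_d
    hC]
  simp

include hC in
theorem insertAug_wordD (x : Words C.X) :
    𝐈 α (wordD C.X C.d x) = 𝐈 (α ∘ₗ C.d) x := by
  refine tensorAlgebra_ext (f := 𝐈 α ∘ₗ wordD C.X C.d)
    (g := 𝐈 (α ∘ₗ C.d)) ?_ (fun c x h => ?_) x
  · simp [insertAug_one, wordD_one]
  · rw [lcomp_apply] at h ⊢
    rw [wordD_letter_mul, map_add, insertAug_letter_mul, insertAug_letter_mul, h,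
      insertAug_letter_mul, augUnits_wordD hC, augUnit_sg hC, augUnit_d hC]
    simp

include hA in
theorem wordD_augUnits (x : Words C.X) : wordD A.X A.d (𝐔 x) = 0 := by
  refine tensorAlgebra_ext (f := wordD A.X A.d ∘ₗ 𝐔) (g := 0)
    (by simp [wordD_one]) (fun c x h => ?_) x
  rw [lcomp_apply, lzero_apply] at h ⊢
  rw [wordMap_mul, wordMap_letter, wordD_letter_mul, h, d_augUnit hA]
  simp

include hA in
theorem wordD_insertAug (x : Words C.X) :
    wordD A.X A.d (𝐈 α x) = 𝐈 (A.d ∘ₗ α) x := by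
  refine tensorAlgebra_ext (f := wordD A.X A.d ∘ₗ 𝐈 α)
    (g := 𝐈 (A.d ∘ₗ α)) ?_ (fun c x h => ?_) x
  · simp [insertAug_one]
  · rw [lcomp_apply] at h ⊢
    rw [insertAug_letter_mul, map_add, wordD_letter_mul, wordD_letter_mul, h, insertAug_letter_mul,
      wordD_augUnits hA, d_augUnit hA, sg_augUnit hA]
    simp

theorem augUnits_word (l : List (HEl C.X)) : 𝐔 (word l) =
    TensorAlgebra.lift k C.aug (word l) •
      (((bots l).map col).map fun e => letter A.X (A.unit e)).prod := by
  induction l with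
  | nil => simp [word_nil]
  | cons c l ih =>
    rw [word_cons, wordMap_mul, wordMap_letter, ih, map_mul, augUnit_tot, map_smul,
      TensorAlgebra.lift_ι_apply, bots_cons, List.map_cons, List.map_cons, List.prod_cons,
      smul_mul_smul_comm]

include hC hA in
/-- The counit law, for maps `C → A`. -/
theorem counit_left (G : Words C.X →ₗ[k] Words A.X) (c : HEl C.X) (y : Tot A.X) {t : List A.E}
    {n : ℤ} (hy : IsIn A.X t (col c.1.bot) n y) (hG : G (letter C.X c.tot) = letter A.X y) :
    TensorProduct.lift A.mul (tmap (augUnit C A col) G (C.comul c.tot)) = y := by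
  have h := hC.comul_ext c (f := TensorProduct.lift A.mul ∘ₗ tmap (augUnit C A col) G)
    (g := A.mul (A.unit (col c.1.bot)) ∘ₗ G ∘ₗ (TensorProduct.lid k _).toLinearMap ∘ₗ
      C.aug.rTensor _) (fun a l _ _ h3 _ => by
        simp only [lcomp_apply, map_tmul, augUnit_tot, TensorProduct.lift.tmul, rTensor_tmul,
          LinearEquiv.coe_coe, lid_tmul, h3, map_smul, lsmul_apply])
  refine h.trans ?_
  simp only [lcomp_apply, LinearEquiv.coe_coe]
  rw [hC.counit_comul', hG, hA.unit_mul' hy]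

include hC hA in
theorem counit_right {β : Tot C.X →ₗ[k] Tot A.X} (j : ℤ)
    (hβ : ∀ a : HEl C.X, IsIn A.X (a.1.top.map col) (col a.1.bot) (a.1.deg + j) (β a.tot))
    (c : HEl C.X) :
    TensorProduct.lift A.mul (tmap β (𝐔) (C.comul c.tot)) =
      β c.tot := by
  have h := hC.comul_ext c (f := TensorProduct.lift A.mul ∘ₗ tmap β (𝐔))
    (g := β ∘ₗ (TensorProduct.rid k _).toLinearMap ∘ₗ
      (TensorAlgebra.lift k C.aug).toLinearMap.lTensor _) (fun a l h1 _ _ _ => by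
        simp only [lcomp_apply, map_tmul, augUnits_word, TensorProduct.lift.tmul, lTensor_tmul,
          LinearEquiv.coe_coe, rid_tmul, h1, map_smul, AlgHom.toLinearMap_apply]
        rw [hA.mul_unit' (hβ a)])
  refine h.trans ?_
  simp only [lcomp_apply, LinearEquiv.coe_coe]
  rw [hC.comul_counit']

variable (hα : ∀ a : HEl C.X, IsIn A.X (a.1.top.map col) (col a.1.bot) (a.1.deg - 1) (α a.tot))

include hC hA hα in
theorem insertAug_mem (l : List (HEl C.X)) :
    𝐈 α (word l) ∈
      WS A.X ((tops l).map col) ((bots l).map col) (degs l - 1) := by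
  induction l with
  | nil => rw [word_nil, insertAug_one]; exact Submodule.zero_mem _
  | cons c l ih =>
    rw [word_cons, insertAug_letter_mul]
    refine Submodule.add_mem _ ?_ ?_
    · have := mul_mem_WS (letter_mem (augUnit_mem hC hA (col := col) c)) ih
      rw [← add_sub_assoc, ← degs_cons] at this
      simpa using this
    · have := mul_mem_WS (letter_mem (hα c)) (augUnits_mem hC hA (col := col) l)
      rw [sub_add_eq_add_sub, ← degs_cons] at this
      simpa using this

theorem words₂_ext {E : Type u} {X : Fam k E} {N : Type u} [AddCommGroup N] [Module k N]
    {f g : Words X ⊗[k] Words X →ₗ[k] N}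
    (h : ∀ l m : List (HEl X), f (word l ⊗ₜ word m) = g (word l ⊗ₜ word m))
    (z : Words X ⊗[k] Words X) : f z = g z := by
  refine tensor_ext (fun x y => ?_) z
  refine words_ext (f := f ∘ₗ (tmk k (Words X) (Words X)).flip y)
    (g := g ∘ₗ (tmk k (Words X) (Words X)).flip y) (fun l => ?_) x
  exact words_ext (f := f ∘ₗ tmk k (Words X) (Words X) (word l))
    (g := g ∘ₗ tmk k (Words X) (Words X) (word l)) (fun m => h l m) y

theorem ksW_word {E : Type u} {X : Fam k E} (b : HEl X) (l l₁ l₂ : List (HEl X)) :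
    ksW X ((letter X b.tot ⊗ₜ word l) ⊗ₜ (word l₁ ⊗ₜ word l₂)) =
      sgn k (degs l * degs l₁) • ((letter X b.tot * word l₁) ⊗ₜ[k] (word l * word l₂)) :=
  ksMul_word _ _ (word_mem _) (word_mem _)

include hC hA in
theorem map_units_units (b : HEl C.X) (l : List (HEl C.X)) (z : Words C.X ⊗[k] Words C.X) :
    tmap (𝐔) (𝐔)
        (ksW C.X ((letter C.X b.tot ⊗ₜ word l) ⊗ₜ z)) =
      ksW A.X ((letter A.X (augUnit C A col b.tot) ⊗ₜ 𝐔 (word l)) ⊗ₜ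
        tmap (𝐔) (𝐔) z) := by
  refine words₂_ext (f := tmap (𝐔) (𝐔) ∘ₗ ksW C.X ∘ₗ
    tmk k _ _ (letter C.X b.tot ⊗ₜ word l))
    (g := ksW A.X ∘ₗ tmk k _ _ (letter A.X (augUnit C A col b.tot) ⊗ₜ
      𝐔 (word l)) ∘ₗ tmap (𝐔) (𝐔))
    (fun l₁ l₂ => ?_) z
  simp only [lcomp_apply, mk_apply, map_tmul]
  rw [ksW_word, ksMul_word _ _ (augUnits_mem hC hA l) (augUnits_mem hC hA l₁), map_smul, map_tmul,
    wordMap_mul, wordMap_mul, wordMap_letter]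

include hC hA hα in
theorem map_insert_units (b : HEl C.X) (l : List (HEl C.X)) (z : Words C.X ⊗[k] Words C.X) :
    tmap (𝐈 α) (𝐔)
        (ksW C.X ((letter C.X b.tot ⊗ₜ word l) ⊗ₜ z)) =
      ksW A.X ((letter A.X (augUnit C A col b.tot) ⊗ₜ 𝐔 (word l)) ⊗ₜ
        tmap (𝐈 α) (𝐔) z) +
      ksW A.X ((letter A.X (α b.tot) ⊗ₜ 𝐔 (word l)) ⊗ₜ
        tmap (𝐔) (𝐔) z) := by
  refine words₂_ext (f := tmap (𝐈 α) (𝐔) ∘ₗ ksW C.X ∘ₗ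
    tmk k _ _ (letter C.X b.tot ⊗ₜ word l))
    (g := ksW A.X ∘ₗ tmk k _ _ (letter A.X (augUnit C A col b.tot) ⊗ₜ
      𝐔 (word l)) ∘ₗ tmap (𝐈 α) (𝐔) +
      ksW A.X ∘ₗ tmk k _ _ (letter A.X (α b.tot) ⊗ₜ
      𝐔 (word l)) ∘ₗ tmap (𝐔) (𝐔))
    (fun l₁ l₂ => ?_) z
  simp only [lcomp_apply, ladd_apply, mk_apply, map_tmul]
  rw [ksW_word, ksMul_word _ _ (augUnits_mem hC hA l) (insertAug_mem hC hA α hα l₁), ksMul_word _ _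
    (augUnits_mem hC hA l) (augUnits_mem hC hA l₁), map_smul, map_tmul, wordMap_mul,
    insertAug_letter_mul, add_tmul, smul_add]
  rcases augUnits_eq_zero_or (A := A) (col := col) hC l with h | h
  · simp [h]
  · simp [h]

include hC hA hα in
theorem map_units_insert (b : HEl C.X) (l : List (HEl C.X)) (z : Words C.X ⊗[k] Words C.X) :
    tmap (𝐔) (𝐈 α)
        (ksW C.X ((letter C.X b.tot ⊗ₜ word l) ⊗ₜ z)) =
      ksW A.X ((letter A.X (augUnit C A col b.tot) ⊗ₜ 𝐈 α (word l)) ⊗ₜ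
        tmap (𝐔) (𝐔) z) +
      ksW A.X ((letter A.X (augUnit C A col b.tot) ⊗ₜ 𝐔 (word l)) ⊗ₜ
        tmap (𝐔) (𝐈 α) z) := by
  refine words₂_ext (f := tmap (𝐔) (𝐈 α) ∘ₗ ksW C.X ∘ₗ
    tmk k _ _ (letter C.X b.tot ⊗ₜ word l))
    (g := ksW A.X ∘ₗ tmk k _ _ (letter A.X (augUnit C A col b.tot) ⊗ₜ
      𝐈 α (word l)) ∘ₗ tmap (𝐔) (𝐔) +
      ksW A.X ∘ₗ tmk k _ _ (letter A.X (augUnit C A col b.tot) ⊗ₜ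
      𝐔 (word l)) ∘ₗ tmap (𝐔) (𝐈 α))
    (fun l₁ l₂ => ?_) z
  simp only [lcomp_apply, ladd_apply, mk_apply, map_tmul]
  rw [ksW_word, ksMul_word _ _ (insertAug_mem hC hA α hα l) (augUnits_mem hC hA l₁), ksMul_word _ _
    (augUnits_mem hC hA l) (augUnits_mem hC hA l₁), map_smul, map_tmul, wordMap_mul, wordMap_letter,
    insertAug_mul, tmul_add, smul_add]
  rcases augUnits_eq_zero_or (A := A) (col := col) hC l₁ with h | h
  · simp [h]
  · simp [h]

include hC in
theorem insertAug_sg_word (l : List (HEl C.X)) : 𝐈 (α ∘ₗ sg C.X) (word l) =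
    sgn k (degs l) • 𝐈 α (word l) := by
  rw [← insertAug_wordMap_sg hC, wordMap_sg_word, map_smul]

include hα in
theorem comp_sg_mem (a : HEl C.X) :
    IsIn A.X (a.1.top.map col) (col a.1.bot) (a.1.deg - 1) ((α ∘ₗ sg C.X) a.tot) := by
  rw [lcomp_apply, sg_tot, map_smul]
  exact (hα a).smul _

include hC hA hα in
theorem map_insert_insert (b : HEl C.X) (l : List (HEl C.X)) (z : Words C.X ⊗[k] Words C.X) :
    tmap (𝐈 (α ∘ₗ sg C.X)) (𝐈 α)
        (ksW C.X ((letter C.X b.tot ⊗ₜ word l) ⊗ₜ z)) =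
      ksW A.X ((letter A.X (augUnit C A col b.tot) ⊗ₜ 𝐔 (word l)) ⊗ₜ
        tmap (𝐈 (α ∘ₗ sg C.X)) (𝐈 α) z) +
      ksW A.X ((letter A.X ((α ∘ₗ sg C.X) b.tot) ⊗ₜ 𝐈 α (word l)) ⊗ₜ
        tmap (𝐔) (𝐔) z) +
      (ksW A.X ((letter A.X ((α ∘ₗ sg C.X) b.tot) ⊗ₜ 𝐔 (word l)) ⊗ₜ
        tmap (𝐔) (𝐈 α) z) -
      ksW A.X ((letter A.X (augUnit C A col b.tot) ⊗ₜ 𝐈 (α ∘ₗ sg C.X) (word l)) ⊗ₜ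
        tmap (𝐈 α) (𝐔) z)) := by
  set α' := α ∘ₗ sg C.X with hα'
  have h' := comp_sg_mem α hα
  have e1 := insertAug_sg_word (A := A) (col := col) hC α
  rw [← hα'] at h' e1
  set I := 𝐈 α with hI
  set I' := 𝐈 α' with hI'
  set U := 𝐔 with hU
  refine words₂_ext (f := tmap I' I ∘ₗ ksW C.X ∘ₗ
    tmk k _ _ (letter C.X b.tot ⊗ₜ word l))
    (g := ksW A.X ∘ₗ tmk k _ _ (letter A.X (augUnit C A col b.tot) ⊗ₜ
        U (word l)) ∘ₗ tmap I' I +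
      ksW A.X ∘ₗ tmk k _ _ (letter A.X (α' b.tot) ⊗ₜ I (word l)) ∘ₗ
        tmap U U +
      (ksW A.X ∘ₗ tmk k _ _ (letter A.X (α' b.tot) ⊗ₜ U (word l)) ∘ₗ
        tmap U I -
      ksW A.X ∘ₗ tmk k _ _ (letter A.X (augUnit C A col b.tot) ⊗ₜ
        I' (word l)) ∘ₗ tmap I U))
    (fun l₁ l₂ => ?_) z
  simp only [lcomp_apply, ladd_apply, LinearMap.sub_apply, mk_apply, map_tmul]
  have m1 := augUnits_mem (col := col) hC hA l
  have m2 := augUnits_mem (col := col) hC hA l₁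
  have m3 := insertAug_mem hC hA α hα l
  have m4 := insertAug_mem hC hA α hα l₁
  have m5 := insertAug_mem hC hA α' h' l
  have m6 := insertAug_mem hC hA α' h' l₁
  rw [← hU] at m1 m2
  rw [← hI] at m3 m4
  rw [← hI'] at m5 m6
  have i1 : I' (letter C.X b.tot * word l₁) = letter A.X (augUnit C A col b.tot) * I' (word l₁) +
    letter A.X (α' b.tot) * U (word l₁) := insertAug_letter_mul ..
  have i2 : I (word l * word l₂) = I (word l) * U (word l₂) + U (word l) * I (word l₂) :=
    insertAug_mul ..
  rw [ksW_word, ksMul_word _ _ m1 m6, ksMul_word _ _ m3 m2, ksMul_word _ _ m1 m2, ksMul_word _ _ m5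
    m4, map_smul, map_tmul, i1, i2]
  rw [e1 l, e1 l₁]
  have s1 : sgn k ((degs l - 1) * (degs l₁ - 1)) * sgn k (degs l) =
      sgn k 1 * (sgn k (degs l * degs l₁) * sgn k (degs l₁)) := by
    rw [← sgn_add, ← sgn_add, ← sgn_add]
    apply sgn_congr
    push_cast
    grind
  simp only [add_tmul, tmul_add, smul_add, mul_smul_comm, smul_mul_assoc, ← smul_tmul', tmul_smul,
    smul_smul, s1]
  have c1 : U (word l) = 0 ∨ degs l = 0 := augUnits_eq_zero_or hC l
  have c2 : U (word l₁) = 0 ∨ degs l₁ = 0 := augUnits_eq_zero_or hC l₁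
  -- The Koszul signs that remain involve the degree of a word of counits, which vanishes unless
  -- the word is sent to zero; the last two terms are opposite to each other up to such signs.
  rcases c1 with h | h <;> rcases c2 with h1 | h1 <;> simp [h, h1] <;> abel

include hC in
/-- Reduction of a statement about `pairRel` and words to a statement about their first letters. -/
theorem pairRel_wordComul {F G H : Words C.X →ₗ[k] Words A.X} {t : List A.E} (c : HEl C.X)
    (l : List (HEl C.X)) (m : Tot C.X ⊗[k] Words C.X →ₗ[k] Words A.X)
    (hH : H (letter C.X c.tot * word l) = m (C.comul c.tot))
    (h : ∀ (b : HEl C.X) (l' : List (HEl C.X)), bots l' = b.1.top → b.1.bot = c.1.bot →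
      (tmap F G (ksW C.X ((letter C.X b.tot ⊗ₜ word l') ⊗ₜ C.wordComul (word l))),
        m (b.tot ⊗ₜ word l')) ∈ pairRel A t) :
    (tmap F G (C.wordComul (word (c :: l))), H (word (c :: l))) ∈ pairRel A t := by
  let f : Tot C.X ⊗[k] Words C.X →ₗ[k] (Words A.X ⊗[k] Words A.X) × Words A.X :=
    LinearMap.prod (tmap F G ∘ₗ ksW C.X ∘ₗ
      (tmk k (Words C.X ⊗[k] Words C.X) _).flip (C.wordComul (word l)) ∘ₗ
      rTensor _ (letter C.X)) m
  have := hC.comul_map_le c f (pairRel A t) (fun a l' h1 _ h3 _ => h a l' h1 h3)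
  rw [word_cons, wordComul_letter_mul, hH]
  exact this

/-- `a ⊗ w ↦ (β(a) ∘ G(w)) y`. -/
abbrev mulWord (β : Tot C.X →ₗ[k] Tot A.X) (G : Words C.X →ₗ[k] Words A.X) (y : Words A.X) :
    Tot C.X ⊗[k] Words C.X →ₗ[k] Words A.X :=
  mulRight k y ∘ₗ letter A.X ∘ₗ TensorProduct.lift A.mul ∘ₗ tmap β G

theorem mulWord_tmul (β : Tot C.X →ₗ[k] Tot A.X) (G : Words C.X →ₗ[k] Words A.X) (y : Words A.X)
    (a : Tot C.X) (x : Words C.X) :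
    mulWord β G y (a ⊗ₜ x) = letter A.X (A.mul (β a) (G x)) * y := rfl

include hC hA in
theorem pairRel_units_units (l : List (HEl C.X)) :
    (tmap (𝐔) (𝐔) (C.wordComul (word l)),
      𝐔 (word l)) ∈ pairRel A ((bots l).map col) := by
  induction l with
  | nil =>
    rw [word_nil, wordComul_one, map_tmul, wordMap_one]
    exact pairRel_nil A
  | cons c l ih =>
    refine pairRel_wordComul hC c l (mulWord (augUnit C A col) (𝐔)
      (𝐔 (word l))) ?_ (fun b l' h1 h3 => ?_)
    · simp only [lcomp_apply, mulRight_apply]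
      rw [counit_left hC hA _ c _ (augUnit_mem hC hA c) (wordMap_letter ..), wordMap_mul,
        wordMap_letter]
    · rw [map_units_units hC hA]
      have h2 := augUnits_mem (col := col) hC hA l'
      rw [h1] at h2
      have := pairRel_cons (augUnit_mem hC hA b) h2 ih
      rw [h3] at this
      exact this

include hC hA hα in
theorem pairRel_insert_units (l : List (HEl C.X)) :
    (tmap (𝐈 α) (𝐔) (C.wordComul (word l)),
      𝐈 α (word l)) ∈ pairRel A ((bots l).map col) := by
  induction l with
  | nil =>
    rw [word_nil, wordComul_one, map_tmul, insertAug_one, zero_tmul]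
    exact pairRel_zero A _
  | cons c l ih =>
    refine pairRel_wordComul hC c l (mulWord (augUnit C A col) (𝐔)
      (𝐈 α (word l)) + mulWord α (𝐔) (𝐔 (word l)))
      ?_ (fun b l' h1 h3 => ?_)
    · simp only [lcomp_apply, ladd_apply, mulRight_apply]
      rw [counit_left hC hA _ c _ (augUnit_mem hC hA c) (wordMap_letter ..), counit_right hC hA (-1)
        hα, insertAug_letter_mul]
    · rw [map_insert_units hC hA α hα]
      have h2 := augUnits_mem (col := col) hC hA l'
      rw [h1] at h2
      have h4 := pairRel_cons (augUnit_mem hC hA b) h2 ih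
      have h5 := pairRel_cons (hα b) h2 (pairRel_units_units hC hA (col := col) l)
      rw [h3] at h4 h5
      exact pairRel_add h4 h5

include hC hA hα in
theorem pairRel_units_insert (l : List (HEl C.X)) :
    (tmap (𝐔) (𝐈 α) (C.wordComul (word l)),
      𝐈 α (word l)) ∈ pairRel A ((bots l).map col) := by
  induction l with
  | nil =>
    rw [word_nil, wordComul_one, map_tmul, insertAug_one, tmul_zero]
    exact pairRel_zero A _
  | cons c l ih =>
    refine pairRel_wordComul hC c l (mulWord (augUnit C A col) (𝐈 α)
      (𝐔 (word l)) + mulWord (augUnit C A col) (𝐔)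
        (𝐈 α (word l))) ?_ (fun b l' h1 h3 => ?_)
    · simp only [lcomp_apply, ladd_apply, mulRight_apply]
      rw [counit_left hC hA _ c _ (augUnit_mem hC hA c) (wordMap_letter ..), counit_left hC hA _ c _
        (hα c) (insertAug_letter α _), insertAug_letter_mul, add_comm]
    · rw [map_units_insert hC hA α hα]
      have h2 := augUnits_mem (col := col) hC hA l'
      have h2' := insertAug_mem hC hA α hα l'
      rw [h1] at h2 h2'
      have h4 := pairRel_cons (augUnit_mem hC hA b) h2' (pairRel_units_units hC hA (col := col) l)
      have h5 := pairRel_cons (augUnit_mem hC hA b) h2 ih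
      rw [h3] at h4 h5
      exact pairRel_add h4 h5

include hC hA hα in
/-- On words, two insertions of `α` in consecutive layers give one insertion of `α ⋆ α`; the
insertions at different letters cancel. -/
theorem pairRel_insert_insert (l : List (HEl C.X)) :
    (tmap (𝐈 (α ∘ₗ sg C.X)) (𝐈 α)
      (C.wordComul (word l)), 𝐈 (starOp C A col α) (word l)) ∈
      pairRel A ((bots l).map col) := by
  induction l with
  | nil =>
    simp only [word_nil, wordComul_one, map_tmul, insertAug_one, zero_tmul]
    exact pairRel_zero A _
  | cons c l ih =>
    have h' := comp_sg_mem α hα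
    refine pairRel_wordComul hC c l (mulWord (augUnit C A col) (𝐔)
        (𝐈 (starOp C A col α) (word l)) +
      mulWord (α ∘ₗ sg C.X) (𝐈 α) (𝐔 (word l)) +
      (mulWord (α ∘ₗ sg C.X) (𝐔) (𝐈 α (word l)) -
      mulWord (augUnit C A col) (𝐈 (α ∘ₗ sg C.X)) (𝐈 α (word l))))
      ?_ (fun b l' h1 h3 => ?_)
    · simp only [lcomp_apply (f := mulRight k _), lcomp_apply (f := letter A.X), lcomp_apply (f :=
        TensorProduct.lift _), ladd_apply, LinearMap.sub_apply, mulRight_apply]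
      rw [counit_left hC hA _ c _ (augUnit_mem hC hA c) (wordMap_letter ..), counit_left hC hA _ c _
        (h' c) (insertAug_letter _ _), counit_right hC hA (-1) h', sub_self, add_zero,
        insertAug_letter_mul]
      rfl
    · rw [map_insert_insert hC hA α hα]
      have h2 := augUnits_mem (col := col) hC hA l'
      have h2' := insertAug_mem hC hA α hα l'
      have h2'' := insertAug_mem hC hA _ h' l'
      rw [h1] at h2 h2' h2''
      have h4 := pairRel_cons (augUnit_mem hC hA b) h2 ih
      have h5 := pairRel_cons (h' b) h2' (pairRel_units_units hC hA (col := col) l)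
      have h6 := pairRel_cons (h' b) h2 (pairRel_units_insert hC hA α hα l)
      have h7 := pairRel_cons (augUnit_mem hC hA b) h2'' (pairRel_insert_units hC hA α hα l)
      rw [h3] at h4 h5 h6 h7
      rw [ladd_apply, ladd_apply, LinearMap.sub_apply, mulWord_tmul, mulWord_tmul, mulWord_tmul,
        mulWord_tmul]
      exact pairRel_add (pairRel_add h4 h5) (pairRel_sub h6 h7)

theorem lift_rTensor_assoc_symm {M N : Type u} [AddCommGroup M] [Module k M] [AddCommGroup N]
    [Module k N] (m : M →ₗ[k] N →ₗ[k] M) (x : M) (z : N ⊗[k] N) :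
    TensorProduct.lift m (rTensor N (TensorProduct.lift m)
      ((tassoc k M N N).symm (x ⊗ₜ z))) =
      TensorProduct.lift m (rTensor N (m x) z) := by
  induction z using induction_on with
  | zero => simp
  | add a b ha hb => simp only [tmul_add, map_add, ha, hb]
  | tmul a b => simp

theorem lift_map_comp_assoc {M N M' N' : Type u} [AddCommGroup M] [Module k M] [AddCommGroup N]
    [Module k N] [AddCommGroup M'] [Module k M'] [AddCommGroup N'] [Module k N']
    (m : M →ₗ[k] N →ₗ[k] M) (Δ : M' →ₗ[k] M' ⊗[k] N') (f : M' →ₗ[k] M) (g h : N' →ₗ[k] N)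
    (z : M' ⊗[k] N') :
    TensorProduct.lift m (tmap (TensorProduct.lift m ∘ₗ tmap f g ∘ₗ Δ)
      h z) = TensorProduct.lift m (rTensor N (TensorProduct.lift m)
        ((tassoc k M N N).symm (tmap f (tmap g h)
          (tassoc k M' N' N' (rTensor N' Δ z))))) := by
  induction z using induction_on with
  | zero => simp
  | add a b ha hb => simp only [map_add, ha, hb]
  | tmul a b =>
    simp only [map_tmul, lcomp_apply, rTensor_tmul]
    generalize Δ a = y
    induction y using induction_on with
    | zero => simp
    | add a b ha hb => simp only [map_add, add_tmul, ha, hb]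
    | tmul x y => simp

theorem map_map_tensor {M N M' N' M'' N'' : Type u} [AddCommGroup M] [Module k M] [AddCommGroup N]
    [Module k N] [AddCommGroup M'] [Module k M'] [AddCommGroup N'] [Module k N'] [AddCommGroup M'']
    [Module k M''] [AddCommGroup N''] [Module k N''] (f : M →ₗ[k] M') (g : N →ₗ[k] N')
    (f' : M' →ₗ[k] M'') (g' : N' →ₗ[k] N'') (z : M ⊗[k] N) :
    tmap f' g' (tmap f g z) =
      tmap (f' ∘ₗ f) (g' ∘ₗ g) z := by
  rw [TensorProduct.map_comp]
  rfl

theorem map_sub_tensor {M N M' N' : Type u} [AddCommGroup M] [Module k M] [AddCommGroup N]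
    [Module k N] [AddCommGroup M'] [Module k M'] [AddCommGroup N'] [Module k N']
    (f f' : M →ₗ[k] M') (g : N →ₗ[k] N') (z : M ⊗[k] N) :
    tmap (f - f') g z = tmap f g z - tmap f' g z := by
  refine tensor_ext (f := tmap (f - f') g)
    (g := tmap f g - tmap f' g) (fun a b => ?_) z
  simp [TensorProduct.sub_tmul]

theorem map_neg_tensor {M N M' N' : Type u} [AddCommGroup M] [Module k M] [AddCommGroup N]
    [Module k N] [AddCommGroup M'] [Module k M'] [AddCommGroup N'] [Module k N']
    (f : M →ₗ[k] M') (g g' : N →ₗ[k] N') (z : M ⊗[k] N) :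
    tmap (-f) (-g - g') z = tmap f g z + tmap f g' z := by
  refine tensor_ext (f := tmap (-f) (-g - g'))
    (g := tmap f g + tmap f g') (fun a b => ?_) z
  simp only [map_tmul, LinearMap.neg_apply, LinearMap.sub_apply, ladd_apply, TensorProduct.neg_tmul,
    TensorProduct.tmul_sub, TensorProduct.tmul_neg]
  abel

include hC in
theorem starOp_sg (c : Tot C.X) : starOp C A col α (sg C.X c) = TensorProduct.lift A.mul
    (tmap α (𝐈 (α ∘ₗ sg C.X)) (C.comul c)) := by
  have h1 : (α ∘ₗ sg C.X) ∘ₗ sg C.X = α := LinearMap.ext fun x => congrArg α (sg_sg x)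
  have h2 : 𝐈 α ∘ₗ wordMap (sg C.X) = 𝐈 (α ∘ₗ sg C.X) :=
    LinearMap.ext fun x => insertAug_wordMap_sg hC α x
  rw [starOp, lcomp_apply, lcomp_apply, hC.comul_sg, map_map_tensor, h1, h2]

include hC hA hα in
/-- `(α ⋆ α) ⋆ α = α ⋆ (α ⋆ α)`. -/
theorem starOp_assoc (c : HEl C.X) :
    TensorProduct.lift A.mul (tmap (starOp C A col α ∘ₗ sg C.X)
      (𝐈 α) (C.comul c.tot)) =
    TensorProduct.lift A.mul (tmap α
      (𝐈 (starOp C A col α)) (C.comul c.tot)) := by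
  have e : starOp C A col α ∘ₗ sg C.X = TensorProduct.lift A.mul ∘ₗ
      tmap α (𝐈 (α ∘ₗ sg C.X)) ∘ₗ C.comul :=
    LinearMap.ext fun x => starOp_sg hC α x
  rw [e, lift_map_comp_assoc, hC.coassoc']
  refine hC.comul_ext c
    (f := TensorProduct.lift A.mul ∘ₗ rTensor _ (TensorProduct.lift A.mul) ∘ₗ
      (tassoc k _ _ _).symm.toLinearMap ∘ₗ tmap α
        (tmap (𝐈 (α ∘ₗ sg C.X)) (𝐈 α)) ∘ₗ
          C.wordComul.lTensor _)
    (g := TensorProduct.lift A.mul ∘ₗ tmap α (𝐈 (starOp C A col α)))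
    (fun a l h1 _ _ _ => ?_)
  have := pairRel_insert_insert hC hA α hα l
  rw [h1] at this
  simp only [lcomp_apply, lTensor_tmul, map_tmul, LinearEquiv.coe_coe, TensorProduct.lift.tmul]
  rw [lift_rTensor_assoc_symm, hA.mul_pairRel (hα a) this]

include hC in
theorem d_sg (c : Tot C.X) : C.d (sg C.X c) = -sg C.X (C.d c) := by
  refine tot_ext (k := k) (f := C.d ∘ₗ sg C.X) (g := (-(sg C.X ∘ₗ C.d) : Tot C.X →ₗ[k] Tot C.X))
    (fun c => ?_) c
  rw [LinearMap.neg_apply, lcomp_apply, lcomp_apply, (hC.d_mem c.1 c.2).sg, sg_tot, map_smul,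
    neg_eq_sgn_smul (k := k), smul_smul, ← sgn_add, add_sub_cancel]

include hα in
theorem sg_comp (c : Tot C.X) : sg A.X (α (sg C.X c)) = -α c := by
  refine tot_ext (k := k) (f := sg A.X ∘ₗ α ∘ₗ sg C.X) (g := -α) (fun c => ?_) c
  rw [LinearMap.neg_apply, lcomp_apply, lcomp_apply, sg_tot, map_smul, map_smul, (hα c).sg,
    smul_smul, ← sgn_add, neg_eq_sgn_smul (k := k)]
  congr 1
  apply sgn_congr
  push_cast
  grind

theorem lift_map_d_mul {A : TwoCatData k I} (hA : PreCat A) {M N : Type u} [AddCommGroup M]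
    [Module k M] [AddCommGroup N] [Module k N] (f : M →ₗ[k] Tot A.X) (g : N →ₗ[k] Words A.X)
    (z : M ⊗[k] N) :
    A.d (TensorProduct.lift A.mul (tmap f g z)) =
      TensorProduct.lift A.mul (tmap (A.d ∘ₗ f) g z) +
      TensorProduct.lift A.mul (tmap (sg A.X ∘ₗ f) (wordD A.X A.d ∘ₗ g) z) := by
  induction z using induction_on with
  | zero => simp
  | add a b ha hb => simp only [map_add, ha, hb]; abel
  | tmul a b => simp only [map_tmul, TensorProduct.lift.tmul, hA.d_mul, lcomp_apply]

include hC hA hα in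
/-- The Bianchi identity: if `α` satisfies the Maurer–Cartan equation, then `α` intertwines the
squares of the differentials. -/
theorem bianchi (hmc : A.d ∘ₗ α + α ∘ₗ C.d + starOp C A col α = 0) (c : Tot C.X) :
    A.d (A.d (α c)) = α (C.d (C.d c)) := by
  have hd : ∀ c, A.d (α c) = -α (C.d c) - starOp C A col α c := fun c => by
    have := congrArg (fun f => f c) hmc
    simp only [ladd_apply, lcomp_apply, lzero_apply] at this
    rw [add_assoc] at this
    rw [eq_neg_of_add_eq_zero_left this]
    abel
  have hd' : A.d ∘ₗ α = -(α ∘ₗ C.d) - starOp C A col α := LinearMap.ext hd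
  suffices h : ∀ c : HEl C.X, A.d (starOp C A col α c.tot) = starOp C A col α (C.d c.tot) by
    have h' := tot_ext (f := A.d ∘ₗ starOp C A col α) (g := starOp C A col α ∘ₗ C.d) h c
    rw [lcomp_apply, lcomp_apply] at h'
    rw [hd, map_sub, map_neg, hd, h']
    abel
  intro c
  set S := starOp C A col α with hS
  -- Apply `d` to both factors of `α ⋆ α`, and replace `d ∘ α` by the Maurer–Cartan equation. The
  -- two terms in which `α ⋆ α` occurs cancel by associativity.
  have h1 : A.d ∘ₗ α ∘ₗ sg C.X = α ∘ₗ sg C.X ∘ₗ C.d - S ∘ₗ sg C.X := by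
    rw [← LinearMap.comp_assoc, hd']
    refine LinearMap.ext fun x => ?_
    simp only [lcomp_apply, LinearMap.sub_apply, LinearMap.neg_apply, d_sg hC, map_neg, neg_neg]
  have h2 : sg A.X ∘ₗ α ∘ₗ sg C.X = -α := LinearMap.ext fun x => sg_comp α hα x
  have h3 : wordD A.X A.d ∘ₗ 𝐈 α =
      -𝐈 (α ∘ₗ C.d) - 𝐈 S := by
    refine LinearMap.ext fun x => ?_
    rw [lcomp_apply, wordD_insertAug hA, hd', LinearMap.sub_apply, LinearMap.neg_apply]
    have := insertAug_add (C := C) (col := col) (-(α ∘ₗ C.d) - S) (α ∘ₗ C.d + S) x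
    rw [show -(α ∘ₗ C.d) - S + (α ∘ₗ C.d + S) = 0 by abel, insertAug_add] at this
    have h0 : 𝐈 0 x = 0 := by
      have := insertAug_add (C := C) (A := A) (col := col) 0 0 x
      simpa using this
    rw [h0] at this
    rw [eq_neg_of_add_eq_zero_left this.symm]
    abel
  have h4 : 𝐈 α ∘ₗ wordD C.X C.d = 𝐈 (α ∘ₗ C.d) :=
    LinearMap.ext fun x => insertAug_wordD hC α x
  have h5 := starOp_assoc hC hA α hα c
  rw [← hS] at h5
  rw [hS, starOp, lcomp_apply, lcomp_apply, lift_map_d_mul hA, h1, h2, h3, lcomp_apply, lcomp_apply,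
    hC.comul_d', map_add, map_add]
  have h6 : tmap (α ∘ₗ sg C.X) (𝐈 α) (C.d.rTensor _ (C.comul c.tot)) =
      tmap (α ∘ₗ sg C.X ∘ₗ C.d) (𝐈 α) (C.comul c.tot) :=
    map_map_tensor ..
  have h7 : (α ∘ₗ sg C.X) ∘ₗ sg C.X = α := LinearMap.ext fun x => congrArg α (sg_sg x)
  rw [h6, map_map_tensor, h7, h4, map_sub_tensor, map_neg_tensor, map_sub, map_add, h5]
  abel

end Bianchi

/-! ### The reduced part of a sequence -/

section Reduced

variable {k : Type u} [Field k] {I : Type w} {S : SeqData k I}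

theorem inc_of (p : GCell S.E) (x : S.red p) : S.inc (of S.red p x) = of S.X p x.1 := by
  rw [SeqData.inc, DirectSum.toModule_lof]
  rfl

theorem inc_mem {t : List S.E} {b : S.E} {n : ℤ} {x : Tot S.red} (h : IsIn S.red t b n x) :
    IsIn S.X t b n (S.inc x) := by
  obtain ⟨y, rfl⟩ := h
  exact ⟨y.1, (inc_of _ _).symm⟩

theorem aug_inc (x : Tot S.red) : S.aug (S.inc x) = 0 := by
  refine tot_ext (f := S.aug ∘ₗ S.inc) (g := 0) (fun a => ?_) x
  rw [lcomp_apply, HEl.tot, inc_of]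
  exact a.2.2

variable (h : S.IsComplex)

theorem ret_of (p : GCell S.E) (x : S.X p) :
    SeqData.ret h (of S.X p x) = of S.red p ⟨S.redProj p x, SeqData.redProj_mem h p x⟩ := by
  rw [SeqData.ret, DirectSum.toModule_lof]
  rfl

theorem ret_mem {t : List S.E} {b : S.E} {n : ℤ} {x : Tot S.X} (hx : IsIn S.X t b n x) :
    IsIn S.red t b n (SeqData.ret h x) := by
  obtain ⟨y, rfl⟩ := hx
  exact ⟨_, (ret_of h _ y).symm⟩

theorem ret_inc (x : Tot S.red) : SeqData.ret h (S.inc x) = x := by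
  refine tot_ext (f := SeqData.ret h ∘ₗ S.inc) (g := LinearMap.id) (fun a => ?_) x
  rw [lcomp_apply, HEl.tot, inc_of, ret_of]
  refine congrArg (of S.red a.1) (Subtype.ext ?_)
  have : S.aug (of S.X a.1 a.2.1) = 0 := a.2.2
  simp [SeqData.redProj, this]

theorem inc_ret (c : HEl S.X) :
    S.inc (SeqData.ret h c.tot) = c.tot - S.aug c.tot • S.unit c.1.bot := by
  rw [HEl.tot, ret_of]
  refine (inc_of c.1 ⟨S.redProj c.1 c.2, SeqData.redProj_mem h c.1 c.2⟩).trans ?_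
  change of S.X c.1 (S.redProj c.1 c.2) = _
  have : S.redProj c.1 c.2 = c.2 - S.aug (of S.X c.1 c.2) •
    (DirectSum.component k (GCell S.E) (fun p => S.X p) c.1 (S.unit c.1.bot)) := rfl
  rw [this, map_sub, map_smul]
  by_cases hp : c.1 = ⟨[c.1.bot], c.1.bot, 0⟩
  · obtain ⟨y, hy⟩ := h.unit_mem c.1.bot
    congr 2
    rw [← hy]
    obtain ⟨⟨t, b, n⟩, x⟩ := c
    simp only [GCell.mk.injEq, true_and] at hp
    obtain ⟨rfl, rfl⟩ := hp
    rw [DirectSum.component.lof_self]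
  · rw [h.aug_off _ _ hp, zero_smul, zero_smul]

theorem ret_unit (e : S.E) : SeqData.ret h (S.unit e) = 0 := by
  obtain ⟨a, ha, ha'⟩ := (h.unit_mem e).exists_tot
  have h1 := inc_ret h a
  rw [ha', h.aug_unit, ha, one_smul, sub_self] at h1
  rw [← ret_inc h (SeqData.ret h (S.unit e)), h1, map_zero]

/-- On the kernel of the augmentation, the projection to the reduced part loses nothing. -/
theorem inc_ret_of_aug {t : List S.E} {b : S.E} {n : ℤ} {x : Tot S.X} (hx : IsIn S.X t b n x)
    (h0 : S.aug x = 0) : S.inc (SeqData.ret h x) = x := by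
  obtain ⟨a, -, rfl⟩ := hx.exists_tot
  rw [inc_ret, h0, zero_smul, sub_zero]

include h in
/-- Linear maps that agree on the reduced part and on the units are equal. -/
theorem ext_reduced {N : Type u} [AddCommGroup N] [Module k N] {f g : Tot S.X →ₗ[k] N}
    (h1 : ∀ v, f (S.inc v) = g (S.inc v)) (h2 : ∀ e, f (S.unit e) = g (S.unit e))
    (x : Tot S.X) : f x = g x := by
  refine tot_ext (fun c => ?_) x
  have e : c.tot = S.inc (SeqData.ret h c.tot) + S.aug c.tot • S.unit c.1.bot := by
    rw [inc_ret h]; abel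
  rw [e, map_add, map_add, map_smul, map_smul, h1, h2]

end Reduced

/-! ### Supports of sums over trees -/

section Support

variable {k : Type u} [Field k] {I : Type w}

theorem isPath_append (S : SeqData k I) (s t : List S.E) (i j : I) :
    S.IsPath i (s ++ t) j ↔ ∃ m, S.IsPath i s m ∧ S.IsPath m t j := by
  induction s generalizing i with
  | nil => simp [SeqData.IsPath]
  | cons e s ih => simp [SeqData.IsPath, ih, and_assoc]

/-- A forest whose vertices are cells has a path of leaves parallel to its path of roots. -/
theorem isPath_leaves {S : SeqData k I}
    (hS : ∀ p : GCell S.E, ¬ S.IsCell p.top p.bot → Subsingleton (S.X p)) (f : PForest S.E)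
    (hf : f.WF) (hm : ¬ Subsingleton (f.mod S.red)) (i j : I) (h : S.IsPath i f.roots j) :
    S.IsPath i f.leaves j ∧ (f.roots ≠ [] → f.leaves ≠ []) := by
  induction f generalizing i j with
  | nil => exact ⟨h, fun h => h⟩
  | leaf e f ih => exact ⟨⟨h.1, (ih hf hm _ _ h.2).1⟩, fun _ => by simp [PForest.leaves]⟩
  | node p ch f ih1 ih2 =>
    have hp : ¬ Subsingleton (S.red p) := fun _ => hm (show Subsingleton
      (S.red p ⊗[k] (ch.mod S.red ⊗[k] f.mod S.red)) from inferInstance)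
    have hch : ¬ Subsingleton (ch.mod S.red) := fun _ => hm (show Subsingleton
      (S.red p ⊗[k] (ch.mod S.red ⊗[k] f.mod S.red)) from inferInstance)
    have hf' : ¬ Subsingleton (f.mod S.red) := fun _ => hm (show Subsingleton
      (S.red p ⊗[k] (ch.mod S.red ⊗[k] f.mod S.red)) from inferInstance)
    have hc : S.IsCell p.top p.bot := by
      by_contra hc
      have := hS p hc
      exact hp ⟨fun a b => Subtype.ext (Subsingleton.elim (a.1 : S.X p) b.1)⟩
    obtain ⟨h1, h2⟩ := h
    subst h1
    obtain ⟨g1, g2⟩ := ih1 hf.2.1 hch _ _ (by rw [hf.1]; exact hc.2)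
    refine ⟨(isPath_append S _ _ _ _).2 ⟨_, g1, (ih2 hf.2.2 hf' _ _ h2).1⟩, fun _ => ?_⟩
    simp only [PForest.leaves, ne_eq, List.append_eq_nil_iff, not_and]
    intro h0
    exact absurd h0 (g2 (by rw [hf.1]; exact hc.1))

theorem freeFam_supp {S : SeqData k I}
    (hS : ∀ p : GCell S.E, ¬ S.IsCell p.top p.bot → Subsingleton (S.X p)) (s : ℤ) (p : GCell S.E)
    (hp : ¬ S.IsCell p.top p.bot) : Subsingleton (freeFam S.red s p) := by
  have : ∀ f : {f : PForest S.E // f.WF ∧ f.leaves = p.top ∧ f.roots = [p.bot] ∧ f.deg s = p.deg},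
      Subsingleton (f.1.mod S.red) := by
    rintro ⟨f, h1, h2, h3, -⟩
    by_contra hm
    obtain ⟨g1, g2⟩ := isPath_leaves hS f h1 hm (S.src p.bot) (S.tgt p.bot)
      (by rw [h3]; exact ⟨rfl, rfl⟩)
    rw [h2, h3] at g2
    rw [h2] at g1
    exact hp ⟨g2 (by simp), g1⟩
  exact ⟨fun a b => DFinsupp.ext fun f => Subsingleton.elim _ _⟩

end Support

/-! ### The derivation of the cobar construction -/

section CobarD

variable {k : Type u} [Field k] {I : Type w} (C : TwoCoCat k I)

/-- The derivation `cobarD` on the sum over all forests. -/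
abbrev cobarDF : Forests C.seq.red →ₗ[k] Forests C.seq.red := elimF C.cobarD

/-- The map `C → k_E →` forests. -/
def augLeaf (S : SeqData k I) : Tot S.X →ₗ[k] Forests S.red :=
  DirectSum.toModule k _ _ fun p => (S.aug ∘ₗ of S.X p).smulRight (leafTree S.red p.bot)

variable {C}

theorem augLeaf_tot {S : SeqData k I} (c : HEl S.X) :
    augLeaf S c.tot = S.aug c.tot • leafTree S.red c.1.bot := by
  rw [augLeaf, HEl.tot, DirectSum.toModule_lof]
  rfl

theorem augLeaf_mem {S : SeqData k I} (h : S.IsComplex) (s : ℤ) (c : HEl S.X) :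
    augLeaf S c.tot ∈ FS S.red s c.1.top [c.1.bot] c.1.deg := by
  rw [augLeaf_tot]
  by_cases hp : c.1 = ⟨[c.1.bot], c.1.bot, 0⟩
  · rw [hp]
    exact Submodule.smul_mem _ _ (leafTree_mem s _)
  · rw [h.aug_off _ _ hp, zero_smul]
    exact Submodule.zero_mem _

theorem wordToVertex_eq : C.wordToVertex = catInsert (augLeaf C.seq)
    (corolla C.seq.red ∘ₗ SeqData.ret C.isTwoCoCat.isComplex) (augLeaf C.seq) := rfl

theorem catLift_augLeaf_mem {S : SeqData k I} (h : S.IsComplex) (s : ℤ)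
    (l : List (HEl S.X)) : catLift (augLeaf S) (word l) ∈ FS S.red s (tops l) (bots l) (degs l) := by
  have := catLift_word_mem (V := S.red) id s (augLeaf S) l (fun c _ => by
    simpa using augLeaf_mem h s c)
  simpa using this

theorem wordToVertex_mem (l : List (HEl C.seq.X)) :
    C.wordToVertex (word l) ∈ FS C.seq.red (-1) (tops l) (bots l) (degs l - 1) := by
  rw [wordToVertex_eq]
  induction l with
  | nil => rw [word_nil, catInsert_one]; exact Submodule.zero_mem _
  | cons c l ih =>
    rw [word_cons, catInsert_ι_mul, tops_cons, bots_cons, degs_cons]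
    refine Submodule.add_mem _ ?_ ?_
    · exact FS_cast (catOp_mem (augLeaf_mem C.isTwoCoCat.isComplex (-1) c) ih) rfl rfl (by ring)
    · exact FS_cast (catOp_mem (corolla_mem (-1) (ret_mem _ (isIn_tot c)))
        (catLift_augLeaf_mem C.isTwoCoCat.isComplex (-1) l)) rfl rfl (by ring)

/-- The quadratic part of the differential of a generator. -/
def cobarQuad (C : TwoCoCat k I) : Tot C.seq.X →ₗ[k] Forests C.seq.red :=
  treeOp C.seq.red ∘ₗ tmap (SeqData.ret C.isTwoCoCat.isComplex ∘ₗ sg C.seq.X)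
    C.wordToVertex ∘ₗ C.data.comul

theorem cobarGen_apply (v : Tot C.seq.red) : C.cobarGen v =
    -corolla C.seq.red (SeqData.ret C.isTwoCoCat.isComplex (C.seq.d (C.seq.inc v))) -
      cobarQuad C (C.seq.inc v) := rfl

theorem ret_sg_mem (a : HEl C.seq.X) : IsIn C.seq.red a.1.top a.1.bot a.1.deg
    ((SeqData.ret C.isTwoCoCat.isComplex ∘ₗ sg C.seq.X) a.tot) :=
  ret_mem C.isTwoCoCat.isComplex (isIn_tot a).sg_mem

theorem cobarQuad_mem {t : List C.seq.E} {b : C.seq.E} {n : ℤ} {x : Tot C.seq.X}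
    (hx : IsIn C.seq.X t b n x) : cobarQuad C x ∈ FS C.seq.red (-1) t [b] (n - 1 - 1) := by
  obtain ⟨c, hc, rfl⟩ := hx.exists_tot
  refine C.isTwoCoCat.preCocat.comul_map_le c (treeOp C.seq.red ∘ₗ tmap
    (SeqData.ret C.isTwoCoCat.isComplex ∘ₗ sg C.seq.X) C.wordToVertex) _
    (fun a l h1 h2 h3 h4 => ?_)
  have := wordToVertex_mem l
  rw [h1] at this
  rw [lcomp_apply, map_tmul]
  refine FS_cast (treeOp_mem (ret_sg_mem a) this) ?_ ?_ ?_
  · rw [h2, hc]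
  · rw [h3, hc]
  · have : n = c.1.deg := by rw [hc]
    rw [this, ← h4]; ring

theorem d_inc_mem (a : HEl C.seq.red) :
    IsIn C.seq.X a.1.top a.1.bot (a.1.deg - 1) (C.seq.d (C.seq.inc a.tot)) := by
  rw [HEl.tot, inc_of]
  exact C.isTwoCoCat.isComplex.d_mem _ _

theorem cobarGen_mem (a : HEl C.seq.red) :
    C.cobarGen a.tot ∈ FS C.seq.red (-1) a.1.top [a.1.bot] (a.1.deg - 1 - 1) := by
  rw [cobarGen_apply]
  exact Submodule.sub_mem _ (Submodule.neg_mem _ (corolla_mem (-1) (ret_mem _ (d_inc_mem a))))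
    (cobarQuad_mem (inc_mem (isIn_tot a)))

theorem cobarDF_nil : cobarDF C (nilF C.seq.red) = 0 :=
  (elimF_ofF C.cobarD PForest.nil _).trans rfl

theorem cobarDF_leafOp (e : C.seq.E) (x : Forests C.seq.red) :
    cobarDF C (leafOp C.seq.red e x) = leafOp C.seq.red e (cobarDF C x) := by
  refine forests_ext (f := cobarDF C ∘ₗ leafOp C.seq.red e)
    (g := leafOp C.seq.red e ∘ₗ cobarDF C) (fun x => ?_) x
  rw [lcomp_apply, ← DF.ev_leaf, cobarDF, elimF_ev, lcomp_apply, elimF_ev]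
  rfl

theorem cobarDF_node_ev (a : HEl C.seq.red) (x y : DF C.seq.red) :
    cobarDF C (DF.node a x y).ev =
      catOp C.seq.red (graftOp C.seq.red (-1) (C.cobarGen a.tot ⊗ₜ x.ev) ⊗ₜ y.ev) +
      sgn k (a.1.deg - 1) • nodeOp C.seq.red (a.tot ⊗ₜ (cobarDF C x.ev ⊗ₜ y.ev)) +
      sgn k (a.1.deg - 1 + x.deg (-1)) •
        nodeOp C.seq.red (a.tot ⊗ₜ (x.ev ⊗ₜ cobarDF C y.ev)) := by
  rw [cobarDF, elimF_ev, elimF_ev, elimF_ev, ← negOnePow_smul, ← negOnePow_smul]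
  rfl

theorem cobarDF_node (a : HEl C.seq.red) (x : DF C.seq.red) (y : Forests C.seq.red) :
    cobarDF C (nodeOp C.seq.red (a.tot ⊗ₜ (x.ev ⊗ₜ y))) =
      catOp C.seq.red (graftOp C.seq.red (-1) (C.cobarGen a.tot ⊗ₜ x.ev) ⊗ₜ y) +
      sgn k (a.1.deg - 1) • nodeOp C.seq.red (a.tot ⊗ₜ (cobarDF C x.ev ⊗ₜ y)) +
      sgn k (a.1.deg - 1 + x.deg (-1)) •
        nodeOp C.seq.red (a.tot ⊗ₜ (x.ev ⊗ₜ cobarDF C y)) := by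
  induction y using forests_induction with
  | ev y => rw [← DF.ev_node, cobarDF_node_ev]
  | add c d hc hd =>
    simp only [tmul_add, map_add, hc, hd, smul_add]
    abel
  | smul c d hd =>
    simp only [tmul_smul, map_smul, hd, smul_add, smul_comm c]

theorem cobarDF_tree (a : HEl C.seq.red) (x : Forests C.seq.red) :
    cobarDF C (treeOp C.seq.red (a.tot ⊗ₜ x)) =
      graftOp C.seq.red (-1) (C.cobarGen a.tot ⊗ₜ x) +
      sgn k (a.1.deg - 1) • treeOp C.seq.red (a.tot ⊗ₜ cobarDF C x) := by
  induction x using forests_induction with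
  | ev x => rw [treeOp_tmul, cobarDF_node, cobarDF_nil, catOp_nil_right, tmul_zero, tmul_zero,
      map_zero, smul_zero, add_zero, treeOp_tmul]
  | add c d hc hd =>
    simp only [tmul_add, map_add, hc, hd, smul_add]
    abel
  | smul c d hd =>
    simp only [tmul_smul, map_smul, hd, smul_add, smul_comm c]

theorem cobarDF_leafTree (e : C.seq.E) : cobarDF C (leafTree C.seq.red e) = 0 := by
  rw [leafTree, cobarDF_leafOp, cobarDF_nil, map_zero]

theorem cobarDF_leavesF (l : List C.seq.E) : cobarDF C (leavesF C.seq.red l) = 0 := by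
  induction l with
  | nil => exact cobarDF_nil
  | cons e l ih => rw [leavesF, cobarDF_leafOp, ih, map_zero]

theorem cobarDF_catOp_ev (x : DF C.seq.red) (y : Forests C.seq.red) :
    cobarDF C (catOp C.seq.red (x.ev ⊗ₜ y)) = catOp C.seq.red (cobarDF C x.ev ⊗ₜ y) +
      sgn k (x.deg (-1)) • catOp C.seq.red (x.ev ⊗ₜ cobarDF C y) := by
  induction x with
  | nil =>
    rw [DF.ev_nil, catOp_nil, cobarDF_nil, zero_tmul, map_zero, catOp_nil, DF.deg_nil, sgn_zero,
      one_smul, zero_add]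
  | leaf e f ih =>
    simp only [DF.ev_leaf, catOp_leafOp, cobarDF_leafOp, ih, DF.deg_leaf, map_add, map_smul]
  | node a ch f ih1 ih2 =>
    rw [DF.ev_node, catOp_nodeOp, cobarDF_node, ih2, cobarDF_node, catOp_nodeOp]
    simp only [add_tmul, tmul_add, map_add, tmul_smul, ← smul_tmul', map_smul, smul_add, smul_smul,
      catOp_assoc, catOp_nodeOp, ← sgn_add]
    rw [DF.deg_node, show a.1.deg - 1 + ch.deg (-1) + f.deg (-1) =
      a.1.deg + -1 + (ch.deg (-1) + f.deg (-1)) by ring]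
    abel

/-- `cobarDF` is a derivation for the concatenation of forests. -/
theorem cobarDF_catOp {t b : List C.seq.E} {n : ℤ} {x : Forests C.seq.red}
    (hx : x ∈ FS C.seq.red (-1) t b n) (y : Forests C.seq.red) :
    cobarDF C (catOp C.seq.red (x ⊗ₜ y)) = catOp C.seq.red (cobarDF C x ⊗ₜ y) +
      sgn k n • catOp C.seq.red (x ⊗ₜ cobarDF C y) := by
  refine FS_ext (f := cobarDF C ∘ₗ catOp C.seq.red ∘ₗ (tmk k (Forests C.seq.red) _).flip y)
    (g := catOp C.seq.red ∘ₗ (tmk k (Forests C.seq.red) _).flip y ∘ₗ cobarDF C +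
      sgn k n • catOp C.seq.red ∘ₗ (tmk k (Forests C.seq.red) _).flip (cobarDF C y))
    (fun x _ _ _ h4 => ?_) hx
  rw [← h4]
  exact cobarDF_catOp_ev x y

theorem cobarDF_mem {t b : List C.seq.E} {n : ℤ} {x : Forests C.seq.red}
    (hx : x ∈ FS C.seq.red (-1) t b n) : cobarDF C x ∈ FS C.seq.red (-1) t b (n - 1) := by
  refine FS_map_le (cobarDF C) _ (fun x h1 h2 h3 h4 => ?_) hx
  subst h2 h3 h4
  clear hx
  induction x with
  | nil => rw [DF.ev_nil, cobarDF_nil]; exact Submodule.zero_mem _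
  | leaf e f ih =>
    rw [DF.ev_leaf, cobarDF_leafOp]
    exact leafOp_mem e (ih h1)
  | node a ch f ih1 ih2 =>
    obtain ⟨g1, g2, g3⟩ := h1
    have hch : ch.ev ∈ FS C.seq.red (-1) ch.leaves a.1.top (ch.deg (-1)) :=
      ev_mem' ch g2 rfl g1 rfl
    have hD : cobarDF C ch.ev ∈ FS C.seq.red (-1) ch.leaves a.1.top (ch.deg (-1) - 1) := by
      rw [← show ch.roots = a.1.top from g1]; exact ih1 g2
    rw [cobarDF_node_ev, nodeOp_eq_catOp, nodeOp_eq_catOp]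
    refine Submodule.add_mem _ (Submodule.add_mem _ ?_ (Submodule.smul_mem _ _ ?_))
      (Submodule.smul_mem _ _ ?_)
    · exact FS_cast (catOp_mem (graftOp_mem (cobarGen_mem a) hch) (ev_mem (-1) f g3)) rfl rfl
        (by simp only [DF.deg_node]; ring)
    · exact FS_cast (catOp_mem (treeOp_mem (isIn_tot a) hD) (ev_mem (-1) f g3)) rfl rfl
        (by simp only [DF.deg_node]; ring)
    · exact FS_cast (catOp_mem (treeOp_mem (isIn_tot a) hch) (ih2 g3)) rfl rfl
        (by simp only [DF.deg_node]; ring)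

theorem cobarDF_graft_cat {t b t' b' u u' : List C.seq.E} {n n' m m' : ℤ}
    {x x' y y' : Forests C.seq.red} (hx : x ∈ FS C.seq.red (-1) t b n)
    (hx' : x' ∈ FS C.seq.red (-1) t' b' n') (hy : y ∈ FS C.seq.red (-1) u t m)
    (hy' : y' ∈ FS C.seq.red (-1) u' t' m')
    (h : cobarDF C (graftOp C.seq.red (-1) (x ⊗ₜ y)) = graftOp C.seq.red (-1) (cobarDF C x ⊗ₜ y) +
      sgn k n • graftOp C.seq.red (-1) (x ⊗ₜ cobarDF C y))
    (h' : cobarDF C (graftOp C.seq.red (-1) (x' ⊗ₜ y')) =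
      graftOp C.seq.red (-1) (cobarDF C x' ⊗ₜ y') +
      sgn k n' • graftOp C.seq.red (-1) (x' ⊗ₜ cobarDF C y')) :
    cobarDF C (graftOp C.seq.red (-1) (catOp C.seq.red (x ⊗ₜ x') ⊗ₜ catOp C.seq.red (y ⊗ₜ y'))) =
      graftOp C.seq.red (-1) (cobarDF C (catOp C.seq.red (x ⊗ₜ x')) ⊗ₜ catOp C.seq.red (y ⊗ₜ y')) +
      sgn k (n + n') • graftOp C.seq.red (-1)
        (catOp C.seq.red (x ⊗ₜ x') ⊗ₜ cobarDF C (catOp C.seq.red (y ⊗ₜ y'))) := by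
  rw [cobarDF_catOp hx, cobarDF_catOp hy, add_tmul, tmul_add, map_add, map_add, ← smul_tmul',
    tmul_smul, map_smul, map_smul, graftOp_catOp hx hx' hy hy', graftOp_catOp (cobarDF_mem hx) hx'
    hy hy', graftOp_catOp hx (cobarDF_mem hx') hy hy', graftOp_catOp hx hx' (cobarDF_mem hy) hy',
    graftOp_catOp hx hx' hy (cobarDF_mem hy'), map_smul, cobarDF_catOp (graftOp_mem hx hy), h, h']
  simp only [add_tmul, tmul_add, map_add, tmul_smul, ← smul_tmul', map_smul, smul_add, smul_smul, ←
      sgn_add]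
  have e1 : sgn k (n' * m + n) = sgn k (n + n' + n' * (m - 1)) := by
    apply sgn_congr; push_cast; grind
  have e2 : sgn k (n' * m + (n + m)) = sgn k (n + (n' - 1) * m) := by
    apply sgn_congr; push_cast; grind
  have e3 : sgn k (n' * m + (n + m + n')) = sgn k (n + n' + (m + n' * m)) := by
    apply sgn_congr; push_cast; grind
  rw [e1, e2, e3]
  abel

/-- `cobarDF` is a derivation for grafting. -/
theorem cobarDF_graftOp {t b u : List C.seq.E} {n m : ℤ} {x y : Forests C.seq.red}
    (hx : x ∈ FS C.seq.red (-1) t b n) (hy : y ∈ FS C.seq.red (-1) u t m) :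
    cobarDF C (graftOp C.seq.red (-1) (x ⊗ₜ y)) = graftOp C.seq.red (-1) (cobarDF C x ⊗ₜ y) +
      sgn k n • graftOp C.seq.red (-1) (x ⊗ₜ cobarDF C y) := by
  refine FS_ext₂ (f := cobarDF C ∘ₗ graftOp C.seq.red (-1))
    (g := graftOp C.seq.red (-1) ∘ₗ rTensor _ (cobarDF C) +
      sgn k n • graftOp C.seq.red (-1) ∘ₗ lTensor _ (cobarDF C))
    (fun x h1 h2 h3 h4 y g1 g2 g3 g4 => ?_) hx hy
  clear hx hy
  change cobarDF C (graftOp C.seq.red (-1) (x.ev ⊗ₜ y.ev)) =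
    graftOp C.seq.red (-1) (cobarDF C x.ev ⊗ₜ y.ev) +
      sgn k n • graftOp C.seq.red (-1) (x.ev ⊗ₜ cobarDF C y.ev)
  have hl : y.roots = x.leaves := by rw [g3, h2]
  rw [← h4]
  clear h2 h3 h4 g2 g3 g4
  have tree : ∀ (a : HEl C.seq.red) (x y : DF C.seq.red), x.WF → y.WF → y.roots = x.leaves →
      x.roots = a.1.top →
      cobarDF C (graftOp C.seq.red (-1) (x.ev ⊗ₜ y.ev)) =
        graftOp C.seq.red (-1) (cobarDF C x.ev ⊗ₜ y.ev) +
        sgn k (x.deg (-1)) • graftOp C.seq.red (-1) (x.ev ⊗ₜ cobarDF C y.ev) →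
      cobarDF C (graftOp C.seq.red (-1) (treeOp C.seq.red (a.tot ⊗ₜ x.ev) ⊗ₜ y.ev)) =
        graftOp C.seq.red (-1) (cobarDF C (treeOp C.seq.red (a.tot ⊗ₜ x.ev)) ⊗ₜ y.ev) +
        sgn k (a.1.deg + -1 + x.deg (-1)) •
          graftOp C.seq.red (-1) (treeOp C.seq.red (a.tot ⊗ₜ x.ev) ⊗ₜ cobarDF C y.ev) := by
    intro a x y hx hy hl hr h
    have mx : x.ev ∈ FS C.seq.red (-1) x.leaves a.1.top (x.deg (-1)) := ev_mem' x hx rfl hr rfl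
    have my : y.ev ∈ FS C.seq.red (-1) y.leaves x.leaves (y.deg (-1)) := ev_mem' y hy rfl hl rfl
    rw [graftOp_treeOp _ mx my, cobarDF_tree, cobarDF_tree, h, graftOp_treeOp _ mx (cobarDF_mem my),
      add_tmul, map_add, ← smul_tmul', map_smul, graftOp_treeOp _ (cobarDF_mem mx) my, graftOp_assoc
      (cobarGen_mem a) mx my, tmul_add, map_add, smul_add, tmul_smul, map_smul, smul_smul, ←
      sgn_add, ← sub_eq_add_neg, add_assoc]
  induction x generalizing y with
  | nil =>
    obtain rfl := y.eq_nil_of_roots hl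
    simp [graftOp_nil, cobarDF_nil]
  | leaf e f ih =>
    obtain ⟨y, z, rfl, hy, hz⟩ := y.exists_append [e] f.leaves hl
    rw [DF.wf_append] at g1
    rw [DF.ev_leaf, leafOp_eq_catOp, ← catOp_ev, DF.deg_leaf, ← zero_add (f.deg (-1))]
    have my : y.ev ∈ FS C.seq.red (-1) y.leaves [e] (y.deg (-1)) := ev_mem' y g1.1 rfl hy rfl
    refine cobarDF_graft_cat (leafTree_mem _ e) (ev_mem (-1) f h1) my (ev_mem' z g1.2 rfl hz rfl)
      ?_ (ih h1 z g1.2 hz)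
    have := graftOp_leavesF [e] my
    have h2 := graftOp_leavesF [e] (cobarDF_mem my)
    rw [cobarDF_leafTree, zero_tmul, map_zero, zero_add, sgn_zero, one_smul]
    exact (congrArg _ this).trans h2.symm
  | node a ch f ih1 ih2 =>
    obtain ⟨y, z, rfl, hy, hz⟩ := y.exists_append ch.leaves f.leaves hl
    rw [DF.wf_append] at g1
    have mch : ch.ev ∈ FS C.seq.red (-1) ch.leaves a.1.top (ch.deg (-1)) :=
      ev_mem' ch h1.2.1 rfl h1.1 rfl
    rw [DF.ev_node, nodeOp_eq_catOp, ← catOp_ev, DF.deg_node, ← add_assoc]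
    exact cobarDF_graft_cat (treeOp_mem (isIn_tot a) mch) (ev_mem (-1) f h1.2.2)
      (ev_mem' y g1.1 rfl hy rfl) (ev_mem' z g1.2 rfl hz rfl)
      (tree a ch y h1.2.1 g1.1 hy h1.1 (ih1 h1.2.1 y g1.1 hy)) (ih2 h1.2.2 z g1.2 hz)

theorem cobarDF_corolla (v : Tot C.seq.red) :
    cobarDF C (corolla C.seq.red v) = C.cobarGen v := by
  refine tot_ext (f := cobarDF C ∘ₗ corolla C.seq.red) (g := C.cobarGen) (fun a => ?_) v
  rw [lcomp_apply, corolla_tot, cobarDF_tree, cobarDF_leavesF, tmul_zero, map_zero, smul_zero,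
    add_zero, graftOp_leavesF_right _ (cobarGen_mem a)]

end CobarD

/-! ### The free algebra -/

section FreeAlgebra

variable {k : Type u} [Field k] {E : Type u} (V : Fam k E) (s : ℤ)

/-- The composition of the free algebra: grafting of trees. -/
def freeMul : Tot (freeFam V s) →ₗ[k] Words (freeFam V s) →ₗ[k] Tot (freeFam V s) :=
  TensorProduct.curry (projF V s ∘ₗ graftOp V s ∘ₗ
    tmap (inclF V s) (wordToForest V s))

/-- The units of the free algebra: the trees without vertices. -/
def freeUnit (e : E) : Tot (freeFam V s) := projF V s (leafTree V e)

variable {V s}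

theorem wordToForest_one : wordToForest V s 1 = nilF V := catLift_one _

theorem wordToForest_letter (c : Tot (freeFam V s)) :
    wordToForest V s (letter (freeFam V s) c) = inclF V s c := catLift_ι _ _

theorem wordToForest_letter_mul (c : Tot (freeFam V s)) (x : Words (freeFam V s)) :
    wordToForest V s (letter (freeFam V s) c * x) =
      catOp V (inclF V s c ⊗ₜ wordToForest V s x) := catLift_ι_mul ..

theorem wordToForest_mul (x y : Words (freeFam V s)) :
    wordToForest V s (x * y) = catOp V (wordToForest V s x ⊗ₜ wordToForest V s y) :=
  catLift_mul ..

theorem wordToForest_word_mem (l : List (HEl (freeFam V s))) {b : List E} (h : bots l = b) :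
    wordToForest V s (word l) ∈ FS V s (tops l) b (degs l) := by
  subst h
  exact wordToForest_mem (word_mem l)

theorem freeMul_apply (a : Tot (freeFam V s)) (x : Words (freeFam V s)) :
    freeMul V s a x = projF V s (graftOp V s (inclF V s a ⊗ₜ wordToForest V s x)) := rfl

theorem inclF_freeMul (a : Tot (freeFam V s)) (x : Words (freeFam V s)) :
    inclF V s (freeMul V s a x) = graftOp V s (inclF V s a ⊗ₜ wordToForest V s x) := by
  refine tot_ext (f := inclF V s ∘ₗ (freeMul V s).flip x)
    (g := graftOp V s ∘ₗ (tmk k (Forests V) _).flip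
      (wordToForest V s x) ∘ₗ inclF V s) (fun a => ?_) a
  refine words_ext (f := inclF V s ∘ₗ freeMul V s a.tot)
    (g := graftOp V s ∘ₗ tmk k (Forests V) _ (inclF V s a.tot) ∘ₗ
      wordToForest V s) (fun l => ?_) x
  change inclF V s (projF V s (graftOp V s (inclF V s a.tot ⊗ₜ wordToForest V s (word l)))) =
      graftOp V s (inclF V s a.tot ⊗ₜ wordToForest V s (word l))
  by_cases h : bots l = a.1.top
  · exact inclF_projF (graftOp_mem (inclF_tot_mem a) (wordToForest_word_mem l h))
  · rw [graftOp_eq_zero_of_mem (inclF_tot_mem a) (wordToForest_word_mem l rfl) h, map_zero,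
      map_zero]

theorem inclF_freeUnit (e : E) : inclF V s (freeUnit V s e) = leafTree V e :=
  inclF_projF (leafTree_mem s e)

theorem freeUnit_mem (e : E) : IsIn (freeFam V s) [e] e 0 (freeUnit V s e) :=
  isIn_freeFam_iff.2 (by rw [inclF_freeUnit]; exact leafTree_mem s e)

theorem wordToForest_units (l : List E) :
    wordToForest V s (l.map fun e => letter (freeFam V s) (freeUnit V s e)).prod =
      leavesF V l := by
  induction l with
  | nil => exact wordToForest_one
  | cons e l ih =>
    rw [List.map_cons, List.prod_cons, wordToForest_letter_mul, ih, inclF_freeUnit, leavesF,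
      leafOp_eq_catOp]

theorem bots_flatMap_snd {X : Fam k E} (m : List (HEl X × List (HEl X)))
    (h : ∀ x ∈ m, bots x.2 = x.1.1.top) : bots (m.flatMap Prod.snd) = tops (m.map Prod.fst) := by
  induction m with
  | nil => rfl
  | cons x m ih =>
    rw [List.forall_mem_cons] at h
    rw [List.flatMap_cons, bots_append, List.map_cons, tops_cons, ih h.2, h.1]

theorem wordToForest_koszul (m : List (HEl (freeFam V s) × List (HEl (freeFam V s))))
    (hm : ∀ x ∈ m, bots x.2 = x.1.1.top) :
    graftOp V s (wordToForest V s (word (m.map Prod.fst)) ⊗ₜ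
      wordToForest V s (word (m.flatMap Prod.snd))) = koszul m • wordToForest V s
        (m.map fun x => letter (freeFam V s) (freeMul V s x.1.tot (word x.2))).prod := by
  induction m with
  | nil =>
    rw [koszul, one_smul]
    change graftOp V s (wordToForest V s 1 ⊗ₜ wordToForest V s 1) = wordToForest V s 1
    rw [wordToForest_one, graftOp_nil]
  | cons x m ih =>
    obtain ⟨b, l⟩ := x
    rw [List.forall_mem_cons] at hm
    have h2 : wordToForest V s (word (((b, l) :: m).flatMap Prod.snd)) =
      catOp V (wordToForest V s (word l) ⊗ₜ wordToForest V s (word (m.flatMap Prod.snd))) := by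
      rw [List.flatMap_cons, word_append, wordToForest_mul]
    rw [h2, List.map_cons, word_cons, wordToForest_letter_mul]
    refine (graftOp_catOp (inclF_tot_mem b) (wordToForest_word_mem _ rfl)
      (wordToForest_word_mem l hm.1) (wordToForest_word_mem _ (bots_flatMap_snd m hm.2))).trans ?_
    rw [ih hm.2, List.map_cons, List.prod_cons, wordToForest_letter_mul, inclF_freeMul, koszul,
      mul_smul, negOnePow_smul (k := k), mul_comm (degs l), Units.smul_def, Units.smul_def,
      tmul_smul, map_zsmul]

theorem freeMul_mem (a : HEl (freeFam V s)) (l : List (HEl (freeFam V s)))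
    (h : bots l = a.1.top) :
    IsIn (freeFam V s) (tops l) a.1.bot (a.1.deg + degs l) (freeMul V s a.tot (word l)) :=
  isIn_freeFam_iff.2 (by
    rw [inclF_freeMul]
    exact graftOp_mem (inclF_tot_mem a) (wordToForest_word_mem l h))

theorem freeMul_eq_zero (a : HEl (freeFam V s)) (l : List (HEl (freeFam V s)))
    (h : bots l ≠ a.1.top) : freeMul V s a.tot (word l) = 0 := by
  rw [freeMul_apply, graftOp_eq_zero_of_mem (inclF_tot_mem a) (wordToForest_word_mem l rfl) h,
    map_zero]

theorem freeMul_assoc (a : HEl (freeFam V s))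
    (m : List (HEl (freeFam V s) × List (HEl (freeFam V s))))
    (h1 : bots (m.map Prod.fst) = a.1.top) (h2 : ∀ x ∈ m, bots x.2 = x.1.1.top) :
    freeMul V s (freeMul V s a.tot (word (m.map Prod.fst))) (word (m.flatMap Prod.snd)) =
      koszul m • freeMul V s a.tot
        (m.map fun x => letter (freeFam V s) (freeMul V s x.1.tot (word x.2))).prod := by
  apply inclF_injective
  rw [inclF_freeMul, inclF_freeMul, graftOp_assoc (inclF_tot_mem a) (wordToForest_word_mem _ h1)
    (wordToForest_word_mem _ (bots_flatMap_snd m h2)), wordToForest_koszul m h2, Units.smul_def,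
    Units.smul_def, map_zsmul, inclF_freeMul, tmul_smul, map_zsmul]

theorem freeUnit_mul (a : HEl (freeFam V s)) :
    freeMul V s (freeUnit V s a.1.bot) (letter (freeFam V s) a.tot) = a.tot := inclF_injective (by
  rw [inclF_freeMul, inclF_freeUnit, wordToForest_letter]
  exact graftOp_leavesF [a.1.bot] (inclF_tot_mem a))

theorem freeMul_unit (a : HEl (freeFam V s)) :
    freeMul V s a.tot (a.1.top.map fun e => letter (freeFam V s) (freeUnit V s e)).prod = a.tot :=
  inclF_injective (by
    rw [inclF_freeMul, wordToForest_units, graftOp_leavesF_right _ (inclF_tot_mem a)])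

/-- Trees of nonzero degree, or with more than one leaf, have no component without vertices. -/
theorem leafCoeff_eq_zero {t : List E} {b : E} {n : ℤ}
    {x : Forests V} (hx : x ∈ FS V s t [b] n) (h : (⟨t, b, n⟩ : GCell E) ≠ ⟨[b], b, 0⟩) :
    leafCoeff V x = 0 := by
  refine FS_ext (f := leafCoeff V) (g := 0) (fun x _ h2 h3 h4 => ?_) hx
  rcases x.tree_cases b h3 with rfl | ⟨a, ch, rfl, -⟩
  · exact absurd (by rw [← h2, ← h4]; rfl) h
  · rw [← treeOp_ev, leafCoeff_tree]
    rfl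

theorem leafCoeff_graft_treeOp {t b u : List E} {n m : ℤ}
    (v : Tot V) {x y : Forests V} (hx : x ∈ FS V s t b n) (hy : y ∈ FS V s u t m) :
    leafCoeff V (graftOp V s (treeOp V (v ⊗ₜ x) ⊗ₜ y)) = 0 := by
  rw [graftOp_treeOp v hx hy, leafCoeff_tree]

theorem leafCoeff_freeMul (a : HEl (freeFam V s)) (l : List (HEl (freeFam V s)))
    (h : bots l = a.1.top) :
    leafCoeff V (inclF V s (freeMul V s a.tot (word l))) = leafCoeff V (inclF V s a.tot) *
      (l.map fun b => leafCoeff V (inclF V s b.tot)).prod := by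
  have h2 := wordToForest_word_mem l h
  rw [inclF_freeMul]
  refine FS_ext (f := leafCoeff V ∘ₗ graftOp V s ∘ₗ
    (tmk k (Forests V) _).flip (wordToForest V s (word l)))
    (g := mulRight k ((l.map fun b => leafCoeff V (inclF V s b.tot)).prod) ∘ₗ
      leafCoeff V) (fun x h1 g2 h3 _ => ?_) (inclF_tot_mem a)
  simp only [lcomp_apply, LinearMap.flip_apply, mk_apply, mulRight_apply]
  rcases x.tree_cases a.1.bot h3 with rfl | ⟨b, ch, rfl, -⟩
  · have ht : a.1.top = [a.1.bot] := g2.symm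
    rw [← leafTree_eq_ev, leafCoeff_leafTree, one_mul]
    rw [ht] at h2 h
    refine (congrArg (leafCoeff V) (graftOp_leavesF [a.1.bot] h2)).trans ?_
    obtain ⟨c, rfl⟩ : ∃ c, l = [c] := by
      rw [← List.length_eq_one_iff, ← List.length_map (f := fun b : HEl (freeFam V s) => b.1.bot)]
      exact congrArg List.length h
    rw [word_cons, word_nil, mul_one, List.map_singleton, List.prod_singleton]
    exact congrArg (leafCoeff V) (wordToForest_letter _)
  · rw [← treeOp_ev, leafCoeff_tree, zero_mul]
    have hch : ch.ev ∈ FS V s a.1.top b.1.top (ch.deg s) :=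
      ev_mem' ch h1.2.1 (by simpa using g2) h1.1 rfl
    exact leafCoeff_graft_treeOp _ hch h2

theorem inclF_sg_tot (a : HEl (freeFam V s)) :
    inclF V s (sg (freeFam V s) a.tot) = sgn k a.1.deg • inclF V s a.tot := by
  rw [sg_tot, map_smul]

/-- A map of degree `-1` on forests which preserves leaves and roots restricts to trees. -/
theorem inclF_diff {D : Forests V →ₗ[k] Forests V} (hD : ∀ {t b : List E} {n : ℤ} {x : Forests V},
    x ∈ FS V s t b n → D x ∈ FS V s t b (n - 1)) (z : Tot (freeFam V s)) :
    inclF V s (projF V s (D (inclF V s z))) = D (inclF V s z) := by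
  refine tot_ext (f := inclF V s ∘ₗ projF V s ∘ₗ D ∘ₗ inclF V s) (g := D ∘ₗ inclF V s)
    (fun a => ?_) z
  exact inclF_projF (hD (inclF_tot_mem a))

theorem wordToForest_diff {D : Forests V →ₗ[k] Forests V} (hD : ∀ {t b : List E} {n : ℤ}
    {x : Forests V}, x ∈ FS V s t b n → D x ∈ FS V s t b (n - 1)) (hnil : D (nilF V) = 0)
    (hcat : ∀ {t b : List E} {n : ℤ} {x : Forests V}, x ∈ FS V s t b n → ∀ y,
      D (catOp V (x ⊗ₜ y)) = catOp V (D x ⊗ₜ y) + sgn k n • catOp V (x ⊗ₜ D y))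
    (x : Words (freeFam V s)) :
    wordToForest V s (wordD (freeFam V s) (projF V s ∘ₗ D ∘ₗ inclF V s) x) =
      D (wordToForest V s x) := by
  refine words_ext (f := wordToForest V s ∘ₗ wordD (freeFam V s) (projF V s ∘ₗ D ∘ₗ inclF V s))
    (g := D ∘ₗ wordToForest V s) (fun l => ?_) x
  rw [lcomp_apply, lcomp_apply]
  induction l with
  | nil => rw [word_nil, wordD_one, map_zero, wordToForest_one, hnil]
  | cons c l ih =>
    rw [word_cons, wordD_letter_mul, map_add, wordToForest_letter_mul, wordToForest_letter_mul,
      wordToForest_letter_mul, ih, hcat (inclF_tot_mem c), lcomp_apply, lcomp_apply, inclF_diff hD,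
      inclF_sg_tot, ← smul_tmul', map_smul, add_comm]

end FreeAlgebra

/-! ### The cobar construction as an algebra -/

section CobarObject

variable {k : Type u} [Field k] {I : Type w} (C : TwoCoCat k I)

/-- The differential of the cobar construction. -/
abbrev cobarDiff : Tot (freeFam C.seq.red (-1)) →ₗ[k] Tot (freeFam C.seq.red (-1)) :=
  projF C.seq.red (-1) ∘ₗ cobarDF C ∘ₗ inclF C.seq.red (-1)

variable {C}

theorem inclF_cobarDiff (z : Tot (freeFam C.seq.red (-1))) :
    inclF C.seq.red (-1) (cobarDiff C z) = cobarDF C (inclF C.seq.red (-1) z) :=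
  inclF_diff cobarDF_mem z

theorem wordToForest_cobarDiff (x : Words (freeFam C.seq.red (-1))) :
    wordToForest C.seq.red (-1) (wordD (freeFam C.seq.red (-1)) (cobarDiff C) x) =
      cobarDF C (wordToForest C.seq.red (-1) x) :=
  wordToForest_diff cobarDF_mem cobarDF_nil cobarDF_catOp x

theorem cobarDiff_freeMul (a : Tot (freeFam C.seq.red (-1)))
    (x : Words (freeFam C.seq.red (-1))) :
    cobarDiff C (freeMul C.seq.red (-1) a x) = freeMul C.seq.red (-1) (cobarDiff C a) x +
      freeMul C.seq.red (-1) (sg (freeFam C.seq.red (-1)) a)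
        (wordD (freeFam C.seq.red (-1)) (cobarDiff C) x) := by
  refine tot_ext (f := cobarDiff C ∘ₗ (freeMul C.seq.red (-1)).flip x)
    (g := (freeMul C.seq.red (-1)).flip x ∘ₗ cobarDiff C + (freeMul C.seq.red (-1)).flip
      (wordD (freeFam C.seq.red (-1)) (cobarDiff C) x) ∘ₗ sg (freeFam C.seq.red (-1)))
    (fun a => ?_) a
  refine words_ext (f := cobarDiff C ∘ₗ freeMul C.seq.red (-1) a.tot)
    (g := freeMul C.seq.red (-1) (cobarDiff C a.tot) + freeMul C.seq.red (-1)
      (sg (freeFam C.seq.red (-1)) a.tot) ∘ₗ wordD (freeFam C.seq.red (-1)) (cobarDiff C))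
    (fun l => ?_) x
  apply inclF_injective
  rw [lcomp_apply, ladd_apply, lcomp_apply (f := freeMul _ _ _), map_add]
  refine (inclF_cobarDiff _).trans ?_
  rw [inclF_freeMul, inclF_freeMul, inclF_freeMul, inclF_sg_tot, wordToForest_cobarDiff,
    inclF_cobarDiff, ← smul_tmul', map_smul]
  have g1 := inclF_tot_mem a
  by_cases h : bots l = a.1.top
  · exact cobarDF_graftOp g1 (wordToForest_word_mem l h)
  · have g2 := wordToForest_word_mem l rfl
    rw [graftOp_eq_zero_of_mem g1 g2 h, graftOp_eq_zero_of_mem (cobarDF_mem g1) g2 h,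
      graftOp_eq_zero_of_mem g1 (cobarDF_mem g2) h]
    simp

/-- The laws of the cobar construction, except for `d ∘ d = 0`. -/
theorem cobar_preCat (C : TwoCoCat k I) : PreCat C.cobar where
  unit_mem e := freeUnit_mem (V := C.seq.red) e
  d_unit e := inclF_injective (V := C.seq.red) ((inclF_cobarDiff _).trans
    ((congrArg _ (inclF_freeUnit e)).trans ((cobarDF_leafTree e).trans (map_zero _).symm)))
  mul_assoc := freeMul_assoc (V := C.seq.red)
  unit_mul := freeUnit_mul (V := C.seq.red)
  mul_unit := freeMul_unit (V := C.seq.red)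
  d_mul := cobarDiff_freeMul

/-- The elements of the cobar construction as sums of trees. -/
abbrev cobarInc (C : TwoCoCat k I) : Tot C.cobar.X →ₗ[k] Forests C.seq.red :=
  inclF C.seq.red (-1)

/-- The words in the elements of the cobar construction as sums of forests. -/
abbrev cobarWords (C : TwoCoCat k I) : Words C.cobar.X →ₗ[k] Forests C.seq.red :=
  wordToForest C.seq.red (-1)

theorem cobarWords_letter_mul (c : Tot C.cobar.X) (x : Words C.cobar.X) :
    cobarWords C (letter C.cobar.X c * x) =
      catOp C.seq.red (cobarInc C c ⊗ₜ cobarWords C x) := catLift_ι_mul ..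

theorem cobarInc_d (z : Tot C.cobar.X) :
    cobarInc C (C.cobar.d z) = cobarDF C (cobarInc C z) := inclF_cobarDiff z

theorem cobarInc_unit (e : C.seq.E) :
    cobarInc C (C.cobar.unit e) = leafTree C.seq.red e := inclF_freeUnit e

theorem cobarInc_mem (a : HEl C.cobar.X) :
    cobarInc C a.tot ∈ FS C.seq.red (-1) a.1.top [a.1.bot] a.1.deg :=
  inclF_tot_mem (V := C.seq.red) a

theorem cobarInc_mul (a : Tot C.cobar.X) (x : Words C.cobar.X) :
    cobarInc C (C.cobar.mul a x) =
      graftOp C.seq.red (-1) (cobarInc C a ⊗ₜ cobarWords C x) := inclF_freeMul a x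

theorem cobarInc_injective : Function.Injective (cobarInc C) := inclF_injective

theorem cobar_isIn_iff {t : List C.seq.E} {b : C.seq.E} {n : ℤ} {z : Tot C.cobar.X} :
    IsIn C.cobar.X t b n z ↔ cobarInc C z ∈ FS C.seq.red (-1) t [b] n :=
  isIn_freeFam_iff (V := C.seq.red)

/-! ### The universal twisting cochain of the cobar construction -/

theorem cobarInc_cobarIncl (c : Tot C.seq.X) : cobarInc C (C.cobarIncl c) =
    corolla C.seq.red (SeqData.ret C.isTwoCoCat.isComplex c) := by
  refine tot_ext (f := cobarInc C ∘ₗ C.cobarIncl)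
    (g := corolla C.seq.red ∘ₗ SeqData.ret C.isTwoCoCat.isComplex) (fun a => ?_) c
  exact inclF_projF (corolla_mem (-1) (ret_mem C.isTwoCoCat.isComplex (isIn_tot a)))

theorem cobarIncl_mem (a : HEl C.seq.X) :
    IsIn C.cobar.X a.1.top a.1.bot (a.1.deg - 1) (C.cobarIncl a.tot) :=
  cobar_isIn_iff.2 (by
    rw [cobarInc_cobarIncl]
    exact corolla_mem (-1) (ret_mem C.isTwoCoCat.isComplex (isIn_tot a)))

/-- The 1-morphisms of the cobar construction. -/
def cobarCol (C : TwoCoCat k I) (e : C.seq.E) : C.cobar.E := e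

theorem cobarInc_augUnit (c : Tot C.seq.X) :
    cobarInc C (augUnit C.data C.cobar (cobarCol C) c) = augLeaf C.seq c := by
  refine tot_ext (f := cobarInc C ∘ₗ augUnit C.data C.cobar (cobarCol C)) (g := augLeaf C.seq)
    (fun a => ?_) c
  rw [lcomp_apply, augUnit_tot, map_smul, augLeaf_tot]
  exact congrArg _ (cobarInc_unit _)

theorem cobarWords_insertAug (x : Words C.seq.X) :
    cobarWords C (insertAug C.data C.cobar (cobarCol C) C.cobarIncl x) = C.wordToVertex x := by
  have h1 : ∀ x, cobarWords C (augUnits C.data C.cobar (cobarCol C) x) = catLift (augLeaf C.seq) x :=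
    fun x => (catLift_wordMap _ _ x).trans (congrArg (fun g => catLift g x)
      (LinearMap.ext fun c => cobarInc_augUnit c))
  refine tensorAlgebra_ext (f := cobarWords C ∘ₗ insertAug C.data C.cobar (cobarCol C) C.cobarIncl)
    (g := C.wordToVertex) ?_ (fun c x h => ?_) x
  · rw [lcomp_apply, insertAug_one, map_zero, wordToVertex_eq, catInsert_one]
  · rw [lcomp_apply, insertAug_letter_mul, map_add, cobarWords_letter_mul, cobarWords_letter_mul,
      h1, cobarInc_augUnit, cobarInc_cobarIncl, wordToVertex_eq, catInsert_ι_mul, ← wordToVertex_eq,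
      ← h]
    rfl

theorem cobarInc_starOp (c : Tot C.seq.X) :
    cobarInc C (starOp C.data C.cobar (cobarCol C) C.cobarIncl c) = cobarQuad C c := by
  refine tot_ext (f := cobarInc C ∘ₗ starOp C.data C.cobar (cobarCol C) C.cobarIncl) (g := cobarQuad C)
    (fun c => ?_) c
  refine C.isTwoCoCat.preCocat.comul_ext c
    (f := cobarInc C ∘ₗ TensorProduct.lift C.cobar.mul ∘ₗ tmap
      (C.cobarIncl ∘ₗ sg C.seq.X) (insertAug C.data C.cobar (cobarCol C) C.cobarIncl))
    (g := treeOp C.seq.red ∘ₗ tmap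
      (SeqData.ret C.isTwoCoCat.isComplex ∘ₗ sg C.seq.X) C.wordToVertex) (fun a l h1 _ _ _ => ?_)
  simp only [lcomp_apply, map_tmul, TensorProduct.lift.tmul]
  have h := wordToVertex_mem l
  rw [h1] at h
  rw [cobarInc_mul, cobarInc_cobarIncl, cobarWords_insertAug]
  exact corolla_graftOp (ret_sg_mem a) h

theorem cobarQuad_unit (e : C.seq.E) : cobarQuad C (C.seq.unit e) = 0 := by
  have h := C.isTwoCoCat.comul_unit e
  have h' : sg C.seq.X (C.seq.unit e) = C.seq.unit e := by
    rw [(C.isTwoCoCat.isComplex.unit_mem e).sg, sgn_zero, one_smul]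
  rw [cobarQuad, lcomp_apply, lcomp_apply, h, map_tmul, lcomp_apply, h', ret_unit, zero_tmul,
    map_zero]

/-- The inclusion of the generators satisfies the Maurer–Cartan equation. -/
theorem cobarIncl_maurerCartan (C : TwoCoCat k I) :
    C.cobar.d ∘ₗ C.cobarIncl + C.cobarIncl ∘ₗ C.seq.d + starOp C.data C.cobar (cobarCol C) C.cobarIncl =
      0 := by
  refine LinearMap.ext fun c => cobarInc_injective ?_
  have hc := C.isTwoCoCat.isComplex
  simp only [ladd_apply, lcomp_apply, map_add, lzero_apply, map_zero]
  rw [cobarInc_d, cobarInc_cobarIncl, cobarInc_cobarIncl, cobarInc_starOp, cobarDF_corolla]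
  refine ext_reduced hc (f := C.cobarGen ∘ₗ SeqData.ret hc + corolla C.seq.red ∘ₗ
    SeqData.ret hc ∘ₗ C.seq.d + cobarQuad C) (g := 0) (fun v => ?_) (fun e => ?_) c
  · simp only [ladd_apply, lcomp_apply]
    rw [ret_inc, cobarGen_apply, lzero_apply]
    abel
  · simp only [ladd_apply, lcomp_apply]
    rw [ret_unit, hc.d_unit, cobarQuad_unit]
    simp

theorem cobarIncl_mem' (a : HEl C.seq.X) :
    IsIn C.cobar.X (a.1.top.map (cobarCol C)) (cobarCol C a.1.bot) (a.1.deg - 1)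
      (C.cobarIncl a.tot) := by
  have h : a.1.top.map (cobarCol C) = a.1.top := List.map_id _
  rw [h]
  exact cobarIncl_mem a

theorem cobarDF_cobarGen (v : Tot C.seq.red) : cobarDF C (C.cobarGen v) = 0 := by
  have h := bianchi C.isTwoCoCat.preCocat (cobar_preCat C) C.cobarIncl cobarIncl_mem'
    (cobarIncl_maurerCartan C) (C.seq.inc v)
  have h2 : C.seq.d (C.seq.d (C.seq.inc v)) = 0 :=
    congrArg (fun f => f (C.seq.inc v)) C.isTwoCoCat.isComplex.d_d
  have h3 := congrArg (cobarInc C) (h.trans ((congrArg C.cobarIncl h2).trans (map_zero _)))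
  rwa [cobarInc_d, cobarInc_d, cobarInc_cobarIncl, ret_inc, cobarDF_corolla, map_zero] at h3

/-- The differential of the cobar construction squares to zero: it is a derivation, and on the
generators this is the Bianchi identity for the inclusion of the generators. -/
theorem cobarDF_sq {t b : List C.seq.E} {n : ℤ} {x : Forests C.seq.red}
    (hx : x ∈ FS C.seq.red (-1) t b n) : cobarDF C (cobarDF C x) = 0 := by
  refine FS_ext (f := cobarDF C ∘ₗ cobarDF C) (g := 0) (fun x h1 h2 h3 h4 => ?_) hx
  clear h2 h3 h4 hx
  rw [lcomp_apply, lzero_apply]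
  induction x with
  | nil => rw [DF.ev_nil, cobarDF_nil, map_zero]
  | leaf e f ih => rw [DF.ev_leaf, cobarDF_leafOp, cobarDF_leafOp, ih h1, map_zero]
  | node a ch f ih1 ih2 =>
    have hch : ch.ev ∈ FS C.seq.red (-1) ch.leaves a.1.top (ch.deg (-1)) :=
      ev_mem' ch h1.2.1 rfl h1.1 rfl
    have ht := treeOp_mem (isIn_tot a) hch
    have h : cobarDF C (cobarDF C (treeOp C.seq.red (a.tot ⊗ₜ ch.ev))) = 0 := by
      rw [cobarDF_tree, map_add, map_smul, cobarDF_tree, ih1 h1.2.1,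
        cobarDF_graftOp (cobarGen_mem a) hch, cobarDF_cobarGen, tmul_zero, map_zero,
        smul_zero, add_zero, zero_tmul, map_zero, zero_add, ← add_smul,
        sub_eq_add_neg (a.1.deg - 1), sgn_add, sgn_odd (by decide : Odd (-1 : ℤ))]
      simp
    rw [DF.ev_node, nodeOp_eq_catOp, cobarDF_catOp ht, map_add, map_smul,
      cobarDF_catOp (cobarDF_mem ht), cobarDF_catOp ht, h, ih2 h1.2.2, tmul_zero,
      zero_tmul, map_zero, smul_zero, add_zero, zero_add, ← add_smul,
      sub_eq_add_neg, sgn_add _ (-1 : ℤ), sgn_odd (by decide : Odd (-1 : ℤ))]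
    simp

theorem leafCoeff_graft_cobarGen (a : HEl C.seq.red) {u : List C.seq.E} {m : ℤ}
    {y : Forests C.seq.red} (hy : y ∈ FS C.seq.red (-1) u a.1.top m) :
    leafCoeff C.seq.red (graftOp C.seq.red (-1) (C.cobarGen a.tot ⊗ₜ y)) = 0 := by
  rw [cobarGen_apply, TensorProduct.sub_tmul, map_sub, map_sub, TensorProduct.neg_tmul, map_neg,
    map_neg]
  have h1 : leafCoeff C.seq.red (graftOp C.seq.red (-1) (corolla C.seq.red
      (SeqData.ret C.isTwoCoCat.isComplex (C.seq.d (C.seq.inc a.tot))) ⊗ₜ y)) = 0 := by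
    rw [corolla_graftOp (ret_mem _ (d_inc_mem a)) hy, leafCoeff_tree]
  have h2 : leafCoeff C.seq.red (graftOp C.seq.red (-1)
      (cobarQuad C (C.seq.inc a.tot) ⊗ₜ y)) = 0 := by
    obtain ⟨c, hc, hc'⟩ := (inc_mem (isIn_tot a)).exists_tot
    rw [← hc']
    obtain ⟨L, hL⟩ : ∃ L : Tot C.seq.red ⊗[k] Forests C.seq.red →ₗ[k] k, ∀ z,
        L z = leafCoeff C.seq.red (graftOp C.seq.red (-1) (treeOp C.seq.red z ⊗ₜ y)) :=
      ⟨leafCoeff C.seq.red ∘ₗ graftOp C.seq.red (-1) ∘ₗ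
        (tmk k (Forests C.seq.red) _).flip y ∘ₗ treeOp C.seq.red, fun _ => rfl⟩
    refine (hL (tmap (SeqData.ret C.isTwoCoCat.isComplex ∘ₗ sg C.seq.X)
      C.wordToVertex (C.data.comul c.tot))).symm.trans ?_
    have key := C.isTwoCoCat.preCocat.comul_ext c (f := L ∘ₗ tmap
        (SeqData.ret C.isTwoCoCat.isComplex ∘ₗ sg C.seq.X) C.wordToVertex) (g := 0)
      (fun b l h1 h2 _ _ => by
        have hw := wordToVertex_mem l
        rw [h2, hc] at hw
        rw [lcomp_apply, map_tmul, hL, lzero_apply]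
        exact leafCoeff_graft_treeOp _ hw hy)
    exact key
  rw [h1, h2, neg_zero, sub_zero]

theorem leafCoeff_cobarDF {t : List C.seq.E} {b : C.seq.E} {n : ℤ} {x : Forests C.seq.red}
    (hx : x ∈ FS C.seq.red (-1) t [b] n) : leafCoeff C.seq.red (cobarDF C x) = 0 := by
  refine FS_ext (f := leafCoeff C.seq.red ∘ₗ cobarDF C) (g := 0) (fun x h1 _ h3 _ => ?_) hx
  rw [lcomp_apply, lzero_apply]
  rcases x.tree_cases b h3 with rfl | ⟨a, ch, rfl, -⟩
  · rw [← leafTree_eq_ev, cobarDF_leafTree, map_zero]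
  · rw [← treeOp_ev, cobarDF_tree, map_add, map_smul, leafCoeff_tree, smul_zero, add_zero]
    exact leafCoeff_graft_cobarGen a (ev_mem' ch h1.2.1 rfl h1.1 rfl)

theorem cobar_isPath (i j : I) (s : List C.seq.E) :
    C.cobar.IsPath i s j ↔ C.seq.IsPath i s j := by
  induction s generalizing i with
  | nil => exact Iff.rfl
  | cons e s ih => exact and_congr Iff.rfl (ih _)

theorem cobar_isComplex (C : TwoCoCat k I) : C.cobar.IsComplex where
  supp p hp := freeFam_supp (S := C.seq) C.isTwoCoCat.isComplex.supp (-1) p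
    fun h => hp ⟨h.1, (cobar_isPath _ _ _).2 h.2⟩
  d_mem p x := cobar_isIn_iff.2 (by
    rw [cobarInc_d]; exact cobarDF_mem (cobarInc_mem (C := C) ⟨p, x⟩))
  d_d := by
    refine LinearMap.ext fun z => cobarInc_injective (tot_ext (f := cobarInc C ∘ₗ C.cobar.d ∘ₗ C.cobar.d)
      (g := cobarInc C ∘ₗ 0) (fun a => ?_) z)
    rw [lcomp_apply, lcomp_apply, cobarInc_d, cobarInc_d, cobarDF_sq (cobarInc_mem a),
      LinearMap.comp_zero, lzero_apply]
  unit_mem := (cobar_preCat C).unit_mem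
  d_unit := (cobar_preCat C).d_unit
  aug_off p x hp := leafCoeff_eq_zero (cobarInc_mem (C := C) ⟨p, x⟩) hp
  aug_unit e := (congrArg (leafCoeff C.seq.red) (cobarInc_unit e)).trans (leafCoeff_leafTree e)
  aug_d := by
    refine LinearMap.ext fun z => tot_ext (f := C.cobar.aug ∘ₗ C.cobar.d) (g := 0) (fun a => ?_) z
    exact (congrArg (leafCoeff C.seq.red) (cobarInc_d a.tot)).trans
      (leafCoeff_cobarDF (cobarInc_mem a))

/-- The cobar construction is an object of 2-Cat_I. -/
theorem cobar_isTwoCat (C : TwoCoCat k I) : C.cobar.IsTwoCat where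
  isComplex := cobar_isComplex C
  mul_mem := freeMul_mem (V := C.seq.red)
  mul_zero := freeMul_eq_zero (V := C.seq.red)
  mul_assoc := (cobar_preCat C).mul_assoc
  unit_mul := (cobar_preCat C).unit_mul
  mul_unit := (cobar_preCat C).mul_unit
  d_mul := (cobar_preCat C).d_mul
  aug_mul := leafCoeff_freeMul (V := C.seq.red)

end CobarObject

/-! ### The free algebra: extension of maps -/

section Extension

variable {k : Type u} [Field k] {I : Type w} {E : Type u}

theorem TwoCatData.IsTwoCat.mul_isIn {A : TwoCatData k I} (hA : A.IsTwoCat)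
    {t u : List A.E} {b : A.E} {n m : ℤ} {a : Tot A.X} (ha : IsIn A.X t b n a) {x : Words A.X}
    (hx : x ∈ WS A.X u t m) : IsIn A.X u b (n + m) (A.mul a x) := by
  obtain ⟨a, ha', rfl⟩ := ha.exists_tot
  refine WS_map_le (A.mul a.tot) (LinearMap.range (of A.X ⟨u, b, n + m⟩)) (fun l h1 h2 h3 => ?_) hx
  have h := hA.mul_mem a l (by rw [h2, ha'])
  rw [h1, h3, ha'] at h
  exact h

variable (V : Fam k E) (A : TwoCatData k I) (col : E → A.E) (γ : Tot V →ₗ[k] Tot A.X)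

/-- The extension of a map `γ : V → A` to forests: each tree is evaluated by means of the
composition of `A`. -/
def extForest : ∀ f : PForest E, f.mod V →ₗ[k] Words A.X
  | PForest.nil => LinearMap.toSpanSingleton k _ 1
  | PForest.leaf e f => mulLeft k (letter A.X (A.unit (col e))) ∘ₗ extForest f
  | PForest.node p ch f =>
    LinearMap.mul' k _ ∘ₗ
      tmap (letter A.X ∘ₗ TensorProduct.lift A.mul ∘ₗ
        tmap (γ ∘ₗ of V p) (extForest ch)) (extForest f) ∘ₗ
      (tassoc k (V p) (ch.mod V) (f.mod V)).symm.toLinearMap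

/-- The map from forests to words defined by `extForest`. -/
def extWord : Forests V →ₗ[k] Words A.X := elimF (extForest V A col γ)

/-- The map from trees to elements defined by `extForest`. -/
def extTree : Forests V →ₗ[k] Tot A.X := TensorAlgebra.ιInv ∘ₗ extWord V A col γ

variable {V A col γ} {s : ℤ}

theorem extWord_nil : extWord V A col γ (nilF V) = 1 := by
  refine (elimF_ofF (extForest V A col γ) PForest.nil _).trans ?_
  exact one_smul k (1 : Words A.X)

theorem extWord_leafOp (e : E) (x : Forests V) :
    extWord V A col γ (leafOp V e x) =
      letter A.X (A.unit (col e)) * extWord V A col γ x := by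
  refine forests_ext (f := extWord V A col γ ∘ₗ leafOp V e)
    (g := mulLeft k (letter A.X (A.unit (col e))) ∘ₗ extWord V A col γ) (fun x => ?_) x
  rw [lcomp_apply, ← DF.ev_leaf, extWord, elimF_ev, lcomp_apply, elimF_ev]
  rfl

theorem extWord_nodeOp (v : Tot V) (x y : Forests V) :
    extWord V A col γ (nodeOp V (v ⊗ₜ (x ⊗ₜ y))) =
      letter A.X (A.mul (γ v) (extWord V A col γ x)) * extWord V A col γ y := by
  refine node_ext (f := extWord V A col γ ∘ₗ nodeOp V)
    (g := LinearMap.mul' k _ ∘ₗ tmap (letter A.X ∘ₗ TensorProduct.lift A.mul ∘ₗ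
      tmap γ (extWord V A col γ)) (extWord V A col γ) ∘ₗ
      (tassoc k _ _ _).symm.toLinearMap) (fun a x y => ?_) (v ⊗ₜ (x ⊗ₜ y))
  rw [lcomp_apply, ← DF.ev_node, extWord, elimF_ev]
  simp only [lcomp_apply, LinearEquiv.coe_coe, assoc_symm_tmul, map_tmul, elimF_ev]
  rfl

theorem extWord_treeOp (v : Tot V) (x : Forests V) :
    extWord V A col γ (treeOp V (v ⊗ₜ x)) =
      letter A.X (A.mul (γ v) (extWord V A col γ x)) := by
  rw [treeOp_tmul, extWord_nodeOp, extWord_nil, mul_one]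

theorem extWord_leafTree (e : E) :
    extWord V A col γ (leafTree V e) = letter A.X (A.unit (col e)) := by
  rw [leafTree, extWord_leafOp, extWord_nil, mul_one]

theorem extTree_treeOp (v : Tot V) (x : Forests V) :
    extTree V A col γ (treeOp V (v ⊗ₜ x)) = A.mul (γ v) (extWord V A col γ x) := by
  rw [extTree, lcomp_apply, extWord_treeOp, ιInv_ι]

theorem extTree_leafTree (e : E) : extTree V A col γ (leafTree V e) = A.unit (col e) := by
  rw [extTree, lcomp_apply, extWord_leafTree, ιInv_ι]

theorem extWord_leavesF (l : List E) : extWord V A col γ (leavesF V l) =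
    ((l.map col).map fun e => letter A.X (A.unit e)).prod := by
  induction l with
  | nil => exact extWord_nil
  | cons e l ih => rw [leavesF, extWord_leafOp, ih, List.map_cons, List.map_cons, List.prod_cons]

theorem extWord_catOp (x y : Forests V) : extWord V A col γ (catOp V (x ⊗ₜ y)) =
    extWord V A col γ x * extWord V A col γ y := by
  induction x using forests_induction with
  | add c d hc hd => simp only [map_add, add_tmul, hc, hd, add_mul]
  | smul c d hd => simp only [map_smul, ← smul_tmul', hd, smul_mul_assoc]
  | ev x =>
  induction x with
  | nil => rw [DF.ev_nil, catOp_nil, extWord_nil, one_mul]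
  | leaf e f ih => rw [DF.ev_leaf, catOp_leafOp, extWord_leafOp, extWord_leafOp, ih, mul_assoc]
  | node a ch f _ ih =>
    rw [DF.ev_node, catOp_nodeOp, extWord_nodeOp, extWord_nodeOp, ih, mul_assoc]

theorem extWord_of_tree {t : List E} {b : E} {n : ℤ} {z : Forests V} (hz : z ∈ FS V s t [b] n) :
    extWord V A col γ z = letter A.X (extTree V A col γ z) := by
  refine FS_ext (f := extWord V A col γ) (g := letter A.X ∘ₗ extTree V A col γ)
    (fun x _ _ h3 _ => ?_) hz
  rw [lcomp_apply]
  rcases x.tree_cases b h3 with rfl | ⟨a, ch, rfl, -⟩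
  · rw [← leafTree_eq_ev, extWord_leafTree, extTree_leafTree]
  · rw [← treeOp_ev, extWord_treeOp, extTree_treeOp]

theorem extWord_mem (hA : A.IsTwoCat) (hγ : ∀ a : HEl V, IsIn A.X (a.1.top.map col)
    (col a.1.bot) (a.1.deg + s) (γ a.tot)) {t b : List E} {n : ℤ} {z : Forests V}
    (hz : z ∈ FS V s t b n) :
    extWord V A col γ z ∈ WS A.X (t.map col) (b.map col) n := by
  refine FS_map_le (extWord V A col γ) _ (fun x h h2 h3 h4 => ?_) hz
  subst h2 h3 h4
  clear hz
  induction x with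
  | nil => rw [DF.ev_nil, extWord_nil]; exact one_mem_WS
  | leaf e f ih =>
    rw [DF.ev_leaf, extWord_leafOp]
    simpa using mul_mem_WS (letter_mem (hA.isComplex.unit_mem (col e))) (ih h)
  | node a ch f ih1 ih =>
    have h1 := ih1 h.2.1
    rw [show ch.roots = a.1.top from h.1] at h1
    rw [DF.ev_node, extWord_nodeOp]
    simpa [add_assoc] using mul_mem_WS (letter_mem (hA.mul_isIn (hγ a) h1)) (ih h.2.2)

theorem extTree_isIn (hA : A.IsTwoCat) (hγ : ∀ a : HEl V, IsIn A.X (a.1.top.map col)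
    (col a.1.bot) (a.1.deg + s) (γ a.tot)) {t : List E} {b : E} {n : ℤ} {z : Forests V}
    (hz : z ∈ FS V s t [b] n) : IsIn A.X (t.map col) (col b) n (extTree V A col γ z) := by
  refine FS_map_le (extTree V A col γ) (LinearMap.range (of A.X ⟨t.map col, col b, n⟩))
    (fun x h1 h2 h3 h4 => ?_) hz
  change IsIn A.X (t.map col) (col b) n _
  rcases x.tree_cases b h3 with rfl | ⟨a, ch, rfl, rfl⟩
  · subst h2 h4
    rw [← leafTree_eq_ev, extTree_leafTree]
    exact hA.isComplex.unit_mem _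
  · have hch : ch.ev ∈ FS V s t a.1.top (ch.deg s) := ev_mem' ch h1.2.1 (by simpa using h2) h1.1 rfl
    have hn : n = a.1.deg + s + ch.deg s := by rw [← h4]; simp
    rw [← treeOp_ev, extTree_treeOp, hn]
    exact hA.mul_isIn (hγ a) (extWord_mem hA hγ hch)

theorem pairRel_cons_tmul {A : TwoCatData k I} {r r' t t' b' : List A.E} {b : A.E}
    {n n' n'' : ℤ} {a : Tot A.X} (ha : IsIn A.X r b n a) {v x z y : Words A.X}
    (hv : v ∈ WS A.X r' r n') (hx : x ∈ WS A.X t' b' n'') (h : (x ⊗ₜ z, y) ∈ pairRel A t) :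
    ((letter A.X a * x) ⊗ₜ (v * z), sgn k (n'' * n') • (letter A.X (A.mul a v) * y)) ∈
      pairRel A (b :: t) := by
  have h1 := pairRel_smul (sgn k (n'' * n')) (pairRel_cons ha hv h)
  rwa [ksMul_word _ _ hv hx, mul_comm n', smul_smul, sgn_mul_self, one_smul] at h1

theorem mul_mul_of_pairRel {A : TwoCatData k I} (hA : PreCat A) {r : List A.E} {b : A.E}
    {n : ℤ} {a : Tot A.X} (ha : IsIn A.X r b n a) {x y z : Words A.X}
    (h : (x ⊗ₜ y, z) ∈ pairRel A r) : A.mul (A.mul a x) y = A.mul a z :=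
  hA.mul_pairRel ha h

theorem letter_unit_mul (hA : A.IsTwoCat) (hγ : ∀ a : HEl V, IsIn A.X (a.1.top.map col)
    (col a.1.bot) (a.1.deg + s) (γ a.tot)) {t : List E} {b : E} {n : ℤ} {z : Forests V}
    (hz : z ∈ FS V s t [b] n) : letter A.X (A.mul (A.unit (col b)) (extWord V A col γ z)) =
      extWord V A col γ z := by
  have h := extWord_of_tree (A := A) (col := col) (γ := γ) hz
  rw [h]
  exact congrArg _ (hA.preCat.unit_mul' (extTree_isIn hA hγ hz))

/-- Grafting of forests corresponds to the composition of words. -/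
theorem pairRel_graftOp (hA : A.IsTwoCat) (hγ : ∀ a : HEl V, IsIn A.X (a.1.top.map col)
    (col a.1.bot) (a.1.deg + s) (γ a.tot)) (x y : DF V) (hx : x.WF) (hy : y.WF)
    (h : y.roots = x.leaves) :
    (extWord V A col γ x.ev ⊗ₜ extWord V A col γ y.ev,
      extWord V A col γ (graftOp V s (x.ev ⊗ₜ y.ev))) ∈ pairRel A (x.roots.map col) := by
  induction x generalizing y with
  | nil =>
    rw [y.eq_nil_of_roots h, DF.ev_nil, graftOp_nil, extWord_nil]
    exact pairRel_nil A
  | leaf e f ih =>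
    obtain ⟨t, l, rfl, ht, hl⟩ := y.exists_append [e] f.leaves h
    have hy' := (DF.wf_append t l).1 hy
    have htm : t.ev ∈ FS V s t.leaves [e] (t.deg s) := ev_mem' t hy'.1 rfl ht rfl
    have h2 : extWord V A col γ t.ev ∈ WS A.X (t.leaves.map col) [col e] (t.deg s) :=
      extWord_mem (t := t.leaves) (b := [e]) hA hγ htm
    have h3 := extWord_mem hA hγ (ev_mem s f ((DF.wf_leaf e f).1 hx))
    have h4 := ih l ((DF.wf_leaf e f).1 hx) hy'.2 hl
    have h1 := pairRel_cons_tmul (hA.isComplex.unit_mem (col e)) h2 h3 h4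
    rw [letter_unit_mul hA hγ htm] at h1
    rw [graftOp_leaf e f t l ht hl, map_smul, extWord_catOp, DF.ev_leaf, extWord_leafOp, ← catOp_ev,
      extWord_catOp]
    exact h1
  | node a ch f ih1 ih =>
    obtain ⟨l, m, rfl, hl, hm⟩ := y.exists_append ch.leaves f.leaves h
    have hy' := (DF.wf_append l m).1 hy
    have hch : ch.ev ∈ FS V s ch.leaves a.1.top (ch.deg s) := ev_mem' ch hx.2.1 rfl hx.1 rfl
    have hlm : l.ev ∈ FS V s l.leaves ch.leaves (l.deg s) := ev_mem' l hy'.1 rfl hl rfl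
    have h1 := pairRel_cons_tmul (hA.mul_isIn (hγ a) (extWord_mem hA hγ hch))
      (extWord_mem hA hγ hlm) (extWord_mem hA hγ (ev_mem s f hx.2.2)) (ih m hx.2.2 hy'.2 hm)
    have h3 := ih1 l hx.2.1 hy'.1 hl
    rw [show ch.roots = a.1.top from hx.1] at h3
    rw [mul_mul_of_pairRel hA.preCat (hγ a) h3] at h1
    rw [graftOp_node a ch f l m hl hm, map_smul, extWord_nodeOp, DF.ev_node, extWord_nodeOp, ←
      catOp_ev, extWord_catOp]
    exact h1

theorem extTree_graftOp (hA : A.IsTwoCat) (hγ : ∀ a : HEl V, IsIn A.X (a.1.top.map col)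
    (col a.1.bot) (a.1.deg + s) (γ a.tot)) {t u : List E} {b : E} {n m : ℤ} {x y : Forests V}
    (hx : x ∈ FS V s t [b] n) (hy : y ∈ FS V s u t m) :
    extTree V A col γ (graftOp V s (x ⊗ₜ y)) =
      A.mul (extTree V A col γ x) (extWord V A col γ y) := by
  refine FS_ext₂ (f := extTree V A col γ ∘ₗ graftOp V s) (g := TensorProduct.lift A.mul ∘ₗ
    tmap (extTree V A col γ) (extWord V A col γ))
    (fun x h1 h2 h3 _ y g1 g2 g3 _ => ?_) hx hy
  change extTree V A col γ (graftOp V s (x.ev ⊗ₜ y.ev)) =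
    A.mul (extTree V A col γ x.ev) (extWord V A col γ y.ev)
  have gy : y.ev ∈ FS V s y.leaves t (y.deg s) := ev_mem' y g1 rfl g3 rfl
  rcases x.tree_cases b h3 with rfl | ⟨a, ch, rfl, -⟩
  · have h2' : t = [b] := h2.symm
    subst h2'
    rw [← leafTree_eq_ev, extTree_leafTree, extWord_of_tree gy, hA.preCat.unit_mul' (extTree_isIn hA
      hγ gy)]
    exact congrArg _ (graftOp_leavesF [b] gy)
  · have h2' : ch.leaves = t := by simpa using h2
    subst h2'
    have h3 := pairRel_graftOp hA hγ ch y h1.2.1 g1 g3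
    rw [show ch.roots = a.1.top from h1.1] at h3
    rw [← treeOp_ev, graftOp_treeOp a.tot (ev_mem s ch h1.2.1) gy, extTree_treeOp, extTree_treeOp,
      mul_mul_of_pairRel hA.preCat (hγ a) h3]

theorem extTree_corolla (hA : A.IsTwoCat) (hγ : ∀ a : HEl V, IsIn A.X (a.1.top.map col)
    (col a.1.bot) (a.1.deg + s) (γ a.tot)) (v : Tot V) :
    extTree V A col γ (corolla V v) = γ v := by
  refine tot_ext (f := extTree V A col γ ∘ₗ corolla V) (g := γ) (fun a => ?_) v
  rw [lcomp_apply, corolla_tot, extTree_treeOp, extWord_leavesF, hA.preCat.mul_unit' (hγ a)]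

theorem wordMap_extTree (x : Words (freeFam V s)) :
    wordMap (extTree V A col γ ∘ₗ inclF V s) x = extWord V A col γ (wordToForest V s x) := by
  refine words_ext (f := wordMap (extTree V A col γ ∘ₗ inclF V s))
    (g := extWord V A col γ ∘ₗ wordToForest V s) (fun l => ?_) x
  rw [lcomp_apply]
  induction l with
  | nil => rw [word_nil, wordMap_one, wordToForest_one, extWord_nil]
  | cons a l ih =>
    rw [word_cons, wordMap_mul, ih, wordMap_letter, wordToForest_letter_mul, extWord_catOp,
      extWord_of_tree (inclF_tot_mem a), lcomp_apply]

/-- The tree with root vertex `v` and upper part `x` is the composition of the corolla of `v` with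
the trees of `x`. -/
theorem projF_treeOp {t u : List E} {b : E} {n m : ℤ} {v : Tot V} {x : Forests V}
    (hv : IsIn V t b n v) (hx : x ∈ FS V s u t m) : projF V s (treeOp V (v ⊗ₜ x)) =
      freeMul V s (projF V s (corolla V v)) (ftw V s x) := by
  rw [freeMul_apply, wordToForest_ftw hx, inclF_projF (corolla_mem s hv), corolla_graftOp hv hx]

end Extension

/-! ### The universal property of the cobar construction -/

section CobarUniversal

variable {k : Type u} [Field k] {I : Type w} {C : TwoCoCat k I} {A : TwoCat k I}
  {α : SeqData.PreHom C.seq A.seq}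

/-- The restriction of `α : C → A` to `C̄`. -/
abbrev redRestrict (α : SeqData.PreHom C.seq A.seq) : Tot C.seq.red →ₗ[k] Tot A.seq.X :=
  α.lin ∘ₗ C.seq.inc

theorem redRestrict_mem (hα : IsTwistingCochain C A α) (a : HEl C.seq.red) :
    IsIn A.seq.X (a.1.top.map α.col) (α.col a.1.bot) (a.1.deg + -1) (redRestrict α a.tot) := by
  obtain ⟨b, hb, hb'⟩ := (inc_mem (isIn_tot a)).exists_tot
  have h := hα.mem b.1 b.2
  rw [show of C.seq.X b.1 b.2 = C.seq.inc a.tot from hb', hb] at h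
  exact h

theorem redRestrict_ret (hα : IsTwistingCochain C A α) (c : Tot C.seq.X) :
    redRestrict α (SeqData.ret C.isTwoCoCat.isComplex c) = α.lin c := by
  refine tot_ext (f := redRestrict α ∘ₗ SeqData.ret C.isTwoCoCat.isComplex) (g := α.lin)
    (fun a => ?_) c
  rw [lcomp_apply, lcomp_apply, inc_ret, map_sub, map_smul, hα.unit, smul_zero, sub_zero]

theorem extWord_corolla (hα : IsTwistingCochain C A α) (v : Tot C.seq.red) :
    extWord C.seq.red A.data α.col (redRestrict α) (corolla C.seq.red v) =
      letter A.seq.X (redRestrict α v) := by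
  refine tot_ext (f := extWord C.seq.red A.data α.col (redRestrict α) ∘ₗ corolla C.seq.red)
    (g := letter A.seq.X ∘ₗ redRestrict α) (fun a => ?_) v
  rw [lcomp_apply, corolla_tot, extWord_treeOp, extWord_leavesF, A.isTwoCat.preCat.mul_unit'
    (redRestrict_mem hα a)]
  rfl

theorem extWord_augLeaf {γ : Tot C.seq.red →ₗ[k] Tot A.seq.X} {col : C.seq.E → A.seq.E}
    (c : Tot C.seq.X) :
    extWord C.seq.red A.data col γ (augLeaf C.seq c) =
      letter A.seq.X (augUnit C.data A.data col c) := by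
  refine tot_ext (f := extWord C.seq.red A.data col γ ∘ₗ augLeaf C.seq)
    (g := letter A.seq.X ∘ₗ augUnit C.data A.data col) (fun a => ?_) c
  rw [lcomp_apply, augLeaf_tot, map_smul, extWord_leafTree, lcomp_apply, augUnit_tot, map_smul]

theorem extWord_catLift_augLeaf {γ : Tot C.seq.red →ₗ[k] Tot A.seq.X} {col : C.seq.E → A.seq.E}
    (x : Words C.seq.X) :
    extWord C.seq.red A.data col γ (catLift (augLeaf C.seq) x) =
      augUnits C.data A.data col x := by
  refine tensorAlgebra_ext (f := extWord C.seq.red A.data col γ ∘ₗ catLift (augLeaf C.seq))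
    (g := augUnits C.data A.data col) ?_ (fun c x h => ?_) x
  · rw [lcomp_apply, catLift_one, extWord_nil, wordMap_one]
  · rw [lcomp_apply, catLift_ι_mul, extWord_catOp, extWord_augLeaf, wordMap_mul, wordMap_letter, ←
      h, lcomp_apply]

theorem extWord_wordToVertex (hα : IsTwistingCochain C A α) (x : Words C.seq.X) :
    extWord C.seq.red A.data α.col (redRestrict α) (C.wordToVertex x) =
      insertAug C.data A.data α.col α.lin x := by
  rw [wordToVertex_eq]
  refine tensorAlgebra_ext (f := extWord C.seq.red A.data α.col (redRestrict α) ∘ₗ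
    catInsert (augLeaf C.seq) (corolla C.seq.red ∘ₗ SeqData.ret C.isTwoCoCat.isComplex)
      (augLeaf C.seq)) (g := insertAug C.data A.data α.col α.lin) ?_ (fun c x h => ?_) x
  · rw [lcomp_apply, catInsert_one, map_zero, insertAug_one]
  · rw [lcomp_apply, catInsert_ι_mul, map_add, extWord_catOp, extWord_catOp, extWord_augLeaf,
      extWord_catLift_augLeaf, lcomp_apply (f := corolla C.seq.red), extWord_corolla hα,
      redRestrict_ret hα, insertAug_letter_mul, ← h, lcomp_apply]

theorem extTree_map_treeOp {M N : Type u} [AddCommGroup M] [Module k M] [AddCommGroup N]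
    [Module k N] {E : Type u} {V : Fam k E} {A : TwoCatData k I} {col : E → A.E}
    {γ : Tot V →ₗ[k] Tot A.X} (f : M →ₗ[k] Tot V) (g : N →ₗ[k] Forests V) (z : M ⊗[k] N) :
    extTree V A col γ (treeOp V (tmap f g z)) =
      TensorProduct.lift A.mul (tmap (γ ∘ₗ f) (extWord V A col γ ∘ₗ g) z) := by
  refine tensor_ext (f := extTree V A col γ ∘ₗ treeOp V ∘ₗ tmap f g)
    (g := TensorProduct.lift A.mul ∘ₗ tmap (γ ∘ₗ f) (extWord V A col γ ∘ₗ g))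
    (fun x y => ?_) z
  rw [lcomp_apply, lcomp_apply, lcomp_apply, map_tmul, extTree_treeOp, map_tmul,
    TensorProduct.lift.tmul]
  rfl

theorem extTree_cobarQuad (hα : IsTwistingCochain C A α) (c : Tot C.seq.X) :
    extTree C.seq.red A.data α.col (redRestrict α) (cobarQuad C c) =
      starOp C.data A.data α.col α.lin c := by
  have h1 : redRestrict α ∘ₗ SeqData.ret C.isTwoCoCat.isComplex ∘ₗ sg C.seq.X =
      α.lin ∘ₗ sg C.seq.X := LinearMap.ext fun c => redRestrict_ret hα _
  have h2 : extWord C.seq.red A.data α.col (redRestrict α) ∘ₗ C.wordToVertex =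
      insertAug C.data A.data α.col α.lin := LinearMap.ext fun x => extWord_wordToVertex hα x
  refine (extTree_map_treeOp _ _ _).trans ?_
  rw [h1, h2]
  rfl

theorem extTree_cobarGen (hα : IsTwistingCochain C A α) (v : Tot C.seq.red) :
    extTree C.seq.red A.data α.col (redRestrict α) (C.cobarGen v) =
      A.seq.d (redRestrict α v) := by
  have h := congrArg (fun f => f (C.seq.inc v)) hα.maurerCartan
  simp only [ladd_apply, lcomp_apply, lzero_apply, star_eq_starOp] at h
  rw [cobarGen_apply, map_sub, map_neg, extTree_corolla A.isTwoCat (redRestrict_mem hα),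
    redRestrict_ret hα, extTree_cobarQuad hα, lcomp_apply, eq_comm, ← sub_eq_zero, ← h]
  abel

theorem extWord_cobarDF (hα : IsTwistingCochain C A α) (x : DF C.seq.red) (hx : x.WF) :
    extWord C.seq.red A.data α.col (redRestrict α) (cobarDF C x.ev) =
      wordD A.seq.X A.seq.d (extWord C.seq.red A.data α.col (redRestrict α) x.ev) := by
  have hA := A.isTwoCat
  have hγ := redRestrict_mem hα
  induction x with
  | nil => rw [DF.ev_nil, cobarDF_nil, map_zero, extWord_nil, wordD_one]
  | leaf e f ih =>
    rw [DF.ev_leaf, cobarDF_leafOp, extWord_leafOp, extWord_leafOp, wordD_letter_mul, sg_unit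
      hA.preCat, hA.isComplex.d_unit, map_zero, zero_mul, add_zero, ih hx]
  | node a ch f ih1 ih =>
    have hch : ch.ev ∈ FS C.seq.red (-1) ch.leaves a.1.top (ch.deg (-1)) :=
      ev_mem' ch hx.2.1 rfl hx.1 rfl
    have hw := extWord_mem hA hγ hch
    have h1 := hA.mul_isIn (hγ a) hw
    have h2 := cobarGen_mem a
    rw [DF.ev_node, cobarDF_node, map_add, map_add, map_smul, map_smul, extWord_catOp,
      extWord_of_tree (graftOp_mem h2 hch), extTree_graftOp hA hγ h2 hch, extTree_cobarGen hα,
      extWord_nodeOp, extWord_nodeOp, extWord_nodeOp, wordD_letter_mul, h1.sg, hA.d_mul, (hγ a).sg,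
      ih1 hx.2.1, ih hx.2.2]
    simp only [map_add, map_smul, lsmul_apply, smul_mul_assoc, add_mul, sub_eq_add_neg]
    abel

theorem extTree_cobarDF (hα : IsTwistingCochain C A α) {t : List C.seq.E} {b : C.seq.E} {n : ℤ}
    {z : Forests C.seq.red} (hz : z ∈ FS C.seq.red (-1) t [b] n) :
    extTree C.seq.red A.data α.col (redRestrict α) (cobarDF C z) =
      A.seq.d (extTree C.seq.red A.data α.col (redRestrict α) z) := by
  apply ι_inj (k := k)
  have h : extWord C.seq.red A.data α.col (redRestrict α) (cobarDF C z) =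
      wordD A.seq.X A.seq.d (extWord C.seq.red A.data α.col (redRestrict α) z) :=
    FS_ext (f := extWord C.seq.red A.data α.col (redRestrict α) ∘ₗ cobarDF C)
      (g := wordD A.seq.X A.seq.d ∘ₗ extWord C.seq.red A.data α.col (redRestrict α))
      (fun x h1 _ _ _ => extWord_cobarDF hα x h1) hz
  have h2 := wordD_letter_mul A.seq.d
    (extTree C.seq.red A.data α.col (redRestrict α) z) 1
  rw [wordD_one, mul_zero, zero_add, mul_one, mul_one] at h2
  rw [extWord_of_tree (cobarDF_mem hz), extWord_of_tree hz] at h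
  exact h.trans h2

theorem TwoCatData.IsTwoCat.aug_mul_eq_zero {A : TwoCatData k I} (hA : A.IsTwoCat)
    {t u : List A.E} {b : A.E} {n m : ℤ} {a : Tot A.X} (ha : IsIn A.X t b n a) (h0 : A.aug a = 0)
    {x : Words A.X} (hx : x ∈ WS A.X u t m) : A.aug (A.mul a x) = 0 := by
  obtain ⟨a, ha', rfl⟩ := ha.exists_tot
  refine WS_ext (f := A.aug ∘ₗ A.mul a.tot) (g := 0) (fun l h1 h2 h3 => ?_) hx
  rw [lcomp_apply, hA.aug_mul a l (by rw [h2, ha']), h0, zero_mul, lzero_apply]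

theorem aug_extTree (hα : IsTwistingCochain C A α) {t : List C.seq.E} {b : C.seq.E} {n : ℤ}
    {z : Forests C.seq.red} (hz : z ∈ FS C.seq.red (-1) t [b] n) :
    A.seq.aug (extTree C.seq.red A.data α.col (redRestrict α) z) = leafCoeff C.seq.red z := by
  refine FS_ext (f := A.seq.aug ∘ₗ extTree C.seq.red A.data α.col (redRestrict α))
    (g := leafCoeff C.seq.red) (fun x h1 _ h3 _ => ?_) hz
  have hA := A.isTwoCat
  rw [lcomp_apply]
  rcases x.tree_cases b h3 with rfl | ⟨a, ch, rfl, -⟩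
  · rw [← leafTree_eq_ev, extTree_leafTree, leafCoeff_leafTree, hA.isComplex.aug_unit]
  · have hch : ch.ev ∈ FS C.seq.red (-1) ch.leaves a.1.top (ch.deg (-1)) :=
      ev_mem' ch h1.2.1 rfl h1.1 rfl
    rw [← treeOp_ev, extTree_treeOp, leafCoeff_tree]
    exact hA.aug_mul_eq_zero (redRestrict_mem hα a)
      (congrArg (fun f => f (C.seq.inc a.tot)) hα.aug)
      (extWord_mem hA (redRestrict_mem hα) hch)

/-- The morphism `𝓑*(C) → A` which extends the twisting cochain `α`. -/
def cobarLift (α : SeqData.PreHom C.seq A.seq) : SeqData.PreHom C.cobar.toSeqData A.seq where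
  col := α.col
  lin := extTree C.seq.red A.data α.col (redRestrict α) ∘ₗ inclF C.seq.red (-1)

theorem cobarLift_isHom (hα : IsTwistingCochain C A α) :
    TwoCatData.IsHom (A := C.cobar) (A' := A.data) (cobarLift α) where
  isSeqHom :=
    { src := hα.src
      tgt := hα.tgt
      mem := fun p x => extTree_isIn A.isTwoCat (redRestrict_mem hα)
        (inclF_tot_mem (V := C.seq.red) (s := -1) ⟨p, x⟩)
      d := LinearMap.ext fun z => tot_ext (f := (cobarLift α).lin ∘ₗ C.cobar.d)
        (g := A.seq.d ∘ₗ (cobarLift α).lin) (fun a => (congrArg (extTree C.seq.red A.data α.col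
          (redRestrict α)) (inclF_cobarDiff a.tot)).trans (extTree_cobarDF hα (cobarInc_mem a))) z
      unit := fun e => (congrArg (extTree C.seq.red A.data α.col (redRestrict α))
        (inclF_freeUnit e)).trans (extTree_leafTree e)
      aug := LinearMap.ext fun z => tot_ext (f := A.seq.aug ∘ₗ (cobarLift α).lin)
        (g := C.cobar.aug) (fun a => aug_extTree hα (cobarInc_mem a)) z }
  mul a l h := by
    refine (congrArg (extTree C.seq.red A.data α.col (redRestrict α))
      (inclF_freeMul (V := C.seq.red) (s := -1) a.tot (word l))).trans ?_
    refine (extTree_graftOp A.isTwoCat (redRestrict_mem hα)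
      (inclF_tot_mem (V := C.seq.red) (s := -1) a)
      (wordToForest_word_mem (V := C.seq.red) (s := -1) l h)).trans ?_
    exact congrArg (A.data.mul _) (wordMap_extTree (V := C.seq.red) (s := -1) (word l)).symm

theorem cobarLift_comp_cobarIncl (hα : IsTwistingCochain C A α) :
    (cobarLift α).lin ∘ₗ C.cobarIncl = α.lin := by
  refine LinearMap.ext fun c => ?_
  refine (congrArg (extTree C.seq.red A.data α.col (redRestrict α))
    (cobarInc_cobarIncl c)).trans ?_
  rw [extTree_corolla A.isTwoCat (redRestrict_mem hα), redRestrict_ret hα]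

theorem TwoCatData.IsHom.mul_of_mem {A A' : TwoCatData k I}
    {F : SeqData.PreHom A.toSeqData A'.toSeqData} (hF : TwoCatData.IsHom F) {t u : List A.E}
    {b : A.E} {n m : ℤ} {a : Tot A.X} (ha : IsIn A.X t b n a) {x : Words A.X}
    (hx : x ∈ WS A.X u t m) : F.lin (A.mul a x) = A'.mul (F.lin a) (wordMap F.lin x) := by
  obtain ⟨a, ha', rfl⟩ := ha.exists_tot
  exact WS_ext (f := F.lin ∘ₗ A.mul a.tot) (g := A'.mul (F.lin a.tot) ∘ₗ wordMap F.lin)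
    (fun l h1 h2 h3 => hF.mul a l (by rw [h2, ha'])) hx

theorem cobarIncl_inc (v : Tot C.seq.red) :
    C.cobarIncl (C.seq.inc v) = projF C.seq.red (-1) (corolla C.seq.red v) :=
  congrArg (fun v => projF C.seq.red (-1) (corolla C.seq.red v)) (ret_inc _ v)

/-- The restriction of a map on the cobar construction to the generators. -/
def cobarRestrict (F : SeqData.PreHom C.cobar.toSeqData A.seq) : SeqData.PreHom C.seq A.seq :=
  ⟨F.col, F.lin ∘ₗ C.cobarIncl⟩

/-- A morphism from the cobar construction is the extension of its restriction to the generators. -/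
theorem wordMap_ftw {F : SeqData.PreHom C.cobar.toSeqData A.seq}
    (hF : TwoCatData.IsHom (A := C.cobar) (A' := A.data) F) (x : DF C.seq.red) (hx : x.WF) :
    wordMap F.lin (ftw C.seq.red (-1) x.ev) =
      extWord C.seq.red A.data (cobarRestrict F).col (redRestrict (cobarRestrict F)) x.ev := by
  induction x with
  | nil =>
    rw [DF.ev_nil, extWord_nil]
    exact (congrArg (wordMap F.lin) ftw_nil).trans (wordMap_one _)
  | leaf e f ih =>
    rw [DF.ev_leaf, extWord_leafOp, ← ih hx]
    refine (congrArg (wordMap F.lin) (ftw_leafOp e f.ev)).trans ((wordMap_mul _ _ _).trans ?_)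
    exact congrArg (· * _) ((wordMap_letter F.lin _).trans
      (congrArg (letter A.seq.X) (hF.isSeqHom.unit e)))
  | node a ch f ih1 ih =>
    have hch : ch.ev ∈ FS C.seq.red (-1) ch.leaves a.1.top (ch.deg (-1)) :=
      ev_mem' ch hx.2.1 rfl hx.1 rfl
    rw [DF.ev_node, extWord_nodeOp, ← ih hx.2.2, ← ih1 hx.2.1]
    refine (congrArg (wordMap F.lin) (ftw_nodeOp a.tot ch.ev f.ev)).trans
      ((wordMap_mul _ _ _).trans ?_)
    refine congrArg (· * _) ((wordMap_letter F.lin _).trans (congrArg (letter A.seq.X) ?_))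
    refine (congrArg F.lin (projF_treeOp (isIn_tot a) hch)).trans ?_
    refine (hF.mul_of_mem (projF_isIn (corolla_mem (-1) (isIn_tot a))) (ftw_mem hch)).trans ?_
    exact congrArg (fun v => A.data.mul (F.lin v) _) (cobarIncl_inc a.tot).symm

theorem eq_cobarLift {F : SeqData.PreHom C.cobar.toSeqData A.seq}
    (hF : TwoCatData.IsHom (A := C.cobar) (A' := A.data) F) :
    F = cobarLift (cobarRestrict F) := by
  refine SeqData.PreHom.ext rfl (LinearMap.ext fun z => ?_)
  refine tot_ext (f := F.lin) (g := (cobarLift (cobarRestrict F)).lin) (fun a => ?_) z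
  apply ι_inj (k := k)
  have h := FS_ext (f := wordMap F.lin ∘ₗ ftw C.seq.red (-1))
    (g := extWord C.seq.red A.data (cobarRestrict F).col (redRestrict (cobarRestrict F)))
    (fun x h1 _ _ _ => wordMap_ftw hF x h1) (cobarInc_mem a)
  have h2 : ftw C.seq.red (-1) (cobarInc C a.tot) = letter C.cobar.X a.tot :=
    (ftw_of_tree (cobarInc_mem a)).trans (congrArg (letter C.cobar.X) (projF_inclF _))
  rw [extWord_of_tree (cobarInc_mem a)] at h
  exact (wordMap_letter F.lin _).symm.trans ((congrArg (wordMap F.lin) h2).symm.trans h)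

end CobarUniversal

/-! ### The cofree coalgebra -/

section CofreeCoalgebra

variable {k : Type u} [Field k] {E : Type u} (V : Fam k E) (s : ℤ)

theorem ksMul_natural {M M' : Type u} [AddCommGroup M] [Module k M] [AddCommGroup M'] [Module k M']
    (m : M ⊗[k] M →ₗ[k] M) (o : M →ₗ[k] M) (m' : M' ⊗[k] M' →ₗ[k] M') (o' : M' →ₗ[k] M')
    (φ : M →ₗ[k] M') (hm : ∀ x y, φ (m (x ⊗ₜ y)) = m' (φ x ⊗ₜ φ y)) (ho : ∀ x, φ (o x) = o' (φ x))
    (z : (M ⊗[k] M) ⊗[k] (M ⊗[k] M)) :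
    tmap φ φ (ksMul m o z) =
      ksMul m' o' (tmap (tmap φ φ) (tmap φ φ) z) := by
  refine tensor_ext (f := tmap φ φ ∘ₗ ksMul m o) (g := ksMul m' o' ∘ₗ
    tmap (tmap φ φ) (tmap φ φ)) (fun a b => ?_) z
  refine tensor_ext (f := (tmap φ φ ∘ₗ ksMul m o) ∘ₗ
    (tmk k (M ⊗[k] M) (M ⊗[k] M)).flip b) (g := (ksMul m' o' ∘ₗ
    tmap (tmap φ φ) (tmap φ φ)) ∘ₗ
    (tmk k (M ⊗[k] M) (M ⊗[k] M)).flip b) (fun x y => ?_) a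
  refine tensor_ext (f := (tmap φ φ ∘ₗ ksMul m o) ∘ₗ
    tmk k (M ⊗[k] M) (M ⊗[k] M) (x ⊗ₜ y)) (g := (ksMul m' o' ∘ₗ
    tmap (tmap φ φ) (tmap φ φ)) ∘ₗ
    tmk k (M ⊗[k] M) (M ⊗[k] M) (x ⊗ₜ y)) (fun x' y' => ?_) b
  simp [ksMul, hm, ho]

/-- The decomposition map of the cofree coalgebra: the sum over the cuts of a tree. -/
def freeComul : Tot (freeFam V s) →ₗ[k] Tot (freeFam V s) ⊗[k] Words (freeFam V s) :=
  tmap (projF V s) (ftw V s) ∘ₗ cutOp V s ∘ₗ inclF V s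

/-- The extension of `freeComul` to words. -/
def freeWordComul : Words (freeFam V s) →ₗ[k] Words (freeFam V s) ⊗[k] Words (freeFam V s) :=
  tfold (ksW (freeFam V s) ∘ₗ rTensor _
    (rTensor _ (letter (freeFam V s)) ∘ₗ freeComul V s)) (1 ⊗ₜ[k] 1)

/-- A tree and a word of trees as a pair of forests. -/
abbrev pairIncl : Tot (freeFam V s) ⊗[k] Words (freeFam V s) →ₗ[k] Forests V ⊗[k] Forests V :=
  tmap (inclF V s) (wordToForest V s)

variable {V s}

theorem pairIncl_injective : Function.Injective (pairIncl V s) :=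
  Function.LeftInverse.injective (g := tmap (projF V s) (ftw V s)) fun z => by
    refine tensor_ext (f := tmap (projF V s) (ftw V s) ∘ₗ pairIncl V s)
      (g := LinearMap.id) (fun a b => ?_) z
    simp [projF_inclF, ftw_wordToForest]

theorem pairIncl_cut {x : DF V} (hx : x.WF) {e : E} (he : x.roots = [e])
    {z : Forests V ⊗[k] Forests V} (hz : z ∈ cutSpan x) :
    pairIncl V s (tmap (projF V s) (ftw V s) z) = z := by
  refine cutSpan_ext (f := pairIncl V s ∘ₗ tmap (projF V s) (ftw V s))
    (g := LinearMap.id) (fun y y' _ hr hw => ?_) hz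
  obtain ⟨h1, h2, -, -⟩ := hw hx
  simp only [lcomp_apply, map_tmul, LinearMap.id_apply]
  rw [inclF_projF_ev y h1 e (hr.trans he), wordToForest_ftw (ev_mem s y' h2)]

theorem pairIncl_freeComul (z : Tot (freeFam V s)) :
    pairIncl V s (freeComul V s z) = cutOp V s (inclF V s z) := by
  refine freeFam_ext (f := pairIncl V s ∘ₗ freeComul V s) (g := cutOp V s ∘ₗ inclF V s)
    (fun x e hx he => ?_) z
  simp only [freeComul, lcomp_apply]
  rw [inclF_projF_ev x hx e he, pairIncl_cut hx he (cutOp_ev_mem x)]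

theorem freeWordComul_one : freeWordComul V s 1 = 1 ⊗ₜ 1 := tfold_one ..

theorem freeWordComul_letter_mul (c : Tot (freeFam V s)) (x : Words (freeFam V s)) :
    freeWordComul V s (letter (freeFam V s) c * x) = ksW (freeFam V s)
      (rTensor _ (letter (freeFam V s)) (freeComul V s c) ⊗ₜ freeWordComul V s x) :=
  tfold_ι_mul ..

theorem map_wordToForest_freeWordComul (x : Words (freeFam V s)) :
    tmap (wordToForest V s) (wordToForest V s) (freeWordComul V s x) =
      cutOp V s (wordToForest V s x) := by
  refine tensorAlgebra_ext (f := tmap (wordToForest V s) (wordToForest V s) ∘ₗ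
    freeWordComul V s) (g := cutOp V s ∘ₗ wordToForest V s) ?_ (fun c y hy => ?_) x
  · rw [lcomp_apply, freeWordComul_one, lcomp_apply, wordToForest_one, cutOp_nil, map_tmul,
      wordToForest_one]
  · rw [lcomp_apply, lcomp_apply] at hy ⊢
    rw [freeWordComul_letter_mul, wordToForest_letter_mul, cutOp_catOp, ← hy, ← pairIncl_freeComul]
    rw [ksMul_natural (m := LinearMap.mul' k (Words (freeFam V s))) (m' := catOp V)
      (o' := oddF V s) (φ := wordToForest V s) (hm := fun x y => by
        rw [LinearMap.mul'_apply]; exact wordToForest_mul x y) (ho := wordToForest_odd)]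
    rw [map_tmul, rTensor, map_map_tensor, LinearMap.comp_id]
    rw [show wordToForest V s ∘ₗ letter (freeFam V s) = inclF V s from
      LinearMap.ext wordToForest_letter]

theorem assoc_map {M N P M' N' P' : Type u} [AddCommGroup M] [Module k M] [AddCommGroup N]
    [Module k N] [AddCommGroup P] [Module k P] [AddCommGroup M'] [Module k M'] [AddCommGroup N']
    [Module k N'] [AddCommGroup P'] [Module k P'] (f : M →ₗ[k] M') (g : N →ₗ[k] N')
    (h : P →ₗ[k] P') (z : (M ⊗[k] N) ⊗[k] P) :
    tmap f (tmap g h) (tassoc k M N P z) =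
      tassoc k M' N' P' (tmap (tmap f g) h z) := by
  induction z using induction_on with
  | zero => simp
  | add x y hx hy => simp only [map_add, hx, hy]
  | tmul x y =>
  induction x using induction_on with
  | zero => simp
  | add x x' hx hx' => simp only [add_tmul, map_add, hx, hx']
  | tmul x x' => simp

theorem freeComul_coassoc (z : Tot (freeFam V s)) :
    tassoc k _ _ _ (rTensor _ (freeComul V s) (freeComul V s z)) =
      lTensor _ (freeWordComul V s) (freeComul V s z) := by
  have hinj : Function.Injective (tmap (inclF V s)
      (tmap (wordToForest V s) (wordToForest V s))) :=
    Function.LeftInverse.injective (g := tmap (projF V s)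
      (tmap (ftw V s) (ftw V s))) fun z => by
      rw [map_map_tensor, ← TensorProduct.map_comp,
        show projF V s ∘ₗ inclF V s = LinearMap.id from LinearMap.ext projF_inclF,
        show ftw V s ∘ₗ wordToForest V s = LinearMap.id from LinearMap.ext ftw_wordToForest,
        TensorProduct.map_id, TensorProduct.map_id]
      rfl
  refine hinj ?_
  rw [assoc_map, rTensor, map_map_tensor, lTensor, map_map_tensor,
    LinearMap.comp_id, LinearMap.comp_id,
    show tmap (inclF V s) (wordToForest V s) ∘ₗ freeComul V s = cutOp V s ∘ₗ inclF V s
      from LinearMap.ext pairIncl_freeComul,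
    show tmap (wordToForest V s) (wordToForest V s) ∘ₗ freeWordComul V s =
      cutOp V s ∘ₗ wordToForest V s from LinearMap.ext map_wordToForest_freeWordComul]
  have h := cutOp_coassoc (s := s) (inclF V s z)
  rw [← pairIncl_freeComul, pairIncl, rTensor, lTensor, map_map_tensor, map_map_tensor,
    LinearMap.id_comp, LinearMap.id_comp] at h
  exact h

theorem leafCoeff_eq_leavesCoeffF {x : DF V} {e : E} (h : x.roots = [e]) :
    leafCoeff V x.ev = leavesCoeffF V x.ev := by
  rcases x.tree_cases e h with rfl | ⟨a, ch, rfl, -⟩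
  · rw [← leafTree_eq_ev, leafCoeff_leafTree, leafTree, leavesCoeffF_leafOp, leavesCoeffF_nil]
  · rw [← treeOp_ev, leafCoeff_tree, leavesCoeffF_tree]

theorem leavesCoeffF_catOp (x y : Forests V) :
    leavesCoeffF V (catOp V (x ⊗ₜ y)) = leavesCoeffF V x * leavesCoeffF V y := by
  refine forests₂_ext (f := leavesCoeffF V ∘ₗ catOp V) (g := LinearMap.mul' k k ∘ₗ
    tmap (leavesCoeffF V) (leavesCoeffF V)) (fun x y => ?_) (x ⊗ₜ y)
  simp only [lcomp_apply, map_tmul, LinearMap.mul'_apply]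
  rw [catOp_ev, leavesCoeffF_append]

variable (V s) in
/-- The counit of the cofree coalgebra: the coefficient of the trees without vertices. -/
abbrev freeAug : Tot (freeFam V s) →ₗ[k] k := leafCoeff V ∘ₗ inclF V s

theorem lift_freeAug (x : Words (freeFam V s)) :
    TensorAlgebra.lift k (freeAug V s) x = leavesCoeffF V (wordToForest V s x) := by
  refine tensorAlgebra_ext (f := (TensorAlgebra.lift k (freeAug V s)).toLinearMap)
    (g := leavesCoeffF V ∘ₗ wordToForest V s) ?_ (fun c y hy => ?_) x
  · rw [lcomp_apply, wordToForest_one, leavesCoeffF_nil]; simp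
  · rw [lcomp_apply] at hy ⊢
    rw [wordToForest_letter_mul, leavesCoeffF_catOp, ← hy]
    simp only [AlgHom.toLinearMap_apply, map_mul, TensorAlgebra.lift_ι_apply]
    congr 1
    refine freeFam_ext (f := freeAug V s) (g := leavesCoeffF V ∘ₗ inclF V s)
      (fun x e hx he => ?_) c
    rw [lcomp_apply, lcomp_apply, inclF_projF_ev x hx e he, leafCoeff_eq_leavesCoeffF he]

theorem freeComul_counit_left (z : Tot (freeFam V s)) :
    TensorProduct.lid k _ (rTensor _ (freeAug V s) (freeComul V s z)) =
      letter (freeFam V s) z := by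
  refine freeFam_ext (f := (TensorProduct.lid k _).toLinearMap ∘ₗ
    rTensor _ (freeAug V s) ∘ₗ freeComul V s) (g := letter (freeFam V s))
    (fun x e hx he => ?_) z
  simp only [lcomp_apply, freeComul, LinearEquiv.coe_coe]
  rw [inclF_projF_ev x hx e he]
  refine (cutSpan_ext (f := (TensorProduct.lid k _).toLinearMap ∘ₗ
    rTensor _ (freeAug V s) ∘ₗ tmap (projF V s) (ftw V s))
    (g := ftw V s ∘ₗ (TensorProduct.lid k _).toLinearMap ∘ₗ rTensor _ (leavesCoeffF V))
    (fun y y' _ hr hw => ?_) (cutOp_ev_mem (s := s) x)).trans ?_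
  · obtain ⟨h1, -, -, -⟩ := hw hx
    simp only [lcomp_apply, map_tmul, rTensor_tmul, LinearEquiv.coe_coe, lid_tmul, map_smul]
    rw [inclF_projF_ev y h1 e (hr.trans he), leafCoeff_eq_leavesCoeffF (hr.trans he)]
  · simp only [lcomp_apply, LinearEquiv.coe_coe]
    rw [leavesCoeff_cut_left]
    exact ftw_of_tree (ev_mem' x hx rfl he rfl)

theorem freeComul_counit_right (z : Tot (freeFam V s)) :
    TensorProduct.rid k _ (lTensor _ (TensorAlgebra.lift k (freeAug V s)).toLinearMap
      (freeComul V s z)) = z := by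
  refine freeFam_ext (f := (TensorProduct.rid k _).toLinearMap ∘ₗ lTensor _
    (TensorAlgebra.lift k (freeAug V s)).toLinearMap ∘ₗ freeComul V s) (g := LinearMap.id)
    (fun x e hx he => ?_) z
  simp only [lcomp_apply, freeComul, LinearEquiv.coe_coe, LinearMap.id_apply]
  rw [inclF_projF_ev x hx e he]
  refine (cutSpan_ext (f := (TensorProduct.rid k _).toLinearMap ∘ₗ lTensor _
    (TensorAlgebra.lift k (freeAug V s)).toLinearMap ∘ₗ tmap (projF V s) (ftw V s))
    (g := projF V s ∘ₗ (TensorProduct.rid k _).toLinearMap ∘ₗ lTensor _ (leavesCoeffF V))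
    (fun y y' _ hr hw => ?_) (cutOp_ev_mem (s := s) x)).trans ?_
  · obtain ⟨-, h2, -, -⟩ := hw hx
    simp only [lcomp_apply, map_tmul, lTensor_tmul, LinearEquiv.coe_coe, rid_tmul, map_smul,
      AlgHom.toLinearMap_apply]
    rw [lift_freeAug, wordToForest_ftw (ev_mem s y' h2)]
  · simp only [lcomp_apply, LinearEquiv.coe_coe]
    rw [leavesCoeff_cut_right]

theorem freeComul_mem (p : GCell E) (z : freeFam V s p) : freeComul V s (of (freeFam V s) p z) ∈
    Submodule.span k {y | ∃ (a : HEl (freeFam V s)) (l : List (HEl (freeFam V s))),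
      bots l = a.1.top ∧ tops l = p.top ∧ a.1.bot = p.bot ∧ a.1.deg + degs l = p.deg ∧
      y = a.tot ⊗ₜ[k] word l} := by
  refine FS_map_le (tmap (projF V s) (ftw V s) ∘ₗ cutOp V s) _
    (fun x hx ht hb hn => ?_) (inclF_mem (isIn_of p z))
  rw [lcomp_apply, ← Submodule.mem_comap]
  refine Submodule.span_le.2 ?_ (cutOp_ev_mem (s := s) x)
  rintro _ ⟨y, y', h1, h2, h3, rfl⟩
  obtain ⟨g1, g2, g3, g4⟩ := h3 hx
  obtain ⟨a, ha, ha'⟩ := (projF_isIn (ev_mem' (s := s) y g1 rfl (h2.trans hb) rfl)).exists_tot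
  rw [SetLike.mem_coe, Submodule.mem_comap, map_tmul, ← ha']
  refine WS_map_le (tmk k _ _ a.tot) _ (fun l hl1 hl2 hl3 => ?_)
    (ftw_mem (ev_mem s y' g2))
  refine subset_span ⟨a, l, ?_, ?_, ?_, ?_, rfl⟩
  · rw [hl2, ha, g3]
  · rw [hl1, g4, ht]
  · rw [ha]
  · rw [hl3, ha, h1 s, hn]

theorem freeComul_unit (e : E) : freeComul V s (freeUnit V s e) =
    freeUnit V s e ⊗ₜ letter (freeFam V s) (freeUnit V s e) := by
  rw [freeComul, lcomp_apply, lcomp_apply, inclF_freeUnit, cutOp_leafTree, map_tmul, ftw_of_tree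
    (leafTree_mem s e), freeUnit]

/-- A combination of trees is determined by its coefficients of trees without vertices, and by the
cuts whose lower part has one vertex. -/
theorem eq_leaf_add_tree {t : List E} {b : E} {n : ℤ} {z : Forests V} (hz : z ∈ FS V s t [b] n) :
    z = leafCoeff V z • leafTree V b +
      treeOp V (rTensor _ (cogen V) (cutOp V s z)) := by
  refine FS_ext (f := LinearMap.id) (g := (leafCoeff V).smulRight (leafTree V b) +
    treeOp V ∘ₗ rTensor _ (cogen V) ∘ₗ cutOp V s) (fun x hx _ hb _ => ?_) hz
  simp only [ladd_apply, lcomp_apply, LinearMap.smulRight_apply, LinearMap.id_apply]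
  rcases x.tree_cases b hb with rfl | ⟨a, ch, rfl, -⟩
  · rw [← leafTree_eq_ev, leafCoeff_leafTree, cogen_cut_leafTree, map_zero, one_smul, add_zero]
  · rw [← treeOp_ev, leafCoeff_tree, cogen_cut_tree, zero_smul, zero_add]

/-- The number of vertices. -/
def DF.size (x : DF V) : ℤ := x.deg 1 - x.deg 0

@[simp] theorem DF.size_leaf (e : E) (x : DF V) : (DF.leaf e x).size = x.size := by simp [DF.size]

@[simp] theorem DF.size_nil : (DF.nil : DF V).size = 0 := by simp [DF.size]

@[simp] theorem DF.size_node (a : HEl V) (x y : DF V) :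
    (DF.node a x y).size = 1 + x.size + y.size := by
  simp [DF.size]; ring

theorem DF.size_nonneg (x : DF V) : 0 ≤ x.size := by
  induction x with
  | nil => simp
  | leaf e f ih => simpa using ih
  | node a x y ih1 ih2 => rw [DF.size_node]; omega

variable (V s) in
/-- The trees with at most `n` vertices. -/
def treesLE (n : ℕ) : Set (Tot (freeFam V s)) :=
  {z | ∃ x : DF V, x.WF ∧ (∃ e, x.roots = [e]) ∧ x.size ≤ n ∧ z = projF V s x.ev}

theorem ftw_mem_adjoin_treesLE (n : ℕ) (x : DF V) (hx : x.WF) (hn : x.size ≤ n) :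
    ftw V s x.ev ∈ Algebra.adjoin k (letter (freeFam V s) '' treesLE V s n) := by
  induction x with
  | nil => rw [DF.ev_nil, ftw_nil]; exact one_mem _
  | leaf e f ih =>
    rw [DF.ev_leaf, ftw_leafOp]
    refine mul_mem (Algebra.subset_adjoin ⟨_, ⟨DF.leaf e DF.nil, by simp, ⟨e, by simp⟩, by simp,
      rfl⟩, by rw [leafTree_eq_ev]⟩) (ih (by simpa using hx) (by simpa using hn))
  | node a ch f ih1 ih2 =>
    have h1 := ch.size_nonneg
    have h2 := f.size_nonneg
    rw [DF.size_node] at hn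
    have hx' := hx
    simp only [DF.wf_node] at hx'
    rw [DF.ev_node, ftw_nodeOp]
    refine mul_mem (Algebra.subset_adjoin ⟨_, ⟨DF.node a ch DF.nil, by simp [hx'],
      ⟨_, by simp; rfl⟩, by simp; omega, rfl⟩, by rw [treeOp_ev]⟩)
      (ih2 hx'.2.2 (by omega))

theorem freeComul_treesLE (n : ℕ) {z : Tot (freeFam V s)} (hz : z ∈ treesLE V s (n + 1)) :
    freeComul V s z ∈
      LinearMap.range (rTensor (Words (freeFam V s))
        (Submodule.span k (Set.range (freeUnit V s))).subtype) ⊔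
      LinearMap.range (lTensor (Tot (freeFam V s)) (Subalgebra.toSubmodule
        (Algebra.adjoin k (letter (freeFam V s) '' treesLE V s n))).subtype) := by
  have hu (e : E) (w : Words (freeFam V s)) : freeUnit V s e ⊗ₜ[k] w ∈
      LinearMap.range (rTensor (Words (freeFam V s))
        (Submodule.span k (Set.range (freeUnit V s))).subtype) :=
    ⟨⟨freeUnit V s e, subset_span ⟨e, rfl⟩⟩ ⊗ₜ w, rfl⟩
  obtain ⟨x, hx, ⟨e, he⟩, hn, rfl⟩ := hz
  rcases x.tree_cases e he with rfl | ⟨a, ch, rfl, -⟩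
  · rw [← leafTree_eq_ev]
    change freeComul V s (freeUnit V s e) ∈ _
    rw [freeComul_unit]
    exact Submodule.mem_sup_left (hu _ _)
  · have h1 := ch.size_nonneg
    rw [freeComul, lcomp_apply, lcomp_apply, inclF_projF_ev _ hx e he, ← treeOp_ev, cutOp_tree_ev,
      map_add]
    refine add_mem (Submodule.mem_sup_left (hu _ _)) (Submodule.mem_sup_right ?_)
    rw [← Submodule.mem_comap, ← Submodule.mem_comap]
    refine Submodule.span_le.2 ?_ (cutOp_ev_mem (s := s) ch)
    rintro _ ⟨y, y', h1, h2, h3, rfl⟩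
    simp only [DF.wf_node] at hx
    have hy := y.size_nonneg
    have hs : y.size + y'.size = ch.size := by simp only [DF.size, ← h1]; ring
    rw [DF.size_node, DF.size_nil] at hn
    push_cast at hn
    exact ⟨projF V s (treeMap V a.tot y.ev) ⊗ₜ ⟨_, ftw_mem_adjoin_treesLE n y' (h3 hx.2.1).2.1
      (by omega)⟩, rfl⟩

theorem mem_span_treesLE (z : Tot (freeFam V s)) :
    ∃ n, z ∈ Submodule.span k (treesLE V s n) := by
  have hmono {m n : ℕ} (h : m ≤ n) : treesLE V s m ⊆ treesLE V s n := by
    rintro _ ⟨x, hx, he, hs, rfl⟩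
    exact ⟨x, hx, he, hs.trans (by exact_mod_cast h), rfl⟩
  have key (x : Forests V) : ∃ n, projF V s x ∈ Submodule.span k (treesLE V s n) := by
    induction x using forests_induction with
    | ev x =>
      by_cases h : x.WF ∧ ∃ t, x.roots = [t]
      · exact ⟨x.size.toNat, subset_span ⟨x, h.1, h.2, by
          rw [Int.toNat_of_nonneg x.size_nonneg], rfl⟩⟩
      · exact ⟨0, by rw [projF_eq_zero x h]; exact zero_mem _⟩
    | add x y hx hy =>
      obtain ⟨m, hm⟩ := hx
      obtain ⟨n, hn⟩ := hy
      refine ⟨max m n, ?_⟩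
      rw [map_add]
      exact add_mem (Submodule.span_mono (hmono (le_max_left _ _)) hm)
        (Submodule.span_mono (hmono (le_max_right _ _)) hn)
    | smul c x hx =>
      obtain ⟨m, hm⟩ := hx
      exact ⟨m, by rw [map_smul]; exact Submodule.smul_mem _ _ hm⟩
  rw [← projF_inclF z]
  exact key _

end CofreeCoalgebra

/-! ### The root vertices of a forest -/

section ExtractRoot

variable {k : Type u} [Field k] {I : Type w} (A : TwoCat k I)

/-- The map `extractRoot` on all forests. -/
abbrev rootOp : Forests A.seq.red →ₗ[k] Words A.seq.X ⊗[k] Forests A.seq.red :=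
  elimF A.extractRoot

/-- The word of the units of a list of 1-morphisms. -/
def unitWord (l : List A.seq.E) : Words A.seq.X :=
  (l.map fun e => letter A.seq.X (A.seq.unit e)).prod

/-- `w ↦ (-1)^{j(|w| + 1)} w`. -/
def sgnMap {E : Type u} (X : Fam k E) (j : ℤ) : Words X →ₗ[k] Words X :=
  if Odd j then -wordMap (sg X) else LinearMap.id

theorem sgnMap_of_mem {E : Type u} {X : Fam k E} (j : ℤ) {t b : List E} {n : ℤ} {x : Words X}
    (hx : x ∈ WS X t b n) : sgnMap X j x = sgn k (j * (n + 1)) • x := by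
  rw [sgnMap]
  split_ifs with h
  · obtain ⟨i, rfl⟩ := h
    rw [LinearMap.neg_apply, wordMap_sg_of_mem hx, neg_eq_sgn_smul (k := k), smul_smul, ← sgn_add]
    congr 1
    apply sgn_congr; push_cast; grind
  · obtain ⟨i, rfl⟩ := Int.not_odd_iff_even.1 h
    rw [sgn_even ⟨i * (n + 1), by ring⟩, one_smul, LinearMap.id_apply]

variable {A}

theorem unitWord_mem (l : List A.seq.E) : unitWord A l ∈ WS A.seq.X l l 0 := by
  induction l with
  | nil => exact one_mem_WS
  | cons e l ih =>
    have := mul_mem_WS (letter_mem (A.isTwoCat.isComplex.unit_mem e)) ih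
    change letter A.seq.X (A.seq.unit e) * unitWord A l ∈ _
    simpa using this

theorem rootOp_nil : rootOp A (nilF A.seq.red) = 0 := by
  rw [← DF.ev_nil, rootOp, elimF_ev]; rfl

theorem rootOp_leafOp (e : A.seq.E) (x : Forests A.seq.red) :
    rootOp A (leafOp A.seq.red e x) =
      tmap (mulLeft k (letter A.seq.X (A.seq.unit e)))
        (leafOp A.seq.red e) (rootOp A x) := by
  refine forests_ext (f := rootOp A ∘ₗ leafOp A.seq.red e) (g := tmap
    (mulLeft k (letter A.seq.X (A.seq.unit e))) (leafOp A.seq.red e) ∘ₗ rootOp A)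
    (fun x => ?_) x
  rw [lcomp_apply, lcomp_apply, ← DF.ev_leaf, elimF_ev, elimF_ev]
  rfl

/-- The formula for `rootOp` when a tree `x` with root `e`, of degree `j`, is put in front of `y`:
the part of `rootOp` that comes from `y`. -/
def rootTail (x : Forests A.seq.red) (e : A.seq.E) (j : ℤ) :
    Words A.seq.X ⊗[k] Forests A.seq.red →ₗ[k] Words A.seq.X ⊗[k] Forests A.seq.red :=
  tmap (mulLeft k (letter A.seq.X (A.seq.unit e)) ∘ₗ sgnMap A.seq.X j)
    (catOp A.seq.red ∘ₗ tmk k _ _ x)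

theorem rootOp_node (a : HEl A.seq.red) (x y : DF A.seq.red) :
    rootOp A (DF.node a x y).ev =
      (letter A.seq.X (A.seq.inc a.tot) * unitWord A y.roots) ⊗ₜ
        catOp A.seq.red (x.ev ⊗ₜ y.ev) +
      rootTail (treeOp A.seq.red (a.tot ⊗ₜ x.ev)) a.1.bot (a.1.deg + 1 + x.deg 1)
        (rootOp A y.ev) := by
  have key {p : GCell A.seq.E} (v : A.seq.red p) (ch : PForest A.seq.E) (c : ch.mod A.seq.red)
      (σ : Words A.seq.X →ₗ[k] Words A.seq.X) (z : Words A.seq.X ⊗[k] Forests A.seq.red) :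
      lTensor (Words A.seq.X) (nodeOp A.seq.red ∘ₗ tmap (of A.seq.red p)
          (rTensor _ (ofF A.seq.red ch)))
        (TensorProduct.leftComm k _ _ _ (v ⊗ₜ TensorProduct.leftComm k _ _ _
          (c ⊗ₜ rTensor _ (mulLeft k
            (letter A.seq.X (A.seq.unit p.bot)) ∘ₗ σ) z))) =
      tmap (mulLeft k (letter A.seq.X (A.seq.unit p.bot)) ∘ₗ σ)
        (catOp A.seq.red ∘ₗ tmk k _ _
          (treeOp A.seq.red (of A.seq.red p v ⊗ₜ ofF A.seq.red ch c))) z := by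
    induction z using induction_on with
    | zero => simp
    | add x y hx hy => simp only [map_add, tmul_add, hx, hy]
    | tmul w y =>
      simp only [rTensor_tmul, TensorProduct.leftComm_tmul, lTensor_tmul, lcomp_apply, map_tmul,
        mk_apply]
      rw [← nodeOp_eq_catOp]
  rw [rootOp, elimF_ev, elimF_ev]
  exact congrArg (fun z => (letter A.seq.X (A.seq.inc a.tot) * unitWord A y.roots) ⊗ₜ[k]
    catOp A.seq.red (x.ev ⊗ₜ y.ev) + z) (key a.2 x.shape x.val
      (sgnMap A.seq.X (a.1.deg + 1 + x.deg 1)) (A.extractRoot y.shape y.val))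

/-- The pairs `w ⊗ y` that may occur in `rootOp x`. -/
def rootSpan (x : DF A.seq.red) : Submodule k (Words A.seq.X ⊗[k] Forests A.seq.red) :=
  Submodule.span k {z | ∃ (t b : List A.seq.E) (n : ℤ) (w : Words A.seq.X) (y : DF A.seq.red),
    w ∈ WS A.seq.X t b n ∧ n + 1 + y.deg 1 = x.deg 1 ∧
    (x.WF → y.WF ∧ b = x.roots ∧ t = y.roots ∧ y.leaves = x.leaves) ∧ z = w ⊗ₜ y.ev}

theorem rootOp_ev_mem (x : DF A.seq.red) : rootOp A x.ev ∈ rootSpan x := by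
  induction x with
  | nil => rw [DF.ev_nil, rootOp_nil]; exact zero_mem _
  | leaf e f ih =>
    rw [DF.ev_leaf, rootOp_leafOp, ← Submodule.mem_comap]
    refine Submodule.span_le.2 ?_ ih
    rintro _ ⟨t, b, n, w, y, hw, hn, hx, rfl⟩
    refine subset_span ⟨e :: t, e :: b, n, _, DF.leaf e y, ?_, by simpa using hn,
      fun h => ?_, by rw [DF.ev_leaf]; rfl⟩
    · simpa using mul_mem_WS (letter_mem (A.isTwoCat.isComplex.unit_mem e)) hw
    · obtain ⟨h1, h2, h3, h4⟩ := hx h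
      simp [h1, h2, h3, h4]
  | node a x f _ ih =>
    rw [rootOp_node]
    refine add_mem (subset_span ⟨_, _, _, _, x.append f,
      mul_mem_WS (letter_mem (inc_mem (isIn_tot a))) (unitWord_mem f.roots), ?_, fun h => ?_,
      by rw [catOp_ev]⟩) ?_
    · simp only [DF.deg_append, DF.deg_node]; ring
    · obtain ⟨h1, h2, h3⟩ := h
      exact ⟨(DF.wf_append x f).2 ⟨h2, h3⟩, rfl, by rw [DF.roots_append]; exact congrArg (· ++ _) h1.symm,
        by simp⟩
    · rw [← Submodule.mem_comap]
      refine Submodule.span_le.2 ?_ ih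
      rintro _ ⟨t, b, n, w, y, hw, hn, hx, rfl⟩
      rw [SetLike.mem_coe, Submodule.mem_comap, rootTail, map_tmul, lcomp_apply, sgnMap_of_mem _ hw,
        map_smul, ← smul_tmul']
      refine Submodule.smul_mem _ _ (subset_span ⟨a.1.bot :: t, a.1.bot :: b, n,
        letter A.seq.X (A.seq.unit a.1.bot) * w, DF.node a x y, ?_, ?_, fun h => ?_, ?_⟩)
      · simpa using mul_mem_WS (letter_mem (A.isTwoCat.isComplex.unit_mem a.1.bot)) hw
      · simp only [DF.deg_node, ← hn]; ring
      · obtain ⟨h1, h2, h3, h4⟩ := hx h.2.2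
        exact ⟨⟨h.1, h.2.1, h1⟩, by simp [h2], by simp [h3], by simp [h4]⟩
      · rw [lcomp_apply, mk_apply, DF.ev_node, ← nodeOp_eq_catOp, LinearMap.mulLeft_apply]

/-- The analogue of `rootTail` for the cuts `p` of a tree. -/
def rootTail₂ (e : A.seq.E) (j : ℤ) (p : Forests A.seq.red ⊗[k] Forests A.seq.red) :
    Words A.seq.X ⊗[k] (Forests A.seq.red ⊗[k] Forests A.seq.red) →ₗ[k]
      Words A.seq.X ⊗[k] (Forests A.seq.red ⊗[k] Forests A.seq.red) :=
  tmap (mulLeft k (letter A.seq.X (A.seq.unit e)) ∘ₗ sgnMap A.seq.X j)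
    (ks A.seq.red 1 ∘ₗ tmk k _ _ p)

theorem exists_rootTail₂ (e : A.seq.E) (j : ℤ)
    (z : Words A.seq.X ⊗[k] (Forests A.seq.red ⊗[k] Forests A.seq.red)) :
    ∃ L : Forests A.seq.red ⊗[k] Forests A.seq.red →ₗ[k]
      Words A.seq.X ⊗[k] (Forests A.seq.red ⊗[k] Forests A.seq.red),
      ∀ p, L p = rootTail₂ e j p z :=
  ⟨LinearMap.applyₗ z ∘ₗ (TensorProduct.mapBilinear _ _ _ _ _ (mulLeft k (letter A.seq.X
    (A.seq.unit e)) ∘ₗ sgnMap A.seq.X j)) ∘ₗ TensorProduct.curry (ks A.seq.red 1), fun _ => rfl⟩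

theorem lTensor_rootTail (x : Forests A.seq.red) (e : A.seq.E) (j : ℤ)
    (z : Words A.seq.X ⊗[k] Forests A.seq.red) :
    lTensor _ (cutOp A.seq.red 1) (rootTail x e j z) =
      rootTail₂ e j (cutOp A.seq.red 1 x) (lTensor _ (cutOp A.seq.red 1) z) := by
  refine tensor_ext (f := lTensor _ (cutOp A.seq.red 1) ∘ₗ rootTail x e j)
    (g := rootTail₂ e j (cutOp A.seq.red 1 x) ∘ₗ lTensor _ (cutOp A.seq.red 1))
    (fun w y => ?_) z
  simp only [lcomp_apply, rootTail, rootTail₂, map_tmul, lTensor_tmul, mk_apply, cutOp_catOp]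

/-- The key sign computation for `rootOp_cutOp`: moving the suspension of a root vertex of `y` past
two forests `t` and `p` is compatible with the Koszul sign of `(t ⊗ p)(y ⊗ q)`. -/
theorem rootTail₂_assoc (t p y q : DF A.seq.red) (e : A.seq.E) (j : ℤ)
    (hj : t.deg 1 + p.deg 1 = j) :
    rootTail₂ e j (t.ev ⊗ₜ p.ev) (tassoc k _ _ _ (rootOp A y.ev ⊗ₜ q.ev)) =
      sgn k (p.deg 1 * y.deg 1) • tassoc k _ _ _
        (rootTail t.ev e (t.deg 1) (rootOp A y.ev) ⊗ₜ (p.append q).ev) := by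
  refine span_ext (f := rootTail₂ e j (t.ev ⊗ₜ p.ev) ∘ₗ
      (tassoc k _ _ _).toLinearMap ∘ₗ (tmk k
        (Words A.seq.X ⊗[k] Forests A.seq.red) (Forests A.seq.red)).flip q.ev)
    (g := sgn k (p.deg 1 * y.deg 1) • ((tassoc k _ _ _).toLinearMap ∘ₗ
      (tmk k (Words A.seq.X ⊗[k] Forests A.seq.red) (Forests A.seq.red)).flip
        (p.append q).ev ∘ₗ rootTail t.ev e (t.deg 1))) ?_ (rootOp_ev_mem y)
  rintro _ ⟨t', b', n, w, z, hw, hn, -, rfl⟩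
  simp only [lcomp_apply, LinearMap.flip_apply, mk_apply, LinearEquiv.coe_coe, assoc_tmul, map_tmul,
    lsmul_apply, rootTail, rootTail₂, sgnMap_of_mem _ hw, ksMul_ev, catOp_ev, map_smul, tmul_smul, ←
    smul_tmul', smul_smul, ← sgn_add]
  congr 1
  apply sgn_congr
  rw [← hn, ← hj]
  push_cast
  grind

theorem rootOp_leaf_ks (e : A.seq.E) (t y q : DF A.seq.red) :
    tassoc k _ _ _ (rTensor _ (rootOp A) (ks A.seq.red 1
      ((leafTree A.seq.red e ⊗ₜ t.ev) ⊗ₜ (y.ev ⊗ₜ q.ev)))) =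
    rootTail₂ e (t.deg 1) (leafTree A.seq.red e ⊗ₜ t.ev)
      (tassoc k _ _ _ (rootOp A y.ev ⊗ₜ q.ev)) := by
  rw [leafTree_eq_ev, ksMul_ev, map_smul, rTensor_tmul, DF.leaf_append, DF.nil_append, DF.ev_leaf e
    y, rootOp_leafOp, map_smul]
  refine ((rootTail₂_assoc (DF.leaf e DF.nil) t y q e _ (by simp)).trans ?_).symm
  congr 3
  rw [rootTail, sgnMap, if_neg (by simp), LinearMap.comp_id]
  congr 2
  exact LinearMap.ext fun z => by rw [leafOp_eq_catOp, leafTree_eq_ev]; rfl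

theorem rootOp_tree_ks (a : HEl A.seq.red) (x : DF A.seq.red) (y q : DF A.seq.red)
    {z : Forests A.seq.red ⊗[k] Forests A.seq.red} (hz : z ∈ cutSpan x) :
    tassoc k _ _ _ (rTensor _ (rootOp A) (ks A.seq.red 1
      (rTensor _ (treeMap A.seq.red a.tot) z ⊗ₜ (y.ev ⊗ₜ q.ev)))) =
    (letter A.seq.X (A.seq.inc a.tot) * unitWord A y.roots) ⊗ₜ[k]
      ks A.seq.red 1 (z ⊗ₜ (y.ev ⊗ₜ q.ev)) +
    rootTail₂ a.1.bot (a.1.deg + 1 + x.deg 1) (rTensor _ (treeMap A.seq.red a.tot) z)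
      (tassoc k _ _ _ (rootOp A y.ev ⊗ₜ q.ev)) := by
  obtain ⟨L, hL⟩ := exists_rootTail₂ a.1.bot (a.1.deg + 1 + x.deg 1)
    (tassoc k _ _ _ (rootOp A y.ev ⊗ₜ q.ev))
  rw [← hL]
  refine cutSpan_ext
    (g := tmk k _ _ (letter A.seq.X (A.seq.inc a.tot) * unitWord A y.roots) ∘ₗ
      ks A.seq.red 1 ∘ₗ (tmk k (Forests A.seq.red ⊗[k] Forests A.seq.red) _).flip
        (y.ev ⊗ₜ q.ev) + L ∘ₗ rTensor _ (treeMap A.seq.red a.tot))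
    (f := (tassoc k _ _ _).toLinearMap ∘ₗ rTensor _ (rootOp A) ∘ₗ
      ks A.seq.red 1 ∘ₗ (tmk k (Forests A.seq.red ⊗[k] Forests A.seq.red) _).flip
        (y.ev ⊗ₜ q.ev) ∘ₗ rTensor _ (treeMap A.seq.red a.tot))
    (fun x₁ x₂ hd _ _ => ?_) hz
  simp only [ladd_apply, lcomp_apply, mk_apply, LinearEquiv.coe_coe, rTensor_tmul,
    LinearMap.flip_apply, hL]
  rw [treeOp_ev, ksMul_ev, ksMul_ev, map_smul, rTensor_tmul, DF.node_append, DF.nil_append,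
    rootOp_node, map_smul, add_tmul, map_add, smul_add, tmul_smul, catOp_ev, assoc_tmul]
  congr 1
  refine ((rootTail₂_assoc (DF.node a x₁ DF.nil) x₂ y q a.1.bot _ ?_).trans ?_).symm
  · simp only [DF.deg_node, DF.deg_nil, ← hd 1]; ring
  · rw [← treeOp_ev, DF.deg_node, DF.deg_nil, add_zero]

theorem rootOp_node_ks (a : HEl A.seq.red) (x y q : DF A.seq.red) :
    tassoc k _ _ _ (rTensor _ (rootOp A) (ks A.seq.red 1
      (cutOp A.seq.red 1 (treeOp A.seq.red (a.tot ⊗ₜ x.ev)) ⊗ₜ (y.ev ⊗ₜ q.ev)))) =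
    (letter A.seq.X (A.seq.inc a.tot) * unitWord A y.roots) ⊗ₜ[k]
      ks A.seq.red 1 (cutOp A.seq.red 1 x.ev ⊗ₜ (y.ev ⊗ₜ q.ev)) +
    rootTail₂ a.1.bot (a.1.deg + 1 + x.deg 1) (cutOp A.seq.red 1 (treeOp A.seq.red (a.tot ⊗ₜ x.ev)))
      (tassoc k _ _ _ (rootOp A y.ev ⊗ₜ q.ev)) := by
  obtain ⟨L, hL⟩ := exists_rootTail₂ a.1.bot (a.1.deg + 1 + x.deg 1)
    (tassoc k _ _ _ (rootOp A y.ev ⊗ₜ q.ev))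
  have h := rootOp_leaf_ks a.1.bot (DF.node a x DF.nil) y q
  rw [DF.deg_node, DF.deg_nil, add_zero, ← treeOp_ev, ← hL] at h
  have h' := rootOp_tree_ks a x y q (cutOp_ev_mem (s := 1) x)
  rw [← hL] at h'
  rw [← hL, cutOp_tree_ev, map_add, add_tmul, map_add (ks A.seq.red 1), map_add (rTensor _ (rootOp
    A)), map_add, h, h', add_left_comm]

/-- Removing a root vertex and then cutting the rest is the same as cutting first, and then removing
a root vertex of the lower part. -/
theorem rootOp_cutOp (x : DF A.seq.red) :
    lTensor _ (cutOp A.seq.red 1) (rootOp A x.ev) =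
      tassoc k _ _ _ (rTensor _ (rootOp A) (cutOp A.seq.red 1 x.ev)) := by
  induction x with
  | nil => rw [DF.ev_nil, rootOp_nil, cutOp_nil, rTensor_tmul, rootOp_nil]; simp
  | leaf e f ih =>
    rw [DF.ev_leaf, rootOp_leafOp, cutOp_leafOp, lTensor, map_map_tensor, rTensor, map_map_tensor,
      LinearMap.id_comp, LinearMap.id_comp]
    rw [show cutOp A.seq.red 1 ∘ₗ leafOp A.seq.red e =
      tmap (leafOp A.seq.red e) (leafOp A.seq.red e) ∘ₗ cutOp A.seq.red 1 from
      LinearMap.ext (cutOp_leafOp e), show rootOp A ∘ₗ leafOp A.seq.red e = tmap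
        (mulLeft k (letter A.seq.X (A.seq.unit e))) (leafOp A.seq.red e) ∘ₗ rootOp A from
      LinearMap.ext (rootOp_leafOp e)]
    rw [lTensor, rTensor] at ih
    have h1 := congrArg (tmap (mulLeft k (letter A.seq.X (A.seq.unit e)))
      (tmap (leafOp A.seq.red e) (leafOp A.seq.red e))) ih
    rw [map_map_tensor, LinearMap.comp_id, assoc_map, map_map_tensor, LinearMap.comp_id] at h1
    exact h1
  | node a x y _ ih =>
    rw [rootOp_node, map_add, lTensor_rootTail, ih, cutOp_node, lTensor_tmul, cutOp_catOp]
    refine cutSpan_ext (f := tmk k _ _ (letter A.seq.X (A.seq.inc a.tot) *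
          unitWord A y.roots) ∘ₗ ks A.seq.red 1 ∘ₗ tmk k _ _ (cutOp A.seq.red 1 x.ev) +
        rootTail₂ a.1.bot (a.1.deg + 1 + x.deg 1)
          (cutOp A.seq.red 1 (treeOp A.seq.red (a.tot ⊗ₜ x.ev))) ∘ₗ
        (tassoc k _ _ _).toLinearMap ∘ₗ rTensor _ (rootOp A))
      (g := (tassoc k _ _ _).toLinearMap ∘ₗ rTensor _ (rootOp A) ∘ₗ
        ks A.seq.red 1 ∘ₗ tmk k _ _
          (cutOp A.seq.red 1 (treeOp A.seq.red (a.tot ⊗ₜ x.ev))))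
      (fun y₁ y₂ _ hr _ => ?_) (cutOp_ev_mem (s := 1) y)
    simp only [ladd_apply, lcomp_apply, mk_apply, LinearEquiv.coe_coe, rTensor_tmul]
    rw [rootOp_node_ks, hr]

end ExtractRoot

/-! ### The differential of the bar construction -/

section BarDifferential

variable {k : Type u} [Field k] {I : Type w} (A : TwoCat k I)

/-- The map `barD` on all forests. -/
abbrev barDF : Forests A.seq.red →ₗ[k] Forests A.seq.red := elimF A.barD

/-- `w ⊗ y ↦` the tree with root vertex `v ∘ w` and `y` above it. -/
def contract (v : Tot A.seq.X) : Words A.seq.X ⊗[k] Forests A.seq.red →ₗ[k] Forests A.seq.red :=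
  treeOp A.seq.red ∘ₗ rTensor _ (SeqData.ret A.isTwoCat.isComplex ∘ₗ A.data.mul v)

variable {A}

theorem contract_tmul (v : Tot A.seq.X) (w : Words A.seq.X) (y : Forests A.seq.red) :
    contract A v (w ⊗ₜ y) =
      treeOp A.seq.red (SeqData.ret A.isTwoCat.isComplex (A.data.mul v w) ⊗ₜ y) := rfl

theorem SeqData.IsComplex.isIn_d {S : SeqData k I} (h : S.IsComplex) {t : List S.E} {b : S.E}
    {n : ℤ} {x : Tot S.X} (hx : IsIn S.X t b n x) : IsIn S.X t b (n - 1) (S.d x) := by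
  obtain ⟨y, rfl⟩ := hx
  exact h.d_mem _ y

theorem barDF_nil : barDF A (nilF A.seq.red) = 0 :=
  (elimF_ofF A.barD PForest.nil _).trans rfl

theorem barDF_leafOp (e : A.seq.E) (x : Forests A.seq.red) :
    barDF A (leafOp A.seq.red e x) = leafOp A.seq.red e (barDF A x) := by
  refine forests_ext (f := barDF A ∘ₗ leafOp A.seq.red e) (g := leafOp A.seq.red e ∘ₗ barDF A)
    (fun x => ?_) x
  rw [lcomp_apply, lcomp_apply, ← DF.ev_leaf, elimF_ev, elimF_ev]
  rfl

theorem barDF_node_ev (a : HEl A.seq.red) (x y : DF A.seq.red) :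
    barDF A (DF.node a x y).ev =
      -nodeOp A.seq.red (SeqData.ret A.isTwoCat.isComplex (A.seq.d (A.seq.inc a.tot)) ⊗ₜ
        (x.ev ⊗ₜ y.ev)) +
      sgn k a.1.deg • catOp A.seq.red (contract A (A.seq.inc a.tot) (rootOp A x.ev) ⊗ₜ y.ev) +
      sgn k (a.1.deg + 1) • nodeOp A.seq.red (a.tot ⊗ₜ (barDF A x.ev ⊗ₜ y.ev)) +
      sgn k (a.1.deg + 1 + x.deg 1) • nodeOp A.seq.red (a.tot ⊗ₜ (x.ev ⊗ₜ barDF A y.ev)) := by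
  have key (p : GCell A.seq.E) (v : A.seq.red p) (z : Words A.seq.X ⊗[k] Forests A.seq.red)
      (y : Forests A.seq.red) : nodeOp A.seq.red (tmap
        (SeqData.ret A.isTwoCat.isComplex ∘ₗ TensorProduct.lift A.data.mul ∘ₗ
          rTensor _ (A.seq.inc ∘ₗ of A.seq.red p)) LinearMap.id
        ((tassoc k (A.seq.red p) (Words A.seq.X) _).symm
          (v ⊗ₜ tassoc k _ _ _ (z ⊗ₜ y)))) =
      catOp A.seq.red (contract A (A.seq.inc (of A.seq.red p v)) z ⊗ₜ y) := by
    induction z using induction_on with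
    | zero => simp
    | add x y hx hy => simp only [map_add, tmul_add, add_tmul, hx, hy]
    | tmul w x =>
      simp only [assoc_tmul, assoc_symm_tmul, map_tmul, lcomp_apply, rTensor_tmul,
        TensorProduct.lift.tmul, LinearMap.id_apply, contract_tmul, nodeOp_eq_catOp]
  have h1 : barDF A (DF.node a x y).ev =
      nodeOp A.seq.red ((-(SeqData.ret A.isTwoCat.isComplex ∘ₗ A.seq.d ∘ₗ A.seq.inc ∘ₗ
        of A.seq.red a.1)) a.2 ⊗ₜ (x.ev ⊗ₜ y.ev)) +
      a.1.deg.negOnePow • catOp A.seq.red (contract A (A.seq.inc a.tot) (rootOp A x.ev) ⊗ₜ y.ev) +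
      (a.1.deg + 1).negOnePow • nodeOp A.seq.red (a.tot ⊗ₜ (barDF A x.ev ⊗ₜ y.ev)) +
      (a.1.deg + 1 + x.deg 1).negOnePow • nodeOp A.seq.red (a.tot ⊗ₜ (x.ev ⊗ₜ barDF A y.ev)) := by
    rw [← key, rootOp, barDF, elimF_ev, elimF_ev, elimF_ev, elimF_ev]
    rfl
  rw [h1, negOnePow_smul (k := k), negOnePow_smul (k := k), negOnePow_smul (k := k),
    LinearMap.neg_apply, TensorProduct.neg_tmul, map_neg]
  rfl

theorem barDF_tree (a : HEl A.seq.red) (x : Forests A.seq.red) :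
    barDF A (treeOp A.seq.red (a.tot ⊗ₜ x)) =
      -treeOp A.seq.red (SeqData.ret A.isTwoCat.isComplex (A.seq.d (A.seq.inc a.tot)) ⊗ₜ x) +
      sgn k a.1.deg • contract A (A.seq.inc a.tot) (rootOp A x) +
      sgn k (a.1.deg + 1) • treeOp A.seq.red (a.tot ⊗ₜ barDF A x) := by
  induction x using forests_induction with
  | ev x => rw [treeOp_ev, barDF_node_ev, DF.ev_nil, barDF_nil, catOp_nil_right, tmul_zero,
      tmul_zero, map_zero, smul_zero, add_zero, treeOp_tmul, treeOp_tmul]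
  | add c d hc hd =>
    simp only [tmul_add, map_add, hc, hd, smul_add, neg_add]
    abel
  | smul c d hd =>
    simp only [tmul_smul, map_smul, hd, smul_add, smul_comm c, smul_neg]

theorem barDF_node (a : HEl A.seq.red) (x : DF A.seq.red) (y : Forests A.seq.red) :
    barDF A (nodeOp A.seq.red (a.tot ⊗ₜ (x.ev ⊗ₜ y))) =
      catOp A.seq.red (barDF A (treeOp A.seq.red (a.tot ⊗ₜ x.ev)) ⊗ₜ y) +
      sgn k (a.1.deg + 1 + x.deg 1) •
        catOp A.seq.red (treeOp A.seq.red (a.tot ⊗ₜ x.ev) ⊗ₜ barDF A y) := by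
  induction y using forests_induction with
  | ev y =>
    rw [← DF.ev_node, barDF_node_ev, barDF_tree]
    simp only [add_tmul, map_add, ← smul_tmul', map_smul, TensorProduct.neg_tmul, map_neg,
      nodeOp_eq_catOp]
  | add c d hc hd =>
    simp only [tmul_add, map_add, hc, hd, smul_add]
    abel
  | smul c d hd =>
    simp only [tmul_smul, map_smul, hd, smul_add, smul_comm c]

theorem barDF_leafTree (e : A.seq.E) : barDF A (leafTree A.seq.red e) = 0 := by
  rw [leafTree, barDF_leafOp, barDF_nil, map_zero]

theorem contract_mem (a : HEl A.seq.red) (x : DF A.seq.red) (hx : x.WF) (h : x.roots = a.1.top)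
    {z : Words A.seq.X ⊗[k] Forests A.seq.red} (hz : z ∈ rootSpan x) :
    contract A (A.seq.inc a.tot) z ∈
      FS A.seq.red 1 x.leaves [a.1.bot] (a.1.deg + 1 + x.deg 1 - 1) := by
  rw [← Submodule.mem_comap]
  refine Submodule.span_le.2 ?_ hz
  rintro _ ⟨t, b, n, w, y, hw, hn, h', rfl⟩
  obtain ⟨h1, h2, h3, h4⟩ := h' hx
  rw [SetLike.mem_coe, Submodule.mem_comap, contract_tmul]
  rw [h2, h] at hw
  exact FS_cast (treeOp_mem (ret_mem A.isTwoCat.isComplex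
    (A.isTwoCat.mul_isIn (inc_mem (isIn_tot a)) hw)) (ev_mem' (s := 1) y h1 h4 h3.symm rfl))
    rfl rfl (by rw [← hn]; ring)

theorem barDF_mem {t b : List A.seq.E} {n : ℤ} {x : Forests A.seq.red}
    (hx : x ∈ FS A.seq.red 1 t b n) : barDF A x ∈ FS A.seq.red 1 t b (n - 1) := by
  refine FS_map_le (barDF A) _ (fun x h1 h2 h3 h4 => ?_) hx
  subst h2 h3 h4
  clear hx
  induction x with
  | nil => rw [DF.ev_nil, barDF_nil]; exact Submodule.zero_mem _
  | leaf e f ih =>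
    rw [DF.ev_leaf, barDF_leafOp]
    exact leafOp_mem e (ih h1)
  | node a x y ih1 ih2 =>
    obtain ⟨g1, g2, g3⟩ := h1
    have g1' : x.roots = a.1.top := g1
    have hx : x.ev ∈ FS A.seq.red 1 x.leaves a.1.top (x.deg 1) := ev_mem' x g2 rfl g1 rfl
    have hD : barDF A x.ev ∈ FS A.seq.red 1 x.leaves a.1.top (x.deg 1 - 1) := by
      rw [← g1']; exact ih1 g2
    rw [barDF_node_ev, nodeOp_eq_catOp, nodeOp_eq_catOp, nodeOp_eq_catOp]
    refine Submodule.add_mem _ (Submodule.add_mem _ (Submodule.add_mem _ (Submodule.neg_mem _ ?_)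
      (Submodule.smul_mem _ _ ?_)) (Submodule.smul_mem _ _ ?_)) (Submodule.smul_mem _ _ ?_)
    · exact FS_cast (catOp_mem (treeOp_mem (ret_mem A.isTwoCat.isComplex
        (A.isTwoCat.isComplex.isIn_d (inc_mem (isIn_tot a)))) hx) (ev_mem 1 y g3)) rfl rfl
        (by simp only [DF.deg_node]; ring)
    · exact FS_cast (catOp_mem (contract_mem a x g2 g1' (rootOp_ev_mem x)) (ev_mem 1 y g3)) rfl rfl
        (by simp only [DF.deg_node]; ring)
    · exact FS_cast (catOp_mem (treeOp_mem (isIn_tot a) hD) (ev_mem 1 y g3)) rfl rfl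
        (by simp only [DF.deg_node]; ring)
    · exact FS_cast (catOp_mem (treeOp_mem (isIn_tot a) hx) (ih2 g3)) rfl rfl
        (by simp only [DF.deg_node]; ring)

theorem barDF_catOp_ev (x : DF A.seq.red) (y : Forests A.seq.red) :
    barDF A (catOp A.seq.red (x.ev ⊗ₜ y)) = catOp A.seq.red (barDF A x.ev ⊗ₜ y) +
      sgn k (x.deg 1) • catOp A.seq.red (x.ev ⊗ₜ barDF A y) := by
  induction x with
  | nil => rw [DF.ev_nil, catOp_nil, catOp_nil, barDF_nil]; simp
  | leaf e f ih =>
    rw [DF.ev_leaf, catOp_leafOp, barDF_leafOp, ih, barDF_leafOp, catOp_leafOp, catOp_leafOp,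
      map_add, map_smul, DF.deg_leaf]
  | node a x f _ ih =>
    rw [DF.ev_node, catOp_nodeOp, barDF_node, ih, barDF_node, catOp_nodeOp, nodeOp_eq_catOp,
      add_tmul, map_add, tmul_add, map_add, tmul_smul, map_smul, ← smul_tmul', map_smul,
      catOp_assoc, catOp_assoc, smul_add, smul_smul, ← sgn_add, DF.deg_node, ← add_assoc, ←
      add_assoc]

theorem barDF_catOp {t b : List A.seq.E} {n : ℤ} {x : Forests A.seq.red}
    (hx : x ∈ FS A.seq.red 1 t b n) (y : Forests A.seq.red) :
    barDF A (catOp A.seq.red (x ⊗ₜ y)) = catOp A.seq.red (barDF A x ⊗ₜ y) +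
      sgn k n • catOp A.seq.red (x ⊗ₜ barDF A y) := by
  refine FS_ext (f := barDF A ∘ₗ catOp A.seq.red ∘ₗ
      (tmk k (Forests A.seq.red) _).flip y)
    (g := catOp A.seq.red ∘ₗ (tmk k (Forests A.seq.red) _).flip y ∘ₗ barDF A +
      sgn k n • catOp A.seq.red ∘ₗ (tmk k (Forests A.seq.red) _).flip (barDF A y))
    (fun x _ _ _ hn => ?_) hx
  have h := barDF_catOp_ev x y
  rw [hn] at h
  exact h

theorem leavesCoeffF_contract (v : Tot A.seq.X) (z : Words A.seq.X ⊗[k] Forests A.seq.red) :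
    leavesCoeffF A.seq.red (contract A v z) = 0 := by
  refine tensor_ext (f := leavesCoeffF A.seq.red ∘ₗ contract A v) (g := 0) (fun w y => ?_) z
  rw [lcomp_apply, contract_tmul, leavesCoeffF_tree, lzero_apply]

theorem leavesCoeffF_barDF (x : Forests A.seq.red) : leavesCoeffF A.seq.red (barDF A x) = 0 := by
  refine forests_ext (f := leavesCoeffF A.seq.red ∘ₗ barDF A) (g := 0) (fun x => ?_) x
  rw [lcomp_apply, lzero_apply]
  induction x with
  | nil => rw [DF.ev_nil, barDF_nil, map_zero]
  | leaf e f ih => rw [DF.ev_leaf, barDF_leafOp, leavesCoeffF_leafOp, ih]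
  | node a x y _ _ =>
    rw [barDF_node_ev]
    simp only [nodeOp_eq_catOp, map_add, map_neg, map_smul, leavesCoeffF_catOp, leavesCoeffF_tree,
      leavesCoeffF_contract]
    simp

/-! ### The differential is a coderivation -/

variable (A) in
/-- The differential of pairs of forests. -/
def barDF₂ : Forests A.seq.red ⊗[k] Forests A.seq.red →ₗ[k] Forests A.seq.red ⊗[k] Forests A.seq.red :=
  rTensor _ (barDF A) + tmap (sgF A.seq.red 1 1) (barDF A)

theorem barDF₂_ev (x y : DF A.seq.red) : barDF₂ A (x.ev ⊗ₜ y.ev) =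
    barDF A x.ev ⊗ₜ y.ev + sgn k (x.deg 1) • (x.ev ⊗ₜ barDF A y.ev) := by
  rw [barDF₂, ladd_apply, rTensor_tmul, map_tmul, sgF_ev, one_mul, smul_tmul']

theorem barDF₂_ks {x y : DF A.seq.red} (hx : x.WF) (hy : y.WF)
    {p q : Forests A.seq.red ⊗[k] Forests A.seq.red} (hp : p ∈ cutSpan x) (hq : q ∈ cutSpan y) :
    barDF₂ A (ks A.seq.red 1 (p ⊗ₜ q)) = ks A.seq.red 1 (barDF₂ A p ⊗ₜ q) +
      sgn k (x.deg 1) • ks A.seq.red 1 (p ⊗ₜ barDF₂ A q) := by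
  refine cutSpan_ext (f := barDF₂ A ∘ₗ ks A.seq.red 1 ∘ₗ (tmk k
      (Forests A.seq.red ⊗[k] Forests A.seq.red) _).flip q)
    (g := ks A.seq.red 1 ∘ₗ (tmk k (Forests A.seq.red ⊗[k] Forests A.seq.red) _).flip
      q ∘ₗ barDF₂ A + sgn k (x.deg 1) • ks A.seq.red 1 ∘ₗ (tmk k
      (Forests A.seq.red ⊗[k] Forests A.seq.red) _).flip (barDF₂ A q)) (fun p₁ p₂ hd _ hw => ?_) hp
  obtain ⟨hp₁, hp₂, -, -⟩ := hw hx
  refine cutSpan_ext (f := barDF₂ A ∘ₗ ks A.seq.red 1 ∘ₗ tmk k _ _ (p₁.ev ⊗ₜ p₂.ev))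
    (g := ks A.seq.red 1 ∘ₗ tmk k _ _ (barDF₂ A (p₁.ev ⊗ₜ p₂.ev)) +
      sgn k (x.deg 1) • ks A.seq.red 1 ∘ₗ tmk k _ _ (p₁.ev ⊗ₜ p₂.ev) ∘ₗ barDF₂ A)
    (fun q₁ q₂ _ _ hw => ?_) hq
  obtain ⟨hq₁, hq₂, -, -⟩ := hw hy
  simp only [lcomp_apply, mk_apply, ladd_apply, lsmul_apply]
  rw [ksMul_ev, map_smul, barDF₂_ev, barDF₂_ev, barDF₂_ev, ← catOp_ev, ← catOp_ev, barDF_catOp_ev,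
    barDF_catOp_ev, DF.deg_append, ← hd]
  simp only [add_tmul, tmul_add, map_add, tmul_smul, ← smul_tmul', map_smul]
  rw [ksMul_of_mem _ _ (ev_mem 1 p₂ hp₂) (ev_mem 1 q₁ hq₁), ksMul_of_mem _ _ (barDF_mem (ev_mem 1 p₂
    hp₂)) (ev_mem 1 q₁ hq₁), ksMul_of_mem _ _ (ev_mem 1 p₂ hp₂) (barDF_mem (ev_mem 1 q₁ hq₁)),
    ksMul_of_mem _ _ (ev_mem 1 p₂ hp₂) (ev_mem 1 q₁ hq₁)]
  simp only [smul_add, smul_smul, ← sgn_add]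
  have e1 : sgn k (p₂.deg 1 * q₁.deg 1 + p₁.deg 1) =
      sgn k (p₁.deg 1 + p₂.deg 1 + p₂.deg 1 * (q₁.deg 1 - 1)) := by
    apply sgn_congr; push_cast; grind
  have e2 : sgn k (p₂.deg 1 * q₁.deg 1 + (p₁.deg 1 + q₁.deg 1)) =
      sgn k (p₁.deg 1 + (p₂.deg 1 - 1) * q₁.deg 1) := by
    apply sgn_congr; push_cast; grind
  have e3 : sgn k (p₂.deg 1 * q₁.deg 1 + (p₁.deg 1 + q₁.deg 1 + p₂.deg 1)) =
      sgn k (p₁.deg 1 + p₂.deg 1 + (q₁.deg 1 + p₂.deg 1 * q₁.deg 1)) := by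
    apply sgn_congr; push_cast; grind
  simp only [e1, e2, e3]
  abel

theorem cutOp_tree_of_isIn {E : Type u} {V : Fam k E} {s : ℤ} {t : List E} {b : E} {n : ℤ}
    {v : Tot V} (hv : IsIn V t b n v) (x : Forests V) :
    cutOp V s (treeOp V (v ⊗ₜ x)) = leafTree V b ⊗ₜ treeOp V (v ⊗ₜ x) +
      rTensor _ (treeMap V v) (cutOp V s x) := by
  obtain ⟨a, ha, rfl⟩ := hv.exists_tot
  rw [cutOp_tree, ha]

theorem cutOp_contract (a : HEl A.seq.red) (x : DF A.seq.red) (hx : x.WF)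
    (h : x.roots = a.1.top) :
    cutOp A.seq.red 1 (contract A (A.seq.inc a.tot) (rootOp A x.ev)) =
      leafTree A.seq.red a.1.bot ⊗ₜ contract A (A.seq.inc a.tot) (rootOp A x.ev) +
        rTensor _ (contract A (A.seq.inc a.tot) ∘ₗ rootOp A) (cutOp A.seq.red 1 x.ev) := by
  have h1 := congrArg (rTensor (Forests A.seq.red) (contract A (A.seq.inc a.tot)) ∘ₗ
    (tassoc k _ _ _).symm.toLinearMap) (rootOp_cutOp x)
  rw [lcomp_apply, lcomp_apply, LinearEquiv.coe_coe, LinearEquiv.symm_apply_apply, ← lcomp_apply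
    (rTensor _ _), ← LinearMap.rTensor_comp] at h1
  rw [← h1]
  refine span_ext (f := cutOp A.seq.red 1 ∘ₗ contract A (A.seq.inc a.tot))
    (g := tmk k _ _ (leafTree A.seq.red a.1.bot) ∘ₗ contract A (A.seq.inc a.tot) +
      rTensor (Forests A.seq.red) (contract A (A.seq.inc a.tot)) ∘ₗ
        (tassoc k _ _ _).symm.toLinearMap ∘ₗ lTensor _ (cutOp A.seq.red 1))
    ?_ (rootOp_ev_mem x)
  rintro _ ⟨t, b, n, w, y, hw, hn, h', rfl⟩
  obtain ⟨-, h2, -, -⟩ := h' hx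
  rw [h2, h] at hw
  simp only [ladd_apply, lcomp_apply, lTensor_tmul, mk_apply, LinearEquiv.coe_coe, contract_tmul]
  rw [cutOp_tree_of_isIn (ret_mem A.isTwoCat.isComplex (A.isTwoCat.mul_isIn (inc_mem (isIn_tot a))
    hw))]
  congr 1
  refine forests₂_ext (f := rTensor _ (treeMap A.seq.red _))
    (g := rTensor (Forests A.seq.red) (contract A (A.seq.inc a.tot)) ∘ₗ
      (tassoc k _ _ _).symm.toLinearMap ∘ₗ tmk k _ _ w)
    (fun y y' => ?_) (cutOp A.seq.red 1 y.ev)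
  simp only [lcomp_apply, mk_apply, LinearEquiv.coe_coe, assoc_symm_tmul, rTensor_tmul,
    contract_tmul]

theorem cutOp_barDF_tree (a : HEl A.seq.red) (x : DF A.seq.red) (hx : x.WF)
    (h : x.roots = a.1.top)
    (ih : cutOp A.seq.red 1 (barDF A x.ev) = barDF₂ A (cutOp A.seq.red 1 x.ev)) :
    cutOp A.seq.red 1 (barDF A (treeOp A.seq.red (a.tot ⊗ₜ x.ev))) =
      barDF₂ A (cutOp A.seq.red 1 (treeOp A.seq.red (a.tot ⊗ₜ x.ev))) := by
  have h1 : barDF₂ A (leafTree A.seq.red a.1.bot ⊗ₜ treeOp A.seq.red (a.tot ⊗ₜ x.ev)) =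
      leafTree A.seq.red a.1.bot ⊗ₜ barDF A (treeOp A.seq.red (a.tot ⊗ₜ x.ev)) := by
    rw [leafTree_eq_ev, treeOp_ev, barDF₂_ev, ← leafTree_eq_ev, barDF_leafTree, zero_tmul]
    simp
  have h2 : barDF₂ A (rTensor _ (treeMap A.seq.red a.tot) (cutOp A.seq.red 1 x.ev)) =
      -rTensor _ (treeMap A.seq.red (SeqData.ret A.isTwoCat.isComplex
        (A.seq.d (A.seq.inc a.tot)))) (cutOp A.seq.red 1 x.ev) +
      sgn k a.1.deg • rTensor _ (contract A (A.seq.inc a.tot) ∘ₗ rootOp A)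
        (cutOp A.seq.red 1 x.ev) +
      sgn k (a.1.deg + 1) • rTensor _ (treeMap A.seq.red a.tot)
        (barDF₂ A (cutOp A.seq.red 1 x.ev)) := by
    refine cutSpan_ext (f := barDF₂ A ∘ₗ rTensor _ (treeMap A.seq.red a.tot))
      (g := -rTensor _ (treeMap A.seq.red (SeqData.ret A.isTwoCat.isComplex
          (A.seq.d (A.seq.inc a.tot)))) +
        sgn k a.1.deg • rTensor _ (contract A (A.seq.inc a.tot) ∘ₗ rootOp A) +
        sgn k (a.1.deg + 1) • rTensor _ (treeMap A.seq.red a.tot) ∘ₗ barDF₂ A)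
      (fun y y' _ _ _ => ?_) (cutOp_ev_mem (s := 1) x)
    simp only [ladd_apply, lcomp_apply, LinearMap.neg_apply, lsmul_apply, rTensor_tmul, mk_apply]
    rw [treeOp_ev, barDF₂_ev, barDF₂_ev, ← treeOp_ev, barDF_tree]
    simp only [add_tmul, map_add, map_smul, rTensor_tmul, lcomp_apply, mk_apply, ← smul_tmul',
      smul_add, smul_smul, ← sgn_add, TensorProduct.neg_tmul, DF.deg_node, DF.deg_nil, add_zero,
      add_assoc]
  have hd : IsIn A.seq.X a.1.top a.1.bot (a.1.deg - 1) (A.seq.d (A.seq.inc a.tot)) :=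
    A.isTwoCat.isComplex.isIn_d (inc_mem (isIn_tot a))
  rw [cutOp_tree_ev, map_add, h1, h2, barDF_tree, map_add, map_add, map_smul, map_smul, map_neg,
    cutOp_tree_of_isIn (ret_mem A.isTwoCat.isComplex hd), cutOp_contract a x hx h, cutOp_tree, ih]
  simp only [tmul_add, tmul_smul, TensorProduct.tmul_neg, smul_add, neg_add]
  abel

theorem cutOp_barDF {t b : List A.seq.E} {n : ℤ} {z : Forests A.seq.red}
    (hz : z ∈ FS A.seq.red 1 t b n) :
    cutOp A.seq.red 1 (barDF A z) = barDF₂ A (cutOp A.seq.red 1 z) := by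
  refine FS_ext (f := cutOp A.seq.red 1 ∘ₗ barDF A) (g := barDF₂ A ∘ₗ cutOp A.seq.red 1)
    (fun x hx h1 h2 h3 => ?_) hz
  clear hz h1 h2 h3
  rw [lcomp_apply, lcomp_apply]
  have hcat {x y : DF A.seq.red} (hx : x.WF) (hy : y.WF)
      (h1 : cutOp A.seq.red 1 (barDF A x.ev) = barDF₂ A (cutOp A.seq.red 1 x.ev))
      (h2 : cutOp A.seq.red 1 (barDF A y.ev) = barDF₂ A (cutOp A.seq.red 1 y.ev)) :
      cutOp A.seq.red 1 (barDF A (x.append y).ev) =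
        barDF₂ A (cutOp A.seq.red 1 (x.append y).ev) := by
    rw [← catOp_ev, barDF_catOp_ev, map_add, map_smul, cutOp_catOp, cutOp_catOp, cutOp_catOp,
      barDF₂_ks hx hy (cutOp_ev_mem x) (cutOp_ev_mem y), h1, h2]
  induction x with
  | nil =>
    rw [DF.ev_nil, barDF_nil, cutOp_nil, ← DF.ev_nil, barDF₂_ev, DF.ev_nil, barDF_nil]
    simp
  | leaf e f ih =>
    refine hcat (x := DF.leaf e DF.nil) trivial hx ?_ (ih hx)
    rw [← leafTree_eq_ev, barDF_leafTree, cutOp_leafTree, leafTree_eq_ev, barDF₂_ev, ←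
      leafTree_eq_ev, barDF_leafTree]
    simp
  | node a x y ih1 ih2 =>
    refine hcat (x := DF.node a x DF.nil) ⟨hx.1, hx.2.1, trivial⟩ hx.2.2 ?_ (ih2 hx.2.2)
    rw [← treeOp_ev]
    exact cutOp_barDF_tree a x hx.2.1 hx.1 (ih1 hx.2.1)

end BarDifferential

/-! ### The bar construction is a 2-cocategory -/

section BarObject

variable {k : Type u} [Field k] {I : Type w} {A : TwoCat k I}

variable (A) in
/-- The differential of the bar construction. -/
abbrev barDiff : Tot (freeFam A.seq.red 1) →ₗ[k] Tot (freeFam A.seq.red 1) :=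
  projF A.seq.red 1 ∘ₗ barDF A ∘ₗ inclF A.seq.red 1

theorem inclF_barDiff (z : Tot (freeFam A.seq.red 1)) :
    inclF A.seq.red 1 (barDiff A z) = barDF A (inclF A.seq.red 1 z) := inclF_diff barDF_mem z

theorem wordToForest_barDiff (x : Words (freeFam A.seq.red 1)) :
    wordToForest A.seq.red 1 (wordD (freeFam A.seq.red 1) (barDiff A) x) =
      barDF A (wordToForest A.seq.red 1 x) :=
  wordToForest_diff barDF_mem barDF_nil (fun hx y => barDF_catOp hx y) x

theorem freeComul_barDiff (z : Tot (freeFam A.seq.red 1)) :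
    freeComul A.seq.red 1 (barDiff A z) = rTensor _ (barDiff A) (freeComul A.seq.red 1 z) +
      tmap (sg (freeFam A.seq.red 1)) (wordD (freeFam A.seq.red 1) (barDiff A))
        (freeComul A.seq.red 1 z) := by
  refine pairIncl_injective ?_
  have h : cutOp A.seq.red 1 (barDF A (inclF A.seq.red 1 z)) =
      barDF₂ A (cutOp A.seq.red 1 (inclF A.seq.red 1 z)) :=
    tot_ext (f := cutOp A.seq.red 1 ∘ₗ barDF A ∘ₗ inclF A.seq.red 1)
      (g := barDF₂ A ∘ₗ cutOp A.seq.red 1 ∘ₗ inclF A.seq.red 1)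
      (fun a => cutOp_barDF (inclF_tot_mem a)) z
  rw [pairIncl_freeComul, inclF_barDiff, h, ← pairIncl_freeComul, map_add, barDF₂,
    ladd_apply, pairIncl, rTensor, rTensor, map_map_tensor,
    map_map_tensor, map_map_tensor, map_map_tensor, LinearMap.id_comp, LinearMap.comp_id,
    show inclF A.seq.red 1 ∘ₗ barDiff A = barDF A ∘ₗ inclF A.seq.red 1 from
      LinearMap.ext inclF_barDiff,
    show inclF A.seq.red 1 ∘ₗ sg _ = sgF A.seq.red 1 1 ∘ₗ inclF A.seq.red 1 from
      LinearMap.ext inclF_sg,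
    show wordToForest A.seq.red 1 ∘ₗ wordD (freeFam A.seq.red 1) (barDiff A) =
      barDF A ∘ₗ wordToForest A.seq.red 1 from LinearMap.ext wordToForest_barDiff]

theorem leafCoeff_of_mem {E : Type u} {V : Fam k E} {s : ℤ} {t : List E} {b : E} {n : ℤ}
    {x : Forests V} (hx : x ∈ FS V s t [b] n) : leafCoeff V x = leavesCoeffF V x :=
  FS_ext (fun _ _ _ hb _ => leafCoeff_eq_leavesCoeffF hb) hx

theorem leafCoeff_barDF {t : List A.seq.E} {b : A.seq.E} {n : ℤ} {x : Forests A.seq.red}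
    (hx : x ∈ FS A.seq.red 1 t [b] n) : leafCoeff A.seq.red (barDF A x) = 0 := by
  rw [leafCoeff_of_mem (barDF_mem hx), leavesCoeffF_barDF]

variable (A) in
theorem bar_preCocat : PreCocat A.bar where
  d_mem p x := isIn_freeFam_iff.2 (Eq.mp (congrArg (· ∈ _) (inclF_barDiff _).symm)
    (barDF_mem (inclF_mem (isIn_of p x))))
  aug_off p x hp := leafCoeff_eq_zero (inclF_mem (isIn_of (X := freeFam A.seq.red 1) p x)) hp
  aug_d := LinearMap.ext fun z => tot_ext (f := A.bar.aug ∘ₗ A.bar.d) (g := 0) (fun a =>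
    (congrArg (leafCoeff A.seq.red) (inclF_barDiff _)).trans
      (leafCoeff_barDF (inclF_tot_mem (V := A.seq.red) (s := 1) a))) z
  comul_mem := freeComul_mem (V := A.seq.red) (s := 1)
  coassoc := LinearMap.ext (freeComul_coassoc (V := A.seq.red) (s := 1))
  counit_comul := LinearMap.ext (freeComul_counit_left (V := A.seq.red) (s := 1))
  comul_counit := LinearMap.ext (freeComul_counit_right (V := A.seq.red) (s := 1))
  comul_d := LinearMap.ext freeComul_barDiff

variable (A)

/-- The 1-morphisms of the bar construction. -/
def barCol (e : A.bar.E) : A.seq.E := e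

/-- A tree as an element of the bar construction. -/
def barTree : Forests A.seq.red →ₗ[k] Tot A.bar.X := projF A.seq.red 1

/-- A forest as a word of elements of the bar construction. -/
def barWord : Forests A.seq.red →ₗ[k] Words A.bar.X := ftw A.seq.red 1

variable {A}

theorem bar_ext {N : Type u} [AddCommGroup N] [Module k N] {f g : Tot A.bar.X →ₗ[k] N}
    (h1 : ∀ e : A.seq.E, f (barTree A (leafTree A.seq.red e)) = g (barTree A (leafTree A.seq.red e)))
    (h2 : ∀ (a : HEl A.seq.red) (x : DF A.seq.red), x.WF → x.roots = a.1.top →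
      f (barTree A (treeOp A.seq.red (a.tot ⊗ₜ x.ev))) =
        g (barTree A (treeOp A.seq.red (a.tot ⊗ₜ x.ev)))) (z : Tot A.bar.X) : f z = g z := by
  refine freeFam_ext (V := A.seq.red) (s := 1) (f := f) (g := g) (fun x e hx he => ?_) z
  rcases x.tree_cases e he with rfl | ⟨a, ch, rfl, -⟩
  · rw [← leafTree_eq_ev]; exact h1 e
  · rw [← treeOp_ev]; exact h2 a ch hx.2.1 hx.1

theorem tree_mem (a : HEl A.seq.red) {x : DF A.seq.red} (hx : x.WF) (h : x.roots = a.1.top) :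
    treeOp A.seq.red (a.tot ⊗ₜ x.ev) ∈
      FS A.seq.red 1 x.leaves [a.1.bot] (a.1.deg + 1 + x.deg 1) :=
  treeOp_mem (isIn_tot a) (ev_mem' x hx rfl h rfl)

theorem barWord_leafOp (e : A.seq.E) (x : Forests A.seq.red) :
    barWord A (leafOp A.seq.red e x) =
      letter A.bar.X (barTree A (leafTree A.seq.red e)) * barWord A x := ftw_leafOp e x

theorem barWord_node (a : HEl A.seq.red) (x y : DF A.seq.red) :
    barWord A (DF.node a x y).ev =
      letter A.bar.X (barTree A (treeOp A.seq.red (a.tot ⊗ₜ x.ev))) * barWord A y.ev := by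
  rw [DF.ev_node]; exact ftw_nodeOp _ _ _

theorem bar_d_tree {t : List A.seq.E} {b : A.seq.E} {n : ℤ} {z : Forests A.seq.red}
    (hz : z ∈ FS A.seq.red 1 t [b] n) : A.bar.d (barTree A z) = barTree A (barDF A z) :=
  congrArg (fun z => projF A.seq.red 1 (barDF A z)) (inclF_projF hz)

theorem bar_comul_tree {t : List A.seq.E} {b : A.seq.E} {n : ℤ} {z : Forests A.seq.red}
    (hz : z ∈ FS A.seq.red 1 t [b] n) : A.bar.comul (barTree A z) =
      tmap (barTree A) (barWord A) (cutOp A.seq.red 1 z) :=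
  congrArg (fun z => tmap (projF A.seq.red 1) (ftw A.seq.red 1) (cutOp A.seq.red 1 z))
    (inclF_projF hz)

theorem bar_sg_tree {t : List A.seq.E} {b : A.seq.E} {n : ℤ} {z : Forests A.seq.red}
    (hz : z ∈ FS A.seq.red 1 t [b] n) : sg A.bar.X (barTree A z) = sgn k n • barTree A z :=
  (projF_isIn hz).sg

theorem barProj_tree {t : List A.seq.E} {b : A.seq.E} {n : ℤ} {z : Forests A.seq.red}
    (hz : z ∈ FS A.seq.red 1 t [b] n) :
    A.barProj (barTree A z) = A.seq.inc (cogen A.seq.red z) :=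
  congrArg (fun z => A.seq.inc (cogen A.seq.red z)) (inclF_projF hz)

theorem augUnit_of_isIn {C : TwoCoCatData k I} {A : TwoCatData k I} {col : C.E → A.E}
    {t : List C.E} {b : C.E} {n : ℤ} {x : Tot C.X} (hx : IsIn C.X t b n x) :
    augUnit C A col x = C.aug x • A.unit (col b) := by
  obtain ⟨c, hc, rfl⟩ := hx.exists_tot
  rw [augUnit_tot, hc]

theorem augUnit_tree {t : List A.seq.E} {b : A.seq.E} {n : ℤ} {z : Forests A.seq.red}
    (hz : z ∈ FS A.seq.red 1 t [b] n) : augUnit A.bar A.data (barCol A) (barTree A z) =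
      leafCoeff A.seq.red z • A.seq.unit b :=
  (augUnit_of_isIn (C := A.bar) (projF_isIn hz)).trans
    (congrArg (fun z => leafCoeff A.seq.red z • A.seq.unit b) (inclF_projF hz))

theorem augUnits_barWord (x : DF A.seq.red) (hx : x.WF) :
    augUnits A.bar A.data (barCol A) (barWord A x.ev) =
      leavesCoeffF A.seq.red x.ev • unitWord A x.roots := by
  induction x with
  | nil =>
    rw [DF.ev_nil, show barWord A (nilF A.seq.red) = 1 from ftw_nil, leavesCoeffF_nil, one_smul]
    exact map_one (TensorAlgebra.lift k _)
  | leaf e f ih =>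
    rw [DF.ev_leaf, barWord_leafOp, wordMap_mul, ih hx, leavesCoeffF_leafOp, wordMap_letter,
      augUnit_tree (leafTree_mem 1 e), leafCoeff_leafTree, one_smul, mul_smul_comm]
    rfl
  | node a x y _ _ =>
    rw [barWord_node, wordMap_mul, wordMap_letter, augUnit_tree (tree_mem a hx.2.1 hx.1),
      leafCoeff_tree, leavesCoeffF_node, zero_smul, zero_smul, map_zero, zero_mul]

variable (A) in
/-- The sum over the forests with one vertex that occur in `rootOp`. -/
def rootCoeff : Words A.seq.X ⊗[k] Forests A.seq.red →ₗ[k] Words A.seq.X :=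
  (TensorProduct.rid k _).toLinearMap ∘ₗ lTensor _ (leavesCoeffF A.seq.red)

theorem rootCoeff_tmul (w : Words A.seq.X) (y : Forests A.seq.red) :
    rootCoeff A (w ⊗ₜ y) = leavesCoeffF A.seq.red y • w := by
  simp [rootCoeff]

theorem insertAug_barWord (x : DF A.seq.red) (hx : x.WF) :
    insertAug A.bar A.data (barCol A) A.barProj (barWord A x.ev) =
      rootCoeff A (rootOp A x.ev) := by
  induction x with
  | nil =>
    rw [DF.ev_nil, show barWord A (nilF A.seq.red) = 1 from ftw_nil, insertAug_one, rootOp_nil,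
      map_zero]
  | leaf e f ih =>
    rw [DF.ev_leaf, barWord_leafOp, insertAug_letter_mul, ih hx, augUnit_tree (leafTree_mem 1 e),
      leafCoeff_leafTree, one_smul, barProj_tree (leafTree_mem 1 e), cogen_leafTree, map_zero,
      map_zero, zero_mul, add_zero, rootOp_leafOp]
    refine tensor_ext (f := mulLeft k (letter A.seq.X (A.seq.unit e)) ∘ₗ rootCoeff A)
      (g := rootCoeff A ∘ₗ tmap (mulLeft k (letter A.seq.X (A.seq.unit e)))
        (leafOp A.seq.red e)) (fun w y => ?_) (rootOp A f.ev)
    rw [lcomp_apply, lcomp_apply, map_tmul, rootCoeff_tmul, rootCoeff_tmul, leavesCoeffF_leafOp,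
      map_smul]
  | node a x y _ _ =>
    rw [barWord_node, insertAug_letter_mul, augUnit_tree (tree_mem a hx.2.1 hx.1), leafCoeff_tree,
      zero_smul, map_zero, zero_mul, zero_add, barProj_tree (tree_mem a hx.2.1 hx.1), cogen_tree,
      augUnits_barWord y hx.2.2, rootOp_node, map_add, rootCoeff_tmul, leavesCoeffF_catOp, map_smul,
      map_smul, smul_mul_smul_comm]
    refine (add_eq_left.2 ?_).symm
    refine tensor_ext (f := rootCoeff A ∘ₗ rootTail (treeOp A.seq.red (a.tot ⊗ₜ x.ev)) a.1.bot
      (a.1.deg + 1 + x.deg 1)) (g := 0) (fun w y => ?_) (rootOp A y.ev)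
    rw [lcomp_apply, rootTail, map_tmul, rootCoeff_tmul, lcomp_apply, mk_apply, leavesCoeffF_catOp,
      leavesCoeffF_tree, zero_mul, zero_smul]
    rfl

theorem starOp_barProj_tree (a : HEl A.seq.red) (x : DF A.seq.red) (hx : x.WF)
    (h : x.roots = a.1.top) :
    starOp A.bar A.data (barCol A) A.barProj (barTree A (treeOp A.seq.red (a.tot ⊗ₜ x.ev))) =
      sgn k (a.1.deg + 1) • A.data.mul (A.seq.inc a.tot) (rootCoeff A (rootOp A x.ev)) := by
  have h0 : A.barProj (sg A.bar.X (barTree A (leafTree A.seq.red a.1.bot))) = 0 := by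
    rw [bar_sg_tree (leafTree_mem 1 _), map_smul, barProj_tree (leafTree_mem 1 _), cogen_leafTree,
      map_zero, smul_zero]
  have key : tmap (A.barProj ∘ₗ sg A.bar.X)
      (insertAug A.bar A.data (barCol A) A.barProj) (tmap (barTree A) (barWord A)
        (rTensor _ (treeMap A.seq.red a.tot) (cutOp A.seq.red 1 x.ev))) =
      sgn k (a.1.deg + 1) • (A.seq.inc a.tot ⊗ₜ[k]
        insertAug A.bar A.data (barCol A) A.barProj (barWord A (TensorProduct.lid k _
          (rTensor _ (leavesCoeffF A.seq.red) (cutOp A.seq.red 1 x.ev))))) := by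
    refine cutSpan_ext (f := tmap (A.barProj ∘ₗ sg A.bar.X)
        (insertAug A.bar A.data (barCol A) A.barProj) ∘ₗ
        tmap (barTree A) (barWord A) ∘ₗ
        rTensor _ (treeMap A.seq.red a.tot))
      (g := sgn k (a.1.deg + 1) • (tmk k _ _ (A.seq.inc a.tot) ∘ₗ
        insertAug A.bar A.data (barCol A) A.barProj ∘ₗ barWord A ∘ₗ
        (TensorProduct.lid k _).toLinearMap ∘ₗ rTensor _ (leavesCoeffF A.seq.red)))
      (fun y y' _ hr hw => ?_) (cutOp_ev_mem (s := 1) x)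
    obtain ⟨hy, -, -, -⟩ := hw hx
    have hm := tree_mem a hy (hr.trans h)
    simp only [lcomp_apply, lsmul_apply, rTensor_tmul, map_tmul, LinearEquiv.coe_coe, lid_tmul,
      mk_apply, map_smul]
    rw [bar_sg_tree hm, map_smul, barProj_tree hm, cogen_tree, map_smul, ← smul_tmul', ← smul_tmul',
      smul_smul, smul_smul]
    congr 1
    by_cases h1 : y.deg 1 = 0
    · rw [h1, add_zero]
    · rw [leavesCoeffF_eq_zero y h1, mul_zero, mul_zero]
  rw [starOp, lcomp_apply, lcomp_apply, bar_comul_tree (tree_mem a hx h), cutOp_tree_ev, map_add,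
    map_add, key, leavesCoeff_cut_left, insertAug_barWord x hx, map_tmul, map_tmul, lcomp_apply, h0,
    zero_tmul, zero_add, map_smul, TensorProduct.lift.tmul]

theorem inc_cogen_contract (a : HEl A.seq.red) (x : DF A.seq.red) (hx : x.WF)
    (h : x.roots = a.1.top) :
    A.seq.inc (cogen A.seq.red (contract A (A.seq.inc a.tot) (rootOp A x.ev))) =
      A.data.mul (A.seq.inc a.tot) (rootCoeff A (rootOp A x.ev)) := by
  refine span_ext (f := A.seq.inc ∘ₗ cogen A.seq.red ∘ₗ contract A (A.seq.inc a.tot))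
    (g := A.data.mul (A.seq.inc a.tot) ∘ₗ rootCoeff A) ?_ (rootOp_ev_mem x)
  rintro _ ⟨t, b, n, w, y, hw, hn, h', rfl⟩
  obtain ⟨-, h2, -, -⟩ := h' hx
  rw [h2, h] at hw
  simp only [lcomp_apply]
  rw [contract_tmul, cogen_tree, rootCoeff_tmul, map_smul, map_smul, inc_ret_of_aug _
    (A.isTwoCat.mul_isIn (inc_mem (isIn_tot a)) hw) (A.isTwoCat.aug_mul_eq_zero (inc_mem (isIn_tot
    a)) (aug_inc _) hw)]

variable (A) in
/-- The projection of the bar construction to its cogenerators satisfies the Maurer–Cartan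
equation. -/
theorem barProj_maurerCartan : A.seq.d ∘ₗ A.barProj + A.barProj ∘ₗ A.bar.d +
    starOp A.bar A.data (barCol A) A.barProj = 0 := by
  refine LinearMap.ext fun z => bar_ext (fun e => ?_) (fun a x hx h => ?_) z
  · have hm := leafTree_mem (V := A.seq.red) 1 e
    have h0 : A.barProj (sg A.bar.X (barTree A (leafTree A.seq.red e))) = 0 := by
      rw [bar_sg_tree hm, map_smul, barProj_tree hm, cogen_leafTree, map_zero, smul_zero]
    rw [ladd_apply, ladd_apply, lcomp_apply, lcomp_apply, barProj_tree hm, cogen_leafTree, map_zero,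
      map_zero, bar_d_tree hm, barDF_leafTree, map_zero, map_zero, starOp, lcomp_apply, lcomp_apply,
      bar_comul_tree hm, cutOp_leafTree, map_tmul, map_tmul, lcomp_apply, h0, zero_tmul, map_zero,
      add_zero, zero_add, lzero_apply]
  · have hm := tree_mem a hx h
    have hd : A.seq.inc (SeqData.ret A.isTwoCat.isComplex (A.seq.d (A.seq.inc a.tot))) =
        A.seq.d (A.seq.inc a.tot) :=
      inc_ret_of_aug _ (A.isTwoCat.isComplex.isIn_d (inc_mem (isIn_tot a)))
        (congrArg (fun f => f (A.seq.inc a.tot)) A.isTwoCat.isComplex.aug_d)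
    rw [ladd_apply, ladd_apply, lcomp_apply, lcomp_apply, starOp_barProj_tree a x hx h, barProj_tree
      hm, bar_d_tree hm, barProj_tree (barDF_mem hm), barDF_tree]
    simp only [map_add, map_neg, map_smul, cogen_tree, leavesCoeffF_barDF, hd, inc_cogen_contract a
      x hx h, zero_smul, smul_zero, map_zero, sgn_add, sgn_one, mul_neg_one, neg_smul, lzero_apply]
    abel

theorem leavesCoeffF_ne_zero {x : DF A.seq.red} (h : leavesCoeffF A.seq.red x.ev ≠ 0) :
    x.leaves = x.roots ∧ x.deg 1 = 0 := by
  induction x with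
  | nil => exact ⟨rfl, rfl⟩
  | leaf e f ih =>
    rw [DF.ev_leaf, leavesCoeffF_leafOp] at h
    exact ⟨congrArg (e :: ·) (ih h).1, (ih h).2⟩
  | node a x y _ _ => exact absurd (leavesCoeffF_node a x y) h

theorem barProj_mem (c : HEl A.bar.X) : IsIn A.seq.X (c.1.top.map (barCol A)) (barCol A c.1.bot)
    (c.1.deg - 1) (A.barProj c.tot) := by
  rw [show c.1.top.map (barCol A) = c.1.top from List.map_id' _]
  refine inc_mem ?_
  refine FS_map_le (cogen A.seq.red) (LinearMap.range (of A.seq.red _))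
    (fun x hx ht hb hn => ?_) (inclF_tot_mem (V := A.seq.red) (s := 1) c)
  rcases x.tree_cases _ hb with rfl | ⟨a, ch, rfl, hab⟩
  · rw [← leafTree_eq_ev, cogen_leafTree]; exact zero_mem _
  · rw [← treeOp_ev, cogen_tree]
    by_cases h : leavesCoeffF A.seq.red ch.ev = 0
    · rw [h, zero_smul]; exact zero_mem _
    · obtain ⟨h1, h2⟩ := leavesCoeffF_ne_zero h
      refine Submodule.smul_mem _ _ ?_
      rw [DF.leaves_node, DF.leaves_nil, List.append_nil, h1] at ht
      rw [DF.deg_node, DF.deg_nil, h2] at hn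
      have h3 : a.1 = ⟨c.1.top, barCol A c.1.bot, c.1.deg - 1⟩ := by
        obtain ⟨⟨t, b, n⟩, v⟩ := a
        change (⟨t, b, n⟩ : GCell A.seq.E) = _
        exact (GCell.mk.injEq _ _ _ _ _ _).mpr ⟨hx.1.symm.trans ht, hab, by rw [← hn]; simp⟩
      rw [← h3]
      exact ⟨_, rfl⟩

/-- The Bianchi identity shows that `d ∘ d` vanishes after the projection to the cogenerators, since
`d ∘ d = 0` holds in `A`. -/
theorem cogen_barDF_barDF {x : DF A.seq.red} (hx : x.WF) {b : A.seq.E} (hb : x.roots = [b]) :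
    cogen A.seq.red (barDF A (barDF A x.ev)) = 0 := by
  have hm : x.ev ∈ FS A.seq.red 1 x.leaves [b] (x.deg 1) := ev_mem' x hx rfl hb rfl
  have h := bianchi (bar_preCocat A) A.isTwoCat.preCat A.barProj barProj_mem (barProj_maurerCartan A)
    (barTree A x.ev)
  rw [bar_d_tree hm, bar_d_tree (barDF_mem hm), barProj_tree (barDF_mem (barDF_mem hm))] at h
  rw [← ret_inc A.isTwoCat.isComplex (cogen A.seq.red _), ← h]
  exact (congrArg (fun f => SeqData.ret A.isTwoCat.isComplex (f (A.barProj (barTree A x.ev))))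
    A.isTwoCat.isComplex.d_d).trans (map_zero _)

theorem barDF₂_barDF₂ {x : DF A.seq.red} (hx : x.WF) {z : Forests A.seq.red ⊗[k] Forests A.seq.red}
    (hz : z ∈ cutSpan x) : barDF₂ A (barDF₂ A z) =
      rTensor _ (barDF A ∘ₗ barDF A) z + lTensor _ (barDF A ∘ₗ barDF A) z := by
  refine cutSpan_ext (f := barDF₂ A ∘ₗ barDF₂ A) (g := rTensor _ (barDF A ∘ₗ barDF A) +
    lTensor _ (barDF A ∘ₗ barDF A)) (fun y y' _ _ hw => ?_) hz
  obtain ⟨hy, -, -, -⟩ := hw hx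
  simp only [lcomp_apply, ladd_apply, barDF₂, rTensor_tmul, lTensor_tmul, map_tmul, map_add]
  rw [sgF_of_mem 1 (barDF_mem (ev_mem 1 y hy)), sgF_ev]
  simp only [map_smul, ← smul_tmul', one_mul, sgF_ev, smul_smul, sgn_mul_self, one_smul]
  have h : sgn k (y.deg 1 - 1) = -sgn k (y.deg 1) := by
    rw [sub_eq_add_neg, sgn_add, sgn_odd (n := -1) (by decide), mul_neg_one]
  rw [h]
  module

theorem barDF_barDF {t b : List A.seq.E} {n : ℤ} {z : Forests A.seq.red}
    (hz : z ∈ FS A.seq.red 1 t b n) : barDF A (barDF A z) = 0 := by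
  refine FS_ext (f := barDF A ∘ₗ barDF A) (g := 0) (fun x hx h1 h2 h3 => ?_) hz
  clear hz h1 h2 h3
  rw [lcomp_apply, lzero_apply]
  induction x with
  | nil => rw [DF.ev_nil, barDF_nil, map_zero]
  | leaf e f ih => rw [DF.ev_leaf, barDF_leafOp, barDF_leafOp, ih hx, map_zero]
  | node a x y ih1 ih2 =>
    have hm := tree_mem a hx.2.1 hx.1
    have hm' := barDF_mem hm
    -- A tree is determined by the cuts whose lower part has one vertex. For these cuts, `d ∘ d`
    -- vanishes on the lower part by the Bianchi identity, and above it by induction.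
    have h1 : rTensor _ (cogen A.seq.red) (rTensor _ (barDF A ∘ₗ barDF A)
        (cutOp A.seq.red 1 (DF.node a x DF.nil).ev)) = 0 := by
      refine cutSpan_ext (f := rTensor _ (cogen A.seq.red) ∘ₗ
        rTensor _ (barDF A ∘ₗ barDF A)) (g := 0) (fun y y' _ hr hw => ?_)
        (cutOp_ev_mem (s := 1) (DF.node a x DF.nil))
      rw [lcomp_apply, rTensor_tmul, rTensor_tmul, lcomp_apply, cogen_barDF_barDF (hw ⟨hx.1, hx.2.1,
        trivial⟩).1 hr, zero_tmul, lzero_apply]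
    have h2 : barDF A (barDF A (treeOp A.seq.red (a.tot ⊗ₜ x.ev))) = 0 := by
      rw [eq_leaf_add_tree (barDF_mem hm'), leafCoeff_barDF hm', zero_smul, zero_add, cutOp_barDF
        hm', cutOp_barDF hm, treeOp_ev, barDF₂_barDF₂ (x := DF.node a x DF.nil) ⟨hx.1, hx.2.1,
        trivial⟩ (cutOp_ev_mem _), map_add, h1, ← lTensor_rTensor_comm, ← treeOp_ev, cogen_cut_tree,
        lTensor_tmul, lcomp_apply, ih1 hx.2.1, tmul_zero, add_zero, map_zero]
    rw [DF.ev_node, nodeOp_eq_catOp, barDF_catOp hm, map_add, map_smul, barDF_catOp hm', barDF_catOp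
      hm, h2, ih2 hx.2.2, zero_tmul, tmul_zero, map_zero, smul_zero, add_zero, zero_add, ← add_smul]
    rw [sub_eq_add_neg, sgn_add _ (-1), sgn_odd (n := -1) (by decide), mul_neg_one]
    simp

theorem bar_isPath (i j : I) (s : List A.seq.E) : A.bar.IsPath i s j ↔ A.seq.IsPath i s j := by
  induction s generalizing i with
  | nil => exact Iff.rfl
  | cons e s ih => exact and_congr Iff.rfl (ih _)

variable (A)

theorem bar_isComplex : A.bar.IsComplex where
  supp p hp := freeFam_supp (S := A.seq) A.isTwoCat.isComplex.supp 1 p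
    fun h => hp ⟨h.1, (bar_isPath _ _ _).2 h.2⟩
  d_mem := (bar_preCocat A).d_mem
  d_d := LinearMap.ext fun z => by
    refine tot_ext (V := freeFam A.seq.red 1) (f := barDiff A ∘ₗ barDiff A) (g := 0) (fun a => ?_) z
    refine inclF_injective ?_
    rw [lcomp_apply, inclF_barDiff, inclF_barDiff, barDF_barDF (inclF_tot_mem a), lzero_apply,
      map_zero]
  unit_mem := freeUnit_mem (V := A.seq.red) (s := 1)
  d_unit e := (bar_d_tree (leafTree_mem 1 e)).trans
    ((congrArg (barTree A) (barDF_leafTree e)).trans (map_zero _))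
  aug_off := (bar_preCocat A).aug_off
  aug_unit e := (congrArg (leafCoeff A.seq.red) (inclF_freeUnit e)).trans (leafCoeff_leafTree _)
  aug_d := (bar_preCocat A).aug_d

theorem range_lTensor_subtype_mono (M : Type u) {N : Type u} [AddCommGroup M] [Module k M]
    [AddCommGroup N] [Module k N] {P Q : Submodule k N} (h : P ≤ Q) :
    LinearMap.range (lTensor M P.subtype) ≤
      LinearMap.range (lTensor M Q.subtype) := by
  rintro _ ⟨y, rfl⟩
  refine ⟨lTensor M (Submodule.inclusion h) y, ?_⟩
  rw [← lcomp_apply, ← LinearMap.lTensor_comp, Submodule.subtype_comp_inclusion]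

theorem treesLE_subset_corad (n : ℕ) :
    treesLE A.seq.red 1 n ⊆ (A.bar.corad n : Set (Tot A.bar.X)) := by
  induction n with
  | zero =>
    rintro _ ⟨x, hx, ⟨e, he⟩, hn, rfl⟩
    rcases x.tree_cases e he with rfl | ⟨a, ch, rfl, -⟩
    · rw [← leafTree_eq_ev]
      have h : A.bar.unit e ∈ A.bar.units := subset_span (Set.mem_range_self e)
      exact h
    · have h1 := ch.size_nonneg
      rw [DF.size_node, DF.size_nil] at hn
      push_cast at hn
      omega
  | succ n ih =>
    intro z hz
    have h := freeComul_treesLE (V := A.seq.red) (s := 1) n hz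
    have hle : Subalgebra.toSubmodule (Algebra.adjoin k
          (letter (freeFam A.seq.red 1) '' treesLE A.seq.red 1 n)) ≤
        Subalgebra.toSubmodule (Algebra.adjoin k
          (letter (freeFam A.seq.red 1) '' (A.bar.corad n : Set (Tot A.bar.X)))) :=
      Subalgebra.toSubmodule.monotone (Algebra.adjoin_mono (Set.image_mono ih))
    have h2 := sup_le_sup_left (range_lTensor_subtype_mono (Tot (freeFam A.seq.red 1)) hle)
      (LinearMap.range (rTensor (Words (freeFam A.seq.red 1))
        (Submodule.span k (Set.range (freeUnit A.seq.red 1))).subtype))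
    exact h2 h

/-- The bar construction is an object of 2-coCat_I. -/
theorem bar_isTwoCoCat : A.bar.IsTwoCoCat where
  isComplex := bar_isComplex A
  comul_mem := (bar_preCocat A).comul_mem
  coassoc := (bar_preCocat A).coassoc
  counit_comul := (bar_preCocat A).counit_comul
  comul_counit := (bar_preCocat A).comul_counit
  comul_d := (bar_preCocat A).comul_d
  comul_unit := freeComul_unit (V := A.seq.red) (s := 1)
  connected c := by
    obtain ⟨n, hn⟩ := mem_span_treesLE (V := A.seq.red) (s := 1) c
    have h : Submodule.span k (treesLE A.seq.red 1 n) ≤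
        (show Submodule k (Tot (freeFam A.seq.red 1)) from A.bar.corad n) :=
      Submodule.span_le.2 (treesLE_subset_corad A n)
    exact ⟨n, h hn⟩

end BarObject

/-! ### Twisting cochains and morphisms -/

section TwistingFunctoriality

variable {k : Type u} [Field k] {I : Type w}

theorem IsIn.map {E E' : Type u} {X : Fam k E} {X' : Fam k E'} (φ : ℤ → ℤ)
    {f : Tot X →ₗ[k] Tot X'} {col : E → E'}
    (hf : ∀ (p : GCell E) (x : X p), IsIn X' (p.top.map col) (col p.bot) (φ p.deg) (f (of X p x)))
    {t : List E} {b : E} {n : ℤ} {x : Tot X} (hx : IsIn X t b n x) :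
    IsIn X' (t.map col) (col b) (φ n) (f x) := by
  obtain ⟨⟨p, y⟩, rfl, rfl⟩ := hx.exists_tot
  exact hf ⟨t, b, n⟩ y

theorem map_sg_of_mem {E E' : Type u} {X : Fam k E} {X' : Fam k E'} {f : Tot X →ₗ[k] Tot X'}
    {col : E → E'}
    (hf : ∀ (p : GCell E) (x : X p), IsIn X' (p.top.map col) (col p.bot) p.deg (f (of X p x)))
    (x : Tot X) : sg X' (f x) = f (sg X x) :=
  tot_ext (f := sg X' ∘ₗ f) (g := f ∘ₗ sg X) (fun a => by
    rw [lcomp_apply, lcomp_apply, (hf a.1 a.2).sg, sg_tot, map_smul]) x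

section Algebras

variable {C : TwoCoCatData k I} {A A' : TwoCatData k I}
  {F : SeqData.PreHom A.toSeqData A'.toSeqData} {col : C.E → A.E}

theorem map_augUnit (hF : F.IsSeqHom) (c : Tot C.X) :
    F.lin (augUnit C A col c) = augUnit C A' (F.col ∘ col) c :=
  tot_ext (f := F.lin ∘ₗ augUnit C A col) (g := augUnit C A' (F.col ∘ col)) (fun a => by
    rw [lcomp_apply, augUnit_tot, map_smul, augUnit_tot, hF.unit]
    rfl) c

theorem wordMap_augUnits (hF : F.IsSeqHom) (x : Words C.X) :
    wordMap F.lin (augUnits C A col x) = augUnits C A' (F.col ∘ col) x := by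
  refine tensorAlgebra_ext (f := wordMap F.lin ∘ₗ augUnits C A col)
    (g := augUnits C A' (F.col ∘ col)) ?_ (fun c x h => ?_) x
  · rw [lcomp_apply, wordMap_one, wordMap_one, wordMap_one]
  · rw [lcomp_apply] at h ⊢
    rw [wordMap_mul, wordMap_mul, h, wordMap_mul, wordMap_letter, wordMap_letter, map_augUnit hF,
      wordMap_letter]

theorem wordMap_insertAug (hF : F.IsSeqHom) (α : Tot C.X →ₗ[k] Tot A.X) (x : Words C.X) :
    wordMap F.lin (insertAug C A col α x) = insertAug C A' (F.col ∘ col) (F.lin ∘ₗ α) x := by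
  refine tensorAlgebra_ext (f := wordMap F.lin ∘ₗ insertAug C A col α)
    (g := insertAug C A' (F.col ∘ col) (F.lin ∘ₗ α)) ?_ (fun c x h => ?_) x
  · rw [lcomp_apply, insertAug_one, map_zero, insertAug_one]
  · rw [lcomp_apply] at h ⊢
    rw [insertAug_letter_mul, map_add, wordMap_mul, wordMap_mul, h, wordMap_augUnits hF,
      wordMap_letter, wordMap_letter, map_augUnit hF, insertAug_letter_mul]
    rfl

theorem map_starOp (hC : PreCocat C) (hA : PreCat A) (hF : TwoCatData.IsHom F)
    {α : Tot C.X →ₗ[k] Tot A.X} (hα : ∀ a : HEl C.X,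
      IsIn A.X (a.1.top.map col) (col a.1.bot) (a.1.deg - 1) (α a.tot)) (c : Tot C.X) :
    F.lin (starOp C A col α c) = starOp C A' (F.col ∘ col) (F.lin ∘ₗ α) c := by
  refine tot_ext (f := F.lin ∘ₗ starOp C A col α) (g := starOp C A' (F.col ∘ col) (F.lin ∘ₗ α))
    (fun c => ?_) c
  refine hC.comul_ext c (f := F.lin ∘ₗ TensorProduct.lift A.mul ∘ₗ
    tmap (α ∘ₗ sg C.X) (insertAug C A col α))
    (g := TensorProduct.lift A'.mul ∘ₗ tmap ((F.lin ∘ₗ α) ∘ₗ sg C.X)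
      (insertAug C A' (F.col ∘ col) (F.lin ∘ₗ α))) (fun a l h1 _ _ _ => ?_)
  have hl := insertAug_mem hC hA α hα l
  rw [h1] at hl
  rw [lcomp_apply, lcomp_apply, lcomp_apply, map_tmul, map_tmul, TensorProduct.lift.tmul,
    TensorProduct.lift.tmul, ← wordMap_insertAug hF.isSeqHom, lcomp_apply, lcomp_apply, lcomp_apply,
    sg_tot, map_smul, hF.mul_of_mem ((hα a).smul _) hl]

end Algebras

section Coalgebras

variable {C C' : TwoCoCatData k I} {A : TwoCatData k I} {colG : C.E → C'.E}
  {G : Tot C.X →ₗ[k] Tot C'.X} {col : C'.E → A.E}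

theorem augUnit_map (hG : ∀ (p : GCell C.E) (x : C.X p),
      IsIn C'.X (p.top.map colG) (colG p.bot) p.deg (G (of C.X p x)))
    (haug : ∀ c, C'.aug (G c) = C.aug c) (c : Tot C.X) :
    augUnit C' A col (G c) = augUnit C A (col ∘ colG) c :=
  tot_ext (f := augUnit C' A col ∘ₗ G) (g := augUnit C A (col ∘ colG)) (fun a => by
    rw [lcomp_apply, augUnit_of_isIn (hG a.1 a.2), augUnit_tot, haug]
    rfl) c

theorem insertAug_wordMap (hu : ∀ c, augUnit C' A col (G c) = augUnit C A (col ∘ colG) c)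
    (α : Tot C'.X →ₗ[k] Tot A.X) (x : Words C.X) :
    insertAug C' A col α (wordMap G x) = insertAug C A (col ∘ colG) (α ∘ₗ G) x := by
  have h2 : ∀ x, augUnits C' A col (wordMap G x) = augUnits C A (col ∘ colG) x := fun x => by
    refine tensorAlgebra_ext (f := augUnits C' A col ∘ₗ wordMap G)
      (g := augUnits C A (col ∘ colG)) ?_ (fun c x h => ?_) x
    · rw [lcomp_apply, wordMap_one, wordMap_one, wordMap_one]
    · rw [lcomp_apply] at h ⊢
      rw [wordMap_mul, wordMap_mul, h, wordMap_mul, wordMap_letter, wordMap_letter, hu,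
        wordMap_letter]
  refine tensorAlgebra_ext (f := insertAug C' A col α ∘ₗ wordMap G)
    (g := insertAug C A (col ∘ colG) (α ∘ₗ G)) ?_ (fun c x h => ?_) x
  · rw [lcomp_apply, wordMap_one, insertAug_one, insertAug_one]
  · rw [lcomp_apply] at h ⊢
    rw [wordMap_mul, wordMap_letter, insertAug_letter_mul, h, h2, hu, insertAug_letter_mul]
    rfl

/-- This does not use that `G` is compatible with the differentials. -/
theorem starOp_map (hG : ∀ (p : GCell C.E) (x : C.X p),
      IsIn C'.X (p.top.map colG) (colG p.bot) p.deg (G (of C.X p x)))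
    (haug : ∀ c, C'.aug (G c) = C.aug c)
    (hcomul : ∀ c, C'.comul (G c) = tmap G (wordMap G) (C.comul c))
    (α : Tot C'.X →ₗ[k] Tot A.X) (c : Tot C.X) :
    starOp C' A col α (G c) = starOp C A (col ∘ colG) (α ∘ₗ G) c := by
  have h1 : (α ∘ₗ sg C'.X) ∘ₗ G = (α ∘ₗ G) ∘ₗ sg C.X :=
    LinearMap.ext fun x => congrArg α (map_sg_of_mem hG x)
  have h2 : insertAug C' A col α ∘ₗ wordMap G = insertAug C A (col ∘ colG) (α ∘ₗ G) :=
    LinearMap.ext fun x => insertAug_wordMap (augUnit_map hG haug) α x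
  rw [starOp, lcomp_apply, lcomp_apply, hcomul, map_map_tensor, h1, h2]
  rfl

end Coalgebras

/-- The composition of a twisting cochain with a morphism of 2-Cat_I is a twisting cochain. -/
theorem IsTwistingCochain.comp_hom {C : TwoCoCat k I} {A A' : TwoCat k I}
    {α : SeqData.PreHom C.seq A.seq} (hα : IsTwistingCochain C A α)
    {F : SeqData.PreHom A.seq A'.seq} (hF : TwoCatData.IsHom (A := A.data) (A' := A'.data) F) :
    IsTwistingCochain C A' (α.comp F) where
  src e := (hF.isSeqHom.src _).trans (hα.src e)
  tgt e := (hF.isSeqHom.tgt _).trans (hα.tgt e)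
  mem p x := by
    have h := IsIn.map id hF.isSeqHom.mem (hα.mem p x)
    rw [List.map_map] at h
    exact h
  aug := by
    rw [SeqData.PreHom.comp, ← LinearMap.comp_assoc, hF.isSeqHom.aug, hα.aug]
  unit e := by rw [SeqData.PreHom.comp, lcomp_apply, hα.unit, map_zero]
  maurerCartan := LinearMap.ext fun c => by
    have h1 := congrArg (fun f => F.lin (f c)) hα.maurerCartan
    have h2 := map_starOp C.isTwoCoCat.preCocat A.isTwoCat.preCat hF (fun a => hα.mem a.1 a.2) c
    have h3 := congrArg (fun f => f (α.lin c)) hF.isSeqHom.d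
    simp only [ladd_apply, lcomp_apply, map_add, lzero_apply, map_zero, star_eq_starOp] at h1 h3 ⊢
    rw [h2, h3] at h1
    exact h1

/-- The composition of a morphism of 2-coCat_I with a twisting cochain is a twisting cochain. -/
theorem IsTwistingCochain.hom_comp {C C' : TwoCoCat k I} {A : TwoCat k I}
    {α : SeqData.PreHom C'.seq A.seq} (hα : IsTwistingCochain C' A α)
    {G : SeqData.PreHom C.seq C'.seq}
    (hG : TwoCoCatData.IsHom (C := C.data) (C' := C'.data) G) :
    IsTwistingCochain C A (G.comp α) where
  src e := (hα.src _).trans (hG.isSeqHom.src e)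
  tgt e := (hα.tgt _).trans (hG.isSeqHom.tgt e)
  mem p x := by
    have h := IsIn.map (· - 1) hα.mem (hG.isSeqHom.mem p x)
    rw [List.map_map] at h
    exact h
  aug := by
    rw [SeqData.PreHom.comp, ← LinearMap.comp_assoc, hα.aug, LinearMap.zero_comp]
  unit e := by rw [SeqData.PreHom.comp, lcomp_apply, hG.isSeqHom.unit, hα.unit]
  maurerCartan := LinearMap.ext fun c => by
    have h1 := congrArg (fun f => f (G.lin c)) hα.maurerCartan
    have h2 := starOp_map (col := α.col) hG.isSeqHom.mem
      (fun c => congrArg (fun f => f c) hG.isSeqHom.aug)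
      (fun c => congrArg (fun f => f c) hG.comul) α.lin c
    have h3 := congrArg (fun f => α.lin (f c)) hG.isSeqHom.d
    simp only [ladd_apply, lcomp_apply, lzero_apply, star_eq_starOp] at h1 h3 ⊢
    rw [h2, ← h3] at h1
    exact h1

end TwistingFunctoriality

section ConstructionTwisting

variable {k : Type u} [Field k] {I : Type w}

/-- The generators `C → 𝓑*(C)` form a twisting cochain. -/
theorem cobarIncl_isTwisting (C : TwoCoCat k I) :
    IsTwistingCochain C ⟨C.cobar, cobar_isTwoCat C⟩ ⟨cobarCol C, C.cobarIncl⟩ where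
  src _ := rfl
  tgt _ := rfl
  mem p x := cobarIncl_mem' ⟨p, x⟩
  aug := LinearMap.ext fun c => by
    refine (congrArg (leafCoeff C.seq.red) (cobarInc_cobarIncl c)).trans ?_
    refine tot_ext (f := leafCoeff C.seq.red ∘ₗ corolla C.seq.red) (g := 0) (fun a => ?_) _
    rw [lcomp_apply, corolla_tot, leafCoeff_tree, lzero_apply]
  unit e := (congrArg (fun v => projF C.seq.red (-1) (corolla C.seq.red v)) (ret_unit _ e)).trans
    ((congrArg _ (map_zero _)).trans (map_zero _))
  maurerCartan := cobarIncl_maurerCartan C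

/-- The projection `𝓑(A) → A` to the cogenerators is a twisting cochain. -/
theorem barProj_isTwisting (A : TwoCat k I) :
    IsTwistingCochain ⟨A.bar, bar_isTwoCoCat A⟩ A ⟨barCol A, A.barProj⟩ where
  src _ := rfl
  tgt _ := rfl
  mem p x := barProj_mem ⟨p, x⟩
  aug := LinearMap.ext fun _ => aug_inc _
  unit e := (barProj_tree (leafTree_mem 1 e)).trans
    ((congrArg A.seq.inc (cogen_leafTree _)).trans (map_zero _))
  maurerCartan := barProj_maurerCartan A

end ConstructionTwisting

/-! ### The universal property of the cofree 2-cocategory -/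

section CofreeUniversal

variable {k : Type u} [Field k] {I : Type w} {C : TwoCoCat k I}

/-- If `β` vanishes on the units, then `(β ⊗ L) ∘ Δ` at a point of the `n`-th step of the coradical
filtration depends only on `L` on words in the previous steps. All recursions below rest on this. -/
theorem map_comul_congr {n : ℕ} {c : Tot C.seq.X} (hc : c ∈ C.data.corad n) {M N : Type u}
    [AddCommGroup M] [Module k M] [AddCommGroup N] [Module k N] {β : Tot C.seq.X →ₗ[k] M}
    (hβ : ∀ e, β (C.seq.unit e) = 0) {L L' : Words C.seq.X →ₗ[k] N}
    (h : ∀ m < n, ∀ x ∈ Algebra.adjoin k (letter C.seq.X '' (C.data.corad m : Set (Tot C.seq.X))),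
      L x = L' x) :
    tmap β L (C.data.comul c) = tmap β L' (C.data.comul c) := by
  have hu : ∀ c ∈ C.data.units, β c = 0 := fun c hc =>
    span_ext (f := β) (g := 0) (by rintro _ ⟨e, rfl⟩; exact hβ e) hc
  cases n with
  | zero =>
    refine span_ext (f := tmap β L ∘ₗ C.data.comul)
      (g := tmap β L' ∘ₗ C.data.comul) ?_ hc
    rintro _ ⟨e, rfl⟩
    rw [lcomp_apply, lcomp_apply, C.isTwoCoCat.comul_unit, map_tmul, map_tmul, hβ, zero_tmul,
      zero_tmul]
  | succ n =>
    obtain ⟨_, ⟨p, rfl⟩, _, ⟨q, rfl⟩, hpq⟩ := Submodule.mem_sup.1 hc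
    rw [← hpq, map_add, map_add]
    refine congrArg₂ (· + ·) ?_ ?_
    · refine tensor_ext (f := tmap β L ∘ₗ rTensor _ C.data.units.subtype)
        (g := tmap β L' ∘ₗ rTensor _ C.data.units.subtype)
        (fun a b => ?_) p
      rw [lcomp_apply, lcomp_apply, rTensor_tmul, map_tmul, map_tmul, Submodule.subtype_apply, hu _
        a.2, zero_tmul, zero_tmul]
    · refine tensor_ext (f := tmap β L ∘ₗ lTensor _ (Submodule.subtype _))
        (g := tmap β L' ∘ₗ lTensor _ (Submodule.subtype _))
        (fun a b => ?_) q
      rw [lcomp_apply, lcomp_apply, lTensor_tmul, map_tmul, map_tmul, Submodule.subtype_apply, h n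
        n.lt_succ_self _ b.2]

theorem corad_induction {P : Tot C.seq.X → Prop}
    (h : ∀ n, (∀ m < n, ∀ c ∈ C.data.corad m, P c) → ∀ c ∈ C.data.corad n, P c)
    (c : Tot C.seq.X) : P c := by
  obtain ⟨n, hn⟩ := C.isTwoCoCat.connected c
  exact Nat.strong_induction_on (p := fun n => ∀ c ∈ C.data.corad n, P c) n h c hn

variable {E : Type u} {V : Fam k E} {col : C.seq.E → E} {β : Tot C.seq.X →ₗ[k] Tot V}

variable (V col) in
/-- The map `C → k_E`, with `k_E` as the span of the trees without vertices. -/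
def colLeaf : Tot C.seq.X →ₗ[k] Forests V := DirectSum.toModule k _ _ fun p =>
  (C.seq.aug ∘ₗ of C.seq.X p).smulRight (leafTree V (col p.bot))

theorem colLeaf_tot (c : HEl C.seq.X) :
    colLeaf V col c.tot = C.seq.aug c.tot • leafTree V (col c.1.bot) := by
  simp [colLeaf]

theorem colLeaf_mem (c : HEl C.seq.X) :
    colLeaf V col c.tot ∈ FS V 1 (c.1.top.map col) [col c.1.bot] c.1.deg := by
  rw [colLeaf_tot]
  by_cases hp : c.1 = ⟨[c.1.bot], c.1.bot, 0⟩
  · rw [hp]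
    exact Submodule.smul_mem _ _ (leafTree_mem 1 _)
  · rw [C.isTwoCoCat.isComplex.aug_off _ _ hp, zero_smul]
    exact Submodule.zero_mem _

/-- The equation for the extension of `β : C → ΣV` to a map from `C` to the cofree 2-cocategory: the
root vertex is given by `β`, and the trees above it by the map itself. -/
def IsCoExt (col : C.seq.E → E) (β : Tot C.seq.X →ₗ[k] Tot V)
    (g : Tot C.seq.X →ₗ[k] Forests V) : Prop :=
  ∀ c, g c = colLeaf V col c + treeOp V (tmap β (catLift g) (C.data.comul c))

/-- Uniqueness of the extension, by induction over the coradical filtration. -/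
theorem IsCoExt.unique (hβ : ∀ e, β (C.seq.unit e) = 0) {g g' : Tot C.seq.X →ₗ[k] Forests V}
    (h : IsCoExt col β g) (h' : IsCoExt col β g') : g = g' :=
  LinearMap.ext fun c => corad_induction (P := fun c => g c = g' c) (fun n ih c hc => by
    rw [h c, h' c, map_comul_congr hc hβ fun m hm x hx => catLift_congr_adjoin (ih m hm) hx]) c

variable (col β) in
/-- The approximations of the extension of `β` by trees of bounded height. -/
def coExtN : ℕ → (Tot C.seq.X →ₗ[k] Forests V)
  | 0 => colLeaf V col
  | n + 1 => colLeaf V col + treeOp V ∘ₗ tmap β (catLift (coExtN n)) ∘ₗ C.data.comul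

theorem coExtN_succ (n : ℕ) (c : Tot C.seq.X) : coExtN col β (n + 1) c = colLeaf V col c +
    treeOp V (tmap β (catLift (coExtN col β n)) (C.data.comul c)) := rfl

theorem coExtN_eq (hβ : ∀ e, β (C.seq.unit e) = 0) {n m : ℕ} (h : n ≤ m) {c : Tot C.seq.X}
    (hc : c ∈ C.data.corad n) : coExtN col β m c = coExtN col β n c := by
  induction n using Nat.strong_induction_on generalizing m c with
  | _ n ih =>
    cases m with
    | zero => rw [Nat.le_zero.1 h]
    | succ m =>
      cases n with
      | zero =>
        rw [coExtN_succ, map_comul_congr hc hβ (L' := 0) fun m hm => absurd hm (Nat.not_lt_zero m),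
          TensorProduct.map_zero_right, lzero_apply, map_zero, add_zero, coExtN]
      | succ n =>
        rw [coExtN_succ, coExtN_succ, map_comul_congr hc hβ fun j hj x hx =>
          catLift_congr_adjoin (fun c hc => ?_) hx]
        exact (ih j hj (by omega) hc).trans (ih j hj (by omega) hc).symm

variable (col) in
theorem exists_coExt (hβ : ∀ e, β (C.seq.unit e) = 0) :
    ∃ g : Tot C.seq.X →ₗ[k] Forests V, ∀ n, ∀ c ∈ C.data.corad n, g c = coExtN col β n c := by
  choose N hN using C.isTwoCoCat.connected
  have h : ∀ n c, N c ≤ n → coExtN col β (N c) c = coExtN col β n c :=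
    fun n c hn => (coExtN_eq hβ hn (hN c)).symm
  refine ⟨{ toFun := fun c => coExtN col β (N c) c
            map_add' := fun c c' => ?_
            map_smul' := fun r c => ?_ }, fun n c hc => ?_⟩
  · rw [h (N (c + c') + N c + N c') (c + c') (by omega), h (N (c + c') + N c + N c') c (by omega),
      h (N (c + c') + N c + N c') c' (by omega), map_add]
  · rw [h (N (r • c) + N c) (r • c) (by omega), h (N (r • c) + N c) c (by omega), map_smul]
    rfl
  · exact (h (N c + n) c (by omega)).trans (coExtN_eq hβ (by omega) hc)

theorem coExtN_mem (hβ : ∀ a : HEl C.seq.X, IsIn V (a.1.top.map col) (col a.1.bot) (a.1.deg - 1)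
    (β a.tot)) (n : ℕ) (c : HEl C.seq.X) :
    coExtN col β n c.tot ∈ FS V 1 (c.1.top.map col) [col c.1.bot] c.1.deg := by
  induction n generalizing c with
  | zero => exact colLeaf_mem c
  | succ n ih =>
    refine Submodule.add_mem _ (colLeaf_mem c) ?_
    refine C.isTwoCoCat.preCocat.comul_map_le c
      (treeOp V ∘ₗ tmap β (catLift (coExtN col β n))) _ fun a l h1 h2 h3 h4 => ?_
    have hl := catLift_word_mem col 1 (coExtN col β n) l fun a _ => ih a
    rw [h1, h2] at hl
    exact FS_cast (treeOp_mem (hβ a) hl) rfl (by rw [h3]) (by rw [← h4]; ring)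

/-- The trees of all heights stabilize, since `C` is connected. -/
theorem exists_isCoExt (hβ : ∀ e, β (C.seq.unit e) = 0)
    (hβ' : ∀ a : HEl C.seq.X, IsIn V (a.1.top.map col) (col a.1.bot) (a.1.deg - 1) (β a.tot)) :
    ∃ g : Tot C.seq.X →ₗ[k] Forests V, IsCoExt col β g ∧
      ∀ c : HEl C.seq.X, g c.tot ∈ FS V 1 (c.1.top.map col) [col c.1.bot] c.1.deg := by
  obtain ⟨g, hg⟩ := exists_coExt col hβ
  refine ⟨g, fun c => ?_, fun c => ?_⟩
  · obtain ⟨n, hn⟩ := C.isTwoCoCat.connected c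
    rw [hg n c hn, ← coExtN_eq hβ n.le_succ hn, coExtN_succ, map_comul_congr hn hβ fun m hm x hx =>
      catLift_congr_adjoin (fun c hc => ?_) hx]
    rw [hg m c hc, coExtN_eq hβ hm.le hc]
  · obtain ⟨n, hn⟩ := C.isTwoCoCat.connected c.tot
    rw [hg n _ hn]
    exact coExtN_mem hβ' n c

section Properties

variable {g : Tot C.seq.X →ₗ[k] Forests V} (hg : IsCoExt col β g)

theorem leavesCoeffF_colLeaf (c : Tot C.seq.X) : leavesCoeffF V (colLeaf V col c) = C.seq.aug c :=
  tot_ext (f := leavesCoeffF V ∘ₗ colLeaf V col) (g := C.seq.aug) (fun a => by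
    rw [lcomp_apply, colLeaf_tot, map_smul, leafTree, leavesCoeffF_leafOp, leavesCoeffF_nil,
      smul_eq_mul, mul_one]) c

theorem leavesCoeffF_treeOp (z : Tot V ⊗[k] Forests V) : leavesCoeffF V (treeOp V z) = 0 :=
  tensor_ext (f := leavesCoeffF V ∘ₗ treeOp V) (g := 0) leavesCoeffF_tree z

theorem IsCoExt.leavesCoeffF (hg : IsCoExt col β g) (c : Tot C.seq.X) :
    leavesCoeffF V (g c) = C.seq.aug c := by
  rw [hg c, map_add, leavesCoeffF_colLeaf, leavesCoeffF_treeOp, add_zero]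

theorem IsCoExt.leavesCoeffF_catLift (hg : IsCoExt col β g) (x : Words C.seq.X) :
    BarCobar.leavesCoeffF V (catLift g x) = TensorAlgebra.lift k C.seq.aug x := by
  refine tensorAlgebra_ext (f := BarCobar.leavesCoeffF V ∘ₗ catLift g)
    (g := (TensorAlgebra.lift k C.seq.aug).toLinearMap) ?_ (fun c x h => ?_) x
  · rw [lcomp_apply, catLift_one, leavesCoeffF_nil, AlgHom.toLinearMap_apply, map_one]
  · rw [lcomp_apply, AlgHom.toLinearMap_apply] at h ⊢
    rw [catLift_ι_mul, leavesCoeffF_catOp, h, hg.leavesCoeffF, map_mul, TensorAlgebra.lift_ι_apply]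

theorem IsCoExt.cogen (hg : IsCoExt col β g) (c : Tot C.seq.X) : cogen V (g c) = β c := by
  have h1 : BarCobar.cogen V (colLeaf V col c) = 0 :=
    tot_ext (f := BarCobar.cogen V ∘ₗ colLeaf V col) (g := 0) (fun a => by
      rw [lcomp_apply, colLeaf_tot, map_smul, cogen_leafTree, smul_zero, lzero_apply]) c
  have h2 : BarCobar.cogen V (treeOp V (tmap β (catLift g) (C.data.comul c))) =
      β (TensorProduct.rid k _ ((TensorAlgebra.lift k C.seq.aug).toLinearMap.lTensor _
        (C.data.comul c))) :=
    tensor_ext (f := BarCobar.cogen V ∘ₗ treeOp V ∘ₗ tmap β (catLift g))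
      (g := β ∘ₗ (TensorProduct.rid k _).toLinearMap ∘ₗ
        (TensorAlgebra.lift k C.seq.aug).toLinearMap.lTensor _) (fun a x => by
      rw [lcomp_apply, lcomp_apply, map_tmul, cogen_tree, hg.leavesCoeffF_catLift, lcomp_apply,
        lcomp_apply, lTensor_tmul, LinearEquiv.coe_coe, rid_tmul, map_smul,
        AlgHom.toLinearMap_apply]) _
  rw [hg c, map_add, h1, h2, C.isTwoCoCat.preCocat.comul_counit', zero_add]

variable (V) in
/-- `v ⊗ (x ⊗ y) ↦ v(x) ⊗ y`, where `v(x)` has the root vertex `v` with `x` above it. -/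
def treeLeft : Tot V ⊗[k] (Forests V ⊗[k] Forests V) →ₗ[k] Forests V ⊗[k] Forests V :=
  rTensor _ (treeOp V) ∘ₗ (tassoc k _ _ _).symm.toLinearMap

theorem treeLeft_tmul (v : Tot V) (z : Forests V ⊗[k] Forests V) :
    treeLeft V (v ⊗ₜ z) = rTensor _ (treeMap V v) z :=
  tensor_ext (f := treeLeft V ∘ₗ tmk k _ _ v)
    (g := rTensor _ (treeMap V v)) (fun _ _ => rfl) z

/-- Both sides of the compatibility of `g` with the decompositions satisfy the same recursion. -/
theorem IsCoExt.cutOp_tot (hg : IsCoExt col β g) (hβ : ∀ a : HEl C.seq.X,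
    IsIn V (a.1.top.map col) (col a.1.bot) (a.1.deg - 1) (β a.tot)) (c : HEl C.seq.X) :
    cutOp V 1 (g c.tot) + treeLeft V (tmap β
        (tmap (catLift g) (catLift g) ∘ₗ C.data.wordComul) (C.data.comul c.tot)) =
      tmap g (catLift g) (C.data.comul c.tot) +
        treeLeft V (tmap β (cutOp V 1 ∘ₗ catLift g) (C.data.comul c.tot)) := by
  have hC := C.isTwoCoCat.preCocat
  have h1 : cutOp V 1 (treeOp V (tmap β (catLift g) (C.data.comul c.tot))) =
      leafTree V (col c.1.bot) ⊗ₜ treeOp V (tmap β (catLift g) (C.data.comul c.tot)) +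
        treeLeft V (tmap β (cutOp V 1 ∘ₗ catLift g) (C.data.comul c.tot)) := by
    refine hC.comul_ext c (f := cutOp V 1 ∘ₗ treeOp V ∘ₗ tmap β (catLift g))
      (g := tmk k _ _ (leafTree V (col c.1.bot)) ∘ₗ treeOp V ∘ₗ
        tmap β (catLift g) + treeLeft V ∘ₗ tmap β (cutOp V 1 ∘ₗ catLift g))
      (fun a l _ _ h3 _ => ?_)
    simp only [ladd_apply, lcomp_apply, map_tmul, mk_apply]
    rw [cutOp_tree_of_isIn (hβ a), h3, treeLeft_tmul]
  have h2 : tmap (colLeaf V col) (catLift g) (C.data.comul c.tot) =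
      leafTree V (col c.1.bot) ⊗ₜ g c.tot := by
    have h : tmap (colLeaf V col) (catLift g) (C.data.comul c.tot) =
        leafTree V (col c.1.bot) ⊗ₜ
          catLift g (TensorProduct.lid k _ (C.seq.aug.rTensor _ (C.data.comul c.tot))) := by
      refine hC.comul_ext c (f := tmap (colLeaf V col) (catLift g))
        (g := tmk k _ _ (leafTree V (col c.1.bot)) ∘ₗ catLift g ∘ₗ
          (TensorProduct.lid k _).toLinearMap ∘ₗ C.seq.aug.rTensor _) (fun a l _ _ h3 _ => ?_)
      simp only [lcomp_apply, map_tmul, mk_apply, rTensor_tmul, LinearEquiv.coe_coe, lid_tmul,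
        map_smul]
      rw [colLeaf_tot, h3, smul_tmul']
    rw [h, hC.counit_comul', catLift_ι]
  have h3 : tmap (treeOp V ∘ₗ tmap β (catLift g) ∘ₗ C.data.comul)
      (catLift g) (C.data.comul c.tot) = treeLeft V (tmap β
        (tmap (catLift g) (catLift g) ∘ₗ C.data.wordComul) (C.data.comul c.tot)) := by
    have h : tmap β (tmap (catLift g) (catLift g) ∘ₗ C.data.wordComul)
        (C.data.comul c.tot) = tmap β (tmap (catLift g) (catLift g))
          (C.data.wordComul.lTensor _ (C.data.comul c.tot)) := by
      rw [lTensor, map_map_tensor, LinearMap.comp_id]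
    rw [h, ← hC.coassoc', assoc_map, treeLeft, lcomp_apply, LinearEquiv.coe_coe,
      LinearEquiv.symm_apply_apply, rTensor, rTensor, map_map_tensor, map_map_tensor,
      LinearMap.comp_id, LinearMap.id_comp, LinearMap.comp_assoc]
  have h4 : g = colLeaf V col + treeOp V ∘ₗ tmap β (catLift g) ∘ₗ C.data.comul :=
    LinearMap.ext hg
  have h5 : tmap g (catLift g) (C.data.comul c.tot) =
      leafTree V (col c.1.bot) ⊗ₜ g c.tot + treeLeft V (tmap β
        (tmap (catLift g) (catLift g) ∘ₗ C.data.wordComul) (C.data.comul c.tot)) := by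
    rw [← h2, ← h3, ← ladd_apply, ← TensorProduct.map_add_left, ← h4]
  rw [h5, hg c.tot, map_add, h1, colLeaf_tot, map_smul, cutOp_leafTree, tmul_add, tmul_smul]
  abel

theorem catLift_wordOdd (hg : ∀ c : HEl C.seq.X,
    g c.tot ∈ FS V 1 (c.1.top.map col) [col c.1.bot] c.1.deg) (x : Words C.seq.X) :
    catLift g (wordOdd C.seq.X x) = oddF V 1 (catLift g x) := by
  refine words_ext (f := catLift g ∘ₗ wordOdd C.seq.X) (g := oddF V 1 ∘ₗ catLift g)
    (fun l => ?_) x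
  rw [lcomp_apply, lcomp_apply, wordOdd_word,
    oddF_of_mem (catLift_word_mem col 1 g l fun a _ => hg a), apply_ite (catLift g), map_zero]

/-- The extension of `β` is compatible with the decompositions. -/
theorem IsCoExt.cutOp (hg : IsCoExt col β g) (hu : ∀ e, β (C.seq.unit e) = 0)
    (hβ : ∀ a : HEl C.seq.X, IsIn V (a.1.top.map col) (col a.1.bot) (a.1.deg - 1) (β a.tot))
    (hm : ∀ c : HEl C.seq.X, g c.tot ∈ FS V 1 (c.1.top.map col) [col c.1.bot] c.1.deg)
    (c : Tot C.seq.X) :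
    BarCobar.cutOp V 1 (g c) = tmap g (catLift g) (C.data.comul c) := by
  refine corad_induction (P := fun c => BarCobar.cutOp V 1 (g c) =
    tmap g (catLift g) (C.data.comul c)) (fun n ih c hc => ?_) c
  have h := tot_ext (f := BarCobar.cutOp V 1 ∘ₗ g + treeLeft V ∘ₗ tmap β
      (tmap (catLift g) (catLift g) ∘ₗ C.data.wordComul) ∘ₗ C.data.comul)
    (g := tmap g (catLift g) ∘ₗ C.data.comul +
      treeLeft V ∘ₗ tmap β (BarCobar.cutOp V 1 ∘ₗ catLift g) ∘ₗ C.data.comul)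
    (hg.cutOp_tot hβ) c
  simp only [ladd_apply, lcomp_apply] at h
  refine add_right_cancel (h.trans (congrArg (_ + treeLeft V ·) ?_))
  refine map_comul_congr hc hu fun m hm' x hx => ?_
  refine adjoin_ι_ext (f := BarCobar.cutOp V 1 ∘ₗ catLift g)
    (g := tmap (catLift g) (catLift g) ∘ₗ C.data.wordComul) _ ?_
    (fun c hc x hx => ?_) hx
  · rw [lcomp_apply, lcomp_apply, catLift_one, cutOp_nil, wordComul_one, map_tmul, catLift_one]
  · rw [lcomp_apply, lcomp_apply] at hx ⊢
    rw [catLift_ι_mul, cutOp_catOp, ih m hm' c hc, hx, wordComul_letter_mul,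
      ksMul_natural (m := LinearMap.mul' k (Words C.data.X)) (m' := catOp V)
      (o' := oddF V 1) (φ := catLift g) (hm := fun x y => by
        rw [LinearMap.mul'_apply]; exact catLift_mul g x y) (ho := catLift_wordOdd hm),
      map_tmul, rTensor, map_map_tensor, LinearMap.comp_id,
      show catLift g ∘ₗ letter C.data.X = g from LinearMap.ext fun c => catLift_ι g c]

end Properties

end CofreeUniversal

/-! ### The universal property of the bar construction -/

section BarUniversal

variable {k : Type u} [Field k] {I : Type w} {C : TwoCoCat k I} {A : TwoCat k I}
  {α : SeqData.PreHom C.seq A.seq}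

theorem IsCoExt.inclF_projF {E : Type u} {V : Fam k E} {col : C.seq.E → E}
    {g : Tot C.seq.X →ₗ[k] Forests V}
    (hm : ∀ c : HEl C.seq.X, g c.tot ∈ FS V 1 (c.1.top.map col) [col c.1.bot] c.1.deg) :
    inclF V 1 ∘ₗ projF V 1 ∘ₗ g = g :=
  LinearMap.ext fun c => tot_ext (f := inclF V 1 ∘ₗ projF V 1 ∘ₗ g) (g := g)
    (fun a => BarCobar.inclF_projF (hm a)) c

theorem IsCoExt.freeComul {E : Type u} {V : Fam k E} {col : C.seq.E → E}
    {β : Tot C.seq.X →ₗ[k] Tot V} {g : Tot C.seq.X →ₗ[k] Forests V} (hg : IsCoExt col β g)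
    (hu : ∀ e, β (C.seq.unit e) = 0)
    (hβ : ∀ a : HEl C.seq.X, IsIn V (a.1.top.map col) (col a.1.bot) (a.1.deg - 1) (β a.tot))
    (hm : ∀ c : HEl C.seq.X, g c.tot ∈ FS V 1 (c.1.top.map col) [col c.1.bot] c.1.deg)
    (c : Tot C.seq.X) : BarCobar.freeComul V 1 (projF V 1 (g c)) =
      tmap (projF V 1 ∘ₗ g) (wordMap (projF V 1 ∘ₗ g)) (C.data.comul c) := by
  have h1 := IsCoExt.inclF_projF hm
  have h2 : wordToForest V 1 ∘ₗ wordMap (projF V 1 ∘ₗ g) = catLift g := LinearMap.ext fun x => by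
    rw [lcomp_apply, wordToForest_eq, catLift_wordMap, h1]
  refine pairIncl_injective ?_
  rw [pairIncl_freeComul, ← lcomp_apply (projF V 1), ← lcomp_apply (inclF V 1), h1, hg.cutOp hu hβ
    hm, pairIncl, map_map_tensor, h1, h2]

theorem colLeaf_of_isIn {E : Type u} {V : Fam k E} {col : C.seq.E → E} {t : List C.seq.E}
    {b : C.seq.E} {n : ℤ} {x : Tot C.seq.X} (hx : IsIn C.seq.X t b n x) :
    colLeaf V col x = C.seq.aug x • leafTree V (col b) := by
  obtain ⟨a, ha, rfl⟩ := hx.exists_tot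
  rw [colLeaf_tot, ha]

theorem IsCoExt.unit {E : Type u} {V : Fam k E} {col : C.seq.E → E}
    {β : Tot C.seq.X →ₗ[k] Tot V} {g : Tot C.seq.X →ₗ[k] Forests V} (hg : IsCoExt col β g)
    (hu : ∀ e, β (C.seq.unit e) = 0) (e : C.seq.E) :
    g (C.seq.unit e) = leafTree V (col e) := by
  rw [hg, C.isTwoCoCat.comul_unit, map_tmul, hu, zero_tmul, map_zero, add_zero, colLeaf_of_isIn
    (C.isTwoCoCat.isComplex.unit_mem e), C.isTwoCoCat.isComplex.aug_unit, one_smul]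

/-- A twisting cochain `α : C → A` as a map `C → ΣĀ`. -/
def genPart (α : SeqData.PreHom C.seq A.seq) : Tot C.seq.X →ₗ[k] Tot A.seq.red :=
  SeqData.ret A.isTwoCat.isComplex ∘ₗ α.lin

theorem inc_genPart (hα : IsTwistingCochain C A α) (c : Tot C.seq.X) :
    A.seq.inc (genPart α c) = α.lin c :=
  tot_ext (f := A.seq.inc ∘ₗ genPart α) (g := α.lin) (fun a =>
    inc_ret_of_aug A.isTwoCat.isComplex (hα.mem a.1 a.2)
      (congrArg (fun f => f a.tot) hα.aug)) c

theorem genPart_unit (hα : IsTwistingCochain C A α) (e : C.seq.E) :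
    genPart α (C.seq.unit e) = 0 := by
  rw [genPart, lcomp_apply, hα.unit, map_zero]

theorem genPart_mem (hα : IsTwistingCochain C A α) (a : HEl C.seq.X) :
    IsIn A.seq.red (a.1.top.map α.col) (α.col a.1.bot) (a.1.deg - 1) (genPart α a.tot) :=
  ret_mem A.isTwoCat.isComplex (hα.mem a.1 a.2)

variable {g : Tot C.seq.X →ₗ[k] Forests A.seq.red}

theorem IsCoExt.mem (hα : IsTwistingCochain C A α) (hg : IsCoExt α.col (genPart α) g)
    (c : HEl C.seq.X) : g c.tot ∈ FS A.seq.red 1 (c.1.top.map α.col) [α.col c.1.bot] c.1.deg := by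
  obtain ⟨g', hg', hm⟩ := exists_isCoExt (genPart_unit hα) (genPart_mem hα)
  rw [hg.unique (genPart_unit hα) hg']
  exact hm c

theorem IsCoExt.aug (hα : IsTwistingCochain C A α) (hg : IsCoExt α.col (genPart α) g)
    (c : Tot C.seq.X) : A.bar.aug (barTree A (g c)) = C.seq.aug c :=
  tot_ext (f := A.bar.aug ∘ₗ barTree A ∘ₗ g) (g := C.seq.aug) (fun a =>
    (congrArg (leafCoeff A.seq.red) (BarCobar.inclF_projF (hg.mem hα a))).trans
      ((leafCoeff_of_mem (hg.mem hα a)).trans (hg.leavesCoeffF a.tot))) c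

theorem IsCoExt.barProj (hα : IsTwistingCochain C A α) (hg : IsCoExt α.col (genPart α) g) :
    A.barProj ∘ₗ barTree A ∘ₗ g = α.lin :=
  LinearMap.ext fun c => tot_ext (f := A.barProj ∘ₗ barTree A ∘ₗ g) (g := α.lin) (fun a => by
    rw [lcomp_apply, lcomp_apply, barProj_tree (hg.mem hα a), hg.cogen, inc_genPart hα]) c

/-- After the projection to the cogenerators, compatibility with the differentials is the
Maurer–Cartan equation of `α`, because the projection satisfies the Maurer–Cartan equation. -/
theorem IsCoExt.cogen_barDF (hα : IsTwistingCochain C A α) (hg : IsCoExt α.col (genPart α) g)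
    (c : Tot C.seq.X) : BarCobar.cogen A.seq.red (barDF A (g c)) = genPart α (C.seq.d c) := by
  refine tot_ext (f := BarCobar.cogen A.seq.red ∘ₗ barDF A ∘ₗ g) (g := genPart α ∘ₗ C.seq.d)
    (fun c => ?_) c
  rw [lcomp_apply, lcomp_apply, lcomp_apply, ← ret_inc A.isTwoCat.isComplex (BarCobar.cogen
    A.seq.red (barDF A (g c.tot))), genPart, lcomp_apply]
  refine congrArg (SeqData.ret A.isTwoCat.isComplex) ?_
  have hm := hg.mem hα
  have h1 : A.barProj (A.bar.d (barTree A (g c.tot))) =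
      A.seq.inc (BarCobar.cogen A.seq.red (barDF A (g c.tot))) := by
    rw [bar_d_tree (hm c), barProj_tree (barDF_mem (hm c))]
  have h2 : starOp A.bar A.data (barCol A) A.barProj (barTree A (g c.tot)) =
      starOp C.data A.data α.col α.lin c.tot := by
    have h := starOp_map (C := C.data) (C' := A.bar) (A := A.data) (colG := α.col)
      (G := barTree A ∘ₗ g) (col := barCol A) (fun p x => projF_isIn (hm ⟨p, x⟩)) (hg.aug hα)
      (hg.freeComul (genPart_unit hα) (genPart_mem hα) hm) A.barProj c.tot
    rw [hg.barProj hα] at h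
    exact h
  have h3 := congrArg (fun f => f (barTree A (g c.tot))) (barProj_maurerCartan A)
  have h4 := congrArg (fun f => f c.tot) hα.maurerCartan
  have h5 : A.barProj (barTree A (g c.tot)) = α.lin c.tot :=
    congrArg (fun f => f c.tot) (hg.barProj hα)
  simp only [ladd_apply, lcomp_apply, lzero_apply, star_eq_starOp] at h3 h4
  rw [h1, h2, h5] at h3
  exact add_left_cancel (add_right_cancel (h3.trans h4.symm))

theorem barDF_catOp_sgF (x y : Forests A.seq.red) :
    barDF A (catOp A.seq.red (x ⊗ₜ y)) = catOp A.seq.red (barDF A x ⊗ₜ y) +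
      catOp A.seq.red (sgF A.seq.red 1 1 x ⊗ₜ barDF A y) := by
  refine forests_ext (f := barDF A ∘ₗ catOp A.seq.red ∘ₗ (tmk k _ _).flip y)
    (g := catOp A.seq.red ∘ₗ (tmk k _ _).flip y ∘ₗ barDF A +
      catOp A.seq.red ∘ₗ (tmk k _ _).flip (barDF A y) ∘ₗ sgF A.seq.red 1 1)
    (fun x => ?_) x
  simp only [ladd_apply, lcomp_apply, LinearMap.flip_apply, mk_apply]
  rw [barDF_catOp_ev, sgF_ev, one_mul, ← smul_tmul', map_smul]

theorem sgF_map {E : Type u} {V : Fam k E} {col : C.seq.E → E} {g : Tot C.seq.X →ₗ[k] Forests V}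
    (hm : ∀ c : HEl C.seq.X, g c.tot ∈ FS V 1 (c.1.top.map col) [col c.1.bot] c.1.deg)
    (c : Tot C.seq.X) : sgF V 1 1 (g c) = g (sg C.seq.X c) :=
  tot_ext (f := sgF V 1 1 ∘ₗ g) (g := g ∘ₗ sg C.seq.X) (fun a => by
    rw [lcomp_apply, lcomp_apply, sgF_of_mem 1 (hm a), one_mul, sg_tot, map_smul]) c

theorem barDF_catLift (hα : IsTwistingCochain C A α) (hg : IsCoExt α.col (genPart α) g)
    {S : Set (Tot C.seq.X)} (hS : ∀ c ∈ S, barDF A (g c) = g (C.seq.d c)) {x : Words C.seq.X}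
    (hx : x ∈ Algebra.adjoin k (letter C.seq.X '' S)) :
    barDF A (catLift g x) = catLift g (wordD C.seq.X C.seq.d x) := by
  refine adjoin_ι_ext (f := barDF A ∘ₗ catLift g) (g := catLift g ∘ₗ wordD C.seq.X C.seq.d) S ?_
    (fun c hc x ih => ?_) hx
  · rw [lcomp_apply, lcomp_apply, catLift_one, wordD_one, map_zero, barDF_nil]
  · rw [lcomp_apply, lcomp_apply] at ih ⊢
    rw [catLift_ι_mul, barDF_catOp_sgF, sgF_map (hg.mem hα), hS c hc, ih, wordD_letter_mul, map_add,
      catLift_ι_mul, catLift_ι_mul, add_comm]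

theorem IsCoExt.barDF_eq (hα : IsTwistingCochain C A α) (hg : IsCoExt α.col (genPart α) g)
    (c : Tot C.seq.X) : barDF A (g c) =
      treeOp A.seq.red (tmap (genPart α ∘ₗ C.seq.d) (catLift g) (C.data.comul c)) +
      treeOp A.seq.red (tmap (genPart α ∘ₗ sg C.seq.X) (barDF A ∘ₗ catLift g)
        (C.data.comul c)) := by
  refine tot_ext (f := barDF A ∘ₗ g) (g := treeOp A.seq.red ∘ₗ tmap
    (genPart α ∘ₗ C.seq.d) (catLift g) ∘ₗ C.data.comul + treeOp A.seq.red ∘ₗ tmap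
      (genPart α ∘ₗ sg C.seq.X) (barDF A ∘ₗ catLift g) ∘ₗ C.data.comul) (fun c => ?_) c
  have hm := hg.mem hα
  have h1 : BarCobar.cogen A.seq.red ∘ₗ barDF A ∘ₗ g = genPart α ∘ₗ C.seq.d :=
    LinearMap.ext (hg.cogen_barDF hα)
  have h2 : BarCobar.cogen A.seq.red ∘ₗ sgF A.seq.red 1 1 ∘ₗ g = genPart α ∘ₗ sg C.seq.X :=
    LinearMap.ext fun c => (congrArg _ (sgF_map hm c)).trans (hg.cogen _)
  rw [lcomp_apply, eq_leaf_add_tree (barDF_mem (hm c)), leafCoeff_barDF (hm c), zero_smul, zero_add,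
    cutOp_barDF (hm c), hg.cutOp (genPart_unit hα) (genPart_mem hα) hm, barDF₂, ladd_apply]
  simp only [rTensor, map_map_tensor, map_add, LinearMap.id_comp]
  rw [h1, h2]
  rfl

theorem IsCoExt.map_d (hg : IsCoExt α.col (genPart α) g) (c : Tot C.seq.X) :
    g (C.seq.d c) =
      treeOp A.seq.red (tmap (genPart α ∘ₗ C.seq.d) (catLift g) (C.data.comul c)) +
      treeOp A.seq.red (tmap (genPart α ∘ₗ sg C.seq.X)
        (catLift g ∘ₗ wordD C.seq.X C.seq.d) (C.data.comul c)) := by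
  have h : colLeaf A.seq.red α.col (C.seq.d c) = 0 :=
    tot_ext (f := colLeaf A.seq.red α.col ∘ₗ C.seq.d) (g := 0) (fun a => by
      rw [lcomp_apply, colLeaf_of_isIn (C.isTwoCoCat.isComplex.d_mem a.1 a.2), ← lcomp_apply,
        C.isTwoCoCat.isComplex.aug_d, lzero_apply, zero_smul, lzero_apply]) c
  rw [hg, h, zero_add, C.isTwoCoCat.preCocat.comul_d', map_add, rTensor, map_map_tensor,
    map_map_tensor, map_add, LinearMap.comp_id]

/-- The extension of a twisting cochain is compatible with the differentials. -/
theorem IsCoExt.d (hα : IsTwistingCochain C A α) (hg : IsCoExt α.col (genPart α) g)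
    (c : Tot C.seq.X) : barDF A (g c) = g (C.seq.d c) := by
  refine corad_induction (P := fun c => barDF A (g c) = g (C.seq.d c)) (fun n ih c hc => ?_) c
  have hu : ∀ e, (genPart α ∘ₗ sg C.seq.X) (C.seq.unit e) = 0 := fun e => by
    rw [lcomp_apply, (C.isTwoCoCat.isComplex.unit_mem e).sg, map_smul, genPart_unit hα, smul_zero]
  rw [hg.barDF_eq hα, hg.map_d, map_comul_congr hc hu (L := barDF A ∘ₗ catLift g)
    (L' := catLift g ∘ₗ wordD C.seq.X C.seq.d) fun m hm x hx => barDF_catLift hα hg (ih m hm) hx]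

/-- The extension of a twisting cochain `C → A` is a morphism `C → 𝓑(A)`. -/
theorem IsCoExt.isHom (hα : IsTwistingCochain C A α) (hg : IsCoExt α.col (genPart α) g) :
    TwoCoCatData.IsHom (C := C.data) (C' := A.bar) ⟨α.col, barTree A ∘ₗ g⟩ where
  isSeqHom :=
    { src := hα.src
      tgt := hα.tgt
      mem := fun p x => projF_isIn (hg.mem hα ⟨p, x⟩)
      d := LinearMap.ext fun c => tot_ext (f := (barTree A ∘ₗ g) ∘ₗ C.seq.d)
        (g := A.bar.d ∘ₗ barTree A ∘ₗ g) (fun a => ((bar_d_tree (hg.mem hα a)).trans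
          (congrArg (barTree A) (hg.d hα a.tot))).symm) c
      unit := fun e => congrArg (barTree A) (hg.unit (genPart_unit hα) e)
      aug := LinearMap.ext (hg.aug hα) }
  comul := LinearMap.ext (hg.freeComul (genPart_unit hα) (genPart_mem hα) (hg.mem hα))

/-- A map to the cofree 2-cocategory which is compatible with decompositions satisfies the equation
of the extension of its projection to the cogenerators. -/
theorem isCoExt_of_comul {E : Type u} {V : Fam k E} {col : C.seq.E → E} {β : Tot C.seq.X →ₗ[k] Tot V}
    {G : Tot C.seq.X →ₗ[k] Tot (freeFam V 1)} (hmem : ∀ (p : GCell C.seq.E) (x : C.seq.X p),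
      IsIn (freeFam V 1) (p.top.map col) (col p.bot) p.deg (G (of C.seq.X p x)))
    (haug : ∀ c, leafCoeff V (inclF V 1 (G c)) = C.seq.aug c)
    (hcomul : ∀ c, BarCobar.freeComul V 1 (G c) = tmap G (wordMap G) (C.data.comul c))
    (hβ : cogen V ∘ₗ inclF V 1 ∘ₗ G = β) : IsCoExt col β (inclF V 1 ∘ₗ G) := fun c => by
  refine tot_ext (f := inclF V 1 ∘ₗ G) (g := colLeaf V col +
    treeOp V ∘ₗ tmap β (catLift (inclF V 1 ∘ₗ G)) ∘ₗ C.data.comul)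
    (fun c => ?_) c
  have h2 : cutOp V 1 (inclF V 1 (G c.tot)) = tmap
      (inclF V 1 ∘ₗ G) (catLift (inclF V 1 ∘ₗ G)) (C.data.comul c.tot) := by
    have h3 : wordToForest V 1 ∘ₗ wordMap G = catLift (inclF V 1 ∘ₗ G) := LinearMap.ext fun x => by
      rw [lcomp_apply, wordToForest_eq, catLift_wordMap]
    rw [← h3, ← map_map_tensor, ← hcomul, ← pairIncl_freeComul]
  have h4 := eq_leaf_add_tree (inclF_mem (hmem c.1 c.2))
  rw [show G (of C.seq.X c.1 c.2) = G c.tot from rfl, haug, h2, rTensor,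
    map_map_tensor, LinearMap.id_comp, hβ, ← colLeaf_tot] at h4
  exact h4

theorem isCoExt_of_isHom {G : SeqData.PreHom C.seq A.bar.toSeqData}
    (hG : TwoCoCatData.IsHom (C := C.data) (C' := A.bar) G) {β : Tot C.seq.X →ₗ[k] Tot A.seq.red}
    (hβ : cogen A.seq.red ∘ₗ inclF A.seq.red 1 ∘ₗ G.lin = β) :
    IsCoExt (V := A.seq.red) G.col β (inclF A.seq.red 1 ∘ₗ G.lin) :=
  isCoExt_of_comul (V := A.seq.red) (col := G.col) (G := G.lin) hG.isSeqHom.mem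
    (fun c => congrArg (fun f => f c) hG.isSeqHom.aug) (fun c => congrArg (fun f => f c) hG.comul) hβ

/-- A morphism to the bar construction is determined by its projection to the cogenerators. -/
theorem bar_hom_ext {G G' : SeqData.PreHom C.seq A.bar.toSeqData}
    (hG : TwoCoCatData.IsHom (C := C.data) (C' := A.bar) G)
    (hG' : TwoCoCatData.IsHom (C := C.data) (C' := A.bar) G')
    (h : G.comp ⟨barCol A, A.barProj⟩ = G'.comp ⟨barCol A, A.barProj⟩) : G = G' := by
  have hc' := congrArg SeqData.PreHom.col h
  have hl' := congrArg SeqData.PreHom.lin h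
  have hc : G.col = G'.col := hc'
  have hl : A.barProj ∘ₗ G.lin = A.barProj ∘ₗ G'.lin := hl'
  have h1 : cogen A.seq.red ∘ₗ inclF A.seq.red 1 ∘ₗ G.lin =
      cogen A.seq.red ∘ₗ inclF A.seq.red 1 ∘ₗ G'.lin := LinearMap.ext fun c => by
    have h2 := congrArg (fun f => SeqData.ret A.isTwoCat.isComplex (f c)) hl
    exact (ret_inc A.isTwoCat.isComplex _).symm.trans (h2.trans (ret_inc _ _))
  have h3 := isCoExt_of_isHom hG h1
  rw [hc] at h3
  have h4 := h3.unique (fun e => ?_) (isCoExt_of_isHom hG' rfl)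
  · refine SeqData.PreHom.ext hc (LinearMap.ext fun c => inclF_injective (V := A.seq.red) (s := 1) ?_)
    exact congrArg (fun f => f c) h4
  · refine (congrArg (fun z => cogen A.seq.red (inclF A.seq.red 1 z)) (hG'.isSeqHom.unit e)).trans ?_
    exact (congrArg (cogen A.seq.red) (inclF_freeUnit _)).trans (cogen_leafTree _)

/-- The morphism `C → 𝓑(A)` which extends the twisting cochain `α`. -/
theorem exists_barLift (hα : IsTwistingCochain C A α) :
    ∃ G : SeqData.PreHom C.seq A.bar.toSeqData,
      TwoCoCatData.IsHom (C := C.data) (C' := A.bar) G ∧ G.comp ⟨barCol A, A.barProj⟩ = α := by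
  obtain ⟨g, hg, -⟩ := exists_isCoExt (genPart_unit hα) (genPart_mem hα)
  exact ⟨_, hg.isHom hα, SeqData.PreHom.ext rfl (hg.barProj hα)⟩

end BarUniversal

/-! ### The functors and the adjunction -/

section MapForest

variable {k : Type u} [Field k] {E E' : Type u} {V : Fam k E} {V' : Fam k E'} {col : E → E'}
  {φ : Tot V →ₗ[k] Tot V'} {s : ℤ}

variable (col φ) in
/-- Apply `φ` to every vertex of a forest, and relabel the leaves by `col`. -/
abbrev mapF : Forests V →ₗ[k] Forests V' := elimF (mapForest col φ)

theorem mapF_nil : mapF col φ (nilF V) = nilF V' :=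
  (elimF_ofF (mapForest col φ) PForest.nil _).trans (one_smul k _)

theorem mapF_leafOp (e : E) (x : Forests V) :
    mapF col φ (leafOp V e x) = leafOp V' (col e) (mapF col φ x) := by
  refine forests_ext (f := mapF col φ ∘ₗ leafOp V e) (g := leafOp V' (col e) ∘ₗ mapF col φ)
    (fun x => ?_) x
  rw [lcomp_apply, ← DF.ev_leaf, elimF_ev, lcomp_apply, elimF_ev]
  rfl

theorem mapF_nodeOp (v : Tot V) (x y : Forests V) :
    mapF col φ (nodeOp V (v ⊗ₜ (x ⊗ₜ y))) =
      nodeOp V' (φ v ⊗ₜ (mapF col φ x ⊗ₜ mapF col φ y)) := by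
  refine node_ext (f := mapF col φ ∘ₗ nodeOp V) (g := nodeOp V' ∘ₗ tmap φ
    (tmap (mapF col φ) (mapF col φ))) (fun a x y => ?_) (v ⊗ₜ (x ⊗ₜ y))
  rw [lcomp_apply, ← DF.ev_node, elimF_ev]
  simp only [lcomp_apply, map_tmul, elimF_ev]
  rfl

theorem mapF_leafTree (e : E) : mapF col φ (leafTree V e) = leafTree V' (col e) := by
  rw [leafTree, mapF_leafOp, mapF_nil, leafTree]

theorem mapF_treeOp (v : Tot V) (x : Forests V) :
    mapF col φ (treeOp V (v ⊗ₜ x)) = treeOp V' (φ v ⊗ₜ mapF col φ x) := by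
  rw [treeOp_tmul, mapF_nodeOp, mapF_nil, treeOp_tmul]

theorem mapF_catOp (x y : Forests V) :
    mapF col φ (catOp V (x ⊗ₜ y)) = catOp V' (mapF col φ x ⊗ₜ mapF col φ y) := by
  induction x using forests_induction with
  | add c d hc hd => simp only [map_add, add_tmul, hc, hd]
  | smul c d hd => simp only [map_smul, ← smul_tmul', hd]
  | ev x =>
  induction x with
  | nil => rw [DF.ev_nil, catOp_nil, mapF_nil, catOp_nil]
  | leaf e f ih => rw [DF.ev_leaf, catOp_leafOp, mapF_leafOp, mapF_leafOp, ih, catOp_leafOp]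
  | node a ch f _ ih => rw [DF.ev_node, catOp_nodeOp, mapF_nodeOp, mapF_nodeOp, ih, catOp_nodeOp]

theorem mapF_mem (hφ : ∀ a : HEl V, IsIn V' (a.1.top.map col) (col a.1.bot) a.1.deg (φ a.tot))
    {t b : List E} {n : ℤ} {z : Forests V} (hz : z ∈ FS V s t b n) :
    mapF col φ z ∈ FS V' s (t.map col) (b.map col) n := by
  refine FS_map_le (mapF col φ) _ (fun x h h2 h3 h4 => ?_) hz
  subst h2 h3 h4
  clear hz
  induction x with
  | nil => rw [DF.ev_nil, mapF_nil]; exact nilF_mem s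
  | leaf e f ih =>
    rw [DF.ev_leaf, mapF_leafOp]
    exact leafOp_mem (col e) (ih h)
  | node a ch f ih1 ih =>
    have h1 := ih1 h.2.1
    rw [show ch.roots = a.1.top from h.1] at h1
    rw [DF.ev_node, mapF_nodeOp, nodeOp_eq_catOp]
    exact FS_cast (catOp_mem (treeOp_mem (hφ a) h1) (ih h.2.2)) (by simp) (by simp)
      (by simp [add_assoc])

theorem mapF_wordToForest (x : Words (freeFam V s)) :
    mapF col φ (wordToForest V s x) = catLift (mapF col φ ∘ₗ inclF V s) x := by
  refine tensorAlgebra_ext (f := mapF col φ ∘ₗ wordToForest V s)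
    (g := catLift (mapF col φ ∘ₗ inclF V s)) ?_ (fun c x h => ?_) x
  · rw [lcomp_apply, wordToForest_one, mapF_nil, catLift_one]
  · rw [lcomp_apply] at h ⊢
    rw [wordToForest_letter_mul, mapF_catOp, h, catLift_ι_mul]
    rfl

theorem mapF_inclF (a : HEl (freeFam V s)) : mapF col φ (inclF V s a.tot) =
    leafCoeff V (inclF V s a.tot) • leafTree V' (col a.1.bot) +
      treeOp V' (tmap (φ ∘ₗ cogen V ∘ₗ inclF V s)
        (catLift (mapF col φ ∘ₗ inclF V s)) (freeComul V s a.tot)) := by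
  have h1 : mapF col φ (treeOp V (rTensor _ (cogen V) (cutOp V s (inclF V s a.tot)))) =
      treeOp V' (tmap (φ ∘ₗ cogen V) (mapF col φ) (cutOp V s (inclF V s a.tot))) :=
    tensor_ext (f := mapF col φ ∘ₗ treeOp V ∘ₗ rTensor _ (cogen V))
      (g := treeOp V' ∘ₗ tmap (φ ∘ₗ cogen V) (mapF col φ))
      (fun x y => mapF_treeOp _ _) _
  have h2 : mapF col φ ∘ₗ wordToForest V s = catLift (mapF col φ ∘ₗ inclF V s) :=
    LinearMap.ext mapF_wordToForest
  rw [← h2, ← LinearMap.comp_assoc, ← map_map_tensor, pairIncl_freeComul, ← h1]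
  conv_lhs => rw [eq_leaf_add_tree (inclF_tot_mem a), map_add, map_smul, mapF_leafTree]

end MapForest

section Functors

variable {k : Type u} [Field k] {I : Type w}

/-- The bar construction as an object of 2-coCat_I. -/
abbrev barObj (A : TwoCat k I) : TwoCoCat k I := ⟨A.bar, bar_isTwoCoCat A⟩

/-- The cobar construction as an object of 2-Cat_I. -/
abbrev cobarObj (C : TwoCoCat k I) : TwoCat k I := ⟨C.cobar, cobar_isTwoCat C⟩

/-- The universal twisting cochain `𝓑(A) → A`. -/
abbrev barCochain (A : TwoCat k I) : SeqData.PreHom A.bar.toSeqData A.seq :=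
  ⟨barCol A, A.barProj⟩

/-- The universal twisting cochain `C → 𝓑*(C)`. -/
abbrev cobarCochain (C : TwoCoCat k I) : SeqData.PreHom C.seq C.cobar.toSeqData :=
  ⟨cobarCol C, C.cobarIncl⟩

section Bar

variable {A A' : TwoCat k I} (F : A ⟶ A')

theorem isCoExt_barMap : IsCoExt (C := barObj A) (V := A'.seq.red) F.pre.col
    (genPart (C := barObj A) ((barCochain A).comp F.pre))
    (mapF F.pre.col (SeqData.ret A'.isTwoCat.isComplex ∘ₗ F.pre.lin ∘ₗ A.seq.inc) ∘ₗ
      inclF A.seq.red 1) := fun c =>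
  tot_ext (V := (barObj A).seq.X)
    (f := mapF F.pre.col (SeqData.ret A'.isTwoCat.isComplex ∘ₗ F.pre.lin ∘ₗ A.seq.inc) ∘ₗ
      inclF A.seq.red 1)
    (g := colLeaf (C := barObj A) A'.seq.red F.pre.col + treeOp A'.seq.red ∘ₗ tmap
      (genPart (C := barObj A) ((barCochain A).comp F.pre))
      (catLift (mapF F.pre.col (SeqData.ret A'.isTwoCat.isComplex ∘ₗ F.pre.lin ∘ₗ A.seq.inc) ∘ₗ
        inclF A.seq.red 1)) ∘ₗ A.bar.comul)
    (fun a => (mapF_inclF (V := A.seq.red) (s := 1) a).trans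
      (congrArg (· + _) (colLeaf_tot (C := barObj A) a).symm)) c

theorem isTwisting_barCochain_comp : IsTwistingCochain (barObj A) A' ((barCochain A).comp F.pre) :=
  (barProj_isTwisting A).comp_hom F.isHom

theorem barMap_isHom : TwoCoCatData.IsHom (C := A.bar) (C' := A'.bar) (TwoCat.barMap F) :=
  IsCoExt.isHom (C := barObj A) (isTwisting_barCochain_comp F) (isCoExt_barMap F)

theorem barMap_comp_barCochain :
    (TwoCat.barMap F).comp (barCochain A') = (barCochain A).comp F.pre :=
  SeqData.PreHom.ext rfl
    (IsCoExt.barProj (C := barObj A) (isTwisting_barCochain_comp F) (isCoExt_barMap F))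

end Bar

theorem barMap_comp_isHom {A A' A'' : TwoCat k I} (F : A ⟶ A') (G : A' ⟶ A'') :
    TwoCoCatData.IsHom (C := A.bar) (C' := A''.bar)
      ((TwoCat.barMap F).comp (TwoCat.barMap G)) :=
  let f : barObj A ⟶ barObj A' := ⟨TwoCat.barMap F, barMap_isHom F⟩
  let g : barObj A' ⟶ barObj A'' := ⟨TwoCat.barMap G, barMap_isHom G⟩
  (f ≫ g).isHom

theorem barLaws : BarLaws k I where
  obj := bar_isTwoCoCat
  map := barMap_isHom
  map_id A := bar_hom_ext (C := barObj A) (barMap_isHom (𝟙 A)) (TwoCoCat.Hom.isHom (𝟙 (barObj A)))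
    (barMap_comp_barCochain (𝟙 A))
  map_comp {A _ _} F G := bar_hom_ext (C := barObj A) (barMap_isHom (F ≫ G))
    (barMap_comp_isHom F G)
    ((barMap_comp_barCochain (F ≫ G)).trans
      ((congrArg (SeqData.PreHom.comp · G.pre) (barMap_comp_barCochain F)).symm.trans
        (congrArg (SeqData.PreHom.comp (TwoCat.barMap F)) (barMap_comp_barCochain G)).symm))

section Cobar

/-- A morphism from the cobar construction is determined by its restriction to the generators. -/
theorem cobar_hom_ext {C : TwoCoCat k I} {A : TwoCat k I}
    {F F' : SeqData.PreHom C.cobar.toSeqData A.seq}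
    (hF : TwoCatData.IsHom (A := C.cobar) (A' := A.data) F)
    (hF' : TwoCatData.IsHom (A := C.cobar) (A' := A.data) F')
    (h : (cobarCochain C).comp F = (cobarCochain C).comp F') : F = F' :=
  (eq_cobarLift hF).trans ((congrArg cobarLift h).trans (eq_cobarLift hF').symm)

/-- The trees of a forest, as a word in the cobar construction. -/
def cobarWord (C : TwoCoCat k I) : Forests C.seq.red →ₗ[k] Words C.cobar.X :=
  ftw C.seq.red (-1)

variable {C C' : TwoCoCat k I} (F : C ⟶ C')

theorem isTwisting_comp_cobarCochain :
    IsTwistingCochain C (cobarObj C') (F.pre.comp (cobarCochain C')) :=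
  (cobarIncl_isTwisting C').hom_comp F.isHom

theorem ret_map_inc_mem (a : HEl C.seq.red) :
    IsIn C'.seq.red (a.1.top.map F.pre.col) (F.pre.col a.1.bot) a.1.deg
      ((SeqData.ret C'.isTwoCoCat.isComplex ∘ₗ F.pre.lin ∘ₗ C.seq.inc) a.tot) :=
  ret_mem C'.isTwoCoCat.isComplex (IsIn.map id F.isHom.isSeqHom.mem (inc_mem (isIn_tot a)))

theorem extWord_cobarMap (x : DF C.seq.red) (hx : x.WF) :
    extWord C.seq.red C'.cobar (F.pre.comp (cobarCochain C')).col
      (redRestrict (A := cobarObj C') (F.pre.comp (cobarCochain C'))) x.ev =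
    cobarWord C' (mapF F.pre.col
      (SeqData.ret C'.isTwoCoCat.isComplex ∘ₗ F.pre.lin ∘ₗ C.seq.inc) x.ev) := by
  induction x with
  | nil => rw [DF.ev_nil, extWord_nil, mapF_nil]; exact ftw_nil.symm
  | leaf e f ih =>
    rw [DF.ev_leaf, extWord_leafOp, mapF_leafOp, ih hx]; exact (ftw_leafOp _ _).symm
  | node a ch f ih1 ih =>
    rw [DF.ev_node, extWord_nodeOp, mapF_nodeOp, ih1 hx.2.1, ih hx.2.2]
    refine Eq.trans ?_ (ftw_nodeOp _ _ _).symm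
    refine congrArg (fun z => letter C'.cobar.X z * _) (Eq.symm ?_)
    exact projF_treeOp (ret_map_inc_mem F a)
      (mapF_mem (ret_map_inc_mem F) (ev_mem' ch hx.2.1 rfl hx.1 rfl))

theorem extTree_cobarMap {t : List C.seq.E} {b : C.seq.E} {n : ℤ} {z : Forests C.seq.red}
    (hz : z ∈ FS C.seq.red (-1) t [b] n) :
    projF C'.seq.red (-1) (mapF F.pre.col
      (SeqData.ret C'.isTwoCoCat.isComplex ∘ₗ F.pre.lin ∘ₗ C.seq.inc) z) =
    extTree C.seq.red C'.cobar (F.pre.comp (cobarCochain C')).col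
      (redRestrict (A := cobarObj C') (F.pre.comp (cobarCochain C'))) z := by
  refine FS_ext (f := projF C'.seq.red (-1) ∘ₗ mapF F.pre.col
      (SeqData.ret C'.isTwoCoCat.isComplex ∘ₗ F.pre.lin ∘ₗ C.seq.inc))
    (g := extTree C.seq.red C'.cobar (F.pre.comp (cobarCochain C')).col
      (redRestrict (A := cobarObj C') (F.pre.comp (cobarCochain C')))) (fun x hx _ h3 _ => ?_) hz
  clear hz
  rw [lcomp_apply]
  rcases x.tree_cases b h3 with rfl | ⟨a, ch, rfl, -⟩
  · rw [← leafTree_eq_ev, mapF_leafTree]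
    exact (extTree_leafTree (V := C.seq.red) (A := C'.cobar) b).symm
  · rw [← treeOp_ev, mapF_treeOp]
    refine Eq.trans ?_ (extTree_treeOp (V := C.seq.red) (A := C'.cobar) a.tot ch.ev).symm
    refine Eq.trans ?_ (congrArg (C'.cobar.mul _) (extWord_cobarMap F ch hx.2.1).symm)
    exact projF_treeOp (ret_map_inc_mem F a)
      (mapF_mem (ret_map_inc_mem F) (ev_mem' ch hx.2.1 rfl hx.1 rfl))

theorem cobarMap_eq : TwoCoCat.cobarMap F =
    cobarLift (A := cobarObj C') (F.pre.comp (cobarCochain C')) :=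
  SeqData.PreHom.ext rfl (LinearMap.ext fun z =>
    tot_ext (V := freeFam C.seq.red (-1)) (f := (TwoCoCat.cobarMap F).lin)
      (g := (cobarLift (A := cobarObj C') (F.pre.comp (cobarCochain C'))).lin)
      (fun a => extTree_cobarMap F (cobarInc_mem a)) z)

theorem cobarMap_isHom : TwoCatData.IsHom (A := C.cobar) (A' := C'.cobar) (TwoCoCat.cobarMap F) := by
  rw [cobarMap_eq]
  exact cobarLift_isHom (isTwisting_comp_cobarCochain F)

theorem cobarCochain_comp_cobarMap :
    (cobarCochain C).comp (TwoCoCat.cobarMap F) = F.pre.comp (cobarCochain C') := by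
  rw [cobarMap_eq]
  exact SeqData.PreHom.ext rfl (cobarLift_comp_cobarIncl (isTwisting_comp_cobarCochain F))

end Cobar

theorem cobarMap_comp_isHom {C C' C'' : TwoCoCat k I} (F : C ⟶ C') (G : C' ⟶ C'') :
    TwoCatData.IsHom (A := C.cobar) (A' := C''.cobar)
      ((TwoCoCat.cobarMap F).comp (TwoCoCat.cobarMap G)) :=
  let f : cobarObj C ⟶ cobarObj C' := ⟨TwoCoCat.cobarMap F, cobarMap_isHom F⟩
  let g : cobarObj C' ⟶ cobarObj C'' := ⟨TwoCoCat.cobarMap G, cobarMap_isHom G⟩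
  (f ≫ g).isHom

theorem cobarLaws : CobarLaws k I where
  obj := cobar_isTwoCat
  map := cobarMap_isHom
  map_id C := cobar_hom_ext (A := cobarObj C) (cobarMap_isHom (𝟙 C))
    (TwoCat.Hom.isHom (𝟙 (cobarObj C))) (cobarCochain_comp_cobarMap (𝟙 C))
  map_comp {_ _ C''} F G := cobar_hom_ext (A := cobarObj C'') (cobarMap_isHom (F ≫ G))
    (cobarMap_comp_isHom F G)
    ((cobarCochain_comp_cobarMap (F ≫ G)).trans
      ((congrArg (SeqData.PreHom.comp F.pre) (cobarCochain_comp_cobarMap G)).symm.trans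
        (congrArg (SeqData.PreHom.comp · (TwoCoCat.cobarMap G))
          (cobarCochain_comp_cobarMap F)).symm))

/-- Morphisms from the cobar construction are twisting cochains, by restriction to the
generators. -/
def cobarEquiv (C : TwoCoCat k I) (A : TwoCat k I) :
    (cobarObj C ⟶ A) ≃ {α : SeqData.PreHom C.seq A.seq // IsTwistingCochain C A α} where
  toFun F := ⟨(cobarCochain C).comp F.pre, (cobarIncl_isTwisting C).comp_hom F.isHom⟩
  invFun α := ⟨cobarLift α.1, cobarLift_isHom α.2⟩
  left_inv F := TwoCat.Hom.ext (eq_cobarLift F.isHom).symm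
  right_inv α := Subtype.ext (SeqData.PreHom.ext rfl (cobarLift_comp_cobarIncl α.2))

theorem bijective_comp_barCochain (C : TwoCoCat k I) (A : TwoCat k I) :
    Function.Bijective (fun G : C ⟶ barObj A =>
      (⟨G.pre.comp (barCochain A), (barProj_isTwisting A).hom_comp G.isHom⟩ :
        {α : SeqData.PreHom C.seq A.seq // IsTwistingCochain C A α})) := by
  refine ⟨fun G G' h => TwoCoCat.Hom.ext (bar_hom_ext G.isHom G'.isHom (congrArg Subtype.val h)),
    fun α => ?_⟩
  obtain ⟨G, hG, h⟩ := exists_barLift α.2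
  exact ⟨⟨G, hG⟩, Subtype.ext h⟩

/-- Morphisms to the bar construction are twisting cochains, by projection to the cogenerators. -/
def barEquiv (C : TwoCoCat k I) (A : TwoCat k I) :
    (C ⟶ barObj A) ≃ {α : SeqData.PreHom C.seq A.seq // IsTwistingCochain C A α} :=
  Equiv.ofBijective _ (bijective_comp_barCochain C A)

/-- Both kinds of morphisms are the same as twisting cochains. -/
def cobarBarEquiv (C : TwoCoCat k I) (A : TwoCat k I) :
    (cobarObj C ⟶ A) ≃ (C ⟶ barObj A) := (cobarEquiv C A).trans (barEquiv C A).symm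

theorem barEquiv_cobarBarEquiv {C : TwoCoCat k I} {A : TwoCat k I}
    (F : cobarObj C ⟶ A) : (cobarBarEquiv C A F).pre.comp (barCochain A) =
      (cobarCochain C).comp F.pre :=
  congrArg Subtype.val ((barEquiv C A).apply_symm_apply (cobarEquiv C A F))

theorem cobarEquiv_cobarBarEquiv_symm {C : TwoCoCat k I} {A : TwoCat k I}
    (G : C ⟶ barObj A) : (cobarCochain C).comp ((cobarBarEquiv C A).symm G).pre =
      G.pre.comp (barCochain A) :=
  congrArg Subtype.val ((cobarEquiv C A).apply_symm_apply (barEquiv C A G))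

/-- The adjunction of the cobar and the bar construction. -/
def cobarBarAdjunction : cobarFunctor (cobarLaws (k := k) (I := I)) ⊣ barFunctor barLaws :=
  Adjunction.mkOfHomEquiv
    { homEquiv := cobarBarEquiv
      homEquiv_naturality_left_symm := fun {C' C A} f G => (cobarEquiv C' A).injective <|
        Subtype.ext <| (cobarEquiv_cobarBarEquiv_symm (f ≫ G)).trans <|
          (congrArg (SeqData.PreHom.comp f.pre) (cobarEquiv_cobarBarEquiv_symm G)).symm.trans <|
          (congrArg (SeqData.PreHom.comp · ((cobarBarEquiv C A).symm G).pre)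
            (cobarCochain_comp_cobarMap f)).symm
      homEquiv_naturality_right := fun {C A A'} F g => (barEquiv C A').injective <|
        Subtype.ext <| (barEquiv_cobarBarEquiv (F ≫ g)).trans <|
          (congrArg (SeqData.PreHom.comp · g.pre) (barEquiv_cobarBarEquiv F)).symm.trans <|
          (congrArg (SeqData.PreHom.comp (cobarBarEquiv C A F).pre)
            (barMap_comp_barCochain g)).symm }

theorem cobarBarAdjunction_homEquiv (C : TwoCoCat k I) (A : TwoCat k I) :
    cobarBarAdjunction.homEquiv C A = cobarBarEquiv C A :=
  congrFun (congrFun (Adjunction.mkOfHomEquiv_homEquiv _) C) A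

end Functors

end

end BarCobar

open CategoryTheory BarCobar in
theorem mainTheorem8 (k : Type u) [Field k] (I : Type w) :
    ∃ (hB : BarLaws.{u, w} k I) (hC : CobarLaws.{u, w} k I)
      (adj : cobarFunctor hC ⊣ barFunctor hB),
      ∀ (C : TwoCoCat.{u, w} k I) (A : TwoCat.{u, w} k I),
        (∀ F : (cobarFunctor hC).obj C ⟶ A,
          IsTwistingCochain C A ⟨F.pre.col, F.pre.lin ∘ₗ C.cobarIncl⟩) ∧
        (∀ α : SeqData.PreHom C.seq A.seq, IsTwistingCochain C A α →
          ∃! F : (cobarFunctor hC).obj C ⟶ A, ⟨F.pre.col, F.pre.lin ∘ₗ C.cobarIncl⟩ = α) ∧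
        (∀ G : C ⟶ (barFunctor hB).obj A,
          IsTwistingCochain C A ⟨G.pre.col, A.barProj ∘ₗ G.pre.lin⟩) ∧
        (∀ α : SeqData.PreHom C.seq A.seq, IsTwistingCochain C A α →
          ∃! G : C ⟶ (barFunctor hB).obj A, ⟨G.pre.col, A.barProj ∘ₗ G.pre.lin⟩ = α) ∧
        (∀ F : (cobarFunctor hC).obj C ⟶ A,
          (⟨(adj.homEquiv C A F).pre.col, A.barProj ∘ₗ (adj.homEquiv C A F).pre.lin⟩ :
              SeqData.PreHom C.seq A.seq) =
            ⟨F.pre.col, F.pre.lin ∘ₗ C.cobarIncl⟩) := by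
  refine ⟨barLaws, cobarLaws, cobarBarAdjunction, fun C A =>
    ⟨fun F => (cobarIncl_isTwisting C).comp_hom F.isHom, fun α hα => ?_,
      fun G => (barProj_isTwisting A).hom_comp G.isHom, fun α hα => ?_, fun F => ?_⟩⟩
  · obtain ⟨F, hF⟩ := (cobarEquiv C A).surjective ⟨α, hα⟩
    exact ⟨F, congrArg Subtype.val hF, fun F' h =>
      (cobarEquiv C A).injective (Subtype.ext (h.trans (congrArg Subtype.val hF).symm))⟩
  · obtain ⟨G, hG⟩ := (barEquiv C A).surjective ⟨α, hα⟩
    exact ⟨G, congrArg Subtype.val hG, fun G' h =>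
      (barEquiv C A).injective (Subtype.ext (h.trans (congrArg Subtype.val hG).symm))⟩
  · rw [cobarBarAdjunction_homEquiv]
    exact barEquiv_cobarBarEquiv F
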